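/- **Setting.** Let $U\subset\mathbb C^m$ be open with coordinates $z^k,\bar z^l$, and let $\mathcal A=C^\infty(U\times\mathbb C^{0|d})$ be the superalgebra of sums $f=\sum f_{IJ}\,\theta^I\bar\theta^J$, $I,J\subset\{1,\dots,d\}$, with $f_{IJ}\in C^\infty(U)$ complex-valued and $\theta^\alpha,\bar\theta^\beta$ odd. Such a function is holomorphic if it equals $\sum a_I\theta^I$ with $a_I$ holomorphic, and antiholomorphic if it equals $\sum b_J\bar\theta^J$ with $b_J$ antiholomorphic. Odd derivatives act from the left. Formal functions are the elements of $\mathcal A[\nu^{-1},\nu]]$; one has compact support if each coefficient of each power of $\nu$ has compact support in $U$. A *star product* $*$ is an associative $\mathbb Z_2$-graded product with unit $1$ on $\mathcal A[\nu^{-1},\nu]]$ of the form $f*g=\sum_{r\ge0}\nu^rC_r(f,g)$, $C_0(f,g)=fg$, such that for $f\in\mathcal A$ the operators $L_fg=f*g$ and $R_fg=(-1)^{|f||g|}g*f$ are formal differential operators. It is *of the anti-Wick type* (with separation of variables) if $a*f=af$ and $f*b=fb$ for all holomorphic $a$ and antiholomorphic $b$, and *of the Wick type* if $b*f=bf$ and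 $f*a=fa$. A *nondegenerate formal potential* is an even formal function $X=\nu^{-1}X_{-1}+X_0+\nu X_1+\cdots$ such that, at every point of $U$, the matrix $(b_{\alpha\beta})$ of the part $b_{\alpha\beta}\theta^\alpha\bar\theta^\beta$ of $X_{-1}$ is invertible, and the matrix $(\partial^2\Phi_{-1}/\partial z^k\partial\bar z^l)$ is invertible, where $\Phi_{-1}$ is the part of $X_{-1}$ of degree zero in $\theta,\bar\theta$. It *determines* the anti-Wick type star product $*$ if $$L_{\partial X/\partial z^k}=\tfrac{\partial X}{\partial z^k}+\tfrac{\partial}{\partial z^k},\quad L_{\partial X/\partial\theta^\alpha}=\tfrac{\partial X}{\partial\theta^\alpha}+\tfrac{\partial}{\partial\theta^\alpha},\quad R_{\partial X/\partial\bar z^l}=\tfrac{\partial X}{\partial\bar z^l}+\tfrac{\partial}{\partial\bar z^l},\quad R_{\partial X/\partial\bar\theta^\beta}=\tfrac{\partial X}{\partial\bar\theta^\beta}+\tfrac{\partial}{\partial\bar\theta^\beta};$$ it determines a Wick type star product if the same formulas hold with $L$ and $R$ interchanged. **Theorem.** Let $U\subset\mathbb C^m$ be a contractible open subset and let $*$ be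 a star product of the anti-Wick type on $U\times\mathbb C^{0|d}$ determined by a nondegenerate formal potential $X$. Then there is a unique formal differential operator $\mathcal I=1+\nu\mathcal I_1+\nu^2\mathcal I_2+\cdots$ (the formal Berezin transform of $*$) with $\mathcal I(ba)=b*a$ for all holomorphic $a$ and antiholomorphic $b$. Put $f*'g=\mathcal I^{-1}(\mathcal If*\mathcal Ig)$. (a) There is a nondegenerate formal potential $X'=\nu^{-1}X'_{-1}+X'_0+\cdots$ that determines $*'$ (so $*'$ is a star product of the Wick type), such that $*'$ is the only Wick type star product determined by $X'$, and such that $$\frac{\partial X'}{\partial z^k}=-\mathcal I^{-1}\Big(\frac{\partial X}{\partial z^k}\Big),\quad \frac{\partial X'}{\partial\theta^\alpha}=-\mathcal I^{-1}\Big(\frac{\partial X}{\partial\theta^\alpha}\Big),\quad \frac{\partial X'}{\partial\bar z^l}=-\mathcal I^{-1}\Big(\frac{\partial X}{\partial\bar z^l}\Big),\quad \frac{\partial X'}{\partial\bar\theta^\beta}=-\mathcal I^{-1}\Big(\frac{\partial X}{\partial\bar\theta^\beta}\Big).$$ Moreover $X'$ can be chosen so that $X+X'$ contains no negative powers of $\nu$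 and so that, if the form $i\partial\bar\partial\Phi_{-1}$ is real, then so is the corresponding form of $X'$. (b) For every $X'$ as in (a) for which $X+X'$ contains no negative powers of $\nu$, the Berezin density $e^{X+X'}\,dz\,d\bar z\,d\theta\,d\bar\theta$ is a supertrace density for $*$: for all formal functions $f,g$ of which at least one has compact support, $$\int [f,g]_*\;e^{X+X'}\,dz\,d\bar z\,d\theta\,d\bar\theta=0,\qquad [f,g]_*=L_fg-R_fg,$$ where $dz\,d\bar z$ is Lebesgue measure on $U$ and $\int h_{IJ}\theta^I\bar\theta^J\,d\theta\,d\bar\theta=h_{[d][d]}$, $[d]=\{1,\dots,d\}$. -/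

import Mathlib

open scoped ContDiff BigOperators

/-! ## Grassmann algebras -/

section GrassmannAlgebra

/-- The Grassmann algebra over `R` with anticommuting generators `θ i`, `i : ι`. The value `f K` is
the coefficient of the monomial `θ^K`, the product of the `θ i`, `i ∈ K`, in increasing order. -/
def Grassmann (R ι : Type*) : Type _ := Finset ι → R

namespace Grassmann

variable {R ι : Type*}

instance [CommRing R] : AddCommGroup (Grassmann R ι) := inferInstanceAs (AddCommGroup (Finset ι → R))

instance {S : Type*} [CommRing R] [CommRing S] [Algebra S R] : Module S (Grassmann R ι) :=
  inferInstanceAs (Module S (Finset ι → R))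

@[ext] theorem ext {f g : Grassmann R ι} (h : ∀ K, f K = g K) : f = g := funext h

section
variable [CommRing R]
@[simp] theorem zero_apply (K : Finset ι) : (0 : Grassmann R ι) K = 0 := rfl
@[simp] theorem add_apply (f g : Grassmann R ι) (K : Finset ι) : (f + g) K = f K + g K := rfl
@[simp] theorem smul_apply {S : Type*} [CommRing S] [Algebra S R] (c : S) (f : Grassmann R ι)
    (K : Finset ι) : (c • f) K = c • f K := rfl
end

variable [LinearOrder ι]

/-- Number of pairs `(i, j) ∈ I × J` with `j < i`. -/
def inv (I J : Finset ι) : ℕ := ((I ×ˢ J).filter fun p => p.2 < p.1).card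

theorem inv_union_left {I J : Finset ι} (h : Disjoint I J) (K : Finset ι) :
    inv (I ∪ J) K = inv I K + inv J K := by
  unfold inv
  rw [Finset.union_product, Finset.filter_union, Finset.card_union_of_disjoint]
  apply Finset.disjoint_filter_filter
  rw [Finset.disjoint_product]
  exact Or.inl h

theorem inv_union_right {I J : Finset ι} (h : Disjoint I J) (K : Finset ι) :
    inv K (I ∪ J) = inv K I + inv K J := by
  unfold inv
  rw [Finset.product_union, Finset.filter_union, Finset.card_union_of_disjoint]
  apply Finset.disjoint_filter_filter
  rw [Finset.disjoint_product]
  exact Or.inr h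

@[simp] theorem inv_empty_left (J : Finset ι) : inv ∅ J = 0 := by simp [inv]
@[simp] theorem inv_empty_right (J : Finset ι) : inv J ∅ = 0 := by simp [inv]

variable [CommRing R]

/-- `θ^I θ^J = (-1)^(inv I J) θ^(I ∪ J)` for disjoint `I, J`, and `0` otherwise. -/
instance : Mul (Grassmann R ι) :=
  ⟨fun f g K => ∑ I ∈ K.powerset, (-1) ^ inv I (K \ I) * (f I * g (K \ I))⟩

theorem mul_apply (f g : Grassmann R ι) (K : Finset ι) :
    (f * g) K = ∑ I ∈ K.powerset, (-1) ^ inv I (K \ I) * (f I * g (K \ I)) := rfl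

/-- The element `a` of `R` as an element of degree zero. -/
def scalar (a : R) : Grassmann R ι := fun K => if K = ∅ then a else 0

instance : One (Grassmann R ι) := ⟨scalar 1⟩

theorem one_apply (K : Finset ι) : (1 : Grassmann R ι) K = if K = ∅ then 1 else 0 := rfl

protected theorem mul_assoc (f g h : Grassmann R ι) : f * g * h = f * (g * h) := by
  ext K
  simp only [mul_apply, Finset.mul_sum, Finset.sum_mul]
  rw [Finset.sum_sigma', Finset.sum_sigma']
  refine Finset.sum_bij' (fun p _ => ⟨p.2, p.1 \ p.2⟩) (fun p _ => ⟨p.1 ∪ p.2, p.1⟩) ?_ ?_ ?_ ?_ ?_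
  · rintro ⟨L, I⟩ h
    simp only [Finset.mem_sigma, Finset.mem_powerset] at h ⊢
    exact ⟨h.2.trans h.1, Finset.sdiff_subset_sdiff h.1 le_rfl⟩
  · rintro ⟨I, J⟩ h
    simp only [Finset.mem_sigma, Finset.mem_powerset] at h ⊢
    exact ⟨Finset.union_subset h.1 (h.2.trans Finset.sdiff_subset), Finset.subset_union_left⟩
  · rintro ⟨L, I⟩ h
    simp only [Finset.mem_sigma, Finset.mem_powerset] at h
    simp [Finset.union_sdiff_of_subset h.2]
  · rintro ⟨I, J⟩ h
    simp only [Finset.mem_sigma, Finset.mem_powerset] at h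
    have hd : Disjoint J I := (Finset.disjoint_sdiff.mono_right h.2).symm
    simp [Finset.union_sdiff_left, Finset.sdiff_eq_self_of_disjoint hd]
  · rintro ⟨L, I⟩ h
    simp only [Finset.mem_sigma, Finset.mem_powerset] at h
    obtain ⟨hL, hI⟩ := h
    have e1 : (K \ I) \ (L \ I) = K \ L := by
      ext x
      simp only [Finset.mem_sdiff]
      have := @hI x
      tauto
    have e2 : K \ I = (L \ I) ∪ (K \ L) := by
      ext x
      simp only [Finset.mem_sdiff, Finset.mem_union]
      have := @hI x
      have := @hL x
      tauto
    have d1 : Disjoint (L \ I) (K \ L) := by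
      rw [Finset.disjoint_left]
      intro x
      simp only [Finset.mem_sdiff]
      tauto
    have e3 : inv L (K \ L) = inv I (K \ L) + inv (L \ I) (K \ L) := by
      rw [← inv_union_left Finset.disjoint_sdiff, Finset.union_sdiff_of_subset hI]
    have e4 : inv I (K \ I) = inv I (L \ I) + inv I (K \ L) := by
      rw [e2, inv_union_right d1]
    dsimp only
    rw [e1, e3, e4]
    ring

instance : Ring (Grassmann R ι) where
  __ := (inferInstance : AddCommGroup (Grassmann R ι))
  mul_assoc := Grassmann.mul_assoc
  one_mul f := by
    ext K
    rw [mul_apply, Finset.sum_eq_single ∅]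
    · simp [one_apply]
    · intro I _ hI
      simp [one_apply, hI]
    · simp
  mul_one f := by
    ext K
    rw [mul_apply, Finset.sum_eq_single K]
    · simp [one_apply]
    · intro I hI hne
      have : K \ I ≠ ∅ := fun h => hne
        (subset_antisymm (Finset.mem_powerset.1 hI) (Finset.sdiff_eq_empty_iff_subset.1 h))
      simp [one_apply, this]
    · simp
  left_distrib f g h := by
    ext K
    simp only [mul_apply, add_apply, mul_add, Finset.sum_add_distrib]
  right_distrib f g h := by
    ext K
    simp only [mul_apply, add_apply, mul_add, add_mul, Finset.sum_add_distrib]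
  zero_mul f := by
    ext K
    simp [mul_apply]
  mul_zero f := by
    ext K
    simp [mul_apply]

instance {S : Type*} [CommRing S] [Algebra S R] : Algebra S (Grassmann R ι) :=
  Algebra.ofModule
    (fun c f g => by
      ext K
      simp only [mul_apply, smul_apply, Finset.smul_sum, smul_mul_assoc, mul_smul_comm])
    (fun c f g => by
      ext K
      simp only [mul_apply, smul_apply, Finset.smul_sum, mul_smul_comm])

variable (S : Type*) [CommRing S] [Algebra S R]

/-- The parity automorphism: `f ↦ f` on even and `f ↦ -f` on odd elements. -/
def parity : Grassmann R ι →ₗ[S] Grassmann R ι where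
  toFun f := fun K => (-1) ^ K.card * f K
  map_add' f g := funext fun K => mul_add _ (f K) (g K)
  map_smul' c f := funext fun K => mul_smul_comm c _ (f K)

/-- The even component. -/
def evenPart : Grassmann R ι →ₗ[S] Grassmann R ι where
  toFun f := fun K => if Even K.card then f K else 0
  map_add' f g := funext fun K => by
    change (if Even K.card then (f + g) K else 0) =
      (if Even K.card then f K else 0) + (if Even K.card then g K else 0)
    split_ifs <;> simp
  map_smul' c f := funext fun K => by
    change (if Even K.card then (c • f) K else 0) = c • (if Even K.card then f K else 0)
    split_ifs <;> simp

/-- The odd component. -/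
def oddPart : Grassmann R ι →ₗ[S] Grassmann R ι where
  toFun f := fun K => if Even K.card then 0 else f K
  map_add' f g := funext fun K => by
    change (if Even K.card then 0 else (f + g) K) =
      (if Even K.card then 0 else f K) + (if Even K.card then 0 else g K)
    split_ifs <;> simp
  map_smul' c f := funext fun K => by
    change (if Even K.card then 0 else (c • f) K) = c • (if Even K.card then 0 else f K)
    split_ifs <;> simp

/-- The left partial derivative `∂/∂θ^i`; for `i ∉ K` it sends
`θ^(K ∪ {i}) = (-1)^#{j ∈ K | j < i} θ^i θ^K` to `(-1)^#{j ∈ K | j < i} θ^K`. -/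
def leftDeriv (i : ι) : Grassmann R ι →ₗ[S] Grassmann R ι where
  toFun f := fun K => if i ∈ K then 0 else (-1) ^ (K.filter (· < i)).card * f (insert i K)
  map_add' f g := funext fun K => by
    change (if i ∈ K then 0 else (-1) ^ (K.filter (· < i)).card * (f + g) (insert i K)) =
      (if i ∈ K then 0 else (-1) ^ (K.filter (· < i)).card * f (insert i K)) +
        (if i ∈ K then 0 else (-1) ^ (K.filter (· < i)).card * g (insert i K))
    split_ifs <;> simp [mul_add]
  map_smul' c f := funext fun K => by
    change (if i ∈ K then 0 else (-1) ^ (K.filter (· < i)).card * (c • f) (insert i K)) =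
      c • (if i ∈ K then 0 else (-1) ^ (K.filter (· < i)).card * f (insert i K))
    split_ifs <;> simp

end Grassmann

end GrassmannAlgebra

namespace SuperStar

/-! ## Smooth functions on an open set `U ⊆ ℂ^m` -/

section Smooth

variable {m : ℕ} (U : TopologicalSpace.Opens (Fin m → ℂ))

/-- Extension by zero to `ℂ^m` of a function on `U`. -/
noncomputable def extendZero (f : U → ℂ) : (Fin m → ℂ) → ℂ := Function.extend Subtype.val f 0

theorem extendZero_apply (f : U → ℂ) {x : Fin m → ℂ} (hx : x ∈ U) :
    extendZero U f x = f ⟨x, hx⟩ :=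
  Subtype.val_injective.extend_apply f 0 ⟨x, hx⟩

/-- The smooth complex-valued functions on `U`, as a subalgebra of all functions on `U`. -/
noncomputable def smoothSubalgebra : Subalgebra ℂ (U → ℂ) where
  carrier := {f | ContDiffOn ℝ ∞ (extendZero U f) U}
  mul_mem' {f g} hf hg := (ContDiffOn.mul hf hg).congr fun x hx => by
    have hx : x ∈ U := hx
    simp [extendZero_apply U _ hx]
  add_mem' {f g} hf hg := (ContDiffOn.add hf hg).congr fun x hx => by
    have hx : x ∈ U := hx
    simp [extendZero_apply U _ hx]
  algebraMap_mem' c := (contDiffOn_const (c := c)).congr fun x hx => by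
    have hx : x ∈ U := hx
    simp [extendZero_apply U _ hx]

/-- The algebra `C^∞(U)`. -/
def SmoothFn : Type := smoothSubalgebra U

noncomputable instance : CommRing (SmoothFn U) := inferInstanceAs (CommRing (smoothSubalgebra U))

noncomputable instance : Algebra ℂ (SmoothFn U) :=
  inferInstanceAs (Algebra ℂ (smoothSubalgebra U))

variable {U}

/-- The function `e^f`. -/
noncomputable def SmoothFn.exp (f : SmoothFn U) : SmoothFn U :=
  ⟨fun x => Complex.exp (f.1 x), (ContDiffOn.cexp f.2).congr fun x hx => by
    have hx : x ∈ U := hx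
    simp [extendZero_apply U _ hx]⟩

theorem contDiffOn_extendZero (f : SmoothFn U) : ContDiffOn ℝ ∞ (extendZero U f.1) U := f.2

theorem differentiableAt_extendZero (f : SmoothFn U) (x : U) :
    DifferentiableAt ℝ (extendZero U f.1) x :=
  ((contDiffOn_extendZero f).differentiableOn (by simp)).differentiableAt (U.isOpen.mem_nhds x.2)

/-- The real directional derivative `f ↦ df(v)` along a constant vector `v`. -/
noncomputable def dirDeriv (v : Fin m → ℂ) : SmoothFn U →ₗ[ℂ] SmoothFn U where
  toFun f := ⟨fun x => fderiv ℝ (extendZero U f.1) x v, by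
    have h : ContDiffOn ℝ ∞ (fun x => fderiv ℝ (extendZero U f.1) x v) U :=
      ((contDiffOn_extendZero f).fderiv_of_isOpen U.isOpen (by simp)).clm_apply contDiffOn_const
    exact h.congr fun x hx => by
      have hx : x ∈ U := hx
      simp [extendZero_apply U _ hx]⟩
  map_add' f g := Subtype.ext <| funext fun x => by
    have e : extendZero U (f + g).1 =ᶠ[nhds x.1] extendZero U f.1 + extendZero U g.1 := by
      filter_upwards [U.isOpen.mem_nhds x.2] with y hy
      have hy : y ∈ U := hy
      simp only [Pi.add_apply, extendZero_apply U _ hy]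
      rfl
    change fderiv ℝ (extendZero U (f + g).1) x v =
      fderiv ℝ (extendZero U f.1) x v + fderiv ℝ (extendZero U g.1) x v
    rw [e.fderiv_eq, fderiv_add (differentiableAt_extendZero f x) (differentiableAt_extendZero g x)]
    rfl
  map_smul' c f := Subtype.ext <| funext fun x => by
    have e : extendZero U (c • f).1 =ᶠ[nhds x.1] c • extendZero U f.1 := by
      filter_upwards [U.isOpen.mem_nhds x.2] with y hy
      have hy : y ∈ U := hy
      simp only [Pi.smul_apply, extendZero_apply U _ hy]
      rfl
    change fderiv ℝ (extendZero U (c • f).1) x v = c • fderiv ℝ (extendZero U f.1) x v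
    rw [e.fderiv_eq, fderiv_const_smul (differentiableAt_extendZero f x)]
    rfl

/-- `∂/∂z^k = (∂/∂x^k - i ∂/∂y^k) / 2`. -/
noncomputable def wirtinger (k : Fin m) : SmoothFn U →ₗ[ℂ] SmoothFn U :=
  (1 / 2 : ℂ) • (dirDeriv (U := U) (Pi.single k 1)
    - Complex.I • dirDeriv (U := U) (Pi.single k Complex.I))

/-- `∂/∂z̄^l = (∂/∂x^l + i ∂/∂y^l) / 2`. -/
noncomputable def wirtingerBar (l : Fin m) : SmoothFn U →ₗ[ℂ] SmoothFn U :=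
  (1 / 2 : ℂ) • (dirDeriv (U := U) (Pi.single l 1)
    + Complex.I • dirDeriv (U := U) (Pi.single l Complex.I))

end Smooth

/-! ## Functions and formal functions on `U × ℂ^{0|d}` -/

section Super

variable {m : ℕ} (U : TopologicalSpace.Opens (Fin m → ℂ)) (d : ℕ)

/-- Labels of the odd coordinates `θ^1, …, θ^d, θ̄^1, …, θ̄^d`, in this order. -/
abbrev OddIndex (d : ℕ) : Type := Fin d ⊕ₗ Fin d

/-- The algebra `C^∞(U × ℂ^{0|d})`. Splitting the index set `K` of a monomial into `I` (labels of
`θ`) and `J` (labels of `θ̄`), its elements are the sums `∑ f_{IJ} θ^I θ̄^J`. -/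
abbrev SuperFn : Type := Grassmann (SmoothFn U) (OddIndex d)

/-- The formal functions `f = ν^r f_r + ν^(r+1) f_(r+1) + …`, `r ∈ ℤ`. -/
abbrev FormalFn : Type := LaurentSeries (SuperFn U d)

variable {U d}

/-- `∂/∂z^k` on functions on `U × ℂ^{0|d}`. -/
noncomputable def dz (k : Fin m) : Module.End ℂ (SuperFn U d) where
  toFun f := fun K => wirtinger k (f K)
  map_add' f g := funext fun K => map_add (wirtinger k) (f K) (g K)
  map_smul' c f := funext fun K => map_smul (wirtinger k) c (f K)

/-- `∂/∂z̄^l` on functions on `U × ℂ^{0|d}`. -/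
noncomputable def dzBar (l : Fin m) : Module.End ℂ (SuperFn U d) where
  toFun f := fun K => wirtingerBar l (f K)
  map_add' f g := funext fun K => map_add (wirtingerBar l) (f K) (g K)
  map_smul' c f := funext fun K => map_smul (wirtingerBar l) c (f K)

/-- The left derivative `∂/∂θ^α`. -/
noncomputable def dθ (α : Fin d) : Module.End ℂ (SuperFn U d) :=
  Grassmann.leftDeriv ℂ (Sum.inlₗ α)

/-- The left derivative `∂/∂θ̄^β`. -/
noncomputable def dθBar (β : Fin d) : Module.End ℂ (SuperFn U d) :=
  Grassmann.leftDeriv ℂ (Sum.inrₗ β)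

/-- The parity automorphism of `C^∞(U × ℂ^{0|d})`. -/
noncomputable def par : Module.End ℂ (SuperFn U d) := Grassmann.parity ℂ

/-- `a = a_I θ^I` with `a_I` holomorphic on `U`. -/
def IsHolomorphic (a : SuperFn U d) : Prop :=
  (∀ K, DifferentiableOn ℂ (extendZero U (a K).1) U) ∧
    ∀ K (β : Fin d), Sum.inrₗ β ∈ K → a K = 0

/-- `b = b_J θ̄^J` with `b_J` antiholomorphic on `U`. -/
def IsAntiholomorphic (b : SuperFn U d) : Prop :=
  (∀ K, DifferentiableOn ℂ (fun x => starRingEnd ℂ (extendZero U (b K).1 x)) U) ∧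
    ∀ K (α : Fin d), Sum.inlₗ α ∈ K → b K = 0

/-! ### Differential operators -/

/-- The supercommutator `[f, D]` of (multiplication by) `f` with an operator `D`. For homogeneous
`f` and `D` it is `f D - (-1)^(|f||D|) D f`; note that `par ∘ D ∘ par = (-1)^|D| D`. -/
noncomputable def superComm (f : SuperFn U d) (D : Module.End ℂ (SuperFn U d)) :
    Module.End ℂ (SuperFn U d) :=
  LinearMap.mulLeft ℂ f * D - D * LinearMap.mulLeft ℂ (Grassmann.evenPart ℂ f)
    - par * D * par * LinearMap.mulLeft ℂ (Grassmann.oddPart ℂ f)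

/-- `D` is a differential operator of order at most `n`:
`[f_n, [f_(n-1), … [f_0, D] …]] = 0` for all `f_0, …, f_n`. -/
def IsDiffOpOfOrder : ℕ → Module.End ℂ (SuperFn U d) → Prop
  | 0, D => ∀ f, superComm f D = 0
  | n + 1, D => ∀ f, IsDiffOpOfOrder n (superComm f D)

/-- `D` is a differential operator. -/
def IsDiffOp (D : Module.End ℂ (SuperFn U d)) : Prop := ∃ n, IsDiffOpOfOrder n D

/-! ### Formal operators and products on formal functions -/

theorem exists_lowerBound (f : FormalFn U d) : ∃ N : ℤ, ∀ i < N, f.coeff i = 0 :=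
  ⟨f.order, fun _ hi => HahnSeries.coeff_eq_zero_of_lt_order hi⟩

/-- The action of `T = T_0 + ν T_1 + ν² T_2 + …` on formal functions:
`(T f)_n = ∑_{r ≥ 0} T_r f_(n-r)`, a finite sum. -/
noncomputable def opApply (T : PowerSeries (Module.End ℂ (SuperFn U d))) (f : FormalFn U d) :
    FormalFn U d :=
  HahnSeries.ofSuppBddBelow (fun n : ℤ => ∑ᶠ r : ℕ, PowerSeries.coeff r T (f.coeff (n - r))) <| by
    obtain ⟨N, hN⟩ := exists_lowerBound f
    refine ⟨N, fun n hn => not_lt.1 fun h => hn ?_⟩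
    refine finsum_eq_zero_of_forall_eq_zero fun r => ?_
    rw [hN _ (by omega), map_zero]

/-- The product `f ∗ g = ∑_{r ≥ 0} ν^r C_r(f, g)` of formal functions, with the `C_r` extended
`ν`-linearly: `(f ∗ g)_n = ∑_{r + i + j = n} C_r(f_i, g_j)`, a finite sum. -/
noncomputable def productOf (C : ℕ → SuperFn U d →ₗ[ℂ] SuperFn U d →ₗ[ℂ] SuperFn U d)
    (f g : FormalFn U d) : FormalFn U d :=
  HahnSeries.ofSuppBddBelow
    (fun n : ℤ => ∑ᶠ q : ℕ × ℤ, C q.1 (f.coeff q.2) (g.coeff (n - q.1 - q.2))) <| by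
    obtain ⟨N, hN⟩ := exists_lowerBound f
    obtain ⟨M, hM⟩ := exists_lowerBound g
    refine ⟨N + M, fun n hn => not_lt.1 fun h => hn ?_⟩
    refine finsum_eq_zero_of_forall_eq_zero fun q => ?_
    by_cases hq : q.2 < N
    · rw [hN _ hq, map_zero, LinearMap.zero_apply]
    · rw [hM _ (by omega), map_zero]

/-- A function on `U × ℂ^{0|d}` as a formal function. -/
noncomputable def const (f : SuperFn U d) : FormalFn U d := HahnSeries.single 0 f

/-- Graded right multiplication `R_f g = (-1)^(|f||g|) g ∗ f` for a product `s` on formal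
functions. -/
noncomputable def gradedRight (s : FormalFn U d → FormalFn U d → FormalFn U d)
    (f g : FormalFn U d) : FormalFn U d :=
  s g (f.map (Grassmann.evenPart ℂ)) + s (g.map (par (U := U) (d := d))) (f.map (Grassmann.oddPart ℂ))

/-- The operator `f ↦ (-1)^(|f||g|) C(f, g)` for a bilinear `C`. -/
noncomputable def cochainRight (C : SuperFn U d →ₗ[ℂ] SuperFn U d →ₗ[ℂ] SuperFn U d)
    (g : SuperFn U d) : Module.End ℂ (SuperFn U d) :=
  C.flip (Grassmann.evenPart ℂ g) + C.flip (Grassmann.oddPart ℂ g) ∘ₗ par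

/-- `s` is a star product on the formal functions on `U × ℂ^{0|d}`: an associative `ℤ₂`-graded
product with identity `1`, of the form `∑_{r ≥ 0} ν^r C_r` with `C_0(f, g) = f g`, such that left
and graded right multiplications by functions are formal differential operators. -/
structure IsStarProduct (s : FormalFn U d → FormalFn U d → FormalFn U d) : Prop where
  exists_cochains : ∃ C : ℕ → SuperFn U d →ₗ[ℂ] SuperFn U d →ₗ[ℂ] SuperFn U d,
    s = productOf C ∧ (∀ f g, C 0 f g = f * g) ∧
    (∀ r f g, C r (par f) (par g) = par (C r f g)) ∧
    (∀ r f, IsDiffOp (C r f)) ∧ ∀ r g, IsDiffOp (cochainRight (C r) g)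
  assoc : ∀ f g h, s (s f g) h = s f (s g h)
  one_left : ∀ f, s 1 f = f
  one_right : ∀ f, s f 1 = f

/-- Star product with separation of variables of the anti-Wick type: `a ∗ f = a f` and
`f ∗ b = f b` for `a` holomorphic and `b` antiholomorphic. -/
structure IsAntiWick (s : FormalFn U d → FormalFn U d → FormalFn U d) : Prop where
  isStarProduct : IsStarProduct s
  holomorphic_left : ∀ a f, IsHolomorphic a → s (const a) f = const a * f
  antiholomorphic_right : ∀ b f, IsAntiholomorphic b → s f (const b) = f * const b

/-- Star product with separation of variables of the Wick type: `b ∗ f = b f` and `f ∗ a = f a` for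
`a` holomorphic and `b` antiholomorphic. -/
structure IsWick (s : FormalFn U d → FormalFn U d → FormalFn U d) : Prop where
  isStarProduct : IsStarProduct s
  antiholomorphic_left : ∀ b f, IsAntiholomorphic b → s (const b) f = const b * f
  holomorphic_right : ∀ a f, IsHolomorphic a → s f (const a) = f * const a

/-! ### Nondegenerate potentials -/

/-- The complex Hessian `(∂²Φ/∂z^k ∂z̄^l)` at `x`, where `Φ` is the component of `X_{-1}` of degree
zero in the odd variables. -/
noncomputable def bodyHessian (X : FormalFn U d) (x : U) : Matrix (Fin m) (Fin m) ℂ :=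
  Matrix.of fun k l => (wirtinger k (wirtingerBar l (X.coeff (-1) ∅))).1 x

/-- The matrix `(b_{αβ})` at `x`, where `b_{αβ} θ^α θ̄^β` is the part of `X_{-1}` of bidegree `(1, 1)`
in `θ, θ̄`. -/
noncomputable def oddHessian (X : FormalFn U d) (x : U) : Matrix (Fin d) (Fin d) ℂ :=
  Matrix.of fun α β => (X.coeff (-1) {Sum.inlₗ α, Sum.inrₗ β}).1 x

/-- `X = ν^{-1} X_{-1} + X_0 + ν X_1 + …` is a nondegenerate formal potential: it is even, its
nilpotent component has nondegenerate matrix `(b_{αβ})`, and the leading term `i ∂∂̄Φ_{-1}` of the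
form of its component `Φ` of degree zero in the odd variables is nondegenerate. -/
structure IsNondegeneratePotential (X : FormalFn U d) : Prop where
  coeff_eq_zero : ∀ n : ℤ, n < -1 → X.coeff n = 0
  even : ∀ n, par (X.coeff n) = X.coeff n
  body_nondegenerate : ∀ x, (bodyHessian X x).det ≠ 0
  odd_nondegenerate : ∀ x, (oddHessian X x).det ≠ 0

/-- The anti-Wick star product `s` is the one determined by the potential `X`, i.e.
`L_{∂X/∂z} = ∂X/∂z + ∂/∂z`, `L_{∂X/∂θ} = ∂X/∂θ + ∂/∂θ`,
`R_{∂X/∂z̄} = ∂X/∂z̄ + ∂/∂z̄`, `R_{∂X/∂θ̄} = ∂X/∂θ̄ + ∂/∂θ̄`. -/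
structure DeterminesAntiWick (X : FormalFn U d)
    (s : FormalFn U d → FormalFn U d → FormalFn U d) : Prop where
  isAntiWick : IsAntiWick s
  left_z : ∀ k g, s (X.map (dz k)) g = X.map (dz k) * g + g.map (dz k)
  left_θ : ∀ α g, s (X.map (dθ α)) g = X.map (dθ α) * g + g.map (dθ α)
  right_zBar : ∀ l g, gradedRight s (X.map (dzBar l)) g = X.map (dzBar l) * g + g.map (dzBar l)
  right_θBar : ∀ β g, gradedRight s (X.map (dθBar β)) g = X.map (dθBar β) * g + g.map (dθBar β)

/-- The Wick star product `s` is the one determined by the potential `X`, i.e.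
`R_{∂X/∂z} = ∂X/∂z + ∂/∂z`, `R_{∂X/∂θ} = ∂X/∂θ + ∂/∂θ`,
`L_{∂X/∂z̄} = ∂X/∂z̄ + ∂/∂z̄`, `L_{∂X/∂θ̄} = ∂X/∂θ̄ + ∂/∂θ̄`. -/
structure DeterminesWick (X : FormalFn U d)
    (s : FormalFn U d → FormalFn U d → FormalFn U d) : Prop where
  isWick : IsWick s
  right_z : ∀ k g, gradedRight s (X.map (dz k)) g = X.map (dz k) * g + g.map (dz k)
  right_θ : ∀ α g, gradedRight s (X.map (dθ α)) g = X.map (dθ α) * g + g.map (dθ α)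
  left_zBar : ∀ l g, s (X.map (dzBar l)) g = X.map (dzBar l) * g + g.map (dzBar l)
  left_θBar : ∀ β g, s (X.map (dθBar β)) g = X.map (dθBar β) * g + g.map (dθBar β)

/-! ### The formal Berezin transform and the dual product -/

/-- `T = 1 + ν T_1 + ν² T_2 + …` is the formal Berezin transform of `s`: a formal differential
operator with `T (b a) = b ∗ a` for `a` holomorphic and `b` antiholomorphic. -/
structure IsBerezinTransform (s : FormalFn U d → FormalFn U d → FormalFn U d)
    (T : PowerSeries (Module.End ℂ (SuperFn U d))) : Prop where
  constantCoeff_eq_one : PowerSeries.constantCoeff T = 1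
  isDiffOp : ∀ r, IsDiffOp (PowerSeries.coeff r T)
  map_mul : ∀ a b, IsHolomorphic a → IsAntiholomorphic b →
    opApply T (const (b * a)) = s (const b) (const a)

/-- The inverse `T^{-1}` of a formal operator `T = 1 + ν T_1 + …`. -/
noncomputable def opInv (T : PowerSeries (Module.End ℂ (SuperFn U d))) :
    PowerSeries (Module.End ℂ (SuperFn U d)) := PowerSeries.invOfUnit T 1

/-- `f ∗' g = T^{-1}(T f ∗ T g)`. -/
noncomputable def dualProduct (s : FormalFn U d → FormalFn U d → FormalFn U d)
    (T : PowerSeries (Module.End ℂ (SuperFn U d))) (f g : FormalFn U d) : FormalFn U d :=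
  opApply (opInv T) (s (opApply T f) (opApply T g))

/-- `X'` is a nondegenerate formal potential that determines the Wick product `∗'` (which is the
only Wick product that it determines) and satisfies `∂X' = -T^{-1}(∂X)` in all variables. -/
structure IsDualPotential (s : FormalFn U d → FormalFn U d → FormalFn U d)
    (T : PowerSeries (Module.End ℂ (SuperFn U d))) (X X' : FormalFn U d) : Prop where
  nondegenerate : IsNondegeneratePotential X'
  determines : DeterminesWick X' (dualProduct s T)
  determines_unique : ∀ t, DeterminesWick X' t → t = dualProduct s T
  deriv_z : ∀ k, X'.map (dz k) = -opApply (opInv T) (X.map (dz k))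
  deriv_θ : ∀ α, X'.map (dθ α) = -opApply (opInv T) (X.map (dθ α))
  deriv_zBar : ∀ l, X'.map (dzBar l) = -opApply (opInv T) (X.map (dzBar l))
  deriv_θBar : ∀ β, X'.map (dθBar β) = -opApply (opInv T) (X.map (dθBar β))

/-! ### Supertrace densities -/

/-- `f` has compact support: each coefficient `f_{n, IJ}` has compact support in `U`. -/
def HasCompactSupp (f : FormalFn U d) : Prop :=
  ∀ n K, HasCompactSupport (f.coeff n K).1

/-- The formal Berezin integral `∫ f dz dz̄ dθ dθ̄`, as the family of its coefficients at `ν^n`: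
the Lebesgue integral over `U` of the coefficient of `θ^1 ⋯ θ^d θ̄^1 ⋯ θ̄^d`. -/
noncomputable def berezinIntegral (f : FormalFn U d) (n : ℤ) : ℂ :=
  ∫ x in (U : Set (Fin m → ℂ)), extendZero U (f.coeff n Finset.univ).1 x

/-- `ρ dz dz̄ dθ dθ̄` is a supertrace density for `s`: `∫ [f, g]_∗ ρ dz dz̄ dθ dθ̄ = 0`, where
`[f, g]_∗ = f ∗ g - R_f g`, whenever `f` or `g` has compact support. -/
def IsSupertraceDensity (s : FormalFn U d → FormalFn U d → FormalFn U d) (ρ : FormalFn U d) :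
    Prop :=
  ∀ f g, HasCompactSupp f ∨ HasCompactSupp g →
    berezinIntegral ((s f g - gradedRight s f g) * ρ) = 0

/-- The exponential of `S = S_0 + ν S_1 + …` with `S` even: if `φ` is the component of `S_0` of degree
zero in the odd variables, then `e^S = e^φ ∑_k (S - φ)^k / k!`. The terms with `k > n + 2d` do not
contribute to the coefficient at `ν^n`, since the `ν^0`-term of `S - φ` is nilpotent. -/
noncomputable def formalExp (S : PowerSeries (SuperFn U d)) : PowerSeries (SuperFn U d) :=
  PowerSeries.mk fun n =>
    Grassmann.scalar (SmoothFn.exp (PowerSeries.coeff 0 S ∅)) *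
      ∑ k ∈ Finset.range (n + 2 * d + 1), ((k.factorial : ℂ)⁻¹) •
        PowerSeries.coeff n
          ((S - PowerSeries.C (Grassmann.scalar (PowerSeries.coeff 0 S ∅))) ^ k)

end Super

end SuperStar

set_option linter.unusedSectionVars false

/-! Most of the proof is algebra in a supercommutative algebra with coordinates `x i` and
derivatives `d i` (`SuperCoords`), the index `(true, k)` marking holomorphic and `(false, k)`
antiholomorphic directions. Differential operators are the operators annihilated by iterated graded
commutators with the coordinates. Two facts about them carry everything.

Poincaré lemma (`exists_gamx_eq`): a graded symmetric system `[E, x i] = D i` of differential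
operators is solvable, because the Euler operator `Σ [D, x i] ∂_i` multiplies the leading part of
`D` by its order, which inverts the equations one order at a time.

Rigidity: to lowest order `∂X` is `ν⁻¹ ∂X₋₁`, and the mixed Hessian of `X₋₁` is invertible. Hence a
formal differential operator that graded commutes with the coordinates of one half and with the
operators `∂X + ∂` of the same half is determined by its value at `1` (`eq_zero_of_commute`). So
operators commuting with right multiplications are left multiplications. In the same way a
multiplicative operator `1 + O(ν)` that respects parity and fixes these generators is the identity
(`eq_id_of_multiplicative`).

Berezin transform. Left multiplications by antiholomorphic and graded right multiplications by
holomorphic coordinates supercommute, so they deform the undeformed multiplications by coordinates.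
At each power of `ν` the obstruction to intertwining the two systems is a graded symmetric family of
differential operators, removed by the Poincaré lemma; the limit is `I`
(`exists_coordOp_intertwiner`). For antiholomorphic `b` the operator `I⁻¹ L_b I` supercommutes with
all coordinates, so it is multiplication by `b`, and this gives `I(ba) = b ∗ a`. Uniqueness holds
because the products `ba` determine a differential operator.

Dual potential. Left multiplication by `∂X` in antiholomorphic and graded right multiplication in
holomorphic directions satisfy canonical commutation relations with the previous operators.
Conjugation by `I` therefore turns them into `w_i - ∂_i` with `w_i = I⁻¹(∂_i X)` (`opI_uOp`). Their
symmetry at `1` says that the form `w` is closed (`fd_opI_u`), and the Poincaré lemma on `U ×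
ℂ^{0|d}` provides `X'` with `∂X' = -w`.

Supertrace. The density `ρ = e^{X+X'}` satisfies `∂ρ = (∂X + ∂X')ρ`, so integration by parts makes
`∂X + ∂` and `∂X' + ∂` adjoint up to sign and parity (`adj_cov`). Let `r_f` be right and `L_f` left
multiplication, `†` the adjoint and `F = I†`. By rigidity `r_f† = I⁻¹ L_f I` and `F r_f† F⁻¹ = L_f`.
Comparison gives `F = r_e I` with `e = F 1`; a second adjoint gives `e ∗ e = 1`, hence `e = 1`, and
`I` is selfadjoint. Both sides of the trace identity then reduce to an integral of `g I⁻¹ f ρ` with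
the same sign. -/

namespace SuperStar

/-! ## Formal operators on Laurent series with coefficients in a module -/

section Formal

variable {V W Z : Type*} [AddCommGroup V] [Module ℂ V] [AddCommGroup W] [Module ℂ W]
  [AddCommGroup Z] [Module ℂ Z]

/-- The Laurent series whose coefficients vanish below `N`. -/
def filt (V : Type*) [AddCommGroup V] [Module ℂ V] (N : ℤ) : Submodule ℂ (LaurentSeries V) where
  carrier := {f | ∀ i < N, f.coeff i = 0}
  add_mem' {f g} hf hg i hi := by
    change (f + g).coeff i = 0
    rw [HahnSeries.coeff_add, hf i hi, hg i hi, add_zero]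
  zero_mem' i _ := rfl
  smul_mem' c f hf i hi := by
    change (c • f).coeff i = 0
    rw [HahnSeries.coeff_smul, hf i hi, smul_zero]

theorem filt_anti {N M : ℤ} (h : N ≤ M) : filt V M ≤ filt V N :=
  fun _ hf i hi => hf i (hi.trans_le h)

theorem exists_mem_filt (f : LaurentSeries V) : ∃ N, f ∈ filt V N :=
  ⟨f.order, fun _ hi => HahnSeries.coeff_eq_zero_of_lt_order hi⟩

/-- Multiplication by `ν^n`. -/
noncomputable def shift (n : ℤ) : LaurentSeries V →ₗ[ℂ] LaurentSeries V where
  toFun f := HahnSeries.ofSuppBddBelow (fun k : ℤ => f.coeff (k - n)) <| by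
    obtain ⟨N, hN⟩ := exists_mem_filt f
    exact ⟨N + n, fun k hk => not_lt.1 fun h => hk (hN _ (by omega))⟩
  map_add' f g := rfl
  map_smul' c f := rfl

@[simp] theorem coeff_shift (n k : ℤ) (f : LaurentSeries V) :
    (shift n f).coeff k = f.coeff (k - n) := rfl

/-- The series `ν^n v`. -/
noncomputable def mono (n : ℤ) : V →ₗ[ℂ] LaurentSeries V where
  toFun := HahnSeries.single n
  map_add' v w := by
    ext k
    by_cases h : k = n <;> simp [h]
  map_smul' c v := by
    ext k
    by_cases h : k = n <;> simp [h]

theorem coeff_mono (n k : ℤ) (v : V) : (mono n v).coeff k = if k = n then v else 0 := by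
  change (HahnSeries.single n v).coeff k = _
  simp [HahnSeries.coeff_single]

@[simp] theorem coeff_mono_same (n : ℤ) (v : V) : (mono n v).coeff n = v := by simp [coeff_mono]

theorem mono_mem_filt (n : ℤ) (v : V) : mono n v ∈ filt V n := fun i hi => by
  rw [coeff_mono, if_neg hi.ne]

theorem shift_mono (n k : ℤ) (v : V) : shift n (mono k v) = mono (n + k) v := by
  ext j
  simp only [coeff_shift, coeff_mono]
  congr 1
  exact propext ⟨fun h => by omega, fun h => by omega⟩

theorem shift_shift (n k : ℤ) (f : LaurentSeries V) : shift n (shift k f) = shift (n + k) f := by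
  ext j
  simp only [coeff_shift]
  congr 1
  ring

@[simp] theorem shift_zero (f : LaurentSeries V) : shift 0 f = f := by
  ext j
  simp

theorem shift_mem_filt {n N : ℤ} {f : LaurentSeries V} (hf : f ∈ filt V N) :
    shift n f ∈ filt V (n + N) := fun i hi => hf _ (by omega)

theorem sum_coeff {α : Type*} (s : Finset α) (F : α → LaurentSeries V) (n : ℤ) :
    (∑ a ∈ s, F a).coeff n = ∑ a ∈ s, (F a).coeff n := by
  classical
  induction s using Finset.induction_on with
  | empty => simp
  | insert a s ha ih => rw [Finset.sum_insert ha, Finset.sum_insert ha, HahnSeries.coeff_add, ih]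

/-- Truncation takes the place of convergence: modulo `filt V M` a series is a finite sum of
monomials, so identities extend from monomials without a topology. -/
theorem sub_sum_mono_mem_filt {N M : ℤ} {f : LaurentSeries V} (hf : f ∈ filt V N) :
    f - ∑ i ∈ Finset.Ico N M, mono i (f.coeff i) ∈ filt V M := by
  intro k hk
  rw [HahnSeries.coeff_sub, sum_coeff]
  simp only [coeff_mono]
  rw [Finset.sum_ite_eq]
  split_ifs with h
  · exact sub_self _
  · rw [sub_zero]
    exact hf k (by simp only [Finset.mem_Ico, not_and, not_lt] at h; by_contra hh; have := h (by omega); omega)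

/-- `Φ` is linear over `ℂ[ν⁻¹, ν]]` and maps series without negative powers to series whose pole
orders are bounded. -/
structure IsFormal (Φ : LaurentSeries V →ₗ[ℂ] LaurentSeries W) : Prop where
  map_shift : ∀ n f, Φ (shift n f) = shift n (Φ f)
  bdd : ∃ K, ∀ f ∈ filt V 0, Φ f ∈ filt W K

/-- The coefficient of `Φ` at `ν^n`. -/
noncomputable def coef (Φ : LaurentSeries V →ₗ[ℂ] LaurentSeries W) (n : ℤ) : V →ₗ[ℂ] W where
  toFun v := (Φ (mono 0 v)).coeff n
  map_add' v w := by rw [map_add, map_add, HahnSeries.coeff_add]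
  map_smul' c v := by rw [map_smul, map_smul, HahnSeries.coeff_smul, RingHom.id_apply]

theorem coef_apply (Φ : LaurentSeries V →ₗ[ℂ] LaurentSeries W) (n : ℤ) (v : V) :
    coef Φ n v = (Φ (mono 0 v)).coeff n := rfl

namespace IsFormal

variable {Φ Φ' : LaurentSeries V →ₗ[ℂ] LaurentSeries W} {Ψ : LaurentSeries Z →ₗ[ℂ] LaurentSeries V}

theorem map_mem_filt (h : IsFormal Φ) {K : ℤ} (hK : ∀ f ∈ filt V 0, Φ f ∈ filt W K) {N : ℤ}
    {f : LaurentSeries V} (hf : f ∈ filt V N) : Φ f ∈ filt W (N + K) := by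
  have h1 := shift_mem_filt (n := N) (hK _ (filt_anti (by omega) (shift_mem_filt (n := -N) hf)))
  rwa [← h.map_shift, shift_shift, add_neg_cancel, shift_zero] at h1

theorem map_mono (h : IsFormal Φ) (i n : ℤ) (v : V) :
    (Φ (mono i v)).coeff n = coef Φ (n - i) v := by
  rw [coef_apply, ← coeff_shift, ← h.map_shift, shift_mono, add_zero]

/-- The part of `f` of order at least `M` is sent beyond `n`, so a finite sum remains. The freedom
in `M` allows two operators with different bounds to be compared over one range. -/
theorem coeff_apply (h : IsFormal Φ) {K : ℤ} (hK : ∀ f ∈ filt V 0, Φ f ∈ filt W K) {N M n : ℤ}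
    {f : LaurentSeries V} (hf : f ∈ filt V N) (hM : n < M + K) :
    (Φ f).coeff n = ∑ i ∈ Finset.Ico N M, coef Φ (n - i) (f.coeff i) := by
  have h1 := h.map_mem_filt hK (sub_sum_mono_mem_filt (M := M) hf) n hM
  rw [map_sub, HahnSeries.coeff_sub, sub_eq_zero] at h1
  rw [h1, map_sum, sum_coeff]
  exact Finset.sum_congr rfl fun i _ => h.map_mono i n _

theorem ext_coef (h : IsFormal Φ) (h' : IsFormal Φ') (H : ∀ n, coef Φ n = coef Φ' n) :
    Φ = Φ' := by
  obtain ⟨K, hK⟩ := h.bdd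
  obtain ⟨K', hK'⟩ := h'.bdd
  ext f n
  obtain ⟨N, hN⟩ := exists_mem_filt f
  rw [h.coeff_apply hK (M := max (n - K + 1) (n - K' + 1)) hN (by omega),
    h'.coeff_apply hK' (M := max (n - K + 1) (n - K' + 1)) hN (by omega)]
  exact Finset.sum_congr rfl fun i _ => by rw [H]

/-- The extension principle used throughout: identities of formal operators need checking only on
series free of `ν`. -/
theorem ext_mono (h : IsFormal Φ) (h' : IsFormal Φ') (H : ∀ v, Φ (mono 0 v) = Φ' (mono 0 v)) :
    Φ = Φ' := h.ext_coef h' fun n => by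
  ext v
  rw [coef_apply, coef_apply, H]

theorem comp (h : IsFormal Φ) (hΨ : IsFormal Ψ) : IsFormal (Φ ∘ₗ Ψ) where
  map_shift n f := by
    rw [LinearMap.comp_apply, LinearMap.comp_apply, hΨ.map_shift, h.map_shift]
  bdd := by
    obtain ⟨K, hK⟩ := h.bdd
    obtain ⟨K', hK'⟩ := hΨ.bdd
    exact ⟨K' + K, fun f hf => h.map_mem_filt hK (hK' f hf)⟩

theorem add (h : IsFormal Φ) (h' : IsFormal Φ') : IsFormal (Φ + Φ') where
  map_shift n f := by simp only [LinearMap.add_apply, h.map_shift, h'.map_shift, map_add]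
  bdd := by
    obtain ⟨K, hK⟩ := h.bdd
    obtain ⟨K', hK'⟩ := h'.bdd
    exact ⟨min K K', fun f hf => Submodule.add_mem _ (filt_anti (min_le_left _ _) (hK f hf))
      (filt_anti (min_le_right _ _) (hK' f hf))⟩

theorem smul (h : IsFormal Φ) (c : ℂ) : IsFormal (c • Φ) where
  map_shift n f := by simp only [LinearMap.smul_apply, h.map_shift, map_smul]
  bdd := by
    obtain ⟨K, hK⟩ := h.bdd
    exact ⟨K, fun f hf => Submodule.smul_mem _ c (hK f hf)⟩

theorem neg (h : IsFormal Φ) : IsFormal (-Φ) := by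
  have : -Φ = (-1 : ℂ) • Φ := by ext; simp
  rw [this]
  exact h.smul (-1)

theorem sub (h : IsFormal Φ) (h' : IsFormal Φ') : IsFormal (Φ - Φ') := by
  rw [sub_eq_add_neg]
  exact h.add h'.neg

theorem eq_zero_of_coef (h : IsFormal Φ) (H : ∀ n, coef Φ n = 0) : Φ = 0 := by
  obtain ⟨K, hK⟩ := h.bdd
  ext f n
  obtain ⟨N, hN⟩ := exists_mem_filt f
  rw [h.coeff_apply hK (M := n - K + 1) hN (by omega)]
  exact Finset.sum_eq_zero fun i _ => by rw [H, LinearMap.zero_apply]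

theorem coef_eq_zero (_h : IsFormal Φ) {K : ℤ} (hK : ∀ f ∈ filt V 0, Φ f ∈ filt W K) {n : ℤ}
    (hn : n < K) : coef Φ n = 0 := by
  ext v
  exact hK _ (mono_mem_filt 0 v) n hn

/-- If the coefficients below `K` vanish, the pole order is bounded accordingly. -/
theorem bdd_of_coef (h : IsFormal Φ) {K : ℤ} (H : ∀ n < K, coef Φ n = 0) :
    ∀ f ∈ filt V 0, Φ f ∈ filt W K := by
  intro f hf n hn
  obtain ⟨K', hK'⟩ := h.bdd
  rw [h.coeff_apply hK' (M := n - K' + 1) hf (by omega)]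
  refine Finset.sum_eq_zero fun i hi => ?_
  rw [H _ (by have := (Finset.mem_Ico.1 hi).1; omega), LinearMap.zero_apply]

/-- The lowest coefficient. -/
theorem coeff_lowest (h : IsFormal Φ) {K : ℤ} (hK : ∀ f ∈ filt V 0, Φ f ∈ filt W K) {N : ℤ}
    {f : LaurentSeries V} (hf : f ∈ filt V N) :
    (Φ f).coeff (N + K) = coef Φ K (f.coeff N) := by
  rw [h.coeff_apply hK (M := N + 1) hf (by omega)]
  rw [Finset.sum_eq_single N, add_sub_cancel_left]
  · intro i hi hne
    exact absurd (Finset.mem_Ico.1 hi) (by omega)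
  · simp

theorem coef_comp (h : IsFormal Φ) (_hΨ : IsFormal Ψ) {K K' : ℤ}
    (hK : ∀ f ∈ filt V 0, Φ f ∈ filt W K) (hK' : ∀ f ∈ filt Z 0, Ψ f ∈ filt V K') {n M : ℤ}
    (hM : n < M + K) :
    coef (Φ ∘ₗ Ψ) n = ∑ i ∈ Finset.Ico K' M, coef Φ (n - i) ∘ₗ coef Ψ i := by
  ext v
  rw [coef_apply, LinearMap.comp_apply, h.coeff_apply hK (hK' _ (mono_mem_filt 0 v)) hM,
    LinearMap.sum_apply]
  rfl

end IsFormal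

theorem isFormal_id : IsFormal (LinearMap.id : LaurentSeries V →ₗ[ℂ] LaurentSeries V) :=
  ⟨fun _ _ => rfl, 0, fun _ h => h⟩

theorem isFormal_shift (n : ℤ) : IsFormal (shift n : LaurentSeries V →ₗ[ℂ] LaurentSeries V) :=
  ⟨fun k f => by rw [shift_shift, shift_shift, add_comm], n, fun _ h => by
    have := shift_mem_filt (n := n) h
    rwa [add_zero] at this⟩

theorem coef_sub (Φ Φ' : LaurentSeries V →ₗ[ℂ] LaurentSeries W) (n : ℤ) :
    coef (Φ - Φ') n = coef Φ n - coef Φ' n := by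
  ext v
  simp [coef_apply]

/-- The coefficientwise action of a linear map on series. -/
noncomputable def lift (D : V →ₗ[ℂ] W) : LaurentSeries V →ₗ[ℂ] LaurentSeries W where
  toFun f := f.map D
  map_add' f g := by
    ext n
    simp
  map_smul' c f := by
    ext n
    simp

@[simp] theorem coeff_lift (D : V →ₗ[ℂ] W) (f : LaurentSeries V) (n : ℤ) :
    (lift D f).coeff n = D (f.coeff n) := rfl

theorem lift_mem_filt (D : V →ₗ[ℂ] W) {N : ℤ} {f : LaurentSeries V} (hf : f ∈ filt V N) :
    lift D f ∈ filt W N := fun i hi => by rw [coeff_lift, hf i hi, map_zero]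

theorem isFormal_lift (D : V →ₗ[ℂ] W) : IsFormal (lift D) :=
  ⟨fun _ _ => rfl, 0, fun _ h => lift_mem_filt D h⟩

theorem coef_lift (D : V →ₗ[ℂ] W) (n : ℤ) : coef (lift D) n = if n = 0 then D else 0 := by
  ext v
  rw [coef_apply, coeff_lift, coeff_mono]
  split_ifs <;> simp

theorem lift_mono (D : V →ₗ[ℂ] W) (n : ℤ) (v : V) : lift D (mono n v) = mono n (D v) := by
  ext k
  rw [coeff_lift, coeff_mono, coeff_mono]
  split_ifs <;> simp

/-- The formal operator with given coefficients. -/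
noncomputable def opSeries (T : ℕ → V →ₗ[ℂ] W) : LaurentSeries V →ₗ[ℂ] LaurentSeries W := by
  -- Linearity is read off after the `finsum`s of both arguments are rewritten over one common
  -- finite range.
  have key : ∀ (n N : ℤ) (f : LaurentSeries V), f ∈ filt V N → ∀ R : ℕ, n - N < R →
      ∑ᶠ r : ℕ, T r (f.coeff (n - r)) = ∑ r ∈ Finset.range R, T r (f.coeff (n - r)) := by
    intro n N f hf R hR
    apply finsum_eq_sum_of_support_subset
    intro r hr
    by_contra hh
    apply hr
    simp only [Finset.coe_range, Set.mem_Iio, not_lt] at hh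
    change T r _ = 0
    rw [hf _ (by omega), map_zero]
  exact
  { toFun := fun f => HahnSeries.ofSuppBddBelow (fun n : ℤ => ∑ᶠ r : ℕ, T r (f.coeff (n - r))) <| by
      obtain ⟨N, hN⟩ := exists_mem_filt f
      refine ⟨N, fun n hn => not_lt.1 fun h => hn ?_⟩
      refine finsum_eq_zero_of_forall_eq_zero fun r => ?_
      rw [hN _ (by omega), map_zero]
    map_add' := by
      intro f g
      ext n
      obtain ⟨N, hN⟩ := exists_mem_filt f
      obtain ⟨M, hM⟩ := exists_mem_filt g
      have hf := filt_anti (min_le_left N M) hN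
      have hg := filt_anti (min_le_right N M) hM
      obtain ⟨R, hR⟩ : ∃ R : ℕ, n - min N M < R := ⟨(n - min N M).toNat + 1, by omega⟩
      rw [HahnSeries.coeff_add]
      change ∑ᶠ r : ℕ, T r ((f + g).coeff (n - r)) = ∑ᶠ r : ℕ, T r (f.coeff (n - r)) +
        ∑ᶠ r : ℕ, T r (g.coeff (n - r))
      rw [key n _ _ (Submodule.add_mem _ hf hg) R hR, key n _ _ hf R hR, key n _ _ hg R hR,
        ← Finset.sum_add_distrib]
      exact Finset.sum_congr rfl fun r _ => by rw [HahnSeries.coeff_add, map_add]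
    map_smul' := by
      intro c f
      ext n
      obtain ⟨N, hN⟩ := exists_mem_filt f
      obtain ⟨R, hR⟩ : ∃ R : ℕ, n - N < R := ⟨(n - N).toNat + 1, by omega⟩
      rw [HahnSeries.coeff_smul]
      change ∑ᶠ r : ℕ, T r ((c • f).coeff (n - r)) = c • ∑ᶠ r : ℕ, T r (f.coeff (n - r))
      rw [key n _ _ (Submodule.smul_mem _ c hN) R hR, key n _ _ hN R hR, Finset.smul_sum]
      exact Finset.sum_congr rfl fun r _ => by rw [HahnSeries.coeff_smul, map_smul] }

theorem coeff_opSeries (T : ℕ → V →ₗ[ℂ] W) (f : LaurentSeries V) (n : ℤ) :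
    (opSeries T f).coeff n = ∑ᶠ r : ℕ, T r (f.coeff (n - r)) := rfl

theorem isFormal_opSeries (T : ℕ → V →ₗ[ℂ] W) : IsFormal (opSeries T) where
  map_shift n f := by
    ext k
    rw [coeff_shift, coeff_opSeries, coeff_opSeries]
    refine finsum_congr fun r => ?_
    rw [coeff_shift, show k - (r : ℤ) - n = k - n - r by ring]
  bdd := ⟨0, fun f hf n hn => by
    rw [coeff_opSeries]
    refine finsum_eq_zero_of_forall_eq_zero fun r => ?_
    rw [hf _ (by omega), map_zero]⟩

theorem coef_opSeries (T : ℕ → V →ₗ[ℂ] W) (n : ℕ) : coef (opSeries T) n = T n := by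
  ext v
  rw [coef_apply, coeff_opSeries, finsum_eq_single _ n]
  · simp
  · intro r hr
    rw [coeff_mono, if_neg (by omega), map_zero]

theorem coef_opSeries_neg (T : ℕ → V →ₗ[ℂ] W) {n : ℤ} (hn : n < 0) : coef (opSeries T) n = 0 := by
  ext v
  rw [coef_apply, coeff_opSeries]
  refine finsum_eq_zero_of_forall_eq_zero fun r => ?_
  rw [coeff_mono, if_neg (by omega), map_zero]

/-- A formal operator with no negative powers is the one with the given coefficients. -/
theorem IsFormal.eq_opSeries {Φ : LaurentSeries V →ₗ[ℂ] LaurentSeries W} (h : IsFormal Φ)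
    (H : ∀ n < 0, coef Φ n = 0) : Φ = opSeries fun n : ℕ => coef Φ n := by
  refine h.ext_coef (isFormal_opSeries _) fun n => ?_
  rcases lt_or_ge n 0 with hn | hn
  · rw [H n hn, coef_opSeries_neg _ hn]
  · obtain ⟨k, rfl⟩ := Int.eq_ofNat_of_zero_le hn
    rw [coef_opSeries]

/-- The formal operator with given coefficients, which vanish below `K`. -/
theorem exists_isFormal_of_coef (T : ℤ → V →ₗ[ℂ] W) (K : ℤ) (hT : ∀ n < K, T n = 0) :
    ∃ Φ : LaurentSeries V →ₗ[ℂ] LaurentSeries W, IsFormal Φ ∧ ∀ n, coef Φ n = T n := by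
  refine ⟨shift K ∘ₗ opSeries fun n : ℕ => T (K + n),
    (isFormal_shift K).comp (isFormal_opSeries _), fun n => ?_⟩
  have h : coef (shift K ∘ₗ opSeries fun n : ℕ => T (K + n)) n =
      coef (opSeries fun n : ℕ => T (K + n)) (n - K) := rfl
  rw [h]
  rcases lt_or_ge (n - K) 0 with hn | hn
  · rw [coef_opSeries_neg _ hn, hT n (by omega)]
  · obtain ⟨k, hk⟩ := Int.eq_ofNat_of_zero_le hn
    rw [hk, coef_opSeries]
    congr 1
    omega

/-- The product of series defined by bilinear maps `C r`. -/
noncomputable def prodSeries (C : ℕ → V →ₗ[ℂ] W →ₗ[ℂ] Z) :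
    LaurentSeries V →ₗ[ℂ] LaurentSeries W →ₗ[ℂ] LaurentSeries Z := by
  have key : ∀ (n N M : ℤ) (f : LaurentSeries V) (g : LaurentSeries W), f ∈ filt V N →
      g ∈ filt W M → ∀ R : ℕ, n - N - M < R →
      ∑ᶠ q : ℕ × ℤ, C q.1 (f.coeff q.2) (g.coeff (n - q.1 - q.2)) =
        ∑ q ∈ Finset.range R ×ˢ Finset.Ico N (N + R),
          C q.1 (f.coeff q.2) (g.coeff (n - q.1 - q.2)) := by
    intro n N M f g hf hg R hR
    apply finsum_eq_sum_of_support_subset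
    rintro ⟨r, i⟩ hr
    by_contra hh
    apply hr
    simp only [Finset.coe_product, Finset.coe_range, Finset.coe_Ico, Set.mem_prod, Set.mem_Iio,
      Set.mem_Ico, not_and, not_lt] at hh
    change C r (f.coeff i) (g.coeff (n - r - i)) = 0
    by_cases h : i < N
    · rw [hf _ h, map_zero, LinearMap.zero_apply]
    · rw [hg _ (by by_contra h'; have := hh (by omega) (by omega); omega), map_zero]
  let F (f : LaurentSeries V) (g : LaurentSeries W) : LaurentSeries Z :=
    HahnSeries.ofSuppBddBelow
      (fun n : ℤ => ∑ᶠ q : ℕ × ℤ, C q.1 (f.coeff q.2) (g.coeff (n - q.1 - q.2))) <| by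
      obtain ⟨N, hN⟩ := exists_mem_filt f
      obtain ⟨M, hM⟩ := exists_mem_filt g
      refine ⟨N + M, fun n hn => not_lt.1 fun h => hn ?_⟩
      refine finsum_eq_zero_of_forall_eq_zero fun q => ?_
      by_cases hq : q.2 < N
      · rw [hN _ hq, map_zero, LinearMap.zero_apply]
      · rw [hM _ (by omega), map_zero]
  have hF : ∀ f g n, (F f g).coeff n =
      ∑ᶠ q : ℕ × ℤ, C q.1 (f.coeff q.2) (g.coeff (n - q.1 - q.2)) := fun _ _ _ => rfl
  refine LinearMap.mk₂ ℂ F ?_ ?_ ?_ ?_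
  · intro f f' g
    ext n
    obtain ⟨N, hN⟩ := exists_mem_filt f
    obtain ⟨N', hN'⟩ := exists_mem_filt f'
    obtain ⟨M, hM⟩ := exists_mem_filt g
    have hf := filt_anti (min_le_left N N') hN
    have hf' := filt_anti (min_le_right N N') hN'
    obtain ⟨R, hR⟩ : ∃ R : ℕ, n - min N N' - M < R := ⟨(n - min N N' - M).toNat + 1, by omega⟩
    rw [HahnSeries.coeff_add, hF, hF, hF, key n _ _ _ _ (Submodule.add_mem _ hf hf') hM R hR,
      key n _ _ _ _ hf hM R hR, key n _ _ _ _ hf' hM R hR, ← Finset.sum_add_distrib]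
    exact Finset.sum_congr rfl fun r _ => by
      rw [HahnSeries.coeff_add, map_add, LinearMap.add_apply]
  · intro c f g
    ext n
    obtain ⟨N, hN⟩ := exists_mem_filt f
    obtain ⟨M, hM⟩ := exists_mem_filt g
    obtain ⟨R, hR⟩ : ∃ R : ℕ, n - N - M < R := ⟨(n - N - M).toNat + 1, by omega⟩
    rw [HahnSeries.coeff_smul, hF, hF, key n _ _ _ _ (Submodule.smul_mem _ c hN) hM R hR,
      key n _ _ _ _ hN hM R hR, Finset.smul_sum]
    exact Finset.sum_congr rfl fun r _ => by
      rw [HahnSeries.coeff_smul, map_smul, LinearMap.smul_apply]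
  · intro f g g'
    ext n
    obtain ⟨N, hN⟩ := exists_mem_filt f
    obtain ⟨M, hM⟩ := exists_mem_filt g
    obtain ⟨M', hM'⟩ := exists_mem_filt g'
    have hg := filt_anti (min_le_left M M') hM
    have hg' := filt_anti (min_le_right M M') hM'
    obtain ⟨R, hR⟩ : ∃ R : ℕ, n - N - min M M' < R := ⟨(n - N - min M M').toNat + 1, by omega⟩
    rw [HahnSeries.coeff_add, hF, hF, hF, key n _ _ _ _ hN (Submodule.add_mem _ hg hg') R hR,
      key n _ _ _ _ hN hg R hR, key n _ _ _ _ hN hg' R hR, ← Finset.sum_add_distrib]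
    exact Finset.sum_congr rfl fun r _ => by rw [HahnSeries.coeff_add, map_add]
  · intro c f g
    ext n
    obtain ⟨N, hN⟩ := exists_mem_filt f
    obtain ⟨M, hM⟩ := exists_mem_filt g
    obtain ⟨R, hR⟩ : ∃ R : ℕ, n - N - M < R := ⟨(n - N - M).toNat + 1, by omega⟩
    rw [HahnSeries.coeff_smul, hF, hF, key n _ _ _ _ hN (Submodule.smul_mem _ c hM) R hR,
      key n _ _ _ _ hN hM R hR, Finset.smul_sum]
    exact Finset.sum_congr rfl fun r _ => by rw [HahnSeries.coeff_smul, map_smul]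

theorem coeff_prodSeries (C : ℕ → V →ₗ[ℂ] W →ₗ[ℂ] Z) (f : LaurentSeries V) (g : LaurentSeries W)
    (n : ℤ) : (prodSeries C f g).coeff n =
      ∑ᶠ q : ℕ × ℤ, C q.1 (f.coeff q.2) (g.coeff (n - q.1 - q.2)) := rfl

/-- A bilinear map of Laurent series that is linear over `ℂ[ν⁻¹, ν]]` and does not lower the
order. -/
structure IsFormalBilin (B : LaurentSeries V →ₗ[ℂ] LaurentSeries W →ₗ[ℂ] LaurentSeries Z) :
    Prop where
  shift_left : ∀ n f g, B (shift n f) g = shift n (B f g)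
  shift_right : ∀ n f g, B f (shift n g) = shift n (B f g)
  mem_filt : ∀ N M f g, f ∈ filt V N → g ∈ filt W M → B f g ∈ filt Z (N + M)

theorem isFormalBilin_prodSeries (C : ℕ → V →ₗ[ℂ] W →ₗ[ℂ] Z) :
    IsFormalBilin (prodSeries C) where
  shift_left n f g := by
    ext k
    rw [coeff_shift, coeff_prodSeries, coeff_prodSeries]
    rw [← finsum_comp_equiv ((Equiv.refl ℕ).prodCongr (Equiv.addRight n))]
    refine finsum_congr fun q => ?_
    simp only [Equiv.prodCongr_apply, Prod.map, Equiv.refl_apply, Equiv.coe_addRight, coeff_shift]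
    rw [add_sub_cancel_right, show k - q.1 - (q.2 + n) = k - n - q.1 - q.2 by ring]
  shift_right n f g := by
    ext k
    rw [coeff_shift, coeff_prodSeries, coeff_prodSeries]
    refine finsum_congr fun q => ?_
    rw [coeff_shift, show k - n - (q.1 : ℤ) - q.2 = k - q.1 - q.2 - n by ring]
  mem_filt N M f g hf hg n hn := by
    rw [coeff_prodSeries]
    refine finsum_eq_zero_of_forall_eq_zero fun q => ?_
    by_cases hq : q.2 < N
    · rw [hf _ hq, map_zero, LinearMap.zero_apply]
    · rw [hg _ (by omega), map_zero]

theorem coeff_prodSeries_mono (C : ℕ → V →ₗ[ℂ] W →ₗ[ℂ] Z) (v : V) (w : W) (n : ℕ) :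
    (prodSeries C (mono 0 v) (mono 0 w)).coeff n = C n v w := by
  rw [coeff_prodSeries, finsum_eq_single _ (n, 0)]
  · simp
  · rintro ⟨r, i⟩ hr
    simp only
    by_cases hi : i = 0
    · subst hi
      rw [coeff_mono 0 (n - r - 0), if_neg, map_zero]
      intro h
      apply hr
      ext
      · simp only; omega
      · rfl
    · rw [coeff_mono, if_neg hi, map_zero, LinearMap.zero_apply]

namespace IsFormalBilin

variable {B B' : LaurentSeries V →ₗ[ℂ] LaurentSeries W →ₗ[ℂ] LaurentSeries Z}

theorem left (h : IsFormalBilin B) (f : LaurentSeries V) : IsFormal (B f) where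
  map_shift n g := h.shift_right n f g
  bdd := by
    obtain ⟨N, hN⟩ := exists_mem_filt f
    exact ⟨N + 0, fun g hg => h.mem_filt N 0 f g hN hg⟩

theorem flip (h : IsFormalBilin B) : IsFormalBilin B.flip where
  shift_left n f g := h.shift_right n g f
  shift_right n f g := h.shift_left n g f
  mem_filt N M f g hf hg := by
    rw [add_comm]
    exact h.mem_filt M N g f hg hf

theorem right (h : IsFormalBilin B) (g : LaurentSeries W) : IsFormal (B.flip g) := h.flip.left g

theorem ext_mono (h : IsFormalBilin B) (h' : IsFormalBilin B')
    (H : ∀ v w, B (mono 0 v) (mono 0 w) = B' (mono 0 v) (mono 0 w)) : B = B' := by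
  ext1 f
  refine (h.left f).ext_mono (h'.left f) fun w => ?_
  have := (h.right (mono 0 w)).ext_mono (h'.right (mono 0 w)) fun v => H v w
  exact LinearMap.congr_fun this f

theorem coeff_lowest (h : IsFormalBilin B) {N M : ℤ} {f : LaurentSeries V} {g : LaurentSeries W}
    (hf : f ∈ filt V N) (hg : g ∈ filt W M) :
    (B f g).coeff (N + M) = (B (mono 0 (f.coeff N)) (mono 0 (g.coeff M))).coeff 0 := by
  have h1 := (h.left f).coeff_lowest (K := N) (fun u hu => by
    simpa using h.mem_filt N 0 f u hf hu) hg
  have h2 := (h.right (mono 0 (g.coeff M))).coeff_lowest (K := 0) (fun u hu => by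
    simpa using h.mem_filt 0 0 u _ hu (mono_mem_filt 0 (g.coeff M))) hf
  rw [add_comm N M, h1, coef_apply]
  rw [add_zero] at h2
  exact h2

theorem comp (h : IsFormalBilin B) {V' W' Z' : Type*} [AddCommGroup V'] [Module ℂ V']
    [AddCommGroup W'] [Module ℂ W'] [AddCommGroup Z'] [Module ℂ Z']
    {α : LaurentSeries V' →ₗ[ℂ] LaurentSeries V} {β : LaurentSeries W' →ₗ[ℂ] LaurentSeries W}
    {γ : LaurentSeries Z →ₗ[ℂ] LaurentSeries Z'}
    (hα : IsFormal α) (hβ : IsFormal β) (hγ : IsFormal γ)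
    (hα' : ∀ f ∈ filt V' 0, α f ∈ filt V 0) (hβ' : ∀ f ∈ filt W' 0, β f ∈ filt W 0)
    (hγ' : ∀ f ∈ filt Z 0, γ f ∈ filt Z' 0) :
    IsFormalBilin ((B.compl₁₂ α β).compr₂ γ) where
  shift_left n f g := by
    simp only [LinearMap.compr₂_apply, LinearMap.compl₁₂_apply, hα.map_shift, h.shift_left,
      hγ.map_shift]
  shift_right n f g := by
    simp only [LinearMap.compr₂_apply, LinearMap.compl₁₂_apply, hβ.map_shift, h.shift_right,
      hγ.map_shift]
  mem_filt N M f g hf hg := by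
    have h1 := hα.map_mem_filt hα' hf
    have h2 := hβ.map_mem_filt hβ' hg
    rw [add_zero] at h1 h2
    have h3 := hγ.map_mem_filt hγ' (h.mem_filt _ _ _ _ h1 h2)
    rwa [add_zero] at h3

/-- The way back from an abstract bilinear product to cochains `C_r`, which the definition of a star
product asks for. -/
theorem eq_prodSeries (h : IsFormalBilin B) :
    B = prodSeries fun n : ℕ => LinearMap.mk₂ ℂ
      (fun v w => (B (mono 0 v) (mono 0 w)).coeff n) (by intros; simp) (by intros; simp)
      (by intros; simp) (by intros; simp) := by
  refine h.ext_mono (isFormalBilin_prodSeries _) fun v w => ?_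
  ext n
  rcases lt_or_ge n 0 with hn | hn
  · rw [h.mem_filt 0 0 _ _ (mono_mem_filt 0 v) (mono_mem_filt 0 w) n (by omega),
      (isFormalBilin_prodSeries _).mem_filt 0 0 _ _ (mono_mem_filt 0 v) (mono_mem_filt 0 w) n
        (by omega)]
  · obtain ⟨k, rfl⟩ := Int.eq_ofNat_of_zero_le hn
    rw [coeff_prodSeries_mono]
    rfl

end IsFormalBilin

end Formal

end SuperStar


namespace SuperStar

/-! ## Supercommutative algebras with coordinates -/

/-- The sign `(-1)^p` of a parity `p`. -/
def esgn (p : Bool) : ℂ := if p then -1 else 1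

/-- The sign `(-1)^(p q)` of two parities `p`, `q`. -/
def ssgn (p q : Bool) : ℂ := if p && q then -1 else 1

@[simp] theorem esgn_true : esgn true = -1 := rfl
@[simp] theorem esgn_false : esgn false = 1 := rfl
@[simp] theorem ssgn_true_true : ssgn true true = -1 := rfl
@[simp] theorem ssgn_false_left (q : Bool) : ssgn false q = 1 := rfl
@[simp] theorem ssgn_false_right (p : Bool) : ssgn p false = 1 := by cases p <;> rfl
@[simp] theorem ssgn_true_left (q : Bool) : ssgn true q = esgn q := by cases q <;> rfl

theorem ssgn_comm (p q : Bool) : ssgn p q = ssgn q p := by cases p <;> cases q <;> rfl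

@[simp] theorem ssgn_mul_self (p q : Bool) : ssgn p q * ssgn p q = 1 := by
  cases p <;> cases q <;> simp

/-- A supercommutative algebra with parity automorphism `P` and with coordinates `x i`, whose
partial (left) derivatives are `d i`. -/
structure SuperCoords (A ι : Type*) [Ring A] [Module ℂ A] [SMulCommClass ℂ A A]
    [IsScalarTower ℂ A A] [DecidableEq ι] where
  P : Module.End ℂ A
  P_mul : ∀ a b, P (a * b) = P a * P b
  P_one : P 1 = 1
  P_P : ∀ a, P (P a) = a
  even_comm : ∀ a b, P a = a → a * b = b * a
  odd_comm : ∀ a b, P a = -a → a * b = P b * a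
  odd : ι → Bool
  x : ι → A
  d : ι → Module.End ℂ A
  P_x : ∀ i, P (x i) = esgn (odd i) • x i
  P_d : ∀ i a, P (d i a) = esgn (odd i) • d i (P a)
  d_mul : ∀ i a b, d i (a * b) = d i a * b + (if odd i then P a else a) * d i b
  d_d : ∀ i j a, d i (d j a) = ssgn (odd i) (odd j) • d j (d i a)
  d_x : ∀ i j, d i (x j) = if i = j then 1 else 0
  -- Hadamard's lemma in operator form. Because of the inserted parities, the hypothesis says that
  -- `D` graded commutes with every coordinate. This is what makes operators of order zero
  -- multiplications.
  hadamard : ∀ D : Module.End ℂ A,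
    (∀ i a, D (x i * a) =
      x i * (if odd i then P (D (P a)) else D a)) → D 1 = 0 → D = 0

namespace SuperCoords

variable {A ι : Type*} [Ring A] [Module ℂ A] [SMulCommClass ℂ A A] [IsScalarTower ℂ A A]
  [DecidableEq ι] (c : SuperCoords A ι)

/-- `P` for odd parity and the identity for even parity. -/
def Q (p : Bool) : Module.End ℂ A := if p then c.P else 1

@[simp] theorem Q_true : c.Q true = c.P := rfl
@[simp] theorem Q_false : c.Q false = 1 := rfl

theorem Q_mul (p : Bool) (a b : A) : c.Q p (a * b) = c.Q p a * c.Q p b := by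
  cases p <;> simp [c.P_mul]

@[simp] theorem Q_one (p : Bool) : c.Q p 1 = 1 := by cases p <;> simp [c.P_one]

@[simp] theorem Q_Q (p : Bool) (a : A) : c.Q p (c.Q p a) = a := by cases p <;> simp [c.P_P]

theorem Q_comm (p q : Bool) (a : A) : c.Q p (c.Q q a) = c.Q q (c.Q p a) := by
  cases p <;> cases q <;> simp

/-- `a` is homogeneous of parity `p`. -/
def Homog (p : Bool) (a : A) : Prop := c.P a = esgn p • a

variable {c} in
theorem Homog.Q {p : Bool} {a : A} (h : c.Homog p a) (q : Bool) : c.Q q a = ssgn q p • a := by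
  cases q
  · simp
  · rw [ssgn_true_left]
    exact h

variable {c} in
theorem Homog.mul_comm {p : Bool} {a : A} (h : c.Homog p a) (b : A) : a * b = c.Q p b * a := by
  cases p
  · simpa using c.even_comm a b (by simpa [Homog] using h)
  · simpa using c.odd_comm a b (by simpa [Homog] using h)

variable {c} in
theorem Homog.comm_mul {p : Bool} {a : A} (h : c.Homog p a) (b : A) : b * a = a * c.Q p b := by
  rw [h.mul_comm, Q_Q]

theorem homog_x (i : ι) : c.Homog (c.odd i) (c.x i) := c.P_x i

variable {c} in
theorem Homog.d {p : Bool} {a : A} (h : c.Homog p a) (i : ι) :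
    c.Homog (xor (c.odd i) p) (c.d i a) := by
  unfold Homog at *
  rw [c.P_d, h]
  cases c.odd i <;> cases p <;> simp

theorem Q_x (p : Bool) (i : ι) : c.Q p (c.x i) = ssgn p (c.odd i) • c.x i := (c.homog_x i).Q p

theorem Q_d (p : Bool) (i : ι) (a : A) :
    c.Q p (c.d i a) = ssgn p (c.odd i) • c.d i (c.Q p a) := by
  cases p
  · simp
  · simpa using c.P_d i a

theorem d_mul' (i : ι) (a b : A) :
    c.d i (a * b) = c.d i a * b + c.Q (c.odd i) a * c.d i b := by
  rw [c.d_mul]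
  cases c.odd i <;> simp

@[simp] theorem d_one (i : ι) : c.d i 1 = 0 := by
  have := c.d_mul' i 1 1
  simpa using this

theorem exists_homog_add (a : A) : ∃ a₀ a₁, c.Homog false a₀ ∧ c.Homog true a₁ ∧ a = a₀ + a₁ := by
  refine ⟨(1 / 2 : ℂ) • (a + c.P a), (1 / 2 : ℂ) • (a - c.P a), ?_, ?_, ?_⟩
  · simp [Homog, c.P_P, add_comm]
  · simp only [Homog, map_smul, map_sub, c.P_P, esgn_true]
    module
  · module

/-- Left multiplication by `a`. -/
def L (a : A) : Module.End ℂ A := LinearMap.mulLeft ℂ a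

@[simp] theorem L_apply (a b : A) : L a b = a * b := rfl

/-- Conjugation of an operator by `Q p`. -/
def cj (p : Bool) : Module.End ℂ A →ₗ[ℂ] Module.End ℂ A where
  toFun D := c.Q p * D * c.Q p
  map_add' D E := by rw [mul_add, add_mul]
  map_smul' r D := by simp

@[simp] theorem cj_apply (p : Bool) (D : Module.End ℂ A) (a : A) :
    c.cj p D a = c.Q p (D (c.Q p a)) := rfl

@[simp] theorem cj_cj (p : Bool) (D : Module.End ℂ A) : c.cj p (c.cj p D) = D := by
  ext a
  simp

/-- The graded commutator `D a - (-1)^(|a||D|) a D` of an operator `D` and an element `a` of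
parity `p`. -/
def gam (p : Bool) (a : A) : Module.End ℂ A →ₗ[ℂ] Module.End ℂ A where
  toFun D := D * L a - L a * c.cj p D
  map_add' D E := by
    rw [map_add, mul_add, add_mul]
    abel
  map_smul' r D := by
    ext b
    simp [smul_sub]

@[simp] theorem gam_apply (p : Bool) (a b : A) (D : Module.End ℂ A) :
    c.gam p a D b = D (a * b) - a * c.Q p (D (c.Q p b)) := rfl

variable {c} in
-- Homogeneous elements supercommute, hence so do the commutators with them.
theorem gam_gam {p q : Bool} {a b : A} (ha : c.Homog p a) (hb : c.Homog q b)
    (D : Module.End ℂ A) :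
    c.gam p a (c.gam q b D) = ssgn p q • c.gam q b (c.gam p a D) := by
  ext f
  have hab : b * a = ssgn p q • (a * b) := by
    rw [ha.comm_mul, hb.Q, mul_smul_comm]
  simp only [gam_apply, LinearMap.smul_apply, c.Q_mul, map_sub, ha.Q, hb.Q, mul_sub,
    mul_smul_comm, smul_mul_assoc, map_smul]
  simp only [← mul_assoc, hab, smul_mul_assoc, map_smul]
  rw [c.Q_comm p q f, c.Q_comm p q]
  cases p <;> cases q <;> simp <;> abel

variable {c} in
theorem gam_cj {p : Bool} {a : A} (ha : c.Homog p a) (q : Bool) (D : Module.End ℂ A) :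
    c.gam p a (c.cj q D) = ssgn p q • c.cj q (c.gam p a D) := by
  ext f
  simp only [gam_apply, cj_apply, LinearMap.smul_apply, c.Q_mul, map_sub, ha.Q,
    smul_mul_assoc, map_smul]
  rw [c.Q_comm p q f, c.Q_comm p q, ssgn_comm q p]
  cases p <;> cases q <;> simp <;> abel

theorem gam_mul (p : Bool) (a : A) (D E : Module.End ℂ A) :
    c.gam p a (D * E) = D * c.gam p a E + c.gam p a D * c.cj p E := by
  ext f
  simp [Module.End.mul_apply]

variable {c} in
theorem gam_L {p : Bool} {a : A} (ha : c.Homog p a) (b : A) : c.gam p a (L b) = 0 := by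
  ext f
  simp only [gam_apply, L_apply, c.Q_mul, Q_Q, LinearMap.zero_apply, ← mul_assoc]
  rw [ha.comm_mul, sub_self]

variable {c} in
theorem gam_mul_L {p : Bool} {a : A} (ha : c.Homog p a) (D : Module.End ℂ A) (b : A) :
    c.gam p a (D * L b) = c.gam p a D * L (c.Q p b) := by
  rw [gam_mul, gam_L ha, mul_zero, zero_add]
  congr 1
  ext f
  simp [c.Q_mul]

variable {c} in
theorem gam_L_mul {p : Bool} {a : A} (ha : c.Homog p a) (b : A) (D : Module.End ℂ A) :
    c.gam p a (L b * D) = L b * c.gam p a D := by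
  ext f
  simp only [gam_apply, Module.End.mul_apply, L_apply, mul_sub, c.Q_mul, ← mul_assoc]
  rw [ha.comm_mul]

/-- The graded commutator with the coordinate `x i`. -/
def gamx (i : ι) : Module.End ℂ A →ₗ[ℂ] Module.End ℂ A := c.gam (c.odd i) (c.x i)

theorem gamx_apply (i : ι) (b : A) (D : Module.End ℂ A) :
    c.gamx i D b = D (c.x i * b) - c.x i * c.Q (c.odd i) (D (c.Q (c.odd i) b)) := rfl

theorem gamx_gamx (i j : ι) (D : Module.End ℂ A) :
    c.gamx i (c.gamx j D) = ssgn (c.odd i) (c.odd j) • c.gamx j (c.gamx i D) :=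
  gam_gam (c.homog_x i) (c.homog_x j) D

/-- The Leibniz rule for the commutator combined with the canonical relation `[∂_i, x_j] = δ_ij`. -/
theorem gamx_mul_d (i j : ι) (D : Module.End ℂ A) :
    c.gamx j (D * c.d i) =
      (if i = j then D else 0) + ssgn (c.odd i) (c.odd j) • (c.gamx j D * c.d i) := by
  ext f
  simp only [gamx_apply, Module.End.mul_apply, LinearMap.add_apply, LinearMap.smul_apply, c.d_mul',
    c.d_x, c.Q_x, c.Q_d, map_add, map_smul, smul_mul_assoc]
  rw [ssgn_comm (c.odd j) (c.odd i)]
  split_ifs with h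
  · subst h
    simp only [one_mul, mul_smul_comm, smul_sub, smul_smul, ssgn_mul_self, one_smul]
    abel
  · simp only [zero_mul, map_zero, LinearMap.zero_apply, mul_smul_comm, smul_sub,
      smul_smul, ssgn_mul_self, one_smul]
    abel

theorem gamx_d (i j : ι) : c.gamx j (c.d i) = if i = j then 1 else 0 := by
  have h := c.gamx_mul_d i j 1
  have h1 : c.gamx j (1 : Module.End ℂ A) = 0 := by
    ext f
    simp [gamx_apply]
  rwa [h1, zero_mul, smul_zero, add_zero, one_mul] at h

/-- The operators all of whose `n`-fold graded commutators with coordinates vanish; these are the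
differential operators of order less than `n`. -/
def W : ℕ → Submodule ℂ (Module.End ℂ A)
  | 0 => ⊥
  | n + 1 => ⨅ i, (W n).comap (c.gamx i)

theorem mem_W_zero {D : Module.End ℂ A} : D ∈ c.W 0 ↔ D = 0 := Iff.rfl

theorem mem_W_succ {n : ℕ} {D : Module.End ℂ A} : D ∈ c.W (n + 1) ↔ ∀ i, c.gamx i D ∈ c.W n := by
  simp [W]

theorem W_le_succ (n : ℕ) : c.W n ≤ c.W (n + 1) := by
  induction n with
  | zero =>
    intro D hD
    rw [mem_W_zero] at hD
    rw [hD]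
    exact Submodule.zero_mem _
  | succ n ih =>
    intro D hD
    rw [mem_W_succ] at hD ⊢
    exact fun i => ih (hD i)

theorem W_mono {n k : ℕ} (h : n ≤ k) : c.W n ≤ c.W k := by
  induction h with
  | refl => exact le_rfl
  | step _ ih => exact ih.trans (c.W_le_succ _)

theorem cj_mem_W (q : Bool) {n : ℕ} {D : Module.End ℂ A} (hD : D ∈ c.W n) : c.cj q D ∈ c.W n := by
  induction n generalizing D with
  | zero =>
    rw [mem_W_zero] at hD ⊢
    rw [hD, map_zero]
  | succ n ih =>
    rw [mem_W_succ] at hD ⊢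
    intro i
    rw [gamx, gam_cj (c.homog_x i)]
    exact Submodule.smul_mem _ _ (ih (hD i))

theorem mul_L_mem_W {n : ℕ} {D : Module.End ℂ A} (hD : D ∈ c.W n) (b : A) : D * L b ∈ c.W n := by
  induction n generalizing D b with
  | zero =>
    rw [mem_W_zero] at hD ⊢
    rw [hD, zero_mul]
  | succ n ih =>
    rw [mem_W_succ] at hD ⊢
    intro i
    rw [gamx, gam_mul_L (c.homog_x i)]
    exact ih (hD i) _

theorem mul_d_mem_W {n : ℕ} {D : Module.End ℂ A} (hD : D ∈ c.W n) (i : ι) :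
    D * c.d i ∈ c.W (n + 1) := by
  induction n generalizing D with
  | zero =>
    rw [mem_W_zero] at hD
    rw [hD, zero_mul]
    exact Submodule.zero_mem _
  | succ n ih =>
    rw [mem_W_succ]
    intro j
    rw [gamx_mul_d]
    refine Submodule.add_mem _ ?_ (Submodule.smul_mem _ _ (ih (c.mem_W_succ.1 hD j)))
    split_ifs
    · exact hD
    · exact Submodule.zero_mem _

/-- Orders add under composition. The bound is one larger than the sharp `n + k - 1`; only
finiteness of the order is used later. -/
theorem mul_mem_W {n k : ℕ} {D E : Module.End ℂ A} (hD : D ∈ c.W n) (hE : E ∈ c.W k) :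
    D * E ∈ c.W (n + k) := by
  induction h : n + k generalizing n k D E with
  | zero =>
    obtain ⟨rfl, rfl⟩ : n = 0 ∧ k = 0 := by omega
    rw [mem_W_zero] at hD ⊢
    rw [hD, zero_mul]
  | succ l ih =>
    rw [mem_W_succ]
    intro i
    rw [gamx, gam_mul]
    refine Submodule.add_mem _ ?_ ?_
    · rcases k with _ | k
      · rw [mem_W_zero] at hE
        rw [hE, map_zero, mul_zero]
        exact Submodule.zero_mem _
      · exact ih hD (c.mem_W_succ.1 hE i) (by omega)
    · rcases n with _ | n
      · rw [mem_W_zero] at hD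
        rw [hD, map_zero, zero_mul]
        exact Submodule.zero_mem _
      · exact ih (c.mem_W_succ.1 hD i) (c.cj_mem_W _ hE) (by omega)

theorem L_mem_W (a : A) : L a ∈ c.W 1 :=
  c.mem_W_succ.2 fun i => c.mem_W_zero.2 (gam_L (c.homog_x i) a)

theorem eq_zero_of_mem_W_one {D : Module.End ℂ A} (hD : D ∈ c.W 1) (h : D 1 = 0) : D = 0 := by
  refine c.hadamard D (fun i a => ?_) h
  have := LinearMap.congr_fun (c.mem_W_zero.1 (c.mem_W_succ.1 hD i)) a
  rw [gamx_apply, LinearMap.zero_apply, sub_eq_zero] at this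
  rw [this]
  cases c.odd i <;> simp

theorem eq_L_of_mem_W_one {D : Module.End ℂ A} (hD : D ∈ c.W 1) : D = L (D 1) := by
  rw [← sub_eq_zero]
  exact c.eq_zero_of_mem_W_one (Submodule.sub_mem _ hD (c.L_mem_W _)) (by simp)

/-- Differential operators. -/
def DO (D : Module.End ℂ A) : Prop := ∃ n, D ∈ c.W n

namespace DO

variable {c} {D E : Module.End ℂ A}

theorem mul (hD : c.DO D) (hE : c.DO E) : c.DO (D * E) := by
  obtain ⟨n, hn⟩ := hD
  obtain ⟨k, hk⟩ := hE
  exact ⟨_, c.mul_mem_W hn hk⟩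

theorem add (hD : c.DO D) (hE : c.DO E) : c.DO (D + E) := by
  obtain ⟨n, hn⟩ := hD
  obtain ⟨k, hk⟩ := hE
  exact ⟨max n k, Submodule.add_mem _ (c.W_mono (le_max_left _ _) hn)
    (c.W_mono (le_max_right _ _) hk)⟩

theorem smul (hD : c.DO D) (r : ℂ) : c.DO (r • D) := by
  obtain ⟨n, hn⟩ := hD
  exact ⟨n, Submodule.smul_mem _ r hn⟩

theorem sub (hD : c.DO D) (hE : c.DO E) : c.DO (D - E) := by
  have : D - E = D + (-1 : ℂ) • E := by module
  rw [this]
  exact hD.add (hE.smul _)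

theorem neg (hD : c.DO D) : c.DO (-D) := by
  have : -D = (-1 : ℂ) • D := by module
  rw [this]
  exact hD.smul _

theorem zero : c.DO 0 := ⟨0, Submodule.zero_mem _⟩

theorem L (a : A) : c.DO (L a) := ⟨1, c.L_mem_W a⟩

theorem one : c.DO 1 := by
  have h : (1 : Module.End ℂ A) = SuperCoords.L 1 := by ext; simp
  rw [h]
  exact DO.L 1

theorem sum {α : Type*} (s : Finset α) (F : α → Module.End ℂ A) (h : ∀ a ∈ s, c.DO (F a)) :
    c.DO (∑ a ∈ s, F a) := by
  classical
  induction s using Finset.induction_on with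
  | empty => exact zero
  | insert a s ha ih =>
    rw [Finset.sum_insert ha]
    exact (h a (Finset.mem_insert_self a s)).add
      (ih fun b hb => h b (Finset.mem_insert_of_mem hb))

theorem d (i : ι) : c.DO (c.d i) := by
  refine ⟨2, c.mem_W_succ.2 fun j => ?_⟩
  rw [gamx_d]
  split_ifs
  · have h : (1 : Module.End ℂ A) = SuperCoords.L 1 := by ext; simp
    rw [h]
    exact c.L_mem_W 1
  · exact Submodule.zero_mem _

end DO

/-- The graded commutator with a function lowers the order. -/
theorem gam_mem_W {p : Bool} {f : A} (hf : c.Homog p f) {n : ℕ} {D : Module.End ℂ A}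
    (hD : D ∈ c.W (n + 1)) : c.gam p f D ∈ c.W n := by
  induction n generalizing D with
  | zero =>
    rw [c.eq_L_of_mem_W_one hD, gam_L hf]
    exact Submodule.zero_mem _
  | succ n ih =>
    rw [mem_W_succ] at hD ⊢
    intro i
    rw [gamx, gam_gam (c.homog_x i) hf]
    exact Submodule.smul_mem _ _ (ih (hD i))

/-! ### The Euler operator and the Poincaré lemma for differential operators -/

section Euler

variable [Fintype ι]

/-- The operator which multiplies the part of order exactly `n` of a differential operator by `n`,
up to terms of lower order. -/
def euler : Module.End ℂ A →ₗ[ℂ] Module.End ℂ A where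
  toFun D := ∑ i, c.gamx i D * c.d i
  map_add' D E := by
    rw [← Finset.sum_add_distrib]
    exact Finset.sum_congr rfl fun i _ => by rw [map_add, add_mul]
  map_smul' r D := by
    rw [RingHom.id_apply, Finset.smul_sum]
    exact Finset.sum_congr rfl fun i _ => by rw [map_smul, smul_mul_assoc]

theorem euler_apply (D : Module.End ℂ A) : c.euler D = ∑ i, c.gamx i D * c.d i := rfl

/-- The homotopy formula: the relation `[∂_j, x_j] = 1` produces `D j`, and closedness lets the
remaining terms reassemble into the Euler operator of `D j`. -/
theorem gamx_sum_mul_d (D : ι → Module.End ℂ A)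
    (hD : ∀ i j, c.gamx j (D i) = ssgn (c.odd i) (c.odd j) • c.gamx i (D j)) (j : ι) :
    c.gamx j (∑ i, D i * c.d i) = D j + c.euler (D j) := by
  rw [map_sum, euler_apply]
  simp only [c.gamx_mul_d, hD _ j, Finset.sum_add_distrib, smul_mul_assoc, smul_smul, ssgn_mul_self,
    one_smul]
  simp

theorem gamx_euler (D : Module.End ℂ A) (j : ι) :
    c.gamx j (c.euler D) = c.gamx j D + c.euler (c.gamx j D) :=
  c.gamx_sum_mul_d (fun i => c.gamx i D) (fun i j => by
    rw [c.gamx_gamx j i, ssgn_comm]) j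

/-- A commutator with a coordinate lowers the order by one, and by `gamx_euler` it commutes with
`euler` up to adding the commutator itself. This matches the passage from `n` to `n + 1`. -/
theorem euler_sub_mem_W {n : ℕ} {D : Module.End ℂ A} (hD : D ∈ c.W (n + 1)) :
    c.euler D - (n : ℂ) • D ∈ c.W n := by
  induction n generalizing D with
  | zero =>
    rw [mem_W_zero, euler_apply]
    simp only [Nat.cast_zero, zero_smul, sub_zero]
    exact Finset.sum_eq_zero fun i _ => by
      rw [c.mem_W_zero.1 (c.mem_W_succ.1 hD i), zero_mul]
  | succ n ih =>
    rw [mem_W_succ] at hD ⊢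
    intro j
    have h := ih (hD j)
    rw [map_sub, gamx_euler, map_smul]
    convert h using 1
    push_cast
    module

/-- The Poincaré lemma for differential operators. -/
theorem exists_gamx_eq {n : ℕ} (D : ι → Module.End ℂ A) (hn : ∀ i, D i ∈ c.W n)
    (hD : ∀ i j, c.gamx j (D i) = ssgn (c.odd i) (c.odd j) • c.gamx i (D j)) :
    ∃ E ∈ c.W (n + 1), ∀ i, c.gamx i E = D i := by
  induction n generalizing D with
  | zero => exact ⟨0, Submodule.zero_mem _, fun i => by rw [map_zero, c.mem_W_zero.1 (hn i)]⟩
  | succ n ih =>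
    -- The first approximation. Its commutators are `(D j + euler (D j)) / (n + 1)`, which agree
    -- with `D j` up to lower order since `D j` has order at most `n`. The defect is again closed,
    -- and the induction hypothesis removes it.
    set E₀ : Module.End ℂ A := ((n : ℂ) + 1)⁻¹ • ∑ i, D i * c.d i with hE₀
    have hn0 : (n : ℂ) + 1 ≠ 0 := by exact_mod_cast Nat.succ_ne_zero n
    have hE₀W : E₀ ∈ c.W (n + 2) :=
      Submodule.smul_mem _ _ (Submodule.sum_mem _ fun i _ => c.mul_d_mem_W (hn i) i)
    have hg : ∀ j, c.gamx j E₀ = ((n : ℂ) + 1)⁻¹ • (D j + c.euler (D j)) := fun j => by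
      rw [hE₀, map_smul, c.gamx_sum_mul_d D hD]
    have hdiff : ∀ j, D j - c.gamx j E₀ = -((n : ℂ) + 1)⁻¹ • (c.euler (D j) - (n : ℂ) • D j) := by
      intro j
      rw [hg]
      have : D j = (((n : ℂ) + 1)⁻¹ * ((n : ℂ) + 1)) • D j := by
        rw [inv_mul_cancel₀ hn0, one_smul]
      nth_rewrite 1 [this]
      module
    obtain ⟨E₁, hE₁W, hE₁⟩ := ih (fun j => D j - c.gamx j E₀)
      (fun j => by
        rw [hdiff]
        exact Submodule.smul_mem _ _ (c.euler_sub_mem_W (hn j)))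
      (fun i j => by
        rw [map_sub, map_sub, hD i j, c.gamx_gamx j i E₀, smul_sub, ssgn_comm (c.odd j)])
    refine ⟨E₀ + E₁, Submodule.add_mem _ hE₀W (c.W_le_succ _ hE₁W), fun i => ?_⟩
    rw [map_add, hE₁]
    abel

/-- The induction principle for differential operators: they are generated by multiplications and
derivatives. -/
theorem W_induction {p : Module.End ℂ A → Prop} (hL : ∀ a, p (L a))
    (hd : ∀ D i, c.DO D → p D → p (D * c.d i)) (hadd : ∀ D E, c.DO D → c.DO E → p D → p E →
      p (D + E)) (hsmul : ∀ D (r : ℂ), c.DO D → p D → p (r • D)) {D : Module.End ℂ A}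
    (hD : c.DO D) : p D := by
  obtain ⟨n, hn⟩ := hD
  have h0 : p 0 := by
    have := hL 0
    rwa [show L (0 : A) = 0 by ext; simp] at this
  induction n generalizing D with
  | zero =>
    rw [c.mem_W_zero.1 hn]
    exact h0
  | succ n ih =>
    rcases n with _ | n
    · rw [c.eq_L_of_mem_W_one hn]
      exact hL _
    have hn0 : (n : ℂ) + 1 ≠ 0 := by exact_mod_cast Nat.succ_ne_zero n
    have h1 := c.euler_sub_mem_W hn
    have h2 : ∀ s : Finset ι, p (∑ i ∈ s, c.gamx i D * c.d i) := by
      intro s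
      classical
      induction s using Finset.induction_on with
      | empty => simpa using h0
      | insert a s ha ihs =>
        rw [Finset.sum_insert ha]
        have hg := c.mem_W_succ.1 hn
        exact hadd _ _ (DO.mul ⟨_, hg a⟩ (DO.d a))
          (DO.sum s _ fun i _ => DO.mul ⟨_, hg i⟩ (DO.d i)) (hd _ _ ⟨_, hg a⟩ (ih (hg a))) ihs
    -- `D` is recovered from `euler D`, whose summands end in a derivative, and from a defect of
    -- lower order.
    have h3 : D = ((n : ℂ) + 1)⁻¹ • (c.euler D +
        (-1 : ℂ) • (c.euler D - ((n + 1 : ℕ) : ℂ) • D)) := by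
      have : D = (((n : ℂ) + 1)⁻¹ * ((n : ℂ) + 1)) • D := by
        rw [inv_mul_cancel₀ hn0, one_smul]
      nth_rewrite 1 [this]
      push_cast
      module
    have hE : c.DO (c.euler D) :=
      DO.sum _ _ fun i _ => DO.mul ⟨_, c.mem_W_succ.1 hn i⟩ (DO.d i)
    rw [h3]
    exact hsmul _ _ (hE.add (DO.smul ⟨_, h1⟩ _))
      (hadd _ _ hE (DO.smul ⟨_, h1⟩ _) (h2 _) (hsmul _ _ ⟨_, h1⟩ (ih h1)))

/-- The graded commutator with a function, up to terms of lower order. -/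
theorem gam_sub_sum_mem_W {p : Bool} {f : A} (hf : c.Homog p f) {n : ℕ} {D : Module.End ℂ A}
    (hD : D ∈ c.W (n + 2)) :
    c.gam p f D - ∑ i, c.gamx i D * L (c.d i f) ∈ c.W n := by
  induction n generalizing D with
  | zero =>
    -- For first order operators the formula is exact: `D` differs from `euler D` by a
    -- multiplication, which does not contribute to the commutator, and for `euler D` the claim is
    -- the Leibniz rule.
    have h1 : c.euler D - ((1 : ℕ) : ℂ) • D ∈ c.W 1 := c.euler_sub_mem_W hD
    have h2 : D = c.euler D - (c.euler D - ((1 : ℕ) : ℂ) • D) := by simp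
    rw [mem_W_zero]
    have h3 : c.gam p f D = c.gam p f (c.euler D) := by
      conv_lhs => rw [h2]
      rw [map_sub, c.mem_W_zero.1 (c.gam_mem_W hf h1), sub_zero]
    rw [h3, euler_apply, map_sum, ← Finset.sum_sub_distrib]
    refine Finset.sum_eq_zero fun i _ => ?_
    rw [c.eq_L_of_mem_W_one (c.mem_W_succ.1 hD i), gam_L_mul hf]
    set g : A := c.gamx i D 1
    ext b
    simp only [LinearMap.sub_apply, Module.End.mul_apply, L_apply, gam_apply, c.d_mul', c.Q_d,
      Q_Q, LinearMap.zero_apply, hf.Q, mul_smul_comm, smul_mul_assoc]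
    rw [ssgn_comm p, add_sub_cancel_right, sub_self]
  | succ n ih =>
    rw [mem_W_succ] at hD ⊢
    intro j
    have h := Submodule.smul_mem _ (ssgn (c.odd j) p) (ih (hD j))
    rw [map_sub, map_sum, gamx, gam_gam (c.homog_x j) hf]
    convert h using 1
    rw [smul_sub, Finset.smul_sum]
    congr 1
    refine Finset.sum_congr rfl fun i _ => ?_
    rw [gam_mul_L (c.homog_x j)]
    change c.gamx j (c.gamx i D) * _ = _
    rw [c.gamx_gamx j i, (hf.d i).Q]
    ext b
    simp only [Module.End.mul_apply, LinearMap.smul_apply, L_apply, smul_mul_assoc, map_smul,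
      smul_smul]
    congr 1
    cases c.odd i <;> cases c.odd j <;> cases p <;> simp

end Euler

end SuperCoords

end SuperStar


namespace SuperStar

/-! ### Multiplication of Laurent series as a formal bilinear map -/

section FormalMul

variable {A : Type*} [Ring A] [Module ℂ A] [SMulCommClass ℂ A A] [IsScalarTower ℂ A A]

theorem mono_zero_one : (mono 0 (1 : A) : LaurentSeries A) = 1 := rfl

theorem coeff_mono_zero_mul (a : A) (f : LaurentSeries A) (n : ℤ) :
    (mono 0 a * f).coeff n = a * f.coeff n := HahnSeries.coeff_single_zero_mul

theorem coeff_mul_mono_zero (a : A) (f : LaurentSeries A) (n : ℤ) :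
    (f * mono 0 a).coeff n = f.coeff n * a := HahnSeries.coeff_mul_single_zero

theorem mono_zero_mul_mono_zero (a b : A) :
    (mono 0 a * mono 0 b : LaurentSeries A) = mono 0 (a * b) := by
  ext n
  rw [coeff_mono_zero_mul, coeff_mono, coeff_mono]
  split_ifs <;> simp

/-- Scalars become factors by constant series; the compatibility of `mulB` with scalars is then
associativity. -/
theorem smul_eq_mul_mono (r : ℂ) (f : LaurentSeries A) : r • f = f * mono 0 (r • (1 : A)) := by
  ext n
  rw [coeff_mul_mono_zero, HahnSeries.coeff_smul, mul_smul_comm, mul_one]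

theorem smul_eq_mono_mul (r : ℂ) (f : LaurentSeries A) : r • f = mono 0 (r • (1 : A)) * f := by
  ext n
  rw [coeff_mono_zero_mul, HahnSeries.coeff_smul, smul_mul_assoc, one_mul]

theorem shift_eq_mul_single (n : ℤ) (f : LaurentSeries A) :
    shift n f = f * HahnSeries.single n 1 := by
  ext k
  rw [HahnSeries.coeff_mul_single, mul_one, coeff_shift]

theorem shift_eq_single_mul (n : ℤ) (f : LaurentSeries A) :
    shift n f = HahnSeries.single n 1 * f := by
  ext k
  rw [HahnSeries.coeff_single_mul, one_mul, coeff_shift]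

/-- Multiplication of Laurent series as a bilinear map. -/
noncomputable def mulB : LaurentSeries A →ₗ[ℂ] LaurentSeries A →ₗ[ℂ] LaurentSeries A :=
  LinearMap.mk₂ ℂ (fun f g => f * g) add_mul
    (fun r f g => by rw [smul_eq_mono_mul, smul_eq_mono_mul, mul_assoc]) mul_add
    (fun r f g => by rw [smul_eq_mul_mono, smul_eq_mul_mono, mul_assoc])

@[simp] theorem mulB_apply (f g : LaurentSeries A) : mulB f g = f * g := rfl

theorem isFormalBilin_mulB :
    IsFormalBilin (mulB : LaurentSeries A →ₗ[ℂ] LaurentSeries A →ₗ[ℂ] LaurentSeries A) where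
  shift_left n f g := by
    simp only [mulB_apply, shift_eq_single_mul, mul_assoc]
  shift_right n f g := by
    simp only [mulB_apply, shift_eq_mul_single, mul_assoc]
  mem_filt N M f g hf hg n hn := by
    rw [mulB_apply, HahnSeries.coeff_mul]
    refine Finset.sum_eq_zero fun ij hij => ?_
    rw [Finset.mem_antidiagonal] at hij
    by_cases h : ij.1 < N
    · rw [hf _ h, zero_mul]
    · rw [hg _ (by have := hij.2.2; omega), mul_zero]

theorem mul_mem_filt {N M : ℤ} {f g : LaurentSeries A} (hf : f ∈ filt A N) (hg : g ∈ filt A M) :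
    f * g ∈ filt A (N + M) := isFormalBilin_mulB.mem_filt N M f g hf hg

theorem coeff_mul_lowest {N M : ℤ} {f g : LaurentSeries A} (hf : f ∈ filt A N)
    (hg : g ∈ filt A M) : (f * g).coeff (N + M) = f.coeff N * g.coeff M := by
  have := isFormalBilin_mulB.coeff_lowest hf hg
  rwa [mulB_apply, mulB_apply, mono_zero_mul_mono_zero, coeff_mono_same] at this

theorem isFormal_mulB (f : LaurentSeries A) : IsFormal (mulB f) := isFormalBilin_mulB.left f

theorem mul_smul_series (r : ℂ) (f g : LaurentSeries A) : f * (r • g) = r • (f * g) :=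
  (mulB f).map_smul r g

theorem smul_mul_series (r : ℂ) (f g : LaurentSeries A) : (r • f) * g = r • (f * g) := by
  rw [← mulB_apply, map_smul, LinearMap.smul_apply, mulB_apply]

theorem IsFormalBilin.comp_left {V V' W Z : Type*} [AddCommGroup V] [Module ℂ V] [AddCommGroup V']
    [Module ℂ V'] [AddCommGroup W] [Module ℂ W] [AddCommGroup Z] [Module ℂ Z]
    {B : LaurentSeries V →ₗ[ℂ] LaurentSeries W →ₗ[ℂ] LaurentSeries Z} (h : IsFormalBilin B)
    (D : V' →ₗ[ℂ] V) : IsFormalBilin (B ∘ₗ lift D) where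
  shift_left n f := h.shift_left n (lift D f)
  shift_right n f := h.shift_right n (lift D f)
  mem_filt N M _ g hf hg := h.mem_filt N M _ g (lift_mem_filt D hf) hg

theorem IsFormalBilin.comp_right {V W' W Z : Type*} [AddCommGroup V] [Module ℂ V]
    [AddCommGroup W'] [Module ℂ W'] [AddCommGroup W] [Module ℂ W] [AddCommGroup Z] [Module ℂ Z]
    {B : LaurentSeries V →ₗ[ℂ] LaurentSeries W →ₗ[ℂ] LaurentSeries Z} (h : IsFormalBilin B)
    (D : W' →ₗ[ℂ] W) : IsFormalBilin (B.compl₂ (lift D)) where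
  shift_left n f g := h.shift_left n f (lift D g)
  shift_right n f g := h.shift_right n f (lift D g)
  mem_filt N M _ _ hf hg := h.mem_filt N M _ _ hf (lift_mem_filt D hg)

theorem IsFormalBilin.lift_comp {V W Z Z' : Type*} [AddCommGroup V] [Module ℂ V]
    [AddCommGroup W] [Module ℂ W] [AddCommGroup Z] [Module ℂ Z] [AddCommGroup Z'] [Module ℂ Z']
    {B : LaurentSeries V →ₗ[ℂ] LaurentSeries W →ₗ[ℂ] LaurentSeries Z} (h : IsFormalBilin B)
    (D : Z →ₗ[ℂ] Z') : IsFormalBilin (B.compr₂ (lift D)) where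
  shift_left n f g := by
    rw [LinearMap.compr₂_apply, h.shift_left]
    rfl
  shift_right n f g := by
    rw [LinearMap.compr₂_apply, h.shift_right]
    rfl
  mem_filt N M f g hf hg := lift_mem_filt D (h.mem_filt N M f g hf hg)

theorem IsFormalBilin.add {V W Z : Type*} [AddCommGroup V] [Module ℂ V]
    [AddCommGroup W] [Module ℂ W] [AddCommGroup Z] [Module ℂ Z]
    {B B' : LaurentSeries V →ₗ[ℂ] LaurentSeries W →ₗ[ℂ] LaurentSeries Z} (h : IsFormalBilin B)
    (h' : IsFormalBilin B') : IsFormalBilin (B + B') where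
  shift_left n f g := by
    simp only [LinearMap.add_apply, h.shift_left, h'.shift_left, map_add]
  shift_right n f g := by
    simp only [LinearMap.add_apply, h.shift_right, h'.shift_right, map_add]
  mem_filt N M f g hf hg := Submodule.add_mem _ (h.mem_filt N M f g hf hg)
    (h'.mem_filt N M f g hf hg)

end FormalMul

namespace SuperCoords

variable {A ι : Type*} [Ring A] [Module ℂ A] [SMulCommClass ℂ A A] [IsScalarTower ℂ A A]
  [DecidableEq ι] (c : SuperCoords A ι)

/-! ### Formal functions -/

/-- The action of `Q p` on formal functions. -/
noncomputable def fQ (p : Bool) : LaurentSeries A →ₗ[ℂ] LaurentSeries A := lift (c.Q p)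

/-- The action of the partial derivatives on formal functions. -/
noncomputable def fd (i : ι) : LaurentSeries A →ₗ[ℂ] LaurentSeries A := lift (c.d i)

/-- The coordinates as formal functions. -/
noncomputable def fx (i : ι) : LaurentSeries A := mono 0 (c.x i)

@[simp] theorem coeff_fQ (p : Bool) (f : LaurentSeries A) (n : ℤ) :
    (c.fQ p f).coeff n = c.Q p (f.coeff n) := rfl

@[simp] theorem coeff_fd (i : ι) (f : LaurentSeries A) (n : ℤ) :
    (c.fd i f).coeff n = c.d i (f.coeff n) := rfl

@[simp] theorem fQ_fQ (p : Bool) (f : LaurentSeries A) : c.fQ p (c.fQ p f) = f := by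
  ext n
  simp

theorem fQ_comm (p q : Bool) (f : LaurentSeries A) : c.fQ p (c.fQ q f) = c.fQ q (c.fQ p f) := by
  ext n
  simp [c.Q_comm p q]

@[simp] theorem fQ_false (f : LaurentSeries A) : c.fQ false f = f := by
  ext n
  simp

@[simp] theorem fQ_one (p : Bool) : c.fQ p 1 = 1 := by
  rw [← mono_zero_one, fQ, lift_mono, Q_one]

theorem fQ_mul (p : Bool) (f g : LaurentSeries A) : c.fQ p (f * g) = c.fQ p f * c.fQ p g := by
  have h := (isFormalBilin_mulB.lift_comp (c.Q p)).ext_mono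
    ((isFormalBilin_mulB.comp_left (c.Q p)).comp_right (c.Q p)) (fun v w => by
      simp [lift_mono, mono_zero_mul_mono_zero, c.Q_mul])
  exact LinearMap.congr_fun₂ h f g

theorem fd_mul (i : ι) (f g : LaurentSeries A) :
    c.fd i (f * g) = c.fd i f * g + c.fQ (c.odd i) f * c.fd i g := by
  have h := (isFormalBilin_mulB.lift_comp (c.d i)).ext_mono
    ((isFormalBilin_mulB.comp_left (c.d i)).add
      ((isFormalBilin_mulB.comp_left (c.Q (c.odd i))).comp_right (c.d i))) (fun v w => by
      simp [lift_mono, mono_zero_mul_mono_zero, c.d_mul'])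
  exact LinearMap.congr_fun₂ h f g

theorem fQ_fd (p : Bool) (i : ι) (f : LaurentSeries A) :
    c.fQ p (c.fd i f) = ssgn p (c.odd i) • c.fd i (c.fQ p f) := by
  ext n
  simp [c.Q_d]

theorem fd_fd (i j : ι) (f : LaurentSeries A) :
    c.fd i (c.fd j f) = ssgn (c.odd i) (c.odd j) • c.fd j (c.fd i f) := by
  ext n
  simp [c.d_d i j]

theorem fd_fx (i j : ι) : c.fd i (c.fx j) = if i = j then 1 else 0 := by
  rw [fd, fx, lift_mono, c.d_x]
  split_ifs
  · rfl
  · simp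

@[simp] theorem fd_one (i : ι) : c.fd i 1 = 0 := by
  rw [← mono_zero_one, fd, lift_mono, d_one, map_zero]

/-- `f` is homogeneous of parity `p`. -/
def FHomog (p : Bool) (f : LaurentSeries A) : Prop := c.fQ true f = esgn p • f

theorem fhomog_fx (i : ι) : c.FHomog (c.odd i) (c.fx i) := by
  rw [FHomog, fQ, fx, lift_mono, Q_true, c.P_x, map_smul]

variable {c} in
theorem FHomog.coeff {p : Bool} {f : LaurentSeries A} (h : c.FHomog p f) (n : ℤ) :
    c.Homog p (f.coeff n) := by
  have := congrArg (fun g => HahnSeries.coeff g n) h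
  simpa [Homog] using this

variable {c} in
theorem FHomog.fQ {p : Bool} {f : LaurentSeries A} (h : c.FHomog p f) (q : Bool) :
    c.fQ q f = ssgn q p • f := by
  ext n
  simp [(h.coeff n).Q q]

variable {c} in
theorem fhomog_of_coeff {p : Bool} {f : LaurentSeries A} (h : ∀ n, c.Homog p (f.coeff n)) :
    c.FHomog p f := by
  ext n
  rw [HahnSeries.coeff_smul]
  exact h n

variable {c} in
theorem FHomog.fd {p : Bool} {f : LaurentSeries A} (h : c.FHomog p f) (i : ι) :
    c.FHomog (xor (c.odd i) p) (c.fd i f) :=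
  fhomog_of_coeff fun n => (h.coeff n).d i

variable {c} in
theorem FHomog.fd_even {f : LaurentSeries A} (h : c.FHomog false f) (i : ι) :
    c.FHomog (c.odd i) (c.fd i f) := by
  simpa using h.fd i

variable {c} in
theorem FHomog.mul_comm {p : Bool} {f : LaurentSeries A} (h : c.FHomog p f)
    (g : LaurentSeries A) : f * g = c.fQ p g * f := by
  have h1 : mulB f = mulB.flip f ∘ₗ lift (c.Q p) := by
    refine (isFormal_mulB f).ext_mono ((isFormalBilin_mulB.right f).comp (isFormal_lift _))
      fun v => ?_
    ext n
    simp only [mulB_apply, LinearMap.comp_apply, LinearMap.flip_apply, lift_mono,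
      coeff_mono_zero_mul, coeff_mul_mono_zero]
    exact (h.coeff n).mul_comm v
  exact LinearMap.congr_fun h1 g

variable {c} in
theorem FHomog.comm_mul {p : Bool} {f : LaurentSeries A} (h : c.FHomog p f)
    (g : LaurentSeries A) : g * f = f * c.fQ p g := by
  rw [h.mul_comm, fQ_fQ]

theorem fd_fx_mul (i j : ι) (f : LaurentSeries A) :
    c.fd i (c.fx j * f) = (if i = j then f else 0) +
      ssgn (c.odd i) (c.odd j) • (c.fx j * c.fd i f) := by
  rw [fd_mul, fd_fx, (c.fhomog_fx j).fQ, smul_mul_series]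
  split_ifs <;> simp

/-! ### Formal differential operators -/

/-- Formal differential operators. -/
structure FDO (Φ : LaurentSeries A →ₗ[ℂ] LaurentSeries A) : Prop where
  isFormal : IsFormal Φ
  coef : ∀ n, c.DO (coef Φ n)

namespace FDO

variable {c} {Φ Ψ : LaurentSeries A →ₗ[ℂ] LaurentSeries A}

theorem comp (h : c.FDO Φ) (h' : c.FDO Ψ) : c.FDO (Φ ∘ₗ Ψ) where
  isFormal := h.isFormal.comp h'.isFormal
  coef n := by
    obtain ⟨K, hK⟩ := h.isFormal.bdd
    obtain ⟨K', hK'⟩ := h'.isFormal.bdd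
    rw [h.isFormal.coef_comp h'.isFormal hK hK' (M := n - K + 1) (by omega)]
    exact DO.sum _ _ fun i _ => (h.coef _).mul (h'.coef _)

theorem add (h : c.FDO Φ) (h' : c.FDO Ψ) : c.FDO (Φ + Ψ) :=
  ⟨h.isFormal.add h'.isFormal, fun n => (h.coef n).add (h'.coef n)⟩

theorem smul (h : c.FDO Φ) (r : ℂ) : c.FDO (r • Φ) :=
  ⟨h.isFormal.smul r, fun n => (h.coef n).smul r⟩

theorem sub (h : c.FDO Φ) (h' : c.FDO Ψ) : c.FDO (Φ - Ψ) :=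
  ⟨h.isFormal.sub h'.isFormal, fun n => by
    rw [coef_sub]
    exact (h.coef n).sub (h'.coef n)⟩

theorem lift {D : Module.End ℂ A} (h : c.DO D) : c.FDO (SuperStar.lift D) :=
  ⟨isFormal_lift D, fun n => by
    rw [coef_lift]
    split_ifs
    · exact h
    · exact DO.zero⟩

theorem fd (i : ι) : c.FDO (c.fd i) := FDO.lift (DO.d i)

theorem mulB (f : LaurentSeries A) : c.FDO (mulB f) :=
  ⟨isFormal_mulB f, fun n => by
    have : SuperStar.coef (SuperStar.mulB f) n = L (f.coeff n) := by
      ext a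
      rw [coef_apply, mulB_apply, coeff_mul_mono_zero, L_apply]
    rw [this]
    exact DO.L _⟩

theorem id : c.FDO LinearMap.id :=
  ⟨isFormal_id, fun n => by
    have : (LinearMap.id : LaurentSeries A →ₗ[ℂ] LaurentSeries A) =
        SuperStar.lift (1 : Module.End ℂ A) := by
      ext f n
      simp
    rw [this]
    exact (FDO.lift DO.one).coef n⟩

theorem opSeries {T : ℕ → Module.End ℂ A} (h : ∀ n, c.DO (T n)) : c.FDO (opSeries T) :=
  ⟨isFormal_opSeries T, fun n => by
    rcases lt_or_ge n 0 with hn | hn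
    · rw [coef_opSeries_neg _ hn]
      exact DO.zero
    · obtain ⟨k, rfl⟩ := Int.eq_ofNat_of_zero_le hn
      rw [coef_opSeries]
      exact h k⟩

end FDO

/-- A formal operator that graded commutes with all coordinates and kills `1` is zero. -/
theorem formal_hadamard {Φ : LaurentSeries A →ₗ[ℂ] LaurentSeries A} (h : IsFormal Φ)
    (hx : ∀ i f, Φ (c.fx i * f) = c.fx i * c.fQ (c.odd i) (Φ (c.fQ (c.odd i) f)))
    (h1 : Φ 1 = 0) : Φ = 0 := by
  refine h.eq_zero_of_coef fun n => c.hadamard _ (fun i a => ?_) ?_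
  · have := congrArg (fun g => HahnSeries.coeff g n) (hx i (mono 0 a))
    simp only [fx, fQ, lift_mono, mono_zero_mul_mono_zero, coeff_mono_zero_mul, coeff_lift] at this
    rw [coef_apply, this]
    cases c.odd i <;> simp [coef_apply]
  · rw [coef_apply, mono_zero_one, h1, HahnSeries.coeff_zero]

/-! ### Rigidity: operators determined by half of the coordinates -/

section Half

variable {κ : Type*} [DecidableEq κ] [Fintype κ] (c : SuperCoords A (Bool × κ))

/-- The mixed second derivatives of `Y` form an invertible matrix. -/
def Nondeg (Y : A) : Prop :=
  ∀ b, ∃ G : κ → κ → A, ∀ j l, ∑ k, c.d (!b, j) (c.d (b, k) Y) * G k l = if j = l then 1 else 0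

variable {c} in
-- Contracting with the inverse Hessian isolates the single `D l`. The submodule `N` is arbitrary so
-- that the argument works both modulo operators of lower order and exactly, with `N = ⊥`.
theorem Nondeg.eq_zero {Y : A} (h : c.Nondeg Y) (b : Bool) (N : Submodule ℂ (Module.End ℂ A))
    (hN : ∀ D ∈ N, ∀ a, D * L a ∈ N) (D : κ → Module.End ℂ A)
    (hD : ∀ k, ∑ j, D j * L (c.d (!b, j) (c.d (b, k) Y)) ∈ N) (l : κ) : D l ∈ N := by
  obtain ⟨G, hG⟩ := h b
  have h1 : D l = ∑ k, (∑ j, D j * L (c.d (!b, j) (c.d (b, k) Y))) * L (G k l) := by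
    simp only [Finset.sum_mul]
    rw [Finset.sum_comm]
    have h2 : ∀ j, ∑ k, D j * L (c.d (!b, j) (c.d (b, k) Y)) * L (G k l) =
        D j * L (if j = l then 1 else 0) := by
      intro j
      rw [← hG j l]
      ext a
      simp [LinearMap.sum_apply, Finset.sum_mul, mul_assoc]
    simp only [h2]
    rw [Finset.sum_eq_single l]
    · ext a
      simp
    · intro j _ hj
      rw [if_neg hj]
      ext a
      simp
    · simp
  rw [h1]
  exact Submodule.sum_mem _ fun k _ => hN _ (hD k) _

/-- A differential operator that graded commutes with half of the coordinates and with the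
corresponding derivatives of a nondegenerate function is a multiplication. -/
theorem mem_W_one_of_comm {Y : A} (hY : c.Nondeg Y) (heven : c.Homog false Y) (b : Bool)
    {D : Module.End ℂ A} (hD : c.DO D) (hx : ∀ k, c.gamx (b, k) D = 0)
    (hu : ∀ k, c.gam (c.odd (b, k)) (c.d (b, k) Y) D = 0) : D ∈ c.W 1 := by
  obtain ⟨n, hn⟩ := hD
  induction n with
  | zero => exact c.W_le_succ 0 hn
  | succ n ih =>
    rcases n with _ | n
    · exact hn
    refine ih (c.mem_W_succ.2 ?_)
    -- Modulo lower order, the commutator with `∂Y` contracts the commutators of `D` with the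
    -- Hessian (`gam_sub_sum_mem_W`). The half `b` drops out by `hx`, and the Hessian of mixed
    -- derivatives is inverted on the other half.
    have key : ∀ l, c.gamx (!b, l) D ∈ c.W n := by
      refine hY.eq_zero b (c.W n) (fun D hD a => c.mul_L_mem_W hD a)
        (fun l => c.gamx (!b, l) D) fun k => ?_
      have hf : c.Homog (c.odd (b, k)) (c.d (b, k) Y) := by simpa using heven.d (b, k)
      have h1 := c.gam_sub_sum_mem_W hf hn
      rw [hu k, zero_sub] at h1
      have h2 := Submodule.neg_mem _ h1
      rw [neg_neg, Fintype.sum_prod_type, Fintype.sum_bool] at h2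
      cases b
      · simpa [hx] using h2
      · simpa [hx] using h2
    rintro ⟨b', k⟩
    by_cases hb : b' = b
    · rw [hb, hx]
      exact Submodule.zero_mem _
    · have : b' = !b := by revert hb; cases b' <;> cases b <;> simp
      rw [this]
      exact key k

/-- An even derivation that kills half of the coordinates and the corresponding derivatives of a
nondegenerate function is zero. -/
theorem derivation_eq_zero {Y : A} (hY : c.Nondeg Y) (b : Bool)
    {D : Module.End ℂ A} (hP : ∀ a, D (c.P a) = c.P (D a))
    (hmul : ∀ a a', D (a * a') = D a * a' + a * D a')
    (hx : ∀ k, D (c.x (b, k)) = 0) (hu : ∀ k, D (c.d (b, k) Y) = 0) : D = 0 := by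
  have h1 : D 1 = 0 := by
    have := hmul 1 1
    simpa using this
  have hQ : ∀ p a, D (c.Q p a) = c.Q p (D a) := by
    intro p a
    cases p
    · simp
    · simpa using hP a
  have hcj : ∀ p, c.cj p D = D := fun p => by
    ext a
    simp [hQ]
  have hg : ∀ i, c.gamx i D = L (D (c.x i)) := by
    intro i
    ext a
    rw [gamx_apply, hQ, Q_Q, hmul, add_sub_cancel_right, L_apply]
  -- A derivation has first order, so it differs from its Euler operator by a multiplication; both
  -- kill `1`, so this multiplication is zero.
  have hD : D = ∑ i, L (D (c.x i)) * c.d i := by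
    have hW : D ∈ c.W 2 := c.mem_W_succ.2 fun i => by
      rw [hg]
      exact c.L_mem_W _
    have h2 := c.euler_sub_mem_W hW
    have h3 := c.eq_zero_of_mem_W_one h2 (by simp [euler_apply, LinearMap.sum_apply, h1])
    rw [Nat.cast_one, one_smul, sub_eq_zero] at h3
    refine h3.symm.trans ?_
    rw [euler_apply]
    exact Finset.sum_congr rfl fun i _ => by rw [hg]
  have hz : ∀ l, L (D (c.x (!b, l))) = 0 := by
    intro l
    have h4 := hY.eq_zero b ⊥ (fun E hE a => by
      rw [Submodule.mem_bot] at hE ⊢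
      rw [hE, zero_mul]) (fun l => L (D (c.x (!b, l)))) (fun k => by
        rw [Submodule.mem_bot]
        have h5 := LinearMap.congr_fun hD (c.d (b, k) Y)
        rw [hu k, Fintype.sum_prod_type, Fintype.sum_bool] at h5
        have h6 : ∑ j, D (c.x (!b, j)) * c.d (!b, j) (c.d (b, k) Y) = 0 := by
          cases b
          · simpa [hx, LinearMap.sum_apply] using h5.symm
          · simpa [hx, LinearMap.sum_apply] using h5.symm
        ext a
        simp only [LinearMap.sum_apply, Module.End.mul_apply, L_apply, LinearMap.zero_apply,
          ← mul_assoc, ← Finset.sum_mul, h6, zero_mul]) l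
    exact (Submodule.mem_bot ℂ).1 h4
  rw [hD]
  refine Finset.sum_eq_zero fun i _ => ?_
  obtain ⟨b', k⟩ := i
  by_cases hb : b' = b
  · rw [hb, hx]
    ext a
    simp
  · have : b' = !b := by revert hb; cases b' <;> cases b <;> simp
    rw [this, hz, zero_mul]

/-- The operator `f ↦ u f + ∂f` for `u = ∂X`. -/
noncomputable def cov (X : LaurentSeries A) (i : Bool × κ) :
    LaurentSeries A →ₗ[ℂ] LaurentSeries A := mulB (c.fd i X) + c.fd i

theorem cov_apply (X : LaurentSeries A) (i : Bool × κ) (f : LaurentSeries A) :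
    c.cov X i f = c.fd i X * f + c.fd i f := rfl

/-- `X` is an even potential with poles of order at most one and nondegenerate leading term. -/
structure IsPotential (X : LaurentSeries A) : Prop where
  mem_filt : X ∈ filt A (-1)
  even : c.FHomog false X
  nondeg : c.Nondeg (X.coeff (-1))

variable {c} in
theorem IsPotential.homog_fd {X : LaurentSeries A} (hX : c.IsPotential X) (i : Bool × κ) :
    c.FHomog (c.odd i) (c.fd i X) := hX.even.fd_even i

/-- A formal differential operator is determined by its value at `1` if it graded commutes with
half of the coordinates and with the corresponding operators `u + ∂`. -/
theorem eq_zero_of_commute {X : LaurentSeries A} (hX : c.IsPotential X) (b : Bool)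
    {Φ : LaurentSeries A →ₗ[ℂ] LaurentSeries A} (hΦ : c.FDO Φ)
    (hx : ∀ k f, Φ (c.fx (b, k) * c.fQ (c.odd (b, k)) f) =
      c.fx (b, k) * c.fQ (c.odd (b, k)) (Φ f))
    (hu : ∀ k f, Φ (c.cov X (b, k) (c.fQ (c.odd (b, k)) f)) =
      c.cov X (b, k) (c.fQ (c.odd (b, k)) (Φ f))) (h1 : Φ 1 = 0) : Φ = 0 := by
  obtain ⟨K, hK⟩ := hΦ.isFormal.bdd
  -- The lowest coefficient `D` of `Φ` graded commutes with the coordinates of the half `b`. In the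
  -- relation with `u + ∂` the term `∂` is one order higher than `u = ν⁻¹ ∂X₋₁ + …`, so `D` also
  -- graded commutes with `∂X₋₁`. Hence `D` is multiplication by `D 1 = 0`, and the order of `Φ`
  -- goes up.
  have key : ∀ r : ℕ, ∀ f ∈ filt A 0, Φ f ∈ filt A (K + r) := by
    intro r
    induction r with
    | zero => simpa using hK
    | succ r ih =>
      refine hΦ.isFormal.bdd_of_coef fun n hn => ?_
      rcases lt_or_ge n (K + r) with hlt | hge
      · exact hΦ.isFormal.coef_eq_zero ih hlt
      obtain rfl : n = K + r := by push_cast at hn; omega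
      set D : Module.End ℂ A := coef Φ (K + r) with hD
      have hDx : ∀ k, c.gamx (b, k) D = 0 := by
        intro k
        ext a
        have h := congrArg (fun g => HahnSeries.coeff g (K + r))
          (hx k (mono 0 (c.Q (c.odd (b, k)) a)))
        simp only [fx, fQ, lift_mono, mono_zero_mul_mono_zero, coeff_mono_zero_mul,
          coeff_lift, Q_Q] at h
        rw [gamx_apply, hD, coef_apply, coef_apply, h, sub_self, LinearMap.zero_apply]
      have hDu : ∀ k, c.gam (c.odd (b, k)) (c.d (b, k) (X.coeff (-1))) D = 0 := by
        intro k
        ext a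
        have h := congrArg (fun g => HahnSeries.coeff g (-1 + (K + r)))
          (hu k (mono 0 (c.Q (c.odd (b, k)) a)))
        have huX : c.fd (b, k) X ∈ filt A (-1) := lift_mem_filt _ hX.mem_filt
        have hl : (c.cov X (b, k) (mono 0 a)) ∈ filt A (-1) := by
          refine Submodule.add_mem _ ?_ ?_
          · simpa using mul_mem_filt huX (mono_mem_filt 0 a)
          · exact filt_anti (by omega) (lift_mem_filt _ (mono_mem_filt 0 a))
        have hw : c.fQ (c.odd (b, k)) (Φ (mono 0 (c.Q (c.odd (b, k)) a))) ∈ filt A (K + r) :=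
          lift_mem_filt _ (ih _ (mono_mem_filt 0 _))
        have hq : c.fQ (c.odd (b, k)) (mono 0 (c.Q (c.odd (b, k)) a)) = mono 0 a := by
          rw [fQ, lift_mono, Q_Q]
        simp only [hq] at h
        rw [hΦ.isFormal.coeff_lowest ih hl, cov_apply, cov_apply, HahnSeries.coeff_add,
          HahnSeries.coeff_add, coeff_mul_mono_zero, coeff_mul_lowest huX hw] at h
        have hz1 : (c.fd (b, k) (mono 0 a)).coeff (-1) = 0 :=
          lift_mem_filt _ (mono_mem_filt 0 a) _ (by omega)
        have hz2 : (c.fd (b, k) (c.fQ (c.odd (b, k))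
            (Φ (mono 0 (c.Q (c.odd (b, k)) a))))).coeff (-1 + (K + r)) = 0 :=
          lift_mem_filt _ hw _ (by omega)
        rw [hz1, hz2, add_zero, add_zero] at h
        rw [gam_apply, LinearMap.zero_apply, sub_eq_zero]
        exact h
      refine c.eq_zero_of_mem_W_one
        (c.mem_W_one_of_comm hX.nondeg (hX.even.coeff _) b (hΦ.coef _) hDx hDu) ?_
      rw [hD, coef_apply, mono_zero_one, h1, HahnSeries.coeff_zero]
  refine hΦ.isFormal.eq_zero_of_coef fun n => ?_
  exact hΦ.isFormal.coef_eq_zero (key (n - K + 1).toNat) (by omega)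

/-! ### Star products -/

/-- `B` is a star product (up to the condition on differential operators). -/
structure IsStar (B : LaurentSeries A →ₗ[ℂ] LaurentSeries A →ₗ[ℂ] LaurentSeries A) : Prop where
  isFormalBilin : IsFormalBilin B
  lowest : ∀ a b, (B (mono 0 a) (mono 0 b)).coeff 0 = a * b
  par : ∀ f g, c.fQ true (B f g) = B (c.fQ true f) (c.fQ true g)
  left : ∀ f, c.FDO (B f)
  right : ∀ f, c.FDO (B.flip f)
  assoc : ∀ f g h, B (B f g) h = B f (B g h)
  one_left : ∀ f, B 1 f = f
  one_right : ∀ f, B f 1 = f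

variable {c} in
theorem IsStar.fQ {B : LaurentSeries A →ₗ[ℂ] LaurentSeries A →ₗ[ℂ] LaurentSeries A}
    (h : c.IsStar B) (p : Bool) (f g : LaurentSeries A) :
    c.fQ p (B f g) = B (c.fQ p f) (c.fQ p g) := by
  cases p
  · simp
  · exact h.par f g

/-- A multiplicative formal operator `1 + O(ν)` that fixes half of the coordinates and the
corresponding derivatives of the potential is the identity. -/
theorem eq_id_of_multiplicative {X : LaurentSeries A} (hX : c.IsPotential X) (b : Bool)
    {B : LaurentSeries A →ₗ[ℂ] LaurentSeries A →ₗ[ℂ] LaurentSeries A} (hB : c.IsStar B)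
    {h : LaurentSeries A →ₗ[ℂ] LaurentSeries A} (hf : IsFormal h)
    (h0 : ∀ f ∈ filt A 0, h f - f ∈ filt A 1)
    (hP : ∀ f, h (c.fQ true f) = c.fQ true (h f)) (hmul : ∀ f g, h (B f g) = B (h f) (h g))
    (hx : ∀ k, h (c.fx (b, k)) = c.fx (b, k)) (hu : ∀ k, h (c.fd (b, k) X) = c.fd (b, k) X) :
    h = LinearMap.id := by
  set Φ : LaurentSeries A →ₗ[ℂ] LaurentSeries A := h - LinearMap.id with hΦ
  have hΦf : IsFormal Φ := hf.sub isFormal_id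
  have hΦapp : ∀ f, Φ f = h f - f := fun _ => rfl
  -- If `h - 1` has order `1 + r`, the quadratic term of the multiplicativity relation has order `2
  -- (1 + r)`. So the lowest coefficient of `h - 1` is a derivation of the undeformed product, and
  -- it kills the generators of half `b`.
  have key : ∀ r : ℕ, ∀ f ∈ filt A 0, Φ f ∈ filt A (1 + r) := by
    intro r
    induction r with
    | zero =>
      rw [Nat.cast_zero, add_zero]
      exact h0
    | succ r ih =>
      refine hΦf.bdd_of_coef fun n hn => ?_
      rcases lt_or_ge n (1 + r) with hlt | hge
      · exact hΦf.coef_eq_zero ih hlt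
      obtain rfl : n = 1 + r := by push_cast at hn; omega
      refine c.derivation_eq_zero hX.nondeg b (fun a => ?_) (fun a a' => ?_) (fun k => ?_)
        (fun k => ?_)
      · rw [coef_apply, coef_apply, ← Q_true, ← lift_mono, hΦapp, hΦapp]
        change (h (c.fQ true (mono 0 a)) - c.fQ true (mono 0 a)).coeff _ = _
        rw [hP, ← map_sub, coeff_fQ]
      · have e0 : Φ (B (mono 0 a) (mono 0 a')) = B (Φ (mono 0 a)) (mono 0 a') +
            B (mono 0 a) (Φ (mono 0 a')) + B (Φ (mono 0 a)) (Φ (mono 0 a')) := by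
          simp only [hΦapp, hmul, map_sub, LinearMap.sub_apply]
          abel
        have h1 := ih _ (mono_mem_filt 0 a)
        have h2 := ih _ (mono_mem_filt 0 a')
        have hB' := hB.isFormalBilin
        have e1 := congrArg (fun g => HahnSeries.coeff g ((0 : ℤ) + (1 + r))) e0
        have hm : B (mono 0 a) (mono 0 a') ∈ filt A 0 := by
          simpa using hB'.mem_filt 0 0 _ _ (mono_mem_filt 0 a) (mono_mem_filt 0 a')
        simp only [HahnSeries.coeff_add] at e1
        rw [hΦf.coeff_lowest ih hm, hB.lowest,
          hB'.coeff_lowest (mono_mem_filt 0 a) h2, hB.lowest, coeff_mono_same,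
          hB'.mem_filt _ _ _ _ h1 h2 _ (by omega), add_zero,
          show (0 : ℤ) + (1 + r) = (1 + r) + 0 by ring,
          hB'.coeff_lowest h1 (mono_mem_filt 0 a'), hB.lowest, coeff_mono_same] at e1
        exact e1
      · change (h (c.fx (b, k)) - c.fx (b, k)).coeff _ = _
        rw [hx, sub_self, HahnSeries.coeff_zero]
      · have huX : c.fd (b, k) X ∈ filt A (-1) := lift_mem_filt _ hX.mem_filt
        have e := hΦf.coeff_lowest ih huX
        rw [hΦapp, hu, sub_self, HahnSeries.coeff_zero] at e
        exact e.symm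
  have hz : Φ = 0 := hΦf.eq_zero_of_coef fun n =>
    hΦf.coef_eq_zero (key n.toNat) (by omega)
  rw [← sub_eq_zero]
  exact hz

end Half

end SuperCoords

end SuperStar


namespace SuperStar

/-! ### Power series of operators and their inverses -/

section OpSeries

variable {V : Type*} [AddCommGroup V] [Module ℂ V]

/-- The action of a power series of operators on Laurent series. -/
noncomputable def op (T : PowerSeries (Module.End ℂ V)) : LaurentSeries V →ₗ[ℂ] LaurentSeries V :=
  opSeries fun n => PowerSeries.coeff n T

theorem isFormal_op (T : PowerSeries (Module.End ℂ V)) : IsFormal (op T) := isFormal_opSeries _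

theorem op_mem_filt (T : PowerSeries (Module.End ℂ V)) {N : ℤ} {f : LaurentSeries V}
    (hf : f ∈ filt V N) : op T f ∈ filt V N := by
  have := (isFormal_op T).map_mem_filt (K := 0)
    ((isFormal_op T).bdd_of_coef fun n hn => coef_opSeries_neg _ hn) hf
  rwa [add_zero] at this

theorem coeff_op_mono (T : PowerSeries (Module.End ℂ V)) (v : V) (n : ℕ) :
    (op T (mono 0 v)).coeff n = PowerSeries.coeff n T v := by
  rw [← coef_apply, op, coef_opSeries]

theorem op_mul (S T : PowerSeries (Module.End ℂ V)) : op (S * T) = op S ∘ₗ op T := by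
  refine (isFormal_op _).ext_coef ((isFormal_op S).comp (isFormal_op T)) fun n => ?_
  have hb : ∀ R : PowerSeries (Module.End ℂ V), ∀ f ∈ filt V 0, op R f ∈ filt V 0 :=
    fun R f hf => op_mem_filt R hf
  rw [(isFormal_op S).coef_comp (isFormal_op T) (hb S) (hb T) (M := n + 1) (by omega)]
  rcases lt_or_ge n 0 with hn | hn
  · rw [op, coef_opSeries_neg _ hn, Finset.Ico_eq_empty (by omega), Finset.sum_empty]
  · obtain ⟨k, rfl⟩ := Int.eq_ofNat_of_zero_le hn
    rw [op, coef_opSeries, PowerSeries.coeff_mul, Finset.Nat.sum_antidiagonal_eq_sum_range_succ_mk]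
    symm
    rw [← Finset.sum_range_reflect]
    refine Finset.sum_bij' (fun i _ => i.toNat) (fun i _ => (i : ℤ)) ?_ ?_ ?_ ?_ ?_
    · intro i hi
      simp only [Finset.mem_Ico, Finset.mem_range] at hi ⊢
      omega
    · intro i hi
      simp only [Finset.mem_Ico, Finset.mem_range] at hi ⊢
      omega
    · intro i hi
      simp only [Finset.mem_Ico] at hi
      omega
    · intro i hi
      simp
    · intro i hi
      simp only [Finset.mem_Ico] at hi
      obtain ⟨j, rfl⟩ := Int.eq_ofNat_of_zero_le hi.1
      rw [show ((k : ℤ) - (j : ℤ)) = ((k - j : ℕ) : ℤ) by omega, op, op, coef_opSeries,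
        coef_opSeries, Int.toNat_natCast]
      dsimp only
      rw [Nat.succ_eq_add_one, Nat.add_sub_cancel, show k - (k - j) = j by omega]
      rfl

theorem op_one : op (1 : PowerSeries (Module.End ℂ V)) = LinearMap.id := by
  refine (isFormal_op _).ext_coef isFormal_id fun n => ?_
  have : (LinearMap.id : LaurentSeries V →ₗ[ℂ] LaurentSeries V) =
      lift (1 : Module.End ℂ V) := by
    ext f n
    simp
  rw [this, coef_lift]
  rcases lt_or_ge n 0 with hn | hn
  · rw [op, coef_opSeries_neg _ hn, if_neg (by omega)]
  · obtain ⟨k, rfl⟩ := Int.eq_ofNat_of_zero_le hn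
    rw [op, coef_opSeries, PowerSeries.coeff_one]
    simp

theorem op_inv_op {T : PowerSeries (Module.End ℂ V)} (h : PowerSeries.constantCoeff T = 1)
    (f : LaurentSeries V) : op (PowerSeries.invOfUnit T 1) (op T f) = f := by
  rw [← LinearMap.comp_apply, ← op_mul, PowerSeries.invOfUnit_mul T 1 (by simpa using h), op_one,
    LinearMap.id_apply]

theorem op_op_inv {T : PowerSeries (Module.End ℂ V)} (h : PowerSeries.constantCoeff T = 1)
    (f : LaurentSeries V) : op T (op (PowerSeries.invOfUnit T 1) f) = f := by
  rw [← LinearMap.comp_apply, ← op_mul, PowerSeries.mul_invOfUnit T 1 (by simpa using h), op_one,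
    LinearMap.id_apply]

theorem coeff_op_lowest {T : PowerSeries (Module.End ℂ V)} (h : PowerSeries.constantCoeff T = 1)
    {N : ℤ} {f : LaurentSeries V} (hf : f ∈ filt V N) : (op T f).coeff N = f.coeff N := by
  have := (isFormal_op T).coeff_lowest (K := 0) (fun f hf => op_mem_filt T hf) hf
  rw [add_zero] at this
  rw [this]
  have h0 : coef (op T) 0 = PowerSeries.coeff 0 T := coef_opSeries _ 0
  rw [h0, PowerSeries.coeff_zero_eq_constantCoeff_apply, h]
  rfl

end OpSeries

namespace SuperCoords

variable {A ι : Type*} [Ring A] [Module ℂ A] [SMulCommClass ℂ A A] [IsScalarTower ℂ A A]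
  [DecidableEq ι] (c : SuperCoords A ι)

variable {c} in
-- The recursion for the coefficients of the inverse uses only sums and compositions.
theorem DO.coeff_inv {T : PowerSeries (Module.End ℂ A)} (h : ∀ n, c.DO (PowerSeries.coeff n T))
    (n : ℕ) : c.DO (PowerSeries.coeff n (PowerSeries.invOfUnit T 1)) := by
  induction n using Nat.strong_induction_on with
  | _ n ih =>
    rw [PowerSeries.coeff_invOfUnit]
    split_ifs with hn
    · simpa using DO.one
    · simp only [inv_one, Units.val_one]
      refine DO.neg (DO.sum _ _ fun x _ => ?_)
      split_ifs with hx
      · exact (h _).mul (ih _ hx)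
      · exact DO.zero

variable {c} in
/-- A formal operator that graded commutes with all coordinates is a multiplication. -/
theorem eq_mul_of_commute {Φ : LaurentSeries A →ₗ[ℂ] LaurentSeries A} (h : IsFormal Φ)
    (hx : ∀ i f, Φ (c.fx i * f) = c.fx i * c.fQ (c.odd i) (Φ (c.fQ (c.odd i) f)))
    (f : LaurentSeries A) : Φ f = Φ 1 * f := by
  have h0 : Φ - mulB (Φ 1) = 0 := by
    refine c.formal_hadamard (h.sub (isFormal_mulB _)) (fun i f => ?_) ?_
    · simp only [LinearMap.sub_apply, mulB_apply, map_sub, hx, mul_sub, c.fQ_mul, fQ_fQ,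
        ← mul_assoc]
      rw [(c.fhomog_fx i).comm_mul]
    · simp
  exact sub_eq_zero.1 (LinearMap.congr_fun h0 f)

/-! ### Functions of half of the coordinates and the Berezin transform -/

section Half

variable {κ : Type*} [DecidableEq κ] [Fintype κ] (c : SuperCoords A (Bool × κ))

/-- `a` depends only on the coordinates of the half `b`. -/
def Hol (b : Bool) (a : A) : Prop := ∀ k, c.d (!b, k) a = 0

variable {c}

theorem Hol.Q {b : Bool} {a : A} (h : c.Hol b a) (p : Bool) : c.Hol b (c.Q p a) := fun k => by
  have := c.Q_d p (!b, k) a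
  rw [h k, map_zero] at this
  have h2 := congrArg (fun y => ssgn p (c.odd (!b, k)) • y) this
  simpa [smul_smul] using h2.symm

theorem Hol.mul {b : Bool} {a a' : A} (h : c.Hol b a) (h' : c.Hol b a') : c.Hol b (a * a') :=
  fun k => by rw [c.d_mul', h k, h' k, zero_mul, mul_zero, add_zero]

theorem hol_x (b : Bool) (k : κ) : c.Hol b (c.x (b, k)) := fun l => by
  rw [c.d_x, if_neg]
  intro h
  have := congrArg Prod.fst h
  cases b <;> simp at this

theorem hol_one (b : Bool) : c.Hol b 1 := fun k => c.d_one _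

theorem Hol.d {b : Bool} {a : A} (h : c.Hol b a) (i : Bool × κ) : c.Hol b (c.d i a) := fun k => by
  rw [c.d_d, h k, map_zero, smul_zero]

/-- A differential operator that kills all products of antiholomorphic and holomorphic functions
is zero. -/
theorem eq_zero_of_hol_mul {D : Module.End ℂ A} (hD : c.DO D)
    (h : ∀ a b, c.Hol true a → c.Hol false b → D (b * a) = 0) : D = 0 := by
  obtain ⟨n, hn⟩ := hD
  induction n generalizing D with
  | zero => exact hn
  | succ n ih =>
    refine c.eq_zero_of_mem_W_one (c.mem_W_succ.2 fun i => c.mem_W_zero.2 ?_) ?_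
    -- The commutators of `D` with coordinates again kill the products `b a`: a coordinate is
    -- absorbed into `b`, or moved past `b` and absorbed into `a`.
    · refine ih (fun a b ha hb => ?_) (c.mem_W_succ.1 hn i)
      rw [gamx_apply, c.Q_mul, h _ _ (ha.Q _) (hb.Q _), map_zero, mul_zero, sub_zero]
      obtain ⟨b', k⟩ := i
      cases b'
      · rw [← mul_assoc]
        exact h _ _ ha ((hol_x false k).mul hb)
      · rw [← mul_assoc, (c.homog_x _).mul_comm, mul_assoc]
        exact h _ _ ((hol_x true k).mul ha) (hb.Q _)
    · have := h 1 1 (hol_one _) (hol_one _)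
      simpa using this

theorem formal_eq_zero_of_hol_mul {Φ : LaurentSeries A →ₗ[ℂ] LaurentSeries A} (hΦ : c.FDO Φ)
    (h : ∀ a b, c.Hol true a → c.Hol false b → Φ (mono 0 (b * a)) = 0) : Φ = 0 :=
  hΦ.isFormal.eq_zero_of_coef fun n => eq_zero_of_hol_mul (hΦ.coef n) fun a b ha hb => by
    rw [coef_apply, h a b ha hb, HahnSeries.coeff_zero]

variable (c) in
/-- The monomials in the coordinates of the half `b`. -/
inductive Monom (b : Bool) : A → Prop
  | one : Monom b 1
  | mul_x (k : κ) (a : A) : Monom b a → Monom b (c.x (b, k) * a)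

theorem Monom.hol {b : Bool} {a : A} (h : c.Monom b a) : c.Hol b a := by
  induction h with
  | one => exact hol_one b
  | mul_x k a _ ih => exact (hol_x b k).mul ih

theorem Monom.Q {b : Bool} {a : A} (h : c.Monom b a) (p : Bool) : ∃ r : ℂ, c.Q p a = r • a := by
  induction h with
  | one => exact ⟨1, by simp⟩
  | mul_x k a _ ih =>
    obtain ⟨r, hr⟩ := ih
    exact ⟨ssgn p (c.odd (b, k)) * r, by
      rw [c.Q_mul, hr, c.Q_x, smul_mul_assoc, mul_smul_comm, smul_smul]⟩

/-- A differential operator that kills the monomials in half of the coordinates kills all functions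
that depend only on these coordinates. -/
theorem eq_zero_on_hol (b : Bool) {D : Module.End ℂ A} (hD : c.DO D)
    (h : ∀ a, c.Monom b a → D a = 0) {a : A} (ha : c.Hol b a) : D a = 0 := by
  obtain ⟨n, hn⟩ := hD
  induction n generalizing D a with
  | zero =>
    rw [c.mem_W_zero.1 hn, LinearMap.zero_apply]
  | succ n ih =>
    rcases n with _ | n
    · rw [c.eq_zero_of_mem_W_one hn (h 1 Monom.one), LinearMap.zero_apply]
    -- On functions of the half `b` only the derivatives of that half act, and the corresponding
    -- commutators of `D` also kill the monomials, so they fall under the induction hypothesis. Up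
    -- to lower order `D` is a multiple of `euler D`.
    have hg : ∀ a, c.Hol b a → c.euler D a = 0 := by
      intro a ha
      rw [euler_apply, LinearMap.sum_apply]
      refine Finset.sum_eq_zero fun i _ => ?_
      rw [Module.End.mul_apply]
      obtain ⟨b', k⟩ := i
      by_cases hb : b' = b
      · subst hb
        refine ih (fun a' ha' => ?_) (ha.d _) (c.mem_W_succ.1 hn _)
        obtain ⟨r, hr⟩ := ha'.Q (c.odd (b', k))
        rw [gamx_apply, hr, map_smul, h a' ha', smul_zero, map_zero, mul_zero, sub_zero]
        exact h _ (Monom.mul_x k a' ha')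
      · have : b' = !b := by revert hb; cases b' <;> cases b <;> simp
        rw [this, ha k, map_zero]
    have h1 := ih (D := c.euler D - ((n + 1 : ℕ) : ℂ) • D) (fun a' ha' => by
      rw [LinearMap.sub_apply, LinearMap.smul_apply, h a' ha', smul_zero, sub_zero]
      exact hg _ ha'.hol) ha (c.euler_sub_mem_W hn)
    rw [LinearMap.sub_apply, hg a ha, zero_sub, neg_eq_zero, LinearMap.smul_apply] at h1
    exact (smul_eq_zero.1 h1).resolve_left (by exact_mod_cast Nat.succ_ne_zero n)

variable (c) in
/-- The star product `B` is determined by the potential `X`; of anti-Wick type for `b = true`, of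
Wick type for `b = false`. -/
structure Determines (b : Bool) (X : LaurentSeries A)
    (B : LaurentSeries A →ₗ[ℂ] LaurentSeries A →ₗ[ℂ] LaurentSeries A) : Prop where
  isStar : c.IsStar B
  isPotential : c.IsPotential X
  left_hol : ∀ a f, c.Hol b a → B (mono 0 a) f = mono 0 a * f
  right_hol : ∀ a f, c.Hol (!b) a → B f (mono 0 a) = f * mono 0 a
  left_u : ∀ k f, B (c.fd (b, k) X) f = c.cov X (b, k) f
  right_u : ∀ k f, B f (c.fd (!b, k) X) = c.cov X (!b, k) (c.fQ (c.odd (!b, k)) f)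

namespace Determines

variable {b : Bool} {X : LaurentSeries A}
  {B : LaurentSeries A →ₗ[ℂ] LaurentSeries A →ₗ[ℂ] LaurentSeries A}

theorem left_x (h : c.Determines b X B) (k : κ) (f : LaurentSeries A) :
    B (c.fx (b, k)) f = c.fx (b, k) * f := h.left_hol _ f (hol_x b k)

theorem right_x (h : c.Determines b X B) (k : κ) (f : LaurentSeries A) :
    B f (c.fx (!b, k)) = c.fx (!b, k) * c.fQ (c.odd (!b, k)) f := by
  rw [← (c.fhomog_fx _).comm_mul]
  exact h.right_hol _ f (hol_x (!b) k)

/-- Operators commuting with right multiplications are left multiplications. -/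
theorem eq_left (h : c.Determines b X B) {Φ : LaurentSeries A →ₗ[ℂ] LaurentSeries A}
    (hΦ : c.FDO Φ) (hx : ∀ k f, Φ (B f (c.fx (!b, k))) = B (Φ f) (c.fx (!b, k)))
    (hu : ∀ k f, Φ (B f (c.fd (!b, k) X)) = B (Φ f) (c.fd (!b, k) X)) : Φ = B (Φ 1) := by
  rw [← sub_eq_zero]
  refine c.eq_zero_of_commute h.isPotential (!b) (hΦ.sub (h.isStar.left _)) (fun k f => ?_)
    (fun k f => ?_) ?_
  · rw [← h.right_x, ← h.right_x, LinearMap.sub_apply, LinearMap.sub_apply, hx, map_sub,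
      LinearMap.sub_apply, h.isStar.assoc]
  · rw [← h.right_u, ← h.right_u, LinearMap.sub_apply, LinearMap.sub_apply, hu, map_sub,
      LinearMap.sub_apply, h.isStar.assoc]
  · rw [LinearMap.sub_apply, h.isStar.one_right, sub_self]

end Determines

/-! ### The formal Berezin transform -/

variable (c) in
/-- Graded right multiplication by holomorphic coordinates, left multiplication by antiholomorphic
coordinates. -/
noncomputable def coordOp (B : LaurentSeries A →ₗ[ℂ] LaurentSeries A →ₗ[ℂ] LaurentSeries A) :
    Bool × κ → LaurentSeries A →ₗ[ℂ] LaurentSeries A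
  | (false, k) => B (c.fx (false, k))
  | (true, k) => B.flip (c.fx (true, k)) ∘ₗ c.fQ (c.odd (true, k))

variable {X : LaurentSeries A}
  {B : LaurentSeries A →ₗ[ℂ] LaurentSeries A →ₗ[ℂ] LaurentSeries A}

theorem coordOp_false (k : κ) (f : LaurentSeries A) :
    c.coordOp B (false, k) f = B (c.fx (false, k)) f := rfl

theorem coordOp_true (k : κ) (f : LaurentSeries A) :
    c.coordOp B (true, k) f = B (c.fQ (c.odd (true, k)) f) (c.fx (true, k)) := rfl

theorem isFormal_coordOp (h : c.IsStar B) (i : Bool × κ) : IsFormal (c.coordOp B i) := by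
  obtain ⟨b, k⟩ := i
  cases b
  · exact h.isFormalBilin.left _
  · exact (h.isFormalBilin.right _).comp (isFormal_lift _)

variable (c) in
/-- The parity automorphism is a differential operator. -/
def ParityDO : Prop := c.DO c.P

theorem ParityDO.fQ (hP : c.ParityDO) (p : Bool) : c.FDO (c.fQ p) := by
  cases p
  · exact FDO.lift DO.one
  · exact FDO.lift hP

theorem fdo_coordOp (hP : c.ParityDO) (h : c.IsStar B) (i : Bool × κ) :
    c.FDO (c.coordOp B i) := by
  obtain ⟨b, k⟩ := i
  cases b
  · exact h.left _
  · exact (h.right _).comp (hP.fQ _)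

theorem fQ_coordOp (h : c.IsStar B) (p : Bool) (i : Bool × κ) (f : LaurentSeries A) :
    c.fQ p (c.coordOp B i f) = ssgn p (c.odd i) • c.coordOp B i (c.fQ p f) := by
  obtain ⟨b, k⟩ := i
  cases b
  · rw [coordOp_false, coordOp_false, h.fQ, (c.fhomog_fx _).fQ, map_smul, LinearMap.smul_apply]
  · rw [coordOp_true, coordOp_true, h.fQ, (c.fhomog_fx _).fQ, map_smul, c.fQ_comm p]

theorem coordOp_mem_filt (h : c.IsStar B) (i : Bool × κ) {N : ℤ} {f : LaurentSeries A}
    (hf : f ∈ filt A N) : c.coordOp B i f ∈ filt A N := by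
  obtain ⟨b, k⟩ := i
  cases b
  · have := h.isFormalBilin.mem_filt 0 N _ f (mono_mem_filt 0 (c.x (false, k))) hf
    rwa [zero_add] at this
  · have := h.isFormalBilin.mem_filt N 0 _ _ (lift_mem_filt (c.Q (c.odd (true, k))) hf)
      (mono_mem_filt 0 (c.x (true, k)))
    rwa [add_zero] at this

theorem coeff_coordOp_lowest (h : c.IsStar B) (i : Bool × κ) {N : ℤ} {f : LaurentSeries A}
    (hf : f ∈ filt A N) : (c.coordOp B i f).coeff N = c.x i * f.coeff N := by
  obtain ⟨b, k⟩ := i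
  cases b
  · have := h.isFormalBilin.coeff_lowest (mono_mem_filt 0 (c.x (false, k))) hf
    rwa [zero_add, h.lowest, coeff_mono_same] at this
  · have := h.isFormalBilin.coeff_lowest (lift_mem_filt (c.Q (c.odd (true, k))) hf)
      (mono_mem_filt 0 (c.x (true, k)))
    rw [add_zero, h.lowest, coeff_mono_same] at this
    rw [(c.homog_x _).mul_comm]
    exact this

/-- The operators `coordOp` supercommute. -/
theorem coordOp_coordOp (h : c.Determines true X B) (i j : Bool × κ) (f : LaurentSeries A) :
    c.coordOp B i (c.coordOp B j f) =
      ssgn (c.odd i) (c.odd j) • c.coordOp B j (c.coordOp B i f) := by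
  have hs := h.isStar
  have hxx : ∀ i j, c.fx i * c.fx j = ssgn (c.odd i) (c.odd j) • (c.fx j * c.fx i) := by
    intro i j
    rw [(c.fhomog_fx i).mul_comm, (c.fhomog_fx j).fQ, smul_mul_series]
  -- Left and right multiplications commute by associativity. Within one half, separation of
  -- variables makes the product of two coordinates the undeformed one.
  have key : ∀ k l : κ, c.coordOp B (false, k) (c.coordOp B (true, l) f) =
      ssgn (c.odd (false, k)) (c.odd (true, l)) •
        c.coordOp B (true, l) (c.coordOp B (false, k) f) := by
    intro k l
    rw [coordOp_false, coordOp_false, coordOp_true, coordOp_true, hs.fQ, (c.fhomog_fx _).fQ,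
      map_smul, LinearMap.smul_apply, map_smul, LinearMap.smul_apply, smul_smul, ssgn_comm,
      ssgn_mul_self, one_smul, hs.assoc]
  obtain ⟨b, k⟩ := i
  obtain ⟨b', l⟩ := j
  cases b <;> cases b'
  · have h1 : ∀ k l, B (c.fx (false, k)) (c.fx (false, l)) = c.fx (false, k) * c.fx (false, l) :=
      fun k l => h.right_hol _ _ (hol_x false l)
    simp only [coordOp_false, ← hs.assoc, h1]
    rw [hxx, map_smul, LinearMap.smul_apply]
  · exact key k l
  · rw [key l k, smul_smul, ssgn_comm, ssgn_mul_self, one_smul]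
  · have h1 : ∀ k l, B (c.fx (true, k)) (c.fx (true, l)) = c.fx (true, k) * c.fx (true, l) :=
      fun k l => h.left_hol _ _ (hol_x true k)
    simp only [coordOp_true, hs.fQ, hs.assoc, (c.fhomog_fx _).fQ, map_smul, LinearMap.smul_apply,
      h1]
    rw [hxx (true, l), map_smul, c.fQ_comm, smul_smul]

variable (c) in
/-- `J` satisfies the equations of the formal Berezin transform up to order `n`. -/
structure BerezinUpTo (B : LaurentSeries A →ₗ[ℂ] LaurentSeries A →ₗ[ℂ] LaurentSeries A)
    (n : ℤ) (J : LaurentSeries A →ₗ[ℂ] LaurentSeries A) : Prop where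
  fdo : c.FDO J
  par : ∀ f, c.fQ true (J f) = J (c.fQ true f)
  mem_filt : ∀ f ∈ filt A 0, J f - f ∈ filt A 1
  one : J 1 = 1
  eqn : ∀ i, ∀ f ∈ filt A 0, c.coordOp B i (J f) - J (c.fx i * f) ∈ filt A n

theorem fx_mul_mem_filt (i : Bool × κ) {N : ℤ} {f : LaurentSeries A} (hf : f ∈ filt A N) :
    c.fx i * f ∈ filt A N := by
  have := mul_mem_filt (mono_mem_filt 0 (c.x i)) hf
  rwa [zero_add] at this

theorem BerezinUpTo.fQ {n : ℤ} {J : LaurentSeries A →ₗ[ℂ] LaurentSeries A}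
    (h : c.BerezinUpTo B n J) (p : Bool) (f : LaurentSeries A) :
    c.fQ p (J f) = J (c.fQ p f) := by
  cases p
  · simp
  · exact h.par f

theorem BerezinUpTo.zero_le {n : ℤ} {J : LaurentSeries A →ₗ[ℂ] LaurentSeries A}
    (h : c.BerezinUpTo B n J) : ∀ f ∈ filt A 0, J f ∈ filt A 0 := fun f hf => by
  have := Submodule.add_mem _ (filt_anti (by omega) (h.mem_filt f hf)) hf
  rwa [sub_add_cancel] at this

theorem berezinUpTo_id (h : c.IsStar B) : c.BerezinUpTo B 1 LinearMap.id where
  fdo := FDO.id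
  par _ := rfl
  mem_filt f _ := by
    rw [LinearMap.id_apply, sub_self]
    exact Submodule.zero_mem _
  one := rfl
  eqn i f hf n hn := by
    rw [LinearMap.id_apply, LinearMap.id_apply]
    rcases lt_or_ge n 0 with hn' | hn'
    · exact Submodule.sub_mem _ (coordOp_mem_filt h i hf) (fx_mul_mem_filt i hf) n hn'
    · obtain rfl : n = 0 := by omega
      rw [HahnSeries.coeff_sub, coeff_coordOp_lowest h i hf, fx, coeff_mono_zero_mul, sub_self]

/-- The inductive step in the construction of the formal Berezin transform. -/
theorem BerezinUpTo.step (hP : c.ParityDO) (h : c.Determines true X B) {n : ℤ} (hn : 1 ≤ n)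
    {J : LaurentSeries A →ₗ[ℂ] LaurentSeries A} (hJ : c.BerezinUpTo B n J) :
    ∃ J', c.BerezinUpTo B (n + 1) J' ∧ ∀ f ∈ filt A 0, J' f - J f ∈ filt A n := by
  have hs := h.isStar
  set Φ : Bool × κ → LaurentSeries A →ₗ[ℂ] LaurentSeries A :=
    fun i => c.coordOp B i ∘ₗ J - J ∘ₗ mulB (c.fx i) with hΦ
  have hΦapp : ∀ i f, Φ i f = c.coordOp B i (J f) - J (c.fx i * f) := fun _ _ => rfl
  have hΦn : ∀ i, ∀ f ∈ filt A 0, Φ i f ∈ filt A n := hJ.eqn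
  have hΦd : ∀ i, c.FDO (Φ i) := fun i =>
    ((fdo_coordOp hP hs i).comp hJ.fdo).sub (hJ.fdo.comp (FDO.mulB _))
  have hΦQ : ∀ p i f, c.fQ p (Φ i f) = ssgn p (c.odd i) • Φ i (c.fQ p f) := by
    intro p i f
    rw [hΦapp, hΦapp, map_sub, fQ_coordOp hs, hJ.fQ, hJ.fQ, c.fQ_mul, (c.fhomog_fx i).fQ,
      smul_mul_series, map_smul, smul_sub]
  set D : Bool × κ → Module.End ℂ A := fun i => coef (Φ i) n with hD
  have hDapp : ∀ i a, D i a = (Φ i (mono 0 a)).coeff n := fun _ _ => rfl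
  have hDQ : ∀ p i a, c.Q p (D i a) = ssgn p (c.odd i) • D i (c.Q p a) := by
    intro p i a
    rw [hDapp, hDapp, ← coeff_fQ, hΦQ, HahnSeries.coeff_smul, SuperCoords.fQ, lift_mono]
  -- The `coordOp`s supercommute and so do the coordinates inside `J`; comparing the two orders of
  -- application, the defects at `ν^n` must have the same symmetry. Rewritten with commutators this
  -- is the closedness of `D`.
  have hsymm : ∀ i j a, D j (c.x i * a) + c.x j * D i a =
      ssgn (c.odd j) (c.odd i) • (D i (c.x j * a) + c.x i * D j a) := by
    intro i j a
    have e : ∀ i j, c.coordOp B j (c.coordOp B i (J (mono 0 a))) =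
        J (c.fx j * (c.fx i * mono 0 a)) + Φ j (c.fx i * mono 0 a) +
          c.coordOp B j (Φ i (mono 0 a)) := by
      intro i j
      rw [hΦapp, hΦapp, map_sub]
      abel
    have e1 := coordOp_coordOp h j i (J (mono 0 a))
    rw [e i j, e j i] at e1
    have e2 : J (c.fx j * (c.fx i * mono 0 a)) =
        ssgn (c.odd j) (c.odd i) • J (c.fx i * (c.fx j * mono 0 a)) := by
      rw [← mul_assoc, (c.fhomog_fx j).mul_comm, (c.fhomog_fx i).fQ, smul_mul_series,
        smul_mul_series, map_smul, mul_assoc]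
    rw [e2, add_assoc, add_assoc, smul_add, add_right_inj] at e1
    have e3 := congrArg (fun g => HahnSeries.coeff g n) e1
    have hm := mono_mem_filt 0 a
    simp only [HahnSeries.coeff_add, HahnSeries.coeff_smul,
      coeff_coordOp_lowest hs _ (hΦn _ _ hm), fx, mono_zero_mul_mono_zero] at e3
    exact e3
  have hclosed : ∀ i j, c.gamx j (D i) = ssgn (c.odd i) (c.odd j) • c.gamx i (D j) := by
    intro i j
    ext a
    rw [LinearMap.smul_apply, gamx_apply, gamx_apply, hDQ, Q_Q, hDQ, Q_Q]
    have e := hsymm i j a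
    rw [ssgn_comm] at e
    rw [ssgn_comm (c.odd j) (c.odd i)]
    simp only [mul_smul_comm, smul_sub, smul_smul, ssgn_mul_self, one_smul]
    have e' := congrArg (fun y => ssgn (c.odd i) (c.odd j) • y) e
    simp only [smul_add, smul_smul, ssgn_mul_self, one_smul] at e'
    rw [sub_eq_sub_iff_add_eq_add]
    rw [e', add_comm]
  obtain ⟨N, hN⟩ : ∃ N, ∀ i, D i ∈ c.W N := by
    choose F hF using fun i => (hΦd i).coef n
    exact ⟨Finset.univ.sup F, fun i => c.W_mono (Finset.le_sup (Finset.mem_univ i)) (hF i)⟩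
  obtain ⟨E₀, hE₀W, hE₀⟩ := c.exists_gamx_eq D hN hclosed
  -- Averaging over parity makes the solution even. The equations persist because `D i` has the
  -- parity of `x i`.
  set E₁ : Module.End ℂ A := (1 / 2 : ℂ) • (E₀ + c.cj true E₀) with hE₁
  have hE₁P : ∀ p a, c.Q p (E₁ a) = E₁ (c.Q p a) := by
    intro p a
    cases p
    · simp
    · simp [hE₁, c.P_P, add_comm]
  have hE₁W : E₁ ∈ c.W (N + 1) :=
    Submodule.smul_mem _ _ (Submodule.add_mem _ hE₀W (c.cj_mem_W _ hE₀W))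
  have hE₁g : ∀ i, c.gamx i E₁ = D i := by
    intro i
    have h1 : ssgn (c.odd i) true • c.cj true (D i) = D i := by
      ext a
      rw [LinearMap.smul_apply, cj_apply, hDQ, Q_Q, smul_smul, ssgn_comm, ssgn_mul_self, one_smul]
    rw [hE₁, map_smul, map_add, hE₀, gamx, gam_cj (c.homog_x i)]
    change (1 / 2 : ℂ) • (D i + ssgn (c.odd i) true • c.cj true (c.gamx i E₀)) = _
    rw [hE₀, h1]
    module
  -- Multiplications graded commute with the coordinates, so the normalization `E 1 = 0` costs
  -- nothing.
  set E : Module.End ℂ A := E₁ - L (E₁ 1) with hE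
  have hEP : ∀ p a, c.Q p (E a) = E (c.Q p a) := by
    intro p a
    rw [hE, LinearMap.sub_apply, LinearMap.sub_apply, map_sub, hE₁P, L_apply, L_apply, c.Q_mul,
      hE₁P, Q_one]
  have hEd : c.DO E := DO.sub ⟨_, hE₁W⟩ (DO.L _)
  have hEg : ∀ i a, E (c.x i * a) - c.x i * E a = D i a := by
    intro i a
    have h1 : c.gamx i E = D i := by
      rw [hE, map_sub, hE₁g, gamx, gam_L (c.homog_x i), sub_zero]
    rw [← h1, gamx_apply, hEP, Q_Q]
  have hE1 : E 1 = 0 := by simp [hE]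
  have hshift : ∀ f ∈ filt A 0, shift n (lift E f) ∈ filt A n := fun f hf => by
    have := shift_mem_filt (n := n) (lift_mem_filt E hf)
    rwa [add_zero] at this
  refine ⟨J + shift n ∘ₗ lift E, ⟨?_, fun f => ?_, fun f hf => ?_, ?_, fun i f hf => ?_⟩,
    fun f hf => ?_⟩
  · refine hJ.fdo.add ⟨(isFormal_shift n).comp (isFormal_lift E), fun k => ?_⟩
    change c.DO (coef (lift E) (k - n))
    exact (FDO.lift hEd).coef _
  · rw [LinearMap.add_apply, LinearMap.add_apply, map_add, hJ.par]
    congr 1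
    ext k
    simp only [LinearMap.comp_apply, coeff_fQ, coeff_shift, coeff_lift, hEP]
  · rw [LinearMap.add_apply, add_sub_right_comm]
    exact Submodule.add_mem _ (hJ.mem_filt f hf) (filt_anti (by omega) (hshift f hf))
  · rw [LinearMap.add_apply, hJ.one, LinearMap.comp_apply, ← mono_zero_one, lift_mono, hE1,
      map_zero, map_zero, add_zero]
  · have e : c.coordOp B i ((J + shift n ∘ₗ lift E) f) - (J + shift n ∘ₗ lift E) (c.fx i * f) =
        Φ i f + (c.coordOp B i (shift n (lift E f)) - shift n (lift E (c.fx i * f))) := by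
      rw [hΦapp, LinearMap.add_apply, LinearMap.add_apply, map_add, LinearMap.comp_apply,
        LinearMap.comp_apply]
      abel
    rw [e]
    intro k hk
    rcases lt_or_ge k n with hlt | hge
    · exact Submodule.add_mem _ (hΦn i f hf) (Submodule.sub_mem _
        (coordOp_mem_filt hs i (hshift f hf)) (hshift _ (fx_mul_mem_filt i hf))) k hlt
    -- At order `ν^n` the operator `coordOp B i` acts as multiplication by `x i`; the correction
    -- contributes `x_i E - E x_i = -D_i` and cancels the defect.
    · obtain rfl : k = n := by omega
      have h1 := (hΦd i).isFormal.coeff_lowest (hΦn i) hf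
      rw [zero_add] at h1
      rw [HahnSeries.coeff_add, HahnSeries.coeff_sub, h1, coeff_coordOp_lowest hs i (hshift f hf),
        coeff_shift, coeff_shift, sub_self, coeff_lift, coeff_lift, fx, coeff_mono_zero_mul]
      have := hEg i (f.coeff 0)
      rw [hD] at this
      rw [← this]
      abel
  · rw [LinearMap.add_apply, add_sub_cancel_left]
    exact hshift f hf

variable (c) in
/-- The formal Berezin transform of `B`. -/
structure IsBerezin (B : LaurentSeries A →ₗ[ℂ] LaurentSeries A →ₗ[ℂ] LaurentSeries A)
    (T : PowerSeries (Module.End ℂ A)) : Prop where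
  constantCoeff : PowerSeries.constantCoeff T = 1
  coeff_do : ∀ n, c.DO (PowerSeries.coeff n T)
  map_mul : ∀ a b, c.Hol true a → c.Hol false b → op T (mono 0 (b * a)) = B (mono 0 b) (mono 0 a)

theorem fdo_op {T : PowerSeries (Module.End ℂ A)} (h : ∀ n, c.DO (PowerSeries.coeff n T)) :
    c.FDO (op T) := FDO.opSeries h

theorem IsBerezin.unique {T T' : PowerSeries (Module.End ℂ A)} (h : c.IsBerezin B T)
    (h' : c.IsBerezin B T') : T = T' := by
  ext1 n
  rw [← sub_eq_zero]
  refine eq_zero_of_hol_mul ((h.coeff_do n).sub (h'.coeff_do n)) fun a b ha hb => ?_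
  rw [LinearMap.sub_apply, ← coeff_op_mono, ← coeff_op_mono, h.map_mul a b ha hb,
    h'.map_mul a b ha hb, sub_self]

/-- The `ν`-adic limit of the approximations from `BerezinUpTo.step`. Intertwining with the
coordinates is imposed first since it is an operator equation to which the Poincaré lemma applies.
-/
theorem exists_coordOp_intertwiner (hP : c.ParityDO) (h : c.Determines true X B) :
    ∃ T : PowerSeries (Module.End ℂ A), PowerSeries.constantCoeff T = 1 ∧
      (∀ n, c.DO (PowerSeries.coeff n T)) ∧ (∀ f, c.fQ true (op T f) = op T (c.fQ true f)) ∧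
      op T 1 = 1 ∧ ∀ i f, op T (c.fx i * f) = c.coordOp B i (op T f) := by
  choose! F hF hF' using fun (n : ℕ) (J : LaurentSeries A →ₗ[ℂ] LaurentSeries A)
    (hJ : c.BerezinUpTo B (1 + n) J) => hJ.step hP h (by omega)
  let J : ℕ → LaurentSeries A →ₗ[ℂ] LaurentSeries A := fun n => Nat.rec LinearMap.id F n
  have hJ : ∀ n : ℕ, c.BerezinUpTo B (1 + n) (J n) := by
    intro n
    induction n with
    | zero =>
      have := berezinUpTo_id h.isStar
      rw [Nat.cast_zero, add_zero]
      exact this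
    | succ n ih =>
      have := hF n (J n) ih
      rw [add_assoc] at this
      exact_mod_cast this
  have hstep : ∀ n : ℕ, ∀ f ∈ filt A 0, J (n + 1) f - J n f ∈ filt A (1 + n) :=
    fun n => hF' n (J n) (hJ n)
  have hdiff : ∀ n k : ℕ, ∀ f ∈ filt A 0, J (n + k) f - J n f ∈ filt A (1 + n) := by
    intro n k
    induction k with
    | zero =>
      intro f _
      rw [add_zero, sub_self]
      exact Submodule.zero_mem _
    | succ k ih =>
      intro f hf
      have := Submodule.add_mem _ (filt_anti (by push_cast; omega) (hstep (n + k) f hf)) (ih f hf)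
      rwa [sub_add_sub_cancel] at this
  -- Passing from `J n` to `J (n + 1)` changes only orders at least `n + 1`, so the coefficient at
  -- `ν^n` is stable from `J n` on.
  set T : PowerSeries (Module.End ℂ A) := PowerSeries.mk fun n => coef (J n) n with hT
  have hTJ : ∀ n : ℕ, ∀ f ∈ filt A 0, op T f - J n f ∈ filt A (1 + n) := by
    intro n
    refine ((isFormal_op T).sub (hJ n).fdo.isFormal).bdd_of_coef fun k hk => ?_
    rw [coef_sub]
    rcases lt_or_ge k 0 with hk0 | hk0
    · rw [op, coef_opSeries_neg _ hk0, (hJ n).fdo.isFormal.coef_eq_zero (hJ n).zero_le hk0,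
        sub_zero]
    · obtain ⟨l, rfl⟩ := Int.eq_ofNat_of_zero_le hk0
      rw [op, coef_opSeries, hT, PowerSeries.coeff_mk, sub_eq_zero]
      ext a
      have hln : n = l + (n - l) := by omega
      have h1 := hdiff l (n - l) _ (mono_mem_filt 0 a) l (by omega)
      rw [← hln, HahnSeries.coeff_sub, sub_eq_zero] at h1
      exact h1.symm
  have hlim : ∀ g : LaurentSeries A, (∀ n : ℕ, g ∈ filt A (1 + n)) → g = 0 := by
    intro g hg
    ext k
    exact hg k.toNat k (by omega)
  have hone : (1 : LaurentSeries A) ∈ filt A 0 := mono_mem_filt 0 1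
  have hTd : ∀ n, c.DO (PowerSeries.coeff n T) := fun n => by
    rw [hT, PowerSeries.coeff_mk]
    exact (hJ n).fdo.coef n
  refine ⟨T, ?_, hTd, ?_, ?_, ?_⟩
  · rw [← PowerSeries.coeff_zero_eq_constantCoeff_apply, hT, PowerSeries.coeff_mk]
    ext a
    change (J 0 (mono 0 a)).coeff 0 = _
    change ((mono 0 a : LaurentSeries A)).coeff 0 = _
    rw [coeff_mono_same]
    rfl
  · have : lift c.P ∘ₗ op T = op T ∘ₗ lift c.P := by
      refine ((isFormal_lift _).comp (isFormal_op T)).ext_mono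
        ((isFormal_op T).comp (isFormal_lift _)) fun a => ?_
      rw [← sub_eq_zero]
      refine hlim _ fun n => ?_
      have h1 := lift_mem_filt c.P (hTJ n _ (mono_mem_filt 0 a))
      have h2 := hTJ n _ (lift_mem_filt c.P (mono_mem_filt 0 a))
      have h3 := Submodule.sub_mem _ h1 h2
      have h4 : lift c.P (J n (mono 0 a)) = J n (lift c.P (mono 0 a)) := (hJ n).par _
      rw [map_sub, h4, sub_sub_sub_cancel_right] at h3
      exact h3
    exact fun f => LinearMap.congr_fun this f
  · rw [← sub_eq_zero]
    refine hlim _ fun n => ?_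
    have := hTJ n 1 hone
    rwa [(hJ n).one] at this
  · intro i
    have : op T ∘ₗ mulB (c.fx i) = c.coordOp B i ∘ₗ op T := by
      refine ((isFormal_op T).comp (isFormal_mulB _)).ext_mono
        ((isFormal_coordOp h.isStar i).comp (isFormal_op T)) fun a => ?_
      rw [← sub_eq_zero]
      refine hlim _ fun n => ?_
      have hm := mono_mem_filt 0 a
      have h1 := hTJ n _ (fx_mul_mem_filt (c := c) i hm)
      have h2 := coordOp_mem_filt h.isStar i (hTJ n _ hm)
      have h3 := (hJ n).eqn i _ hm
      rw [map_sub] at h2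
      have h4 := Submodule.sub_mem _ (Submodule.sub_mem _ h1 h2) h3
      convert h4 using 1
      simp only [LinearMap.comp_apply, mulB_apply]
      abel
    exact fun f => LinearMap.congr_fun this f

/-- Existence of the formal Berezin transform. -/
theorem exists_isBerezin (hP : c.ParityDO) (h : c.Determines true X B) :
    ∃ T, c.IsBerezin B T := by
  obtain ⟨T, hT0, hTd, hTP, hT1, hTx⟩ := exists_coordOp_intertwiner hP h
  have hs := h.isStar
  -- On monomials of one half `coordOp` is undeformed multiplication by the coordinates of this
  -- half, so `T` fixes these monomials. Its coefficients of positive order then kill them, hence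
  -- kill every function of that half.
  have hfix : ∀ b a, c.Hol b a → op T (mono 0 a) = mono 0 a := by
    intro b a ha
    have hmon : ∀ p, c.Monom b p → op T (mono 0 p) = mono 0 p := by
      intro p hp
      induction hp with
      | one => exact hT1
      | mul_x k a ha ih =>
        rw [← mono_zero_mul_mono_zero]
        change op T (c.fx (b, k) * _) = c.fx (b, k) * _
        rw [hTx, ih]
        cases b
        · rw [coordOp_false, h.right_hol _ _ ha.hol]
        · rw [coordOp_true, fQ, lift_mono, h.left_hol _ _ (ha.hol.Q _), (c.fhomog_fx _).mul_comm,
            fQ, lift_mono]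
    ext n
    rcases lt_or_ge n 0 with hn | hn
    · rw [op_mem_filt T (mono_mem_filt 0 a) n hn, mono_mem_filt 0 a n hn]
    · obtain ⟨k, rfl⟩ := Int.eq_ofNat_of_zero_le hn
      rcases Nat.eq_zero_or_pos k with rfl | hk
      · exact coeff_op_lowest hT0 (mono_mem_filt 0 a)
      · rw [coeff_op_mono, coeff_mono, if_neg (by omega)]
        refine eq_zero_on_hol b (hTd k) (fun p hp => ?_) ha
        rw [← coeff_op_mono, hmon p hp, coeff_mono, if_neg (by omega)]
  refine ⟨T, hT0, hTd, fun a b ha hb => ?_⟩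
  set I := op T with hI
  set I' := op (PowerSeries.invOfUnit T 1) with hI'
  have h1 : ∀ f, I' (I f) = f := op_inv_op hT0
  have h2 : ∀ f, I (I' f) = f := op_op_inv hT0
  have hIQ : ∀ p f, c.fQ p (I f) = I (c.fQ p f) := by
    intro p f
    cases p
    · simp
    · exact hTP f
  have hI'Q : ∀ p f, c.fQ p (I' f) = I' (c.fQ p f) := by
    intro p f
    rw [← h1 (c.fQ p (I' f)), ← hIQ, h2]
  have hI'x : ∀ i f, I' (c.coordOp B i f) = c.fx i * I' f := by
    intro i f
    rw [← h1 (c.fx i * I' f), hTx, h2]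
  -- For antiholomorphic `b`, left multiplication graded commutes with every `coordOp`. Its
  -- conjugate by `T` therefore graded commutes with the coordinates and is multiplication by its
  -- value at `1`, which is `b`.
  have hΨ := eq_mul_of_commute (c := c) (Φ := I' ∘ₗ B (mono 0 b) ∘ₗ I)
    ((isFormal_op _).comp ((hs.isFormalBilin.left _).comp (isFormal_op _))) (fun i f => by
      simp only [LinearMap.comp_apply]
      rw [hTx, hI'Q, hs.fQ, hIQ, fQ_fQ, ← hI'x]
      congr 1
      obtain ⟨b', k⟩ := i
      cases b'
      · rw [coordOp_false, coordOp_false, ← hs.assoc, ← hs.assoc, fQ, lift_mono,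
          h.right_hol _ _ (hb.Q _)]
        congr 2
        rw [← lift_mono]
        exact h.right_x k _
      · rw [coordOp_true, coordOp_true, hs.fQ, fQ_fQ, hs.assoc]) (mono 0 a)
  simp only [LinearMap.comp_apply] at hΨ
  rw [hT1, hs.one_right, hfix true a ha] at hΨ
  have h3 : I' (mono 0 b) = mono 0 b := by
    conv_lhs => rw [← hfix false b hb]
    exact h1 _
  rw [h3, mono_zero_mul_mono_zero] at hΨ
  rw [← hΨ, h2]

namespace IsBerezin

variable {T : PowerSeries (Module.End ℂ A)}

theorem fdo (hT : c.IsBerezin B T) : c.FDO (op T) := fdo_op hT.coeff_do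

theorem op_one (hT : c.IsBerezin B T) (hs : c.IsStar B) : op T 1 = 1 := by
  have := hT.map_mul 1 1 (hol_one _) (hol_one _)
  rwa [mul_one, mono_zero_one, hs.one_left] at this

theorem fQ (hT : c.IsBerezin B T) (hP : c.ParityDO) (hs : c.IsStar B) (p : Bool)
    (f : LaurentSeries A) : c.fQ p (op T f) = op T (c.fQ p f) := by
  have h : c.fQ p ∘ₗ op T - op T ∘ₗ c.fQ p = 0 :=
    formal_eq_zero_of_hol_mul (((hP.fQ p).comp hT.fdo).sub (hT.fdo.comp (hP.fQ p)))
      fun a b ha hb => by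
        rw [LinearMap.sub_apply, LinearMap.comp_apply, LinearMap.comp_apply,
          hT.map_mul a b ha hb, SuperCoords.fQ, lift_mono, c.Q_mul,
          hT.map_mul _ _ (ha.Q _) (hb.Q _), ← lift_mono, ← lift_mono]
        exact sub_eq_zero.2 (hs.fQ p _ _)
  exact sub_eq_zero.1 (LinearMap.congr_fun h f)

/-- Checked on the products `b a`, which determine a formal differential operator. Thus every
Berezin transform has the intertwining property of the one constructed. -/
theorem op_fx_mul (hT : c.IsBerezin B T) (hP : c.ParityDO) (h : c.Determines true X B)
    (i : Bool × κ) (f : LaurentSeries A) :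
    op T (c.fx i * f) = c.coordOp B i (op T f) := by
  have hs := h.isStar
  have h : op T ∘ₗ mulB (c.fx i) - c.coordOp B i ∘ₗ op T = 0 :=
    formal_eq_zero_of_hol_mul ((hT.fdo.comp (FDO.mulB _)).sub
      ((fdo_coordOp hP hs i).comp hT.fdo)) fun a b ha hb => by
        rw [LinearMap.sub_apply, LinearMap.comp_apply, LinearMap.comp_apply,
          hT.map_mul a b ha hb, sub_eq_zero, mulB_apply, fx, mono_zero_mul_mono_zero, ← mul_assoc]
        obtain ⟨b', k⟩ := i
        cases b'
        · rw [hT.map_mul _ _ ha ((hol_x false k).mul hb), coordOp_false, ← hs.assoc,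
            h.right_hol _ _ hb, fx, mono_zero_mul_mono_zero]
        · rw [(c.homog_x _).mul_comm, mul_assoc, hT.map_mul _ _ ((hol_x true k).mul ha) (hb.Q _),
            coordOp_true, hs.fQ, hs.assoc, SuperCoords.fQ, lift_mono, lift_mono,
            h.left_hol _ _ (ha.Q _), fx, mono_zero_mul_mono_zero, ← (c.homog_x _).mul_comm]
  exact sub_eq_zero.1 (LinearMap.congr_fun h f)

end IsBerezin

end Half

end SuperCoords

end SuperStar


/-! ### Uniqueness of the determined product, and the dual product -/

namespace SuperStar

namespace SuperCoords

variable {A : Type*} [Ring A] [Module ℂ A] [SMulCommClass ℂ A A] [IsScalarTower ℂ A A]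
  {κ : Type*} [DecidableEq κ] [Fintype κ] {c : SuperCoords A (Bool × κ)}
  {X X' : LaurentSeries A} {B B' : LaurentSeries A →ₗ[ℂ] LaurentSeries A →ₗ[ℂ] LaurentSeries A}
  {T : PowerSeries (Module.End ℂ A)}

/-- A star product is the only one determined by its potential. -/
theorem Determines.unique {b : Bool} (h : c.Determines b X B) (h' : c.Determines b X B') :
    B = B' := by
  ext1 f
  -- Right multiplications by the generators are given by formulas in `X` alone, so they agree for
  -- both products, and left multiplications of `B'` commute with those of `B`.
  have := h.eq_left (h'.isStar.left f) (fun k g => by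
    rw [h.right_x, ← h'.right_x, ← h'.isStar.assoc, h'.right_x, h.right_x]) (fun k g => by
    rw [h.right_u, ← h'.right_u, ← h'.isStar.assoc, h'.right_u, h.right_u])
  rw [this, h'.isStar.one_right]

/-! ### The dual product -/

/-- The inverse of a formal operator `1 + O(ν)`. -/
noncomputable def opI (T : PowerSeries (Module.End ℂ A)) :
    LaurentSeries A →ₗ[ℂ] LaurentSeries A := op (PowerSeries.invOfUnit T 1)

/-- The product `T⁻¹ (T f ∗ T g)`. -/
noncomputable def dualB (B : LaurentSeries A →ₗ[ℂ] LaurentSeries A →ₗ[ℂ] LaurentSeries A)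
    (T : PowerSeries (Module.End ℂ A)) :
    LaurentSeries A →ₗ[ℂ] LaurentSeries A →ₗ[ℂ] LaurentSeries A :=
  (B.compl₁₂ (op T) (op T)).compr₂ (opI T)

theorem dualB_apply (f g : LaurentSeries A) : dualB B T f g = opI T (B (op T f) (op T g)) := rfl

/-- Graded right multiplication by the derivatives of the potential in the holomorphic directions,
left multiplication in the antiholomorphic directions. -/
noncomputable def uOp (c : SuperCoords A (Bool × κ))
    (B : LaurentSeries A →ₗ[ℂ] LaurentSeries A →ₗ[ℂ] LaurentSeries A) (X : LaurentSeries A) :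
    Bool × κ → LaurentSeries A →ₗ[ℂ] LaurentSeries A
  | (false, k) => B (c.fd (false, k) X)
  | (true, k) => B.flip (c.fd (true, k) X) ∘ₗ c.fQ (c.odd (true, k))

theorem uOp_false (k : κ) (f : LaurentSeries A) :
    uOp c B X (false, k) f = B (c.fd (false, k) X) f := rfl

theorem uOp_true (k : κ) (f : LaurentSeries A) :
    uOp c B X (true, k) f = B (c.fQ (c.odd (true, k)) f) (c.fd (true, k) X) := rfl

theorem isFormal_uOp (h : c.IsStar B) (i : Bool × κ) : IsFormal (uOp c B X i) := by
  obtain ⟨b, k⟩ := i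
  cases b
  · exact h.isFormalBilin.left _
  · exact (h.isFormalBilin.right _).comp (isFormal_lift _)

theorem uOp_one (h : c.IsStar B) (i : Bool × κ) : uOp c B X i 1 = c.fd i X := by
  obtain ⟨b, k⟩ := i
  cases b
  · rw [uOp_false, h.one_right]
  · rw [uOp_true, fQ_one, h.one_left]

theorem fQ_uOp (h : c.Determines true X B) (p : Bool) (i : Bool × κ) (f : LaurentSeries A) :
    c.fQ p (uOp c B X i f) = ssgn p (c.odd i) • uOp c B X i (c.fQ p f) := by
  have hs := h.isStar
  obtain ⟨b, k⟩ := i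
  cases b
  · rw [uOp_false, uOp_false, hs.fQ, (h.isPotential.homog_fd _).fQ, map_smul, LinearMap.smul_apply]
  · rw [uOp_true, uOp_true, hs.fQ, (h.isPotential.homog_fd _).fQ, map_smul, c.fQ_comm p]

theorem fx_mul_u (h : c.Determines true X B) (i j : Bool × κ) :
    c.fx j * c.fd i X = ssgn (c.odd i) (c.odd j) • (c.fd i X * c.fx j) := by
  rw [(c.fhomog_fx j).mul_comm, (h.isPotential.homog_fd i).fQ, smul_mul_series, ssgn_comm]

theorem u_mul_u (h : c.Determines true X B) (i j : Bool × κ) :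
    c.fd i X * c.fd j X = ssgn (c.odd i) (c.odd j) • (c.fd j X * c.fd i X) := by
  rw [(h.isPotential.homog_fd i).mul_comm, (h.isPotential.homog_fd j).fQ, smul_mul_series]

/-- The pair `coordOp`, `uOp` obeys the commutation relations of `x_j` and `-∂_i`. In mixed cases
this is associativity; within one half the contribution `δ_ij` comes from the derivative in `∂X +
∂`. -/
theorem uOp_coordOp (h : c.Determines true X B) (i j : Bool × κ) (f : LaurentSeries A) :
    uOp c B X i (c.coordOp B j f) = ssgn (c.odd i) (c.odd j) • c.coordOp B j (uOp c B X i f) -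
      if i = j then f else 0 := by
  have hs := h.isStar
  have hm := fx_mul_u h
  obtain ⟨b, k⟩ := i
  obtain ⟨b', l⟩ := j
  have hfd := c.fd_fx
  cases b <;> cases b'
  · have h1 : B (c.fd (false, k) X) (c.fx (false, l)) =
        ssgn (c.odd (false, k)) (c.odd (false, l)) • B (c.fx (false, l)) (c.fd (false, k) X) -
          if (false, k) = (false, l) then 1 else 0 := by
      have h2 := h.right_u k (c.fx (false, l))
      simp only [Bool.not_true] at h2
      rw [show B (c.fd (false, k) X) (c.fx (false, l)) = c.fd (false, k) X * c.fx (false, l) from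
        h.right_hol _ _ (hol_x false l), h2, (c.fhomog_fx _).fQ, map_smul, smul_smul, ssgn_mul_self, one_smul, cov_apply, hfd,
        add_sub_cancel_right]
    rw [uOp_false, uOp_false, coordOp_false, coordOp_false, ← hs.assoc, h1, ← hs.assoc]
    split_ifs
    · rw [map_sub, LinearMap.sub_apply, hs.one_left, map_smul, LinearMap.smul_apply]
    · rw [sub_zero, sub_zero, map_smul, LinearMap.smul_apply]
  · rw [if_neg (by simp), sub_zero, uOp_false, uOp_false, coordOp_true, coordOp_true, hs.fQ,
      (h.isPotential.homog_fd _).fQ, map_smul, LinearMap.smul_apply, map_smul,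
      LinearMap.smul_apply, smul_smul, ssgn_comm, ssgn_mul_self, one_smul, hs.assoc]
  · rw [if_neg (by simp), sub_zero, uOp_true, uOp_true, coordOp_false, coordOp_false, hs.fQ,
      (c.fhomog_fx _).fQ, map_smul, LinearMap.smul_apply, map_smul,
      LinearMap.smul_apply, hs.assoc]
  · have h1 : B (c.fx (true, l)) (c.fd (true, k) X) =
        ssgn (c.odd (true, k)) (c.odd (true, l)) • (B (c.fd (true, k) X) (c.fx (true, l)) -
          if (true, k) = (true, l) then 1 else 0) := by
      rw [h.left_x, h.left_u, cov_apply, hfd, add_sub_cancel_right, hm]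
    rw [uOp_true, uOp_true, coordOp_true, coordOp_true, hs.fQ, hs.fQ, (c.fhomog_fx _).fQ,
      (h.isPotential.homog_fd _).fQ, map_smul, map_smul, LinearMap.smul_apply,
      map_smul, map_smul, LinearMap.smul_apply, hs.assoc, hs.assoc, h1, map_smul, smul_smul,
      smul_smul,
      ssgn_comm (c.odd (true, l)), ssgn_mul_self, one_smul, one_smul, map_sub, c.fQ_comm]
    by_cases hkl : k = l
    · subst hkl
      rw [if_pos rfl, if_pos rfl, hs.one_right, fQ_fQ]
    · rw [if_neg (by simpa using hkl), if_neg (by simpa using hkl), map_zero]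

/-- The value at `1` of the supercommutation of the `uOp`s, which is all that closedness needs.
Within one half it rests on the graded symmetry of `u_i u_j + ∂_i u_j`, hence on that of `∂_i ∂_j
X`. -/
theorem uOp_uOp_one (h : c.Determines true X B) (i j : Bool × κ) :
    uOp c B X i (c.fd j X) = ssgn (c.odd i) (c.odd j) • uOp c B X j (c.fd i X) := by
  have hs := h.isStar
  have hu := u_mul_u h
  have hdd := fun i j => c.fd_fd i j X
  have hQ := fun i => (h.isPotential.homog_fd i).fQ
  obtain ⟨b, k⟩ := i
  obtain ⟨b', l⟩ := j
  cases b <;> cases b'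
  · have e := fun k l => h.right_u k (c.fd (false, l) X)
    simp only [Bool.not_true] at e
    rw [uOp_false, uOp_false, e, e, hQ, hQ, map_smul, map_smul, smul_smul,
      ssgn_comm (c.odd (false, l)), ssgn_mul_self, one_smul, cov_apply, cov_apply, hu, hdd,
      ← smul_add, smul_smul, ssgn_comm (c.odd (false, l)), ssgn_mul_self, one_smul]
  · rw [uOp_false, uOp_true, hQ, map_smul, LinearMap.smul_apply, smul_smul, ssgn_comm,
      ssgn_mul_self, one_smul]
  · rw [uOp_true, uOp_false, hQ, map_smul, LinearMap.smul_apply]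
  · rw [uOp_true, uOp_true, hQ, hQ, map_smul, map_smul, LinearMap.smul_apply,
      LinearMap.smul_apply, h.left_u, h.left_u, smul_smul,
      ssgn_comm (c.odd (true, l)), ssgn_mul_self, one_smul, cov_apply, cov_apply, hu, hdd,
      ← smul_add, smul_smul, ssgn_comm, ssgn_mul_self, one_smul]

namespace IsBerezin

theorem opI_op (hT : c.IsBerezin B T) (f : LaurentSeries A) : opI T (op T f) = f :=
  op_inv_op hT.constantCoeff f

theorem op_opI (hT : c.IsBerezin B T) (f : LaurentSeries A) : op T (opI T f) = f :=
  op_op_inv hT.constantCoeff f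

theorem fdo_opI (hT : c.IsBerezin B T) : c.FDO (opI T) := fdo_op (DO.coeff_inv hT.coeff_do)

theorem opI_one (hT : c.IsBerezin B T) (hs : c.IsStar B) : opI T 1 = 1 := by
  conv_lhs => rw [← hT.op_one hs]
  rw [hT.opI_op]

theorem opI_fQ (hT : c.IsBerezin B T) (hP : c.ParityDO) (hs : c.IsStar B) (p : Bool)
    (f : LaurentSeries A) : c.fQ p (opI T f) = opI T (c.fQ p f) := by
  rw [← hT.opI_op (c.fQ p (opI T f)), ← hT.fQ hP hs, hT.op_opI]

theorem opI_coordOp (hT : c.IsBerezin B T) (hP : c.ParityDO) (h : c.Determines true X B)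
    (i : Bool × κ) (f : LaurentSeries A) : opI T (c.coordOp B i f) = c.fx i * opI T f := by
  rw [← hT.opI_op (c.fx i * opI T f), hT.op_fx_mul hP h, hT.op_opI]

theorem op_hol (hT : c.IsBerezin B T) (hs : c.IsStar B) {b : Bool} {a : A} (ha : c.Hol b a) :
    op T (mono 0 a) = mono 0 a := by
  cases b
  · have := hT.map_mul 1 a (hol_one _) ha
    rwa [mul_one, mono_zero_one, hs.one_right] at this
  · have := hT.map_mul a 1 ha (hol_one _)
    rwa [one_mul, mono_zero_one, hs.one_left] at this

theorem opI_mem_filt {N : ℤ} {f : LaurentSeries A} (hf : f ∈ filt A N) : opI T f ∈ filt A N :=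
  op_mem_filt _ hf

theorem coeff_opI_lowest {N : ℤ} {f : LaurentSeries A} (hT : c.IsBerezin B T)
    (hf : f ∈ filt A N) : (opI T f).coeff N = f.coeff N := by
  rw [← coeff_op_lowest hT.constantCoeff (opI_mem_filt hf), hT.op_opI]

/-- The Berezin transform intertwines covariant derivatives with multiplications. -/
theorem opI_uOp (hT : c.IsBerezin B T) (hP : c.ParityDO) (h : c.Determines true X B)
    (i : Bool × κ) (f : LaurentSeries A) :
    opI T (uOp c B X i (op T f)) = opI T (c.fd i X) * f - c.fd i f := by
  have hs := h.isStar
  -- By the canonical relations adding `∂_i` cancels the commutators with the coordinates, so the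
  -- sum is multiplication by its value `I⁻¹(∂_i X)` at `1`.
  have e := eq_mul_of_commute (c := c) (Φ := opI T ∘ₗ uOp c B X i ∘ₗ op T + c.fd i)
    (((isFormal_op _).comp ((isFormal_uOp hs i).comp (isFormal_op _))).add (isFormal_lift _))
    (fun j f => by
      simp only [LinearMap.comp_apply, LinearMap.add_apply]
      rw [hT.op_fx_mul hP h, uOp_coordOp h, map_sub, map_smul, hT.opI_coordOp hP h, c.fd_fx_mul,
        ← hT.fQ hP hs, map_add, hT.opI_fQ hP hs, fQ_uOp h, fQ_fQ, map_smul,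
        c.fQ_fd, fQ_fQ, ssgn_comm (c.odd j), mul_add, mul_smul_series, mul_smul_series]
      split_ifs
      · rw [hT.opI_op]
        abel
      · rw [map_zero]
        abel) f
  simp only [LinearMap.comp_apply, LinearMap.add_apply] at e
  rw [hT.op_one hs, uOp_one hs, c.fd_one, add_zero] at e
  rw [← e, add_sub_cancel_right]

theorem homog_opI_u (hT : c.IsBerezin B T) (hP : c.ParityDO) (h : c.Determines true X B)
    (i : Bool × κ) : c.FHomog (c.odd i) (opI T (c.fd i X)) := by
  rw [FHomog, hT.opI_fQ hP h.isStar, (h.isPotential.homog_fd i).fQ, map_smul, ssgn_true_left]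

/-- The form `-T⁻¹ (∂X)` is closed. -/
theorem fd_opI_u (hT : c.IsBerezin B T) (hP : c.ParityDO) (h : c.Determines true X B)
    (i j : Bool × κ) : c.fd i (opI T (c.fd j X)) =
      ssgn (c.odd i) (c.odd j) • c.fd j (opI T (c.fd i X)) := by
  -- With `w_i = I⁻¹(∂_i X)` the right side is `w_i w_j - ∂_i w_j`. The left side is graded
  -- symmetric by `uOp_uOp_one` and `w_i w_j` by parity, so `∂_i w_j` is as well.
  have e := fun i j => hT.opI_uOp hP h i (opI T (c.fd j X))
  simp only [hT.op_opI] at e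
  have e1 := e i j
  rw [uOp_uOp_one h, map_smul, e j i, (hT.homog_opI_u hP h i).mul_comm,
    (hT.homog_opI_u hP h j).fQ, smul_mul_series, smul_sub, sub_right_inj] at e1
  exact e1.symm

theorem isStar_dualB (hT : c.IsBerezin B T) (hP : c.ParityDO) (hs : c.IsStar B) :
    c.IsStar (dualB B T) where
  isFormalBilin := hs.isFormalBilin.comp (isFormal_op _) (isFormal_op _) (isFormal_op _)
    (fun f hf => op_mem_filt _ hf) (fun f hf => op_mem_filt _ hf) (fun f hf => op_mem_filt _ hf)
  lowest a b := by
    have ha : op T (mono 0 a) ∈ filt A 0 := op_mem_filt T (mono_mem_filt 0 a)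
    have hb : op T (mono 0 b) ∈ filt A 0 := op_mem_filt T (mono_mem_filt 0 b)
    have h1 := hs.isFormalBilin.coeff_lowest ha hb
    rw [dualB_apply, hT.coeff_opI_lowest (by simpa using hs.isFormalBilin.mem_filt _ _ _ _ ha hb)]
    rw [add_zero] at h1
    rw [h1, hs.lowest, coeff_op_lowest hT.constantCoeff (mono_mem_filt 0 a),
      coeff_op_lowest hT.constantCoeff (mono_mem_filt 0 b), coeff_mono_same, coeff_mono_same]
  par f g := by
    rw [dualB_apply, dualB_apply, hT.opI_fQ hP hs, hs.par, hT.fQ hP hs, hT.fQ hP hs]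
  left f := hT.fdo_opI.comp ((hs.left _).comp hT.fdo)
  right f := hT.fdo_opI.comp ((hs.right _).comp hT.fdo)
  assoc f g k := by
    simp only [dualB_apply, hT.op_opI, hs.assoc]
  one_left f := by rw [dualB_apply, hT.op_one hs, hs.one_left, hT.opI_op]
  one_right f := by rw [dualB_apply, hT.op_one hs, hs.one_right, hT.opI_op]

theorem op_mul_left (hT : c.IsBerezin B T) (h : c.Determines true X B) {a : A}
    (ha : c.Hol false a) (f : LaurentSeries A) :
    op T (mono 0 a * f) = B (mono 0 a) (op T f) := by
  have hs := h.isStar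
  have e : op T ∘ₗ mulB (mono 0 a) - B (mono 0 a) ∘ₗ op T = 0 :=
    formal_eq_zero_of_hol_mul ((hT.fdo.comp (FDO.mulB _)).sub ((hs.left _).comp hT.fdo))
      fun a' b' ha' hb' => by
        rw [LinearMap.sub_apply, LinearMap.comp_apply, LinearMap.comp_apply, mulB_apply,
          mono_zero_mul_mono_zero, ← mul_assoc, hT.map_mul _ _ ha' (ha.mul hb'),
          hT.map_mul _ _ ha' hb', ← hs.assoc, h.right_hol _ _ hb', mono_zero_mul_mono_zero,
          sub_self]
  exact sub_eq_zero.1 (LinearMap.congr_fun e f)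

end IsBerezin

/-- On the odd part of `f`, right and left multiplication differ by the parity automorphism, which
is why that automorphism has to be a differential operator. -/
theorem fdo_mulB_flip (hP : c.ParityDO) (f : LaurentSeries A) : c.FDO (mulB.flip f) := by
  have h0 : c.FHomog false ((1 / 2 : ℂ) • (f + c.fQ true f)) := by
    rw [FHomog, map_smul, map_add, fQ_fQ, esgn_false, one_smul, add_comm]
  have h1 : c.FHomog true ((1 / 2 : ℂ) • (f - c.fQ true f)) := by
    rw [FHomog, map_smul, map_sub, fQ_fQ, esgn_true]
    module
  have e : mulB.flip f = mulB ((1 / 2 : ℂ) • (f + c.fQ true f)) +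
      mulB ((1 / 2 : ℂ) • (f - c.fQ true f)) ∘ₗ c.fQ true := by
    ext1 g
    rw [LinearMap.add_apply, LinearMap.comp_apply, LinearMap.flip_apply, mulB_apply, mulB_apply,
      mulB_apply, ← h1.comm_mul, ← c.fQ_false g, ← h0.comm_mul, c.fQ_false, ← mul_add]
    congr 1
    module
  rw [e]
  exact (FDO.mulB _).add ((FDO.mulB _).comp (hP.fQ true))

namespace IsBerezin

theorem op_mul_right (hT : c.IsBerezin B T) (hP : c.ParityDO) (h : c.Determines true X B) {a : A}
    (ha : c.Hol true a) (f : LaurentSeries A) :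
    op T (f * mono 0 a) = B (op T f) (mono 0 a) := by
  have hs := h.isStar
  have e : op T ∘ₗ mulB.flip (mono 0 a) - B.flip (mono 0 a) ∘ₗ op T = 0 :=
    formal_eq_zero_of_hol_mul ((hT.fdo.comp (fdo_mulB_flip hP _)).sub ((hs.right _).comp hT.fdo))
      fun a' b' ha' hb' => by
        rw [LinearMap.sub_apply, LinearMap.comp_apply, LinearMap.comp_apply, LinearMap.flip_apply,
          LinearMap.flip_apply, mulB_apply, mono_zero_mul_mono_zero, mul_assoc,
          hT.map_mul _ _ (ha'.mul ha) hb', hT.map_mul _ _ ha' hb', hs.assoc,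
          h.left_hol _ _ ha', mono_zero_mul_mono_zero, sub_self]
  exact sub_eq_zero.1 (LinearMap.congr_fun e f)

/-- The dual product is determined by each potential `X'` with `∂X' = -T⁻¹ (∂X)`. -/
theorem determines_dualB (hT : c.IsBerezin B T) (hP : c.ParityDO) (h : c.Determines true X B)
    (hX' : c.IsPotential X') (hd : ∀ i, c.fd i X' = -opI T (c.fd i X)) :
    c.Determines false X' (dualB B T) where
  isStar := hT.isStar_dualB hP h.isStar
  isPotential := hX'
  left_hol a f ha := by
    rw [dualB_apply, hT.op_hol h.isStar ha, ← hT.op_mul_left h ha, hT.opI_op]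
  right_hol a f ha := by
    rw [dualB_apply, hT.op_hol h.isStar ha, ← hT.op_mul_right hP h ha, hT.opI_op]
  left_u k f := by
    -- The relation reads `w - ∂` for the conjugate of multiplication by `∂X`; the sign in `∂X' =
    -- -w` converts it into `∂X' + ∂`.
    have := hT.opI_uOp hP h (false, k) f
    rw [uOp_false] at this
    rw [dualB_apply, cov_apply, hd, map_neg, hT.op_opI, map_neg, LinearMap.neg_apply, map_neg,
      this]
    noncomm_ring
  right_u k f := by
    have := hT.opI_uOp hP h (true, k) (c.fQ (c.odd (true, k)) f)
    rw [uOp_true, hT.fQ hP h.isStar, fQ_fQ] at this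
    change dualB B T f (c.fd (true, k) X') = c.cov X' (true, k) (c.fQ (c.odd (true, k)) f)
    rw [dualB_apply, cov_apply, hd, map_neg, hT.op_opI, map_neg, map_neg, this]
    noncomm_ring

end IsBerezin

end SuperCoords

end SuperStar


namespace SuperStar

namespace SuperCoords

/-! ### Integrals, transposes and adjoints with respect to a density -/

section Integration

variable {A ι : Type*} [Ring A] [Module ℂ A] [SMulCommClass ℂ A A] [IsScalarTower ℂ A A]
  [DecidableEq ι]

/-- An integral on a supercommutative algebra with coordinates, with an ideal `Ac` of elements of
compact support. -/
structure Integration (c : SuperCoords A ι) where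
  Ac : Submodule ℂ A
  int : A →ₗ[ℂ] ℂ
  mul_left : ∀ a b, b ∈ Ac → a * b ∈ Ac
  mul_right : ∀ a b, a ∈ Ac → a * b ∈ Ac
  d_mem : ∀ i a, a ∈ Ac → c.d i a ∈ Ac
  P_mem : ∀ a, a ∈ Ac → c.P a ∈ Ac
  int_d : ∀ i a, a ∈ Ac → int (c.d i a) = 0
  int_P : ∀ a, a ∈ Ac → int (c.P a) = int a
  nondeg : ∀ g, (∀ a ∈ Ac, int (a * g) = 0) → g = 0

namespace Integration

variable {c : SuperCoords A ι} (S : Integration c)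

theorem Q_mem (p : Bool) {a : A} (ha : a ∈ S.Ac) : c.Q p a ∈ S.Ac := by
  cases p
  · simpa using ha
  · exact S.P_mem a ha

theorem int_Q (p : Bool) {a : A} (ha : a ∈ S.Ac) : S.int (c.Q p a) = S.int a := by
  cases p
  · simp
  · exact S.int_P a ha

theorem mul_mem {a b : A} (h : a ∈ S.Ac ∨ b ∈ S.Ac) : a * b ∈ S.Ac :=
  h.elim (S.mul_right a b) (S.mul_left a b)

theorem int_Q_mul (p : Bool) {a b : A} (h : a ∈ S.Ac ∨ b ∈ S.Ac) :
    S.int (c.Q p a * b) = S.int (a * c.Q p b) := by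
  rw [← S.int_Q p (S.mul_mem (h.imp_right (S.Q_mem p))), c.Q_mul, Q_Q]

section DiffOp

variable [Fintype ι]

theorem do_mem {D : Module.End ℂ A} (hD : c.DO D) : ∀ a ∈ S.Ac, D a ∈ S.Ac := by
  refine c.W_induction (p := fun D => ∀ a ∈ S.Ac, D a ∈ S.Ac) (fun b a ha => S.mul_left b a ha)
    (fun D i _ h a ha => h _ (S.d_mem i a ha))
    (fun D E _ _ h h' a ha => Submodule.add_mem _ (h a ha) (h' a ha))
    (fun D r _ h a ha => Submodule.smul_mem _ r (h a ha)) hD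

/-- By `W_induction` only multiplications and derivatives have to be transposed; for derivatives
this is integration by parts. It is enough that one of the two factors has compact support, because
differential operators preserve supports. -/
theorem exists_transpose (hP : c.DO c.P) {D : Module.End ℂ A} (hD : c.DO D) :
    ∃ D', c.DO D' ∧ ∀ a b, a ∈ S.Ac ∨ b ∈ S.Ac → S.int (D a * b) = S.int (a * D' b) := by
  have hQ : ∀ p, c.DO (c.Q p) := by
    intro p
    cases p
    · exact DO.one
    · exact hP
  have hL : ∀ p e, c.Homog p e → ∀ a b, a ∈ S.Ac ∨ b ∈ S.Ac →
      S.int (e * a * b) = S.int (a * (c.Q p * L e) b) := by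
    intro p e he a b hab
    rw [he.mul_comm, mul_assoc, S.int_Q_mul p (hab.imp_right (S.mul_left e b))]
    rfl
  refine c.W_induction (p := fun D => ∃ D', c.DO D' ∧ ∀ a b, a ∈ S.Ac ∨ b ∈ S.Ac →
    S.int (D a * b) = S.int (a * D' b)) (fun e => ?_) (fun D i hD h => ?_)
    (fun D E _ _ h h' => ?_) (fun D r _ h => ?_) hD
  · obtain ⟨e₀, e₁, h0, h1, rfl⟩ := c.exists_homog_add e
    refine ⟨c.Q false * L e₀ + c.Q true * L e₁, ((hQ _).mul (DO.L _)).add ((hQ _).mul (DO.L _)),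
      fun a b hab => ?_⟩
    rw [L_apply, add_mul, add_mul, map_add, hL _ _ h0 a b hab, hL _ _ h1 a b hab, ← map_add,
      ← mul_add]
    rfl
  · obtain ⟨D', hD', h⟩ := h
    refine ⟨-(c.Q (c.odd i) * c.d i * D'), (((hQ _).mul (DO.d i)).mul hD').neg,
      fun a b hab => ?_⟩
    rw [Module.End.mul_apply, h _ _ (hab.imp_left (S.d_mem i a))]
    have hab' : a ∈ S.Ac ∨ D' b ∈ S.Ac := hab.imp_right (S.do_mem hD' b)
    have h1 := S.int_d i _ (S.mul_mem hab')
    rw [c.d_mul', map_add, S.int_Q_mul _ (hab'.imp_right (S.d_mem i _))] at h1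
    rw [LinearMap.neg_apply, mul_neg, map_neg]
    exact eq_neg_of_add_eq_zero_left h1
  · obtain ⟨D', hD', h⟩ := h
    obtain ⟨E', hE', h'⟩ := h'
    refine ⟨D' + E', hD'.add hE', fun a b hab => ?_⟩
    rw [LinearMap.add_apply, add_mul, map_add, h a b hab, h' a b hab, ← map_add, ← mul_add]
    rfl
  · obtain ⟨D', hD', h⟩ := h
    refine ⟨r • D', hD'.smul r, fun a b hab => ?_⟩
    rw [LinearMap.smul_apply, LinearMap.smul_apply, smul_mul_assoc, map_smul, h a b hab,
      mul_smul_comm, map_smul]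

end DiffOp

/-- The integral of formal functions. -/
noncomputable def fint : LaurentSeries A →ₗ[ℂ] LaurentSeries ℂ := lift S.int

/-- Formal functions with compact support. -/
def FAc (f : LaurentSeries A) : Prop := ∀ n, f.coeff n ∈ S.Ac

variable {S}

theorem fAc_mono {a : A} (ha : a ∈ S.Ac) : S.FAc (mono 0 a) := fun n => by
  rw [coeff_mono]
  split_ifs
  · exact ha
  · exact Submodule.zero_mem _

theorem FAc.add {f g : LaurentSeries A} (hf : S.FAc f) (hg : S.FAc g) : S.FAc (f + g) :=
  fun n => Submodule.add_mem _ (hf n) (hg n)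

theorem FAc.smul {f : LaurentSeries A} (hf : S.FAc f) (r : ℂ) : S.FAc (r • f) :=
  fun n => Submodule.smul_mem _ r (hf n)

theorem FAc.sub {f g : LaurentSeries A} (hf : S.FAc f) (hg : S.FAc g) : S.FAc (f - g) :=
  fun n => Submodule.sub_mem _ (hf n) (hg n)

theorem FAc.fQ {f : LaurentSeries A} (hf : S.FAc f) (p : Bool) : S.FAc (c.fQ p f) :=
  fun n => S.Q_mem p (hf n)

theorem FAc.mul_right {f : LaurentSeries A} (hf : S.FAc f) (g : LaurentSeries A) :
    S.FAc (f * g) := fun n => by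
  rw [HahnSeries.coeff_mul]
  exact Submodule.sum_mem _ fun ij _ => S.mul_right _ _ (hf _)

theorem FAc.mul_left {g : LaurentSeries A} (hg : S.FAc g) (f : LaurentSeries A) :
    S.FAc (f * g) := fun n => by
  rw [HahnSeries.coeff_mul]
  exact Submodule.sum_mem _ fun ij _ => S.mul_left _ _ (hg _)

theorem fAc_mul {f g : LaurentSeries A} (h : S.FAc f ∨ S.FAc g) : S.FAc (f * g) :=
  h.elim (fun h => h.mul_right g) (fun h => h.mul_left f)

/-- Makes the extension principle `ext_mono` available for compactly supported series, seen as
series with coefficients in `Ac`. -/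
theorem FAc.exists_lift {f : LaurentSeries A} (hf : S.FAc f) :
    ∃ f' : LaurentSeries S.Ac, SuperStar.lift S.Ac.subtype f' = f := by
  refine ⟨⟨fun n => ⟨f.coeff n, hf n⟩, f.isPWO_support.mono fun n hn h => hn ?_⟩, ?_⟩
  · exact Subtype.ext h
  · ext n
    rfl

theorem fint_fQ (p : Bool) {f : LaurentSeries A} (hf : S.FAc f) : S.fint (c.fQ p f) = S.fint f := by
  ext n
  exact S.int_Q p (hf n)

theorem fint_fd (i : ι) {f : LaurentSeries A} (hf : S.FAc f) : S.fint (c.fd i f) = 0 := by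
  ext n
  exact S.int_d i _ (hf n)

section DiffOp

variable [Fintype ι]

theorem FAc.map {f : LaurentSeries A} (hf : S.FAc f) {Φ : LaurentSeries A →ₗ[ℂ] LaurentSeries A}
    (hΦ : c.FDO Φ) : S.FAc (Φ f) := fun n => by
  obtain ⟨K, hK⟩ := hΦ.isFormal.bdd
  obtain ⟨N, hN⟩ := exists_mem_filt f
  rw [hΦ.isFormal.coeff_apply hK hN (M := n - K + 1) (by omega)]
  exact Submodule.sum_mem _ fun i _ => S.do_mem (hΦ.coef _) _ (hf i)

theorem exists_formal_transpose (hP : c.DO c.P) {Φ : LaurentSeries A →ₗ[ℂ] LaurentSeries A}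
    (hΦ : c.FDO Φ) : ∃ Ψ, c.FDO Ψ ∧ ∀ f g, S.FAc f ∨ S.FAc g →
      S.fint (Φ f * g) = S.fint (f * Ψ g) := by
  obtain ⟨K, hK⟩ := hΦ.isFormal.bdd
  choose T hT hT' using fun n => S.exists_transpose hP (hΦ.coef n)
  obtain ⟨Ψ, hΨ, hΨT⟩ := exists_isFormal_of_coef (fun n => if n < K then 0 else T n) K
    (fun n hn => if_pos hn)
  have hΨd : c.FDO Ψ := ⟨hΨ, fun n => by
    rw [hΨT]
    split_ifs
    · exact DO.zero
    · exact hT n⟩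
  have key : ∀ a b, a ∈ S.Ac ∨ b ∈ S.Ac →
      S.fint (Φ (mono 0 a) * mono 0 b) = S.fint (mono 0 a * Ψ (mono 0 b)) := by
    intro a b hab
    ext n
    change S.int ((Φ (mono 0 a) * mono 0 b).coeff n) = S.int ((mono 0 a * Ψ (mono 0 b)).coeff n)
    rw [coeff_mul_mono_zero, coeff_mono_zero_mul, ← coef_apply, ← coef_apply, hΨT]
    split_ifs with hn
    · rw [hΦ.isFormal.coef_eq_zero hK hn, LinearMap.zero_apply, zero_mul, LinearMap.zero_apply,
        mul_zero]
    · exact hT' n a b hab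
  have hleft : ∀ g, IsFormal (S.fint ∘ₗ mulB.flip g ∘ₗ Φ) := fun g =>
    (isFormal_lift _).comp ((isFormalBilin_mulB.right g).comp hΦ.isFormal)
  have hleft' : ∀ g, IsFormal (S.fint ∘ₗ mulB.flip (Ψ g)) := fun g =>
    (isFormal_lift _).comp (isFormalBilin_mulB.right _)
  have hright : ∀ f, IsFormal (S.fint ∘ₗ mulB (Φ f)) := fun f =>
    (isFormal_lift _).comp (isFormal_mulB _)
  have hright' : ∀ f, IsFormal (S.fint ∘ₗ mulB f ∘ₗ Ψ) := fun f =>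
    (isFormal_lift _).comp ((isFormal_mulB f).comp hΨ)
  -- The identity is extended first in the variable without support condition, afterwards in the
  -- compactly supported one through `exists_lift`.
  have k1 : ∀ a ∈ S.Ac, ∀ g, S.fint (Φ (mono 0 a) * g) = S.fint (mono 0 a * Ψ g) := by
    intro a ha
    have e' : S.fint ∘ₗ mulB (Φ (mono 0 a)) = S.fint ∘ₗ mulB (mono 0 a) ∘ₗ Ψ := by
      refine (hright _).ext_mono (hright' _) fun b => ?_
      simp only [LinearMap.comp_apply, mulB_apply]
      exact key a b (Or.inl ha)
    exact fun g => by simpa only [LinearMap.comp_apply, mulB_apply] using LinearMap.congr_fun e' g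
  have k2 : ∀ b ∈ S.Ac, ∀ f, S.fint (Φ f * mono 0 b) = S.fint (f * Ψ (mono 0 b)) := by
    intro b hb
    have e' : S.fint ∘ₗ mulB.flip (mono 0 b) ∘ₗ Φ = S.fint ∘ₗ mulB.flip (Ψ (mono 0 b)) := by
      refine (hleft _).ext_mono (hleft' _) fun a => ?_
      simp only [LinearMap.comp_apply, mulB_apply, LinearMap.flip_apply]
      exact key a b (Or.inr hb)
    exact fun f => by
      simpa only [LinearMap.comp_apply, mulB_apply, LinearMap.flip_apply] using
        LinearMap.congr_fun e' f
  refine ⟨Ψ, hΨd, fun f g hfg => ?_⟩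
  rcases hfg with hf | hg
  · obtain ⟨f', rfl⟩ := hf.exists_lift
    have e : S.fint ∘ₗ mulB.flip g ∘ₗ Φ ∘ₗ SuperStar.lift S.Ac.subtype =
        S.fint ∘ₗ mulB.flip (Ψ g) ∘ₗ SuperStar.lift S.Ac.subtype := by
      refine ((isFormal_lift _).comp ((isFormalBilin_mulB.right g).comp
        (hΦ.isFormal.comp (isFormal_lift _)))).ext_mono ((isFormal_lift _).comp
        ((isFormalBilin_mulB.right _).comp (isFormal_lift _))) fun a => ?_
      simp only [LinearMap.comp_apply, lift_mono, LinearMap.flip_apply, mulB_apply,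
        Submodule.subtype_apply]
      exact k1 _ a.2 g
    simpa only [LinearMap.comp_apply, mulB_apply, LinearMap.flip_apply] using
      LinearMap.congr_fun e f'
  · obtain ⟨g', rfl⟩ := hg.exists_lift
    have e : S.fint ∘ₗ mulB (Φ f) ∘ₗ SuperStar.lift S.Ac.subtype =
        S.fint ∘ₗ mulB f ∘ₗ Ψ ∘ₗ SuperStar.lift S.Ac.subtype := by
      refine ((isFormal_lift _).comp ((isFormal_mulB _).comp (isFormal_lift _))).ext_mono
        ((isFormal_lift _).comp ((isFormal_mulB f).comp (hΨ.comp (isFormal_lift _)))) fun b => ?_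
      simp only [LinearMap.comp_apply, lift_mono, mulB_apply, Submodule.subtype_apply]
      exact k2 _ b.2 f
    simpa only [LinearMap.comp_apply, mulB_apply] using LinearMap.congr_fun e g'

end DiffOp

/-! ### Adjoint operators with respect to a density -/

variable (c) in
/-- An even invertible density `ρ` without negative powers of `ν`, and its inverse `σ`. -/
structure IsDensity (ρ σ : LaurentSeries A) : Prop where
  mem : ρ ∈ filt A 0
  mem_inv : σ ∈ filt A 0
  even : c.FHomog false ρ
  mul_inv : ρ * σ = 1

variable {ρ σ : LaurentSeries A}

theorem IsDensity.comm (h : IsDensity c ρ σ) (f : LaurentSeries A) : ρ * f = f * ρ := by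
  rw [h.even.mul_comm, fQ_false]

theorem IsDensity.fQ (h : IsDensity c ρ σ) (p : Bool) : c.fQ p ρ = ρ := by
  rw [h.even.fQ, ssgn_false_right, one_smul]

/-- Nondegeneracy of the pairing at each power of `ν`; the density is then removed by its inverse.
-/
theorem IsDensity.mem_filt (h : IsDensity c ρ σ) {N : ℤ} {g : LaurentSeries A}
    (hg : ∀ a ∈ S.Ac, S.fint (mono 0 a * g * ρ) ∈ filt ℂ N) : g ∈ filt A N := by
  have h1 : g * ρ ∈ filt A N := fun n hn => S.nondeg _ fun a ha => by
    have := hg a ha n hn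
    rw [mul_assoc] at this
    change S.int ((mono 0 a * (g * ρ)).coeff n) = 0 at this
    rwa [coeff_mono_zero_mul] at this
  have h2 := mul_mem_filt h1 h.mem_inv
  rwa [mul_assoc, h.mul_inv, mul_one, add_zero] at h2

theorem IsDensity.eq_zero (h : IsDensity c ρ σ) {g : LaurentSeries A}
    (hg : ∀ a ∈ S.Ac, S.fint (mono 0 a * g * ρ) = 0) : g = 0 := by
  ext n
  exact h.mem_filt (S := S) (N := n + 1) (fun a ha => by
    rw [hg a ha]
    exact Submodule.zero_mem _) n (by omega)

theorem fint_fQ_mul (h : IsDensity c ρ σ) (p : Bool) {f g : LaurentSeries A}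
    (hfg : S.FAc f ∨ S.FAc g) : S.fint (c.fQ p f * g * ρ) = S.fint (f * c.fQ p g * ρ) := by
  rw [← fint_fQ p ((fAc_mul (hfg.imp_right fun h => h.fQ p)).mul_right ρ), c.fQ_mul, c.fQ_mul,
    fQ_fQ, h.fQ]

/-- The integral is invariant under parity, so the sign from exchanging an odd `f` with `g` can be
put on `f`. -/
theorem fint_comm (h : IsDensity c ρ σ) {f g : LaurentSeries A}
    (hfg : S.FAc f ∨ S.FAc g) : S.fint (f * g * ρ) = S.fint (g * c.fQ true f * ρ) := by
  have h0 : c.FHomog false ((1 / 2 : ℂ) • (f + c.fQ true f)) := by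
    rw [FHomog, map_smul, map_add, fQ_fQ, esgn_false, one_smul, add_comm]
  have h1 : c.FHomog true ((1 / 2 : ℂ) • (f - c.fQ true f)) := by
    rw [FHomog, map_smul, map_sub, fQ_fQ, esgn_true]
    module
  set f₀ := (1 / 2 : ℂ) • (f + c.fQ true f) with hf₀
  set f₁ := (1 / 2 : ℂ) • (f - c.fQ true f) with hf₁
  have e : f = f₀ + f₁ := by rw [hf₀, hf₁]; module
  have hfg' : S.FAc g ∨ S.FAc f₁ := hfg.symm.imp_right fun h => (h.sub (h.fQ true)).smul _
  rw [e, map_add, add_mul, add_mul, map_add, mul_add, add_mul, map_add, h0.mul_comm, fQ_false,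
    h1.mul_comm, fint_fQ_mul h _ hfg', h0.fQ, ssgn_false_right, one_smul]

section Adjoint

variable [Fintype ι]

variable (S ρ) in
/-- `Ψ` is the adjoint of `Φ` with respect to the density `ρ`. -/
structure Adj (Φ Ψ : LaurentSeries A →ₗ[ℂ] LaurentSeries A) : Prop where
  left : c.FDO Φ
  right : c.FDO Ψ
  eq : ∀ f g, S.FAc f ∨ S.FAc g → S.fint (Φ f * g * ρ) = S.fint (f * Ψ g * ρ)

/-- The transpose conjugated by the density, `σ Φᵗ ρ`. -/
theorem exists_adj (h : IsDensity c ρ σ) (hP : c.DO c.P)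
    {Φ : LaurentSeries A →ₗ[ℂ] LaurentSeries A} (hΦ : c.FDO Φ) : ∃ Ψ, Adj S ρ Φ Ψ := by
  obtain ⟨Ψ, hΨ, e⟩ := exists_formal_transpose (S := S) hP hΦ
  refine ⟨mulB σ ∘ₗ Ψ ∘ₗ mulB ρ, hΦ, (FDO.mulB _).comp (hΨ.comp (FDO.mulB _)), fun f g hfg => ?_⟩
  have h1 : mulB σ (Ψ (ρ * g)) * ρ = Ψ (ρ * g) := by
    rw [← h.comm, mulB_apply, ← mul_assoc, h.mul_inv, one_mul]
  rw [mul_assoc, mul_assoc, ← h.comm g, e _ _ (hfg.imp_right fun h => h.mul_left ρ)]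
  simp only [LinearMap.comp_apply]
  rw [mulB_apply ρ g, h1]

namespace Adj

variable {Φ Ψ Φ' Ψ' : LaurentSeries A →ₗ[ℂ] LaurentSeries A}

theorem unique (h : IsDensity c ρ σ) (hΦ : Adj S ρ Φ Ψ) (hΦ' : Adj S ρ Φ Ψ') : Ψ = Ψ' := by
  ext1 g
  rw [← sub_eq_zero]
  refine h.eq_zero (S := S) fun a ha => ?_
  rw [mul_sub, sub_mul, map_sub, ← hΦ.eq _ _ (Or.inl (fAc_mono ha)),
    ← hΦ'.eq _ _ (Or.inl (fAc_mono ha)), sub_self]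

/-- Order in `ν` passes to the adjoint by testing against compactly supported functions. -/
theorem mem_filt (h : IsDensity c ρ σ) (hΦ : Adj S ρ Φ Ψ) {K : ℤ}
    (hK : ∀ f ∈ filt A 0, Φ f ∈ filt A K) {N : ℤ} {g : LaurentSeries A} (hg : g ∈ filt A N) :
    Ψ g ∈ filt A (K + N) := by
  refine h.mem_filt (S := S) fun a ha => ?_
  rw [← hΦ.eq _ _ (Or.inl (fAc_mono ha))]
  refine lift_mem_filt _ ?_
  have := mul_mem_filt (mul_mem_filt (hK _ (mono_mem_filt 0 a)) hg) h.mem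
  rwa [add_zero] at this

theorem comp (hΦ : Adj S ρ Φ Ψ) (hΦ' : Adj S ρ Φ' Ψ') : Adj S ρ (Φ ∘ₗ Φ') (Ψ' ∘ₗ Ψ) :=
  ⟨hΦ.left.comp hΦ'.left, hΦ'.right.comp hΦ.right, fun f g hfg => by
    rw [LinearMap.comp_apply, hΦ.eq _ _ (hfg.imp_left fun h => h.map hΦ'.left),
      hΦ'.eq _ _ (hfg.imp_right fun h => h.map hΦ.right), LinearMap.comp_apply]⟩

theorem add (hΦ : Adj S ρ Φ Ψ) (hΦ' : Adj S ρ Φ' Ψ') : Adj S ρ (Φ + Φ') (Ψ + Ψ') :=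
  ⟨hΦ.left.add hΦ'.left, hΦ.right.add hΦ'.right, fun f g hfg => by
    rw [LinearMap.add_apply, LinearMap.add_apply, add_mul, add_mul, mul_add, add_mul, map_add,
      map_add, hΦ.eq _ _ hfg, hΦ'.eq _ _ hfg]⟩

theorem smul (hΦ : Adj S ρ Φ Ψ) (r : ℂ) : Adj S ρ (r • Φ) (r • Ψ) :=
  ⟨hΦ.left.smul r, hΦ.right.smul r, fun f g hfg => by
    rw [LinearMap.smul_apply, LinearMap.smul_apply, mul_smul_series, smul_mul_series,
      smul_mul_series, smul_mul_series, map_smul, map_smul, hΦ.eq _ _ hfg]⟩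

theorem sub (hΦ : Adj S ρ Φ Ψ) (hΦ' : Adj S ρ Φ' Ψ') : Adj S ρ (Φ - Φ') (Ψ - Ψ') := by
  have e : ∀ a b : LaurentSeries A →ₗ[ℂ] LaurentSeries A, a - b = a + (-1 : ℂ) • b := by
    intro a b
    module
  rw [e, e]
  exact hΦ.add (hΦ'.smul _)

theorem fQ (h : IsDensity c ρ σ) (hP : c.DO c.P) (p : Bool) : Adj S ρ (c.fQ p) (c.fQ p) := by
  have hd : c.FDO (c.fQ p) := by
    cases p
    · exact FDO.lift DO.one
    · exact FDO.lift hP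
  exact ⟨hd, hd, fun f g hfg => fint_fQ_mul h p hfg⟩

theorem id : Adj S ρ LinearMap.id LinearMap.id := ⟨FDO.id, FDO.id, fun _ _ _ => rfl⟩

/-- The pairing is symmetric only up to parity (`fint_comm`), so the double adjoint is the parity
conjugate of `Φ`. -/
theorem symm (h : IsDensity c ρ σ) (hP : c.DO c.P) (hΦ : Adj S ρ Φ Ψ) :
    Adj S ρ Ψ (c.fQ true ∘ₗ Φ ∘ₗ c.fQ true) :=
  ⟨hΦ.right, (Adj.fQ (S := S) h hP true).left.comp (hΦ.left.comp (Adj.fQ (S := S) h hP true).left),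
    fun f g hfg => by
      have h1 : S.FAc g ∨ S.FAc f := hfg.symm
      rw [fint_comm h (hfg.imp_left fun h => h.map hΦ.right),
        ← fint_fQ_mul h true (h1.imp_right fun h => h.map hΦ.right),
        ← hΦ.eq _ _ (h1.imp_left fun h => h.fQ true),
        fint_comm h ((h1.imp_left fun h => (h.fQ true).map hΦ.left))]
      rfl⟩

theorem mulB_fx (h : IsDensity c ρ σ) (hP : c.DO c.P) (i : ι) :
    Adj S ρ (mulB (c.fx i)) (c.fQ (c.odd i) ∘ₗ mulB (c.fx i)) :=
  ⟨FDO.mulB _, (Adj.fQ (S := S) h hP _).left.comp (FDO.mulB _), fun f g hfg => by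
    rw [mulB_apply, LinearMap.comp_apply, (c.fhomog_fx i).mul_comm, mul_assoc (c.fQ _ f),
      fint_fQ_mul h _ (hfg.imp_right fun h => h.mul_left _), mulB_apply]⟩

end Adj

end Adjoint

end Integration

end Integration

end SuperCoords

end SuperStar


/-! ### The supertrace property -/

namespace SuperStar

namespace SuperCoords

namespace Integration

variable {A : Type*} [Ring A] [Module ℂ A] [SMulCommClass ℂ A A] [IsScalarTower ℂ A A]
  {κ : Type*} [DecidableEq κ] [Fintype κ] {c : SuperCoords A (Bool × κ)}
  {S : Integration c} {ρ σ : LaurentSeries A}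
  {X X' : LaurentSeries A} {B : LaurentSeries A →ₗ[ℂ] LaurentSeries A →ₗ[ℂ] LaurentSeries A}
  {T : PowerSeries (Module.End ℂ A)}

theorem fQ_cov (hX : ∀ i, c.FHomog (c.odd i) (c.fd i X)) (p : Bool) (i : Bool × κ)
    (f : LaurentSeries A) :
    c.fQ p (c.cov X i f) = ssgn p (c.odd i) • c.cov X i (c.fQ p f) := by
  rw [cov_apply, cov_apply, map_add, c.fQ_mul, (hX i).fQ, c.fQ_fd, smul_mul_series, smul_add]

theorem fdo_cov (X : LaurentSeries A) (i : Bool × κ) : c.FDO (c.cov X i) :=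
  (FDO.mulB _).add (FDO.fd i)

/-- The one place where the form of the density matters. The integral of `∂(f g ρ)` vanishes, and
`∂ρ = (∂X + ∂X') ρ` lets `∂X` join the derivative of `f` and `∂X'` the derivative of `g`. -/
theorem adj_cov (hρ : IsDensity c ρ σ) (hP : c.DO c.P)
    (hX : ∀ i, c.FHomog (c.odd i) (c.fd i X)) (hX' : ∀ i, c.FHomog (c.odd i) (c.fd i X'))
    (hd : ∀ i, c.fd i ρ = (c.fd i X + c.fd i X') * ρ) (i : Bool × κ) :
    Adj S ρ (c.cov X i) ((-1 : ℂ) • (c.fQ (c.odd i) ∘ₗ c.cov X' i)) := by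
  refine ⟨fdo_cov X i, ((Adj.fQ (S := S) hρ hP _).left.comp (fdo_cov X' i)).smul _,
    fun f g hfg => ?_⟩
  have hz : S.fint (c.fd i (f * (g * ρ))) = 0 :=
    fint_fd i (fAc_mul (hfg.imp_right fun h => h.mul_right ρ))
  rw [c.fd_mul, c.fd_mul, hd] at hz
  rw [LinearMap.smul_apply, mul_smul_series, smul_mul_series, map_smul, LinearMap.comp_apply,
    ← fint_fQ_mul hρ _ (hfg.imp_right fun h => h.map (fdo_cov X' i)),
    show ∀ y : LaurentSeries ℂ, (-1 : ℂ) • y = -y from fun y => neg_one_smul ℂ y, eq_neg_iff_add_eq_zero, ← map_add, ← hz]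
  congr 1
  have h1 : ∀ y, c.fd i X * (g * y) = c.fQ (c.odd i) g * (c.fd i X * y) := fun y => by
    rw [← mul_assoc, (hX i).mul_comm, mul_assoc]
  have h2 : ∀ y, c.fd i X' * (g * y) = c.fQ (c.odd i) g * (c.fd i X' * y) := fun y => by
    rw [← mul_assoc, (hX' i).mul_comm, mul_assoc]
  have h3 : ∀ y, c.fd i X * (f * y) = c.fQ (c.odd i) f * (c.fd i X * y) := fun y => by
    rw [← mul_assoc, (hX i).mul_comm, mul_assoc]
  simp only [cov_apply, add_mul, mul_add, mul_assoc, h1, h2, h3]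
  abel

namespace Adj

variable {m n Φ Ψ : LaurentSeries A →ₗ[ℂ] LaurentSeries A} {r : ℂ} {p : Bool}

/-- Taking adjoints in `Φ m = m Φ`. The conclusion has the shape `n (Q g)` in which `right_x` and
`right_u` express right multiplications. -/
theorem commute (hρ : IsDensity c ρ σ) (hm : Adj S ρ m (r • (c.fQ p ∘ₗ n)))
    (hr : r ≠ 0) (hn : ∀ g, c.fQ p (n g) = ssgn p p • n (c.fQ p g)) (hΦ : Adj S ρ Φ Ψ)
    (hcomm : ∀ f, Φ (m f) = m (Φ f)) (g : LaurentSeries A) :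
    Ψ (n (c.fQ p g)) = n (c.fQ p (Ψ g)) := by
  have e : Φ ∘ₗ m = m ∘ₗ Φ := LinearMap.ext hcomm
  have h1 := hΦ.comp hm
  rw [e] at h1
  have h2 := LinearMap.congr_fun (h1.unique hρ (hm.comp hΦ)) g
  simp only [LinearMap.comp_apply, LinearMap.smul_apply, hn, map_smul, smul_smul] at h2
  have h3 : r * ssgn p p ≠ 0 := mul_ne_zero hr (by cases p <;> simp)
  exact (smul_right_injective _ h3 h2).symm

theorem mul_fQ (hρ : IsDensity c ρ σ) (hP : c.DO c.P) (hm : Adj S ρ m (r • (c.fQ p ∘ₗ n))) :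
    Adj S ρ (m ∘ₗ c.fQ p) (r • n) := by
  have h1 := hm.comp (Adj.fQ hρ hP p)
  have e : c.fQ p ∘ₗ (r • (c.fQ p ∘ₗ n)) = r • n := by
    ext1 g
    simp only [LinearMap.comp_apply, LinearMap.smul_apply, map_smul, fQ_fQ]
  rwa [e] at h1

end Adj

/-- An anti-Wick star product with its Berezin transform, a dual potential, and the density
`exp (X + X')`. -/
structure TraceData (_S : Integration c) (ρ σ X X' : LaurentSeries A)
    (B : LaurentSeries A →ₗ[ℂ] LaurentSeries A →ₗ[ℂ] LaurentSeries A)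
    (T : PowerSeries (Module.End ℂ A)) : Prop where
  density : IsDensity c ρ σ
  parity : c.ParityDO
  det : c.Determines true X B
  ber : c.IsBerezin B T
  pot : c.IsPotential X'
  fd_pot : ∀ i, c.fd i X' = -opI T (c.fd i X)
  fd_density : ∀ i, c.fd i ρ = (c.fd i X + c.fd i X') * ρ

namespace TraceData

variable (t : TraceData S ρ σ X X' B T)
include t

theorem dual : c.Determines false X' (dualB B T) :=
  t.ber.determines_dualB t.parity t.det t.pot t.fd_pot

open Classical in
/-- The adjoint of a formal differential operator. -/
noncomputable def dag (Φ : LaurentSeries A →ₗ[ℂ] LaurentSeries A) :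
    LaurentSeries A →ₗ[ℂ] LaurentSeries A :=
  if h : c.FDO Φ then (exists_adj (S := S) t.density t.parity h).choose else 0

theorem adj {Φ : LaurentSeries A →ₗ[ℂ] LaurentSeries A} (h : c.FDO Φ) : Adj S ρ Φ (t.dag Φ) := by
  rw [dag, dif_pos h]
  exact (exists_adj (S := S) t.density t.parity h).choose_spec

theorem adj_fx (i : Bool × κ) :
    Adj S ρ (mulB (c.fx i)) ((1 : ℂ) • (c.fQ (c.odd i) ∘ₗ mulB (c.fx i))) := by
  rw [one_smul]
  exact Adj.mulB_fx t.density t.parity i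

theorem adj_D (i : Bool × κ) :
    Adj S ρ (c.cov X i) ((-1 : ℂ) • (c.fQ (c.odd i) ∘ₗ c.cov X' i)) :=
  adj_cov t.density t.parity t.det.isPotential.homog_fd t.pot.homog_fd t.fd_density i

theorem adj_D' (i : Bool × κ) :
    Adj S ρ (c.cov X' i) ((-1 : ℂ) • (c.fQ (c.odd i) ∘ₗ c.cov X i)) :=
  adj_cov t.density t.parity t.pot.homog_fd t.det.isPotential.homog_fd
    (fun i => by rw [t.fd_density, add_comm]) i

theorem fQ_fx (i : Bool × κ) (g : LaurentSeries A) : c.fQ (c.odd i) (mulB (c.fx i) g) =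
    ssgn (c.odd i) (c.odd i) • mulB (c.fx i) (c.fQ (c.odd i) g) := by
  rw [mulB_apply, c.fQ_mul, (c.fhomog_fx i).fQ, smul_mul_series, mulB_apply]

theorem fQ_D (i : Bool × κ) (g : LaurentSeries A) : c.fQ (c.odd i) (c.cov X i g) =
    ssgn (c.odd i) (c.odd i) • c.cov X i (c.fQ (c.odd i) g) :=
  fQ_cov t.det.isPotential.homog_fd _ i g

theorem fQ_D' (i : Bool × κ) (g : LaurentSeries A) : c.fQ (c.odd i) (c.cov X' i g) =
    ssgn (c.odd i) (c.odd i) • c.cov X' i (c.fQ (c.odd i) g) :=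
  fQ_cov t.pot.homog_fd _ i g

theorem fdo_r (f : LaurentSeries A) : c.FDO (B.flip f) := t.det.isStar.right f

/-- The adjoint of right multiplication by `f`. -/
noncomputable def R (f : LaurentSeries A) : LaurentSeries A →ₗ[ℂ] LaurentSeries A :=
  t.dag (B.flip f)

theorem adj_R (f : LaurentSeries A) : Adj S ρ (B.flip f) (t.R f) := t.adj (t.fdo_r f)

/-- The adjoint of the Berezin transform. -/
noncomputable def F : LaurentSeries A →ₗ[ℂ] LaurentSeries A := t.dag (op T)

/-- The adjoint of the inverse Berezin transform. -/
noncomputable def G : LaurentSeries A →ₗ[ℂ] LaurentSeries A := t.dag (opI T)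

theorem adj_F : Adj S ρ (op T) t.F := t.adj t.ber.fdo

theorem adj_G : Adj S ρ (opI T) t.G := t.adj t.ber.fdo_opI

theorem F_G (f : LaurentSeries A) : t.F (t.G f) = f := by
  have h := t.adj_G.comp t.adj_F
  have e : opI T ∘ₗ op T = LinearMap.id := LinearMap.ext t.ber.opI_op
  rw [e] at h
  exact LinearMap.congr_fun (h.unique t.density Adj.id) f

theorem G_F (f : LaurentSeries A) : t.G (t.F f) = f := by
  have h := t.adj_F.comp t.adj_G
  have e : op T ∘ₗ opI T = LinearMap.id := LinearMap.ext t.ber.op_opI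
  rw [e] at h
  exact LinearMap.congr_fun (h.unique t.density Adj.id) f

theorem F_fQ (f : LaurentSeries A) : t.F (c.fQ true f) = c.fQ true (t.F f) := by
  have h := t.adj_F.comp (Adj.fQ t.density t.parity true)
  have h' := (Adj.fQ t.density t.parity true).comp t.adj_F
  have e : op T ∘ₗ c.fQ true = c.fQ true ∘ₗ op T :=
    LinearMap.ext fun g => (t.ber.fQ t.parity t.det.isStar true g).symm
  rw [e] at h
  exact LinearMap.congr_fun (h'.unique t.density h) f

theorem G_fQ (f : LaurentSeries A) : t.G (c.fQ true f) = c.fQ true (t.G f) := by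
  conv_lhs => rw [← t.F_G f, ← t.F_fQ, t.G_F]

theorem R_add (f g : LaurentSeries A) : t.R (f + g) = t.R f + t.R g := by
  refine (t.adj_R (f + g)).unique t.density ?_
  rw [map_add]
  exact (t.adj_R f).add (t.adj_R g)

theorem R_smul (r : ℂ) (f : LaurentSeries A) : t.R (r • f) = r • t.R f := by
  refine (t.adj_R (r • f)).unique t.density ?_
  rw [map_smul]
  exact (t.adj_R f).smul r

theorem R_star (f g : LaurentSeries A) : t.R (B f g) = t.R f ∘ₗ t.R g := by
  refine (t.adj_R _).unique t.density ?_
  have e : B.flip (B f g) = B.flip g ∘ₗ B.flip f :=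
    LinearMap.ext fun a => (t.det.isStar.assoc a f g).symm
  rw [e]
  exact (t.adj_R g).comp (t.adj_R f)

theorem R_fQ (f g : LaurentSeries A) : t.R (c.fQ true f) g = c.fQ true (t.R f (c.fQ true g)) := by
  have hQ := Adj.fQ (S := S) t.density t.parity true
  have e : B.flip (c.fQ true f) = c.fQ true ∘ₗ B.flip f ∘ₗ c.fQ true := LinearMap.ext fun a => by
    simp only [LinearMap.comp_apply, LinearMap.flip_apply]
    rw [t.det.isStar.par, fQ_fQ]
  have h := hQ.comp ((t.adj_R f).comp hQ)
  rw [← e] at h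
  exact LinearMap.congr_fun ((t.adj_R _).unique t.density h) g

/-- To lowest order `r_f` is undeformed right multiplication, whose adjoint is left multiplication
by `f`. -/
theorem R_sub_mem_filt {N M : ℤ} {f g : LaurentSeries A} (hf : f ∈ filt A N) (hg : g ∈ filt A M) :
    t.R f g - f * g ∈ filt A (N + M + 1) := by
  have h1 : Adj S ρ (mulB.flip f) (mulB f) :=
    ⟨fdo_mulB_flip t.parity f, FDO.mulB f, fun a b _ => by
      rw [LinearMap.flip_apply, mulB_apply, mulB_apply, mul_assoc a]⟩
  have h2 := ((t.adj_R f).sub h1).mem_filt t.density (K := N + 1) (fun a ha k hk => ?_) hg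
  · rw [show N + M + 1 = N + 1 + M by ring]
    exact h2
  · have hB := t.det.isStar.isFormalBilin
    have e1 := hB.mem_filt _ _ _ _ ha hf
    have e2 := mul_mem_filt ha hf
    rw [zero_add] at e1 e2
    rcases lt_or_ge k N with hlt | hge
    · exact Submodule.sub_mem _ e1 e2 k hlt
    · obtain rfl : k = N := by omega
      have e3 := hB.coeff_lowest ha hf
      have e4 := coeff_mul_lowest ha hf
      rw [zero_add] at e3 e4
      rw [LinearMap.sub_apply, HahnSeries.coeff_sub, LinearMap.flip_apply, LinearMap.flip_apply,
        mulB_apply, e3, e4, t.det.isStar.lowest, sub_self]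

theorem F_sub_mem_filt {N : ℤ} {f : LaurentSeries A} (hf : f ∈ filt A N) :
    t.F f - f ∈ filt A (N + 1) := by
  have h2 := (t.adj_F.sub Adj.id).mem_filt t.density (K := 1) (fun a ha k hk => ?_) hf
  · rw [add_comm]
    exact h2
  · rw [LinearMap.sub_apply, LinearMap.id_apply, HahnSeries.coeff_sub]
    rcases lt_or_ge k 0 with hlt | hge
    · rw [op_mem_filt T ha k hlt, ha k hlt, sub_zero]
    · obtain rfl : k = 0 := by omega
      rw [coeff_op_lowest t.ber.constantCoeff ha, sub_self]

theorem mem_filt_of_sub {N : ℤ} {f g : LaurentSeries A} (hf : f ∈ filt A N)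
    (h : g - f ∈ filt A (N + 1)) : g ∈ filt A N := by
  have := Submodule.add_mem _ hf (filt_anti (by omega) h)
  rwa [add_sub_cancel] at this

theorem G_mem_filt {N : ℤ} {f : LaurentSeries A} (hf : f ∈ filt A N) : t.G f ∈ filt A N := by
  have h2 := t.adj_G.mem_filt t.density (K := 0) (fun a ha => op_mem_filt _ ha) hf
  rwa [zero_add] at h2

theorem one_mem_filt : (1 : LaurentSeries A) ∈ filt A 0 := mono_mem_filt 0 1

theorem shift_R (n : ℤ) (f g : LaurentSeries A) : t.R (shift n f) g = shift n (t.R f g) := by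
  have e : B.flip (shift n f) = shift n ∘ₗ B.flip f :=
    LinearMap.ext fun a => t.det.isStar.isFormalBilin.shift_right n a f
  have hs : Adj S ρ (shift n) (shift n) := by
    have e' : (shift n : LaurentSeries A →ₗ[ℂ] LaurentSeries A) = mulB (shift n 1) := by
      ext1 f
      rw [mulB_apply, ← mulB_apply, isFormalBilin_mulB.shift_left, mulB_apply, one_mul]
    refine ⟨e' ▸ FDO.mulB _, e' ▸ FDO.mulB _, fun a b _ => ?_⟩
    rw [← mulB_apply (shift n a), isFormalBilin_mulB.shift_left, ← mulB_apply a (shift n b),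
      isFormalBilin_mulB.shift_right]
  have h := hs.comp (t.adj_R f)
  rw [← e] at h
  rw [(t.adj_R _).unique t.density h, LinearMap.comp_apply, (t.adj_R f).right.isFormal.map_shift]

/-- The map `f ↦ r_f† g` for fixed `g`. -/
noncomputable def Rm (g : LaurentSeries A) : LaurentSeries A →ₗ[ℂ] LaurentSeries A where
  toFun f := t.R f g
  map_add' f f' := by rw [t.R_add, LinearMap.add_apply]
  map_smul' r f := by rw [t.R_smul, LinearMap.smul_apply, RingHom.id_apply]

theorem Rm_apply (f g : LaurentSeries A) : t.Rm g f = t.R f g := rfl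

theorem isFormal_Rm (g : LaurentSeries A) : IsFormal (t.Rm g) where
  map_shift n f := t.shift_R n f g
  bdd := by
    obtain ⟨N, hN⟩ := exists_mem_filt g
    refine ⟨0 + N, fun f hf => t.mem_filt_of_sub (mul_mem_filt hf hN) (t.R_sub_mem_filt hf hN)⟩

/-- The operators `F r_f† F⁻¹` are left multiplications. -/
theorem F_R_G (f g : LaurentSeries A) : t.F (t.R f (t.G g)) = B (t.F (t.R f (t.G 1))) g := by
  have hs := t.det.isStar
  -- `F r_f† F⁻¹` is the adjoint of `I⁻¹ r_f I`. In antiholomorphic directions `x` and `∂X' + ∂`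
  -- are, up to sign, the `I`-conjugates of left multiplications and so commute with `I⁻¹ r_f I`.
  -- Their adjoints are, up to sign and parity, `x` and `∂X + ∂`, which give the right
  -- multiplications of `B`.
  have hΦ : Adj S ρ (opI T ∘ₗ B.flip f ∘ₗ op T) (t.F ∘ₗ t.R f ∘ₗ t.G) := by
    have := t.adj_G.comp ((t.adj_R f).comp t.adj_F)
    rwa [LinearMap.comp_assoc] at this
  have h := t.det.eq_left hΦ.right (fun k g => ?_) (fun k g => ?_)
  · exact LinearMap.congr_fun h g
  · rw [t.det.right_x, t.det.right_x]
    refine (t.adj_fx _).commute t.density one_ne_zero (t.fQ_fx _) hΦ (fun a => ?_) g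
    simp only [LinearMap.comp_apply, mulB_apply, LinearMap.flip_apply, Bool.not_true]
    rw [t.ber.op_fx_mul t.parity t.det, ← t.ber.opI_coordOp t.parity t.det, coordOp_false,
      coordOp_false, hs.assoc]
  · rw [t.det.right_u, t.det.right_u]
    refine (t.adj_D' _).commute t.density (by norm_num) (t.fQ_D _) hΦ (fun a => ?_) g
    have e : ∀ a, c.cov X' (false, k) a = -opI T (uOp c B X (false, k) (op T a)) := fun a => by
      rw [t.ber.opI_uOp t.parity t.det, cov_apply, t.fd_pot]
      noncomm_ring
    simp only [LinearMap.comp_apply, LinearMap.flip_apply, Bool.not_true, e, map_neg,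
      t.ber.op_opI, uOp_false, hs.assoc]

/-- The adjoints of right multiplications are left multiplications for the dual product. -/
theorem R_eq_dualB (f g : LaurentSeries A) : t.R f g = dualB B T (t.R f 1) g := by
  have hs := t.det.isStar
  -- `r_f` commutes with the left multiplications by holomorphic `x` and `∂X`, which act as `x` and
  -- `∂X + ∂`. Their adjoints involve `x` and `∂X' + ∂`, which give the right multiplications of the
  -- dual product.
  have h := t.dual.eq_left (t.adj_R f).right (fun k g => ?_) (fun k g => ?_)
  · exact LinearMap.congr_fun h g
  · rw [t.dual.right_x, t.dual.right_x]
    refine (t.adj_fx _).commute t.density one_ne_zero (t.fQ_fx _) (t.adj_R f) (fun a => ?_) g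
    simp only [mulB_apply, LinearMap.flip_apply, Bool.not_false]
    rw [← t.det.left_x, ← t.det.left_x, hs.assoc]
  · rw [t.dual.right_u, t.dual.right_u]
    refine (t.adj_D _).commute t.density (by norm_num) (t.fQ_D' _) (t.adj_R f) (fun a => ?_) g
    simp only [LinearMap.flip_apply, Bool.not_false]
    rw [← t.det.left_u, ← t.det.left_u, hs.assoc]

/-- The map `f ↦ F r_f† F⁻¹ 1` is multiplicative, since `f ↦ r_f†` is and `F r_f† F⁻¹` is a left
multiplication. It is `1 + O(ν)` and fixes the generators of the holomorphic half, so rigidity makes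
it the identity. -/
theorem F_R_G_one (f : LaurentSeries A) : t.F (t.R f (t.G 1)) = f := by
  have hs := t.det.isStar
  have h1 := one_mem_filt t
  have h := c.eq_id_of_multiplicative t.det.isPotential true hs (h := t.F ∘ₗ t.Rm (t.G 1))
    (t.adj_F.right.isFormal.comp (t.isFormal_Rm _)) (fun f hf => ?_) (fun f => ?_) (fun f g => ?_)
    (fun k => ?_) (fun k => ?_)
  · exact LinearMap.congr_fun h f
  · have hG := t.G_mem_filt h1
    have e1 := t.R_sub_mem_filt hf hG
    have e2 := t.F_sub_mem_filt (t.mem_filt_of_sub (mul_mem_filt hf hG) e1)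
    have e3 := t.F_sub_mem_filt hG
    rw [t.F_G] at e3
    have e4 := mul_mem_filt hf e3
    have e5 := Submodule.add_mem _ (Submodule.add_mem _ e2 e1) (Submodule.neg_mem _ e4)
    have e6 : ((t.F ∘ₗ t.Rm (t.G 1)) f - f) = t.F (t.R f (t.G 1)) - t.R f (t.G 1) +
        (t.R f (t.G 1) - f * t.G 1) + -(f * (1 - t.G 1)) := by
      rw [LinearMap.comp_apply, Rm_apply, mul_sub, mul_one]
      abel
    rw [e6]
    simpa using e5
  · simp only [LinearMap.comp_apply, Rm_apply]
    rw [t.R_fQ, ← t.G_fQ, fQ_one, t.F_fQ]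
  · simp only [LinearMap.comp_apply, Rm_apply]
    rw [t.R_star, ← t.F_R_G f, LinearMap.comp_apply, t.G_F]
  -- Right multiplication by a holomorphic coordinate is an `I`-conjugate of undeformed
  -- multiplication, so its adjoint is explicit and `F`, `G` cancel against it.
  · have e : B.flip (c.fx (true, k)) =
        op T ∘ₗ (mulB (c.fx (true, k)) ∘ₗ c.fQ (c.odd (true, k))) ∘ₗ opI T :=
      LinearMap.ext fun g => by
        simp only [LinearMap.comp_apply, mulB_apply]
        rw [t.ber.op_fx_mul t.parity t.det, t.ber.opI_fQ t.parity hs, t.ber.op_opI, coordOp_true,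
          fQ_fQ, LinearMap.flip_apply]
    have h := t.adj_F.comp (((t.adj_fx (true, k)).mul_fQ t.density t.parity).comp t.adj_G)
    rw [← e] at h
    simp only [LinearMap.comp_apply, Rm_apply]
    rw [(t.adj_R _).unique t.density h]
    simp only [LinearMap.comp_apply, t.F_G, one_smul, mulB_apply, mul_one]
  · have e : B.flip (c.fd (true, k) X) =
        op T ∘ₗ ((-1 : ℂ) • c.cov X' (true, k) ∘ₗ c.fQ (c.odd (true, k))) ∘ₗ opI T :=
      LinearMap.ext fun g => by
        have e : ∀ a, c.cov X' (true, k) a = -opI T (uOp c B X (true, k) (op T a)) := fun a => by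
          rw [t.ber.opI_uOp t.parity t.det, cov_apply, t.fd_pot]
          noncomm_ring
        simp only [LinearMap.comp_apply, LinearMap.smul_apply]
        rw [e, ← t.ber.fQ t.parity hs, t.ber.op_opI, uOp_true, fQ_fQ, neg_one_smul, neg_neg,
          t.ber.op_opI, LinearMap.flip_apply]
    have h := t.adj_F.comp
      ((((t.adj_D' (true, k)).mul_fQ t.density t.parity).smul (-1)).comp t.adj_G)
    rw [← e] at h
    simp only [LinearMap.comp_apply, Rm_apply]
    rw [(t.adj_R _).unique t.density h]
    simp only [LinearMap.comp_apply, LinearMap.smul_apply, t.F_G, cov_apply, fd_one, mul_one,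
      add_zero, smul_smul]
    norm_num

/-- Rigidity in the antiholomorphic half. Multiplicativity comes from `R_eq_dualB`, since `I`
carries the dual product to `B`; the generators are fixed because `I` fixes antiholomorphic
functions and sends `-∂X'` to `∂X`. -/
theorem op_R_one (f : LaurentSeries A) : op T (t.R f 1) = f := by
  have hs := t.det.isStar
  have h1 := one_mem_filt t
  have h := c.eq_id_of_multiplicative t.det.isPotential false hs (h := op T ∘ₗ t.Rm 1)
    ((isFormal_op T).comp (t.isFormal_Rm _)) (fun f hf => ?_) (fun f => ?_) (fun f g => ?_)
    (fun k => ?_) (fun k => ?_)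
  · exact LinearMap.congr_fun h f
  · have e1 := t.R_sub_mem_filt hf h1
    have e0 := t.mem_filt_of_sub (mul_mem_filt hf h1) e1
    rw [mul_one] at e1
    intro n hn
    simp only [LinearMap.comp_apply, Rm_apply, HahnSeries.coeff_sub]
    rcases lt_or_ge n 0 with hlt | hge
    · rw [op_mem_filt T e0 n (by omega), hf n hlt, sub_zero]
    · obtain rfl : n = 0 := by omega
      rw [coeff_op_lowest t.ber.constantCoeff (by simpa using e0), ← HahnSeries.coeff_sub]
      exact e1 0 (by norm_num)
  · simp only [LinearMap.comp_apply, Rm_apply]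
    rw [t.R_fQ, fQ_one, t.ber.fQ t.parity hs]
  · simp only [LinearMap.comp_apply, Rm_apply]
    rw [t.R_star, LinearMap.comp_apply, t.R_eq_dualB f, dualB_apply, t.ber.op_opI]
  · have e : B.flip (c.fx (false, k)) = mulB (c.fx (false, k)) ∘ₗ c.fQ (c.odd (false, k)) :=
      LinearMap.ext fun g => t.det.right_x k g
    have h := (t.adj_fx (false, k)).mul_fQ t.density t.parity
    rw [← e] at h
    simp only [LinearMap.comp_apply, Rm_apply]
    rw [(t.adj_R _).unique t.density h, one_smul, mulB_apply, mul_one]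
    exact t.ber.op_hol hs (hol_x false k)
  · have e : B.flip (c.fd (false, k) X) = c.cov X (false, k) ∘ₗ c.fQ (c.odd (false, k)) :=
      LinearMap.ext fun g => t.det.right_u k g
    have h := (t.adj_D (false, k)).mul_fQ t.density t.parity
    rw [← e] at h
    simp only [LinearMap.comp_apply, Rm_apply]
    rw [(t.adj_R _).unique t.density h, LinearMap.smul_apply, cov_apply, fd_one, mul_one, add_zero,
      t.fd_pot, neg_one_smul, neg_neg, t.ber.op_opI]

theorem R_one (f : LaurentSeries A) : t.R f 1 = opI T f := by
  conv_rhs => rw [← t.op_R_one f, t.ber.opI_op]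

theorem R_eq (f g : LaurentSeries A) : t.R f g = opI T (B f (op T g)) := by
  rw [t.R_eq_dualB, dualB_apply, t.op_R_one]

/-- The two descriptions of `r_f†` together say that `F I⁻¹` commutes with left multiplications; so
it is right multiplication by its value at `1`. -/
theorem F_eq_star (g : LaurentSeries A) : t.F g = B (op T g) (t.F 1) := by
  have hs := t.det.isStar
  have h1 : ∀ f g, t.F (opI T (B f g)) = B f (t.F (opI T g)) := by
    intro f g
    have h2 := t.F_R_G f (t.F (opI T g))
    rw [t.G_F, t.F_R_G_one, t.R_eq, t.ber.op_opI] at h2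
    exact h2
  have h3 := h1 (op T g) 1
  rwa [hs.one_right, t.ber.opI_op, t.ber.opI_one hs] at h3

/-- The adjoint of `F = r_e I` is `F r_e†`, and it is also `I`, by the double adjoint and evenness.
At `1` this reads `e ∗ e = 1`, and an element `1 + O(ν)` with this property is `1`. -/
theorem F_one : t.F 1 = 1 := by
  have hs := t.det.isStar
  set e := t.F 1 with he
  have h0 : e - 1 ∈ filt A 1 := by simpa using t.F_sub_mem_filt (one_mem_filt t)
  have hF : t.F = B.flip e ∘ₗ op T := LinearMap.ext t.F_eq_star
  have h1 : Adj S ρ t.F (t.F ∘ₗ t.R e) := by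
    have := (t.adj_R e).comp t.adj_F
    rwa [← hF] at this
  have h2 := h1.unique t.density (t.adj_F.symm t.density t.parity)
  have h3 : B e e = 1 := by
    have := LinearMap.congr_fun h2 1
    simp only [LinearMap.comp_apply] at this
    rw [fQ_one, t.ber.op_one hs, fQ_one, t.R_one, t.F_eq_star, t.ber.op_opI] at this
    exact this
  have h4 : e - 1 = (-1 / 2 : ℂ) • B (e - 1) (e - 1) := by
    simp only [map_sub, LinearMap.sub_apply, hs.one_left, hs.one_right, h3]
    module
  have h5 : ∀ n : ℕ, e - 1 ∈ filt A (1 + n) := by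
    intro n
    induction n with
    | zero => simpa using h0
    | succ n ih =>
      rw [h4]
      exact Submodule.smul_mem _ _ (filt_anti (by push_cast; omega)
        (hs.isFormalBilin.mem_filt _ _ _ _ ih ih))
  rw [← sub_eq_zero]
  ext n
  exact h5 n.toNat n (by omega)

/-- The Berezin transform is self-adjoint. -/
theorem F_eq (g : LaurentSeries A) : t.F g = op T g := by
  rw [t.F_eq_star, t.F_one, t.det.isStar.one_right]

theorem G_one : t.G 1 = 1 := by
  conv_lhs => rw [← t.F_one, t.G_F]

/-- Taking adjoints in `I⁻¹ L_f I = r_f†` and using that `I` is selfadjoint gives the value `I⁻¹(P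
f)` of the adjoint of `L_f` at `1`. -/
theorem fint_star_one (f g : LaurentSeries A) (hg : S.FAc g) :
    S.fint (B f g * ρ) = S.fint (g * opI T (c.fQ true f) * ρ) := by
  have hs := t.det.isStar
  have hL := t.adj (hs.left f)
  have h1 := (t.adj_R f).symm t.density t.parity
  have h2 := t.adj_G.comp (hL.comp t.adj_F)
  have e : opI T ∘ₗ B f ∘ₗ op T = t.R f := LinearMap.ext fun a => (t.R_eq f a).symm
  rw [e] at h2
  have h3 := LinearMap.congr_fun (h2.unique t.density h1) 1
  simp only [LinearMap.comp_apply] at h3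
  rw [t.G_one, t.F_eq, fQ_one, LinearMap.flip_apply, hs.one_left] at h3
  have h4 := hL.eq g 1 (Or.inl hg)
  rw [mul_one] at h4
  rw [h4, ← h3, t.ber.opI_op]

/-- Both integrals equal that of `g I⁻¹(f) ρ` up to the same sign: the first by `fint_star_one`, the
second by `r_f† 1 = I⁻¹ f`. -/
theorem fint_star_homog {p : Bool} {f g : LaurentSeries A} (hf : c.FHomog p f) (hg : S.FAc g) :
    S.fint (B f g * ρ) = S.fint (B (c.fQ p g) f * ρ) := by
  have h1 := (t.adj_R f).eq (c.fQ p g) 1 (Or.inl (hg.fQ p))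
  rw [mul_one, LinearMap.flip_apply, t.R_one, fint_fQ_mul t.density p (Or.inl hg)] at h1
  rw [h1, t.fint_star_one f g hg, t.ber.opI_fQ t.parity t.det.isStar, hf.fQ, hf.fQ]
  cases p <;> rfl

/-- `ρ` is a supertrace density. -/
theorem supertrace {p q : Bool} {f g : LaurentSeries A} (hf : c.FHomog p f) (hg : c.FHomog q g)
    (h : S.FAc f ∨ S.FAc g) : S.fint (B f g * ρ) = S.fint (B (c.fQ p g) f * ρ) := by
  rcases h with h | h
  -- When `f` is the compactly supported factor the roles are exchanged; the two graded signs
  -- cancel.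
  · have h1 := t.fint_star_homog hg h
    rw [hg.fQ, map_smul, LinearMap.smul_apply, smul_mul_series, map_smul, h1, hf.fQ, map_smul,
      LinearMap.smul_apply, smul_mul_series, map_smul, smul_smul, ssgn_comm, ssgn_mul_self,
      one_smul]
  · exact t.fint_star_homog hf h

end TraceData

end Integration

end SuperCoords

end SuperStar


/-! ## Grassmann algebras with coefficients in a complex algebra -/

namespace Grassmann

variable {R ι : Type*} [CommRing R] [LinearOrder ι]

/-- Every pair from disjoint sets is an inversion in exactly one of the two orders. -/
theorem inv_add_inv {I J : Finset ι} (h : Disjoint I J) : inv I J + inv J I = I.card * J.card := by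
  have h1 : inv J I = ((I ×ˢ J).filter fun p => ¬ p.2 < p.1).card := by
    unfold inv
    refine Finset.card_bij' (fun p _ => (p.2, p.1)) (fun p _ => (p.2, p.1)) ?_ ?_ ?_ ?_
    · intro p hp
      simp only [Finset.mem_filter, Finset.mem_product] at hp ⊢
      exact ⟨⟨hp.1.2, hp.1.1⟩, hp.2.not_gt⟩
    · intro p hp
      simp only [Finset.mem_filter, Finset.mem_product] at hp ⊢
      refine ⟨⟨hp.1.2, hp.1.1⟩, lt_of_le_of_ne (not_lt.1 hp.2) fun h' => ?_⟩
      rw [h'] at hp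
      exact (Finset.disjoint_left.1 h hp.1.1) hp.1.2
    · intro p _
      rfl
    · intro p _
      rfl
  rw [h1, inv, Finset.card_filter_add_card_filter_not, Finset.card_product]

theorem inv_singleton_left (i : ι) (J : Finset ι) : inv {i} J = (J.filter (· < i)).card := by
  unfold inv
  refine Finset.card_bij' (fun p _ => p.2) (fun j _ => (i, j)) ?_ ?_ ?_ ?_
  · rintro ⟨a, b⟩ hp
    simp only [Finset.mem_filter, Finset.mem_product, Finset.mem_singleton] at hp ⊢
    exact ⟨hp.1.2, hp.1.1 ▸ hp.2⟩
  · intro j hj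
    simpa using hj
  · rintro ⟨a, b⟩ hp
    simp only [Finset.mem_filter, Finset.mem_product, Finset.mem_singleton] at hp ⊢
    rw [hp.1.1]
  · intro j _
    rfl

theorem inv_singleton_right {i : ι} {J : Finset ι} (h : i ∉ J) :
    inv J {i} + (J.filter (· < i)).card = J.card := by
  rw [← inv_singleton_left, inv_add_inv (by simpa using h), Finset.card_singleton, mul_one]

theorem neg_one_pow_eq {a b n : ℕ} (h : a + b = 2 * n) : (-1 : R) ^ a = (-1) ^ b :=
  neg_one_pow_congr (by
    have : Even (a + b) := ⟨n, by omega⟩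
    exact Nat.even_add.1 this)

variable {S : Type*} [CommRing S] [Algebra S R]

theorem parity_apply (f : Grassmann R ι) (K : Finset ι) : parity S f K = (-1) ^ K.card * f K := rfl

theorem leftDeriv_apply (i : ι) (f : Grassmann R ι) (K : Finset ι) : leftDeriv S i f K =
    if i ∈ K then 0 else (-1) ^ (K.filter (· < i)).card * f (insert i K) := rfl

theorem neg_apply (f : Grassmann R ι) (K : Finset ι) : (-f) K = -f K := rfl

theorem parity_mul (f g : Grassmann R ι) : parity S (f * g) = parity S f * parity S g := by
  ext K
  simp only [parity_apply, mul_apply, Finset.mul_sum]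
  refine Finset.sum_congr rfl fun I hI => ?_
  rw [← Finset.card_sdiff_add_card_eq_card (Finset.mem_powerset.1 hI), pow_add]
  ring

theorem parity_one : parity S (1 : Grassmann R ι) = 1 := by
  ext K
  rw [parity_apply, one_apply]
  split_ifs with h
  · simp [h]
  · simp

theorem parity_parity (f : Grassmann R ι) : parity S (parity S f) = f := by
  ext K
  rw [parity_apply, parity_apply, ← mul_assoc, ← mul_pow]
  simp

theorem mul_apply_symm (f g : Grassmann R ι) (K : Finset ι) :
    (f * g) K = ∑ I ∈ K.powerset, (-1) ^ inv (K \ I) I * (f (K \ I) * g I) := by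
  rw [mul_apply]
  refine Finset.sum_bij' (fun I _ => K \ I) (fun I _ => K \ I) ?_ ?_ ?_ ?_ ?_
  · intro I _
    exact Finset.mem_powerset.2 Finset.sdiff_subset
  · intro I _
    exact Finset.mem_powerset.2 Finset.sdiff_subset
  · intro I hI
    exact Finset.sdiff_sdiff_eq_self (Finset.mem_powerset.1 hI)
  · intro I hI
    exact Finset.sdiff_sdiff_eq_self (Finset.mem_powerset.1 hI)
  · intro I hI
    rw [Finset.sdiff_sdiff_eq_self (Finset.mem_powerset.1 hI)]

theorem neg_one_pow_inv (I K : Finset ι) :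
    (-1 : R) ^ inv (K \ I) I = (-1) ^ (I.card * (K \ I).card) * (-1) ^ inv I (K \ I) := by
  rw [← pow_add]
  refine neg_one_pow_eq (n := I.card * (K \ I).card) ?_
  have := inv_add_inv (Finset.disjoint_sdiff : Disjoint I (K \ I))
  omega

/-- Exchanging the factors costs `(-1)^(|I| |K ∖ I|)`. The sign is trivial for even `|I|`, and the
odd coefficients of `f` vanish since `2` is invertible. -/
theorem even_comm (h2 : IsUnit (2 : R)) (f g : Grassmann R ι) (hf : parity S f = f) :
    f * g = g * f := by
  ext K
  rw [mul_apply, mul_apply_symm]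
  refine Finset.sum_congr rfl fun I hI => ?_
  rw [neg_one_pow_inv I K]
  rcases Nat.even_or_odd I.card with he | ho
  · rw [(he.mul_right _).neg_one_pow, one_mul, mul_comm (f I)]
  · have h1 : parity S f I = f I := by rw [hf]
    rw [parity_apply, ho.neg_one_pow] at h1
    have h3 : f I = 0 := h2.mul_right_eq_zero.1 (by linear_combination -h1)
    rw [h3]
    simp

theorem odd_comm (h2 : IsUnit (2 : R)) (f g : Grassmann R ι) (hf : parity S f = -f) :
    f * g = parity S g * f := by
  ext K
  rw [mul_apply, mul_apply_symm]
  refine Finset.sum_congr rfl fun I hI => ?_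
  rw [neg_one_pow_inv I K, parity_apply]
  rcases Nat.even_or_odd I.card with he | ho
  · have h1 : parity S f I = -f I := by rw [hf, neg_apply]
    rw [parity_apply, he.neg_one_pow] at h1
    have h3 : f I = 0 := h2.mul_right_eq_zero.1 (by linear_combination h1)
    rw [h3]
    simp
  · have h3 : (-1 : R) ^ (I.card * (K \ I).card) = (-1) ^ (K \ I).card := by
      rw [pow_mul, ho.neg_one_pow]
    have h4 : (-1 : R) ^ (K \ I).card * (-1) ^ (K \ I).card = 1 := by
      rw [← mul_pow]
      simp
    rw [h3]
    linear_combination (-((-1) ^ inv I (K \ I) * f I * g (K \ I))) * h4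

theorem card_filter_split {I K : Finset ι} (hI : I ⊆ K) (i : ι) :
    (K.filter (· < i)).card = (I.filter (· < i)).card + ((K \ I).filter (· < i)).card := by
  rw [← Finset.card_union_of_disjoint, ← Finset.filter_union, Finset.union_sdiff_of_subset hI]
  exact Finset.disjoint_filter_filter Finset.disjoint_sdiff

/-- The subsets in the product are split according to whether they contain `i`. For `i ∉ K` the two
classes give the two terms on the right. For `i ∈ K` the left side is zero and the terms on the
right cancel in pairs. -/
theorem leftDeriv_mul (i : ι) (f g : Grassmann R ι) : leftDeriv S i (f * g) =
    leftDeriv S i f * g + parity S f * leftDeriv S i g := by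
  ext K
  rw [add_apply, leftDeriv_apply]
  split_ifs with hi
  · have hi' : i ∉ K.erase i := Finset.notMem_erase i K
    rw [← Finset.insert_erase hi]
    set K₀ := K.erase i
    symm
    rw [mul_apply, mul_apply, Finset.sum_powerset_insert hi', Finset.sum_powerset_insert hi',
      ← Finset.sum_add_distrib, ← Finset.sum_add_distrib, ← Finset.sum_add_distrib]
    refine Finset.sum_eq_zero fun I hI => ?_
    have hIK := Finset.mem_powerset.1 hI
    have h : i ∉ I := fun h => hi' (hIK h)
    have h' : i ∉ K₀ \ I := fun h => hi' (Finset.sdiff_subset h)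
    have e1 : insert i K₀ \ I = insert i (K₀ \ I) := Finset.insert_sdiff_of_notMem K₀ h
    have e1' : insert i K₀ \ insert i I = K₀ \ I := by
      ext x
      simp only [Finset.mem_sdiff, Finset.mem_insert]
      have : x = i → x ∉ K₀ := fun h => h ▸ hi'
      tauto
    have e2 : inv I (insert i (K₀ \ I)) = inv I {i} + inv I (K₀ \ I) := by
      rw [← Finset.singleton_union, inv_union_right (by simpa using h')]
    have e2' : inv (insert i I) (K₀ \ I) =
        ((K₀ \ I).filter (· < i)).card + inv I (K₀ \ I) := by
      rw [← Finset.singleton_union, inv_union_left (by simpa using h), inv_singleton_left]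
    have e3 : (-1 : R) ^ (I.filter (· < i)).card * (-1) ^ inv I {i} = (-1) ^ I.card := by
      rw [← pow_add, add_comm, inv_singleton_right h]
    have e4 : (-1 : R) ^ ((K₀ \ I).filter (· < i)).card *
        (-1) ^ ((K₀ \ I).filter (· < i)).card = 1 := by
      rw [← mul_pow]
      simp
    rw [e1, e1', e2, e2', leftDeriv_apply, leftDeriv_apply, leftDeriv_apply, leftDeriv_apply,
      if_neg h, if_neg h', if_pos (Finset.mem_insert_self _ _),
      if_pos (Finset.mem_insert_self _ _), parity_apply, parity_apply,
      Finset.card_insert_of_notMem h]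
    simp only [pow_add, pow_one]
    linear_combination ((-1) ^ inv I (K₀ \ I) * (f (insert i I) * g (insert i (K₀ \ I)))) *
      (e3 - (-1) ^ I.card * e4)
  · rw [mul_apply, mul_apply, mul_apply, Finset.sum_powerset_insert hi, mul_add, add_comm,
      Finset.mul_sum, Finset.mul_sum]
    congr 1
    · refine Finset.sum_congr rfl fun I hI => ?_
      have hIK := Finset.mem_powerset.1 hI
      have h : i ∉ I := fun h => hi (hIK h)
      have e1 : insert i K \ insert i I = K \ I := by
        ext x
        simp only [Finset.mem_sdiff, Finset.mem_insert]
        have : x = i → x ∉ K := fun h => h ▸ hi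
        tauto
      have e2 : inv (insert i I) (K \ I) = ((K \ I).filter (· < i)).card + inv I (K \ I) := by
        rw [← Finset.singleton_union, inv_union_left (by simpa using h), inv_singleton_left]
      rw [leftDeriv_apply, if_neg h, e1, e2, card_filter_split hIK]
      have e3 : (-1 : R) ^ ((K \ I).filter (· < i)).card *
          (-1) ^ ((K \ I).filter (· < i)).card = 1 := by
        rw [← mul_pow]
        simp
      simp only [pow_add]
      linear_combination ((-1) ^ (I.filter (· < i)).card * (-1) ^ inv I (K \ I) *
        (f (insert i I) * g (K \ I))) * e3
    · refine Finset.sum_congr rfl fun I hI => ?_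
      have hIK := Finset.mem_powerset.1 hI
      have h : i ∉ I := fun h => hi (hIK h)
      have h' : i ∉ K \ I := fun h => hi (Finset.sdiff_subset h)
      have e1 : insert i K \ I = insert i (K \ I) := Finset.insert_sdiff_of_notMem K h
      have e2 : inv I (insert i (K \ I)) = inv I {i} + inv I (K \ I) := by
        rw [← Finset.singleton_union, inv_union_right (by simpa using h')]
      have e3 : (-1 : R) ^ (I.filter (· < i)).card * (-1) ^ inv I {i} = (-1) ^ I.card := by
        rw [← pow_add, add_comm, inv_singleton_right h]
      rw [leftDeriv_apply, if_neg h', parity_apply, e1, e2, card_filter_split hIK]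
      simp only [pow_add]
      linear_combination ((-1) ^ ((K \ I).filter (· < i)).card * (-1) ^ inv I (K \ I) *
        (f I * g (insert i (K \ I)))) * e3

theorem leftDeriv_leftDeriv (i j : ι) (f : Grassmann R ι) :
    leftDeriv S i (leftDeriv S j f) = -leftDeriv S j (leftDeriv S i f) := by
  ext K
  rw [neg_apply]
  simp only [leftDeriv_apply, Finset.mem_insert]
  by_cases hi : i ∈ K
  · simp [hi]
  by_cases hj : j ∈ K
  · simp [hj]
  by_cases hij : i = j
  · simp [hij]
  have hji : ¬ j = i := fun h => hij h.symm
  simp only [hi, hj, hij, hji, or_self, if_false, Finset.filter_insert]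
  rw [Finset.insert_comm]
  rcases lt_or_gt_of_ne hij with hlt | hgt
  · rw [if_pos hlt, if_neg hlt.not_gt, Finset.card_insert_of_notMem (by simp [hi])]
    ring
  · rw [if_neg hgt.not_gt, if_pos hgt, Finset.card_insert_of_notMem (by simp [hj])]
    ring

theorem parity_leftDeriv (i : ι) (f : Grassmann R ι) :
    parity S (leftDeriv S i f) = -leftDeriv S i (parity S f) := by
  ext K
  rw [neg_apply, parity_apply, leftDeriv_apply, leftDeriv_apply]
  split_ifs with h
  · simp
  · rw [parity_apply, Finset.card_insert_of_notMem h]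
    ring

theorem scalar_apply (a : R) (K : Finset ι) :
    (scalar a : Grassmann R ι) K = if K = ∅ then a else 0 := rfl

theorem scalar_mul_apply (a : R) (f : Grassmann R ι) (K : Finset ι) :
    (scalar a * f : Grassmann R ι) K = a * f K := by
  rw [mul_apply, Finset.sum_eq_single ∅]
  · simp [scalar_apply]
  · intro I _ hI
    simp [scalar_apply, hI]
  · simp

theorem parity_scalar (a : R) : parity S (scalar a : Grassmann R ι) = scalar a := by
  ext K
  rw [parity_apply, scalar_apply]
  split_ifs with h
  · simp [h]
  · simp

theorem leftDeriv_scalar (i : ι) (a : R) : leftDeriv S i (scalar a : Grassmann R ι) = 0 := by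
  ext K
  rw [leftDeriv_apply, scalar_apply]
  simp

/-- The generator `θ i`. -/
def gen (i : ι) : Grassmann R ι := fun K => if K = {i} then 1 else 0

theorem gen_apply (i : ι) (K : Finset ι) : (gen i : Grassmann R ι) K = if K = {i} then 1 else 0 :=
  rfl

theorem parity_gen (i : ι) : parity S (gen i : Grassmann R ι) = -gen i := by
  ext K
  rw [neg_apply, parity_apply, gen_apply]
  split_ifs with h
  · simp [h]
  · simp

theorem leftDeriv_gen (i j : ι) :
    leftDeriv S i (gen j : Grassmann R ι) = if i = j then 1 else 0 := by
  ext K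
  rw [leftDeriv_apply, gen_apply]
  by_cases hij : i = j
  · subst hij
    rw [if_pos rfl, one_apply]
    by_cases hK : K = ∅
    · simp [hK]
    · rw [if_neg hK]
      split_ifs with h1 h2
      · rfl
      · exact absurd (by
          have := Finset.card_insert_of_notMem h1
          rw [h2, Finset.card_singleton] at this
          exact Finset.card_eq_zero.1 (by omega)) hK
      · simp
  · rw [if_neg hij, zero_apply]
    split_ifs with h1 h2
    · rfl
    · exact absurd (Finset.mem_singleton.1 (h2 ▸ Finset.mem_insert_self i K)) hij
    · simp

/-- The elements whose coefficients of degree less than `k` vanish. -/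
def degIdeal (R ι : Type*) [CommRing R] (k : ℕ) : AddSubgroup (Grassmann R ι) where
  carrier := {f | ∀ K : Finset ι, K.card < k → f K = 0}
  zero_mem' _ _ := rfl
  add_mem' hf hg K hK := by rw [add_apply, hf K hK, hg K hK, add_zero]
  neg_mem' {f} hf K hK := by
    change -(f K) = 0
    rw [hf K hK, neg_zero]

theorem mul_mem_degIdeal {k l : ℕ} {f g : Grassmann R ι} (hf : f ∈ degIdeal R ι k)
    (hg : g ∈ degIdeal R ι l) : f * g ∈ degIdeal R ι (k + l) := fun K hK => by
  rw [mul_apply]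
  refine Finset.sum_eq_zero fun I hI => ?_
  have h := Finset.card_sdiff_add_card_eq_card (Finset.mem_powerset.1 hI)
  by_cases h1 : I.card < k
  · rw [hf I h1, zero_mul, mul_zero]
  · rw [hg _ (by omega), mul_zero, mul_zero]

theorem gen_mem_degIdeal (i : ι) : (gen i : Grassmann R ι) ∈ degIdeal R ι 1 := fun K hK => by
  rw [gen_apply, if_neg]
  rintro rfl
  simp at hK

theorem eq_zero_of_mem_degIdeal [Fintype ι] {f : Grassmann R ι}
    (hf : f ∈ degIdeal R ι (Fintype.card ι + 1)) : f = 0 := by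
  ext K
  exact hf K (Nat.lt_succ_of_le K.card_le_univ)

theorem mem_degIdeal_zero (f : Grassmann R ι) : f ∈ degIdeal R ι 0 :=
  fun _ h => absurd h (Nat.not_lt_zero _)

/-- The relation `∂_i θ_i + θ_i ∂_i = 1` splits `f` into a part free of `θ_i` and `θ_i` times
another such part, which drives the induction on generators. -/
theorem gen_mul_leftDeriv (i : ι) (f : Grassmann R ι) :
    f = leftDeriv S i (gen i * f) + gen i * leftDeriv S i f := by
  rw [leftDeriv_mul, leftDeriv_gen, if_pos rfl, one_mul, parity_gen, neg_mul, neg_add_cancel_right]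

theorem gen_mul_apply (i : ι) (f : Grassmann R ι) (K : Finset ι) : (gen i * f : Grassmann R ι) K =
    if i ∈ K then (-1) ^ (K.filter (· < i)).card * f (K.erase i) else 0 := by
  rw [mul_apply]
  split_ifs with h
  · rw [Finset.sum_eq_single {i}]
    · rw [gen_apply, if_pos rfl, one_mul, inv_singleton_left, Finset.sdiff_singleton_eq_erase,
        Finset.filter_erase, Finset.erase_eq_of_notMem]
      simp
    · intro I _ hI
      rw [gen_apply, if_neg hI, zero_mul, mul_zero]
    · intro h'
      exact absurd (Finset.mem_powerset.2 (Finset.singleton_subset_iff.2 h)) h'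
  · refine Finset.sum_eq_zero fun I hI => ?_
    rw [gen_apply, if_neg, zero_mul, mul_zero]
    rintro rfl
    exact h (Finset.mem_powerset.1 hI (Finset.mem_singleton_self i))

/-- The elements that involve only generators with labels in `s`. -/
def supportedIn (s : Finset ι) (f : Grassmann R ι) : Prop := ∀ K, ¬ K ⊆ s → f K = 0

theorem eq_scalar_of_supportedIn_empty {f : Grassmann R ι} (h : supportedIn ∅ f) :
    f = scalar (f ∅) := by
  ext K
  rw [scalar_apply]
  split_ifs with hK
  · rw [hK]
  · exact h K fun h' => hK (Finset.subset_empty.1 h')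

theorem supportedIn_leftDeriv {s : Finset ι} {i : ι} {f : Grassmann R ι}
    (h : supportedIn (insert i s) f) : supportedIn s (leftDeriv S i f) := fun K hK => by
  rw [leftDeriv_apply]
  split_ifs with hi
  · rfl
  · rw [h, mul_zero]
    intro h'
    exact hK ((Finset.insert_subset_insert_iff hi).1 h')

theorem supportedIn_leftDeriv_gen_mul {s : Finset ι} {i : ι} {f : Grassmann R ι}
    (h : supportedIn (insert i s) f) : supportedIn s (leftDeriv S i (gen i * f)) := fun K hK => by
  rw [leftDeriv_apply]
  split_ifs with hi
  · rfl
  · rw [gen_mul_apply, if_pos (Finset.mem_insert_self i K), Finset.erase_insert hi, h, mul_zero,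
      mul_zero]
    intro h'
    refine hK fun x hx => (Finset.mem_insert.1 (h' hx)).resolve_left ?_
    rintro rfl
    exact hi hx

theorem supportedIn_parity {s : Finset ι} {f : Grassmann R ι} (h : supportedIn s f) :
    supportedIn s (parity S f) := fun K hK => by rw [parity_apply, h K hK, mul_zero]

/-- An operator that graded commutes with the generators and kills the elements of degree zero
is zero. -/
theorem eq_zero_of_comm_gen [Fintype ι] (D : Module.End S (Grassmann R ι))
    (hD : ∀ i, ∀ f : Grassmann R ι, D (gen i * f) = gen i * parity S (D (parity S f)))
    (h0 : ∀ a : R, D (scalar a) = 0) : D = 0 := by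
  have key : ∀ s : Finset ι, ∀ f : Grassmann R ι, supportedIn s f → D f = 0 := by
    intro s
    induction s using Finset.induction_on with
    | empty =>
      intro f hf
      rw [eq_scalar_of_supportedIn_empty hf, h0]
    | insert i s _ ih =>
      intro f hf
      rw [gen_mul_leftDeriv (S := S) i f, map_add, hD, ih _ (supportedIn_leftDeriv_gen_mul hf),
        ih _ (supportedIn_parity (supportedIn_leftDeriv hf)), map_zero, mul_zero, add_zero]
  exact LinearMap.ext fun f => key Finset.univ f fun K hK => absurd (Finset.subset_univ K) hK

/-- The degree zero part, as a ring homomorphism. -/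
def bodyHom : Grassmann R ι →+* R where
  toFun f := f ∅
  map_one' := (one_apply ∅).trans (if_pos rfl)
  map_mul' f g := by simp [mul_apply]
  map_zero' := rfl
  map_add' _ _ := rfl

theorem bodyHom_apply (f : Grassmann R ι) : bodyHom f = f ∅ := rfl

/-- The inclusion of the coefficients, as a ring homomorphism. -/
def scalarHom : R →+* Grassmann R ι where
  toFun := scalar
  map_one' := rfl
  map_mul' a b := by
    ext K
    rw [scalar_mul_apply, scalar_apply, scalar_apply]
    split_ifs <;> simp
  map_zero' := by
    ext K
    simp [scalar_apply]
  map_add' a b := by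
    ext K
    simp only [scalar_apply, add_apply]
    split_ifs <;> simp

theorem scalarHom_apply (a : R) : scalarHom (ι := ι) a = scalar a := rfl

theorem bodyHom_scalar (a : R) : bodyHom (scalar a : Grassmann R ι) = a := by
  rw [bodyHom_apply, scalar_apply, if_pos rfl]

theorem mem_degIdeal_one {f : Grassmann R ι} : f ∈ degIdeal R ι 1 ↔ bodyHom f = 0 :=
  ⟨fun h => h ∅ (by simp), fun h K hK => by
    rw [Finset.card_eq_zero.1 (Nat.lt_one_iff.1 hK)]
    exact h⟩

theorem pow_mem_degIdeal {f : Grassmann R ι} {k : ℕ} (h : f ∈ degIdeal R ι k) (n : ℕ) :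
    f ^ n ∈ degIdeal R ι (n * k) := by
  induction n with
  | zero => exact (Nat.zero_mul k).symm ▸ mem_degIdeal_zero _
  | succ n ih =>
    rw [pow_succ, Nat.succ_mul]
    exact mul_mem_degIdeal ih h

theorem isNilpotent_of_body [Fintype ι] {f : Grassmann R ι} (h : bodyHom f = 0) :
    IsNilpotent f :=
  ⟨Fintype.card ι + 1, eq_zero_of_mem_degIdeal (by
    simpa using pow_mem_degIdeal (mem_degIdeal_one.2 h) (Fintype.card ι + 1))⟩

theorem isUnit_of_body [Fintype ι] {f : Grassmann R ι} (h : IsUnit (bodyHom f)) : IsUnit f := by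
  obtain ⟨u, hu⟩ := h
  have h1 : IsUnit (1 - (1 - scalarHom (u⁻¹ : Rˣ).1 * f)) :=
    (isNilpotent_of_body (by
      rw [map_sub, map_one, map_mul, scalarHom_apply, bodyHom_scalar, ← hu, Units.inv_mul,
        sub_self])).isUnit_one_sub
  rw [sub_sub_cancel] at h1
  exact ((u⁻¹).isUnit.map scalarHom).unit.isUnit_units_mul f |>.1 h1

/-- A matrix over a Grassmann algebra whose degree zero part is invertible is invertible. -/
theorem exists_matrix_inverse [Fintype ι] {n : Type*} [Fintype n] [DecidableEq n]
    (M : Matrix n n (Grassmann R ι)) (h : IsUnit (bodyHom.mapMatrix M).det) :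
    ∃ N, M * N = 1 := by
  set N₀ : Matrix n n (Grassmann R ι) := scalarHom.mapMatrix (bodyHom.mapMatrix M)⁻¹ with hN₀
  have hE : bodyHom.mapMatrix (1 - M * N₀) = 0 := by
    have h1 : bodyHom.mapMatrix N₀ = (bodyHom.mapMatrix M)⁻¹ := by
      rw [hN₀]
      ext i j
      exact bodyHom_scalar (ι := ι) _
    rw [map_sub, map_one, map_mul, h1, Matrix.mul_nonsing_inv _ h, sub_self]
  -- The inverse of the degree zero part is a right inverse up to an error of positive degree, whose
  -- powers run out of generators.
  have hp : ∀ k i j, ((1 - M * N₀) ^ k) i j ∈ degIdeal R ι k := by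
    intro k
    induction k with
    | zero => exact fun i j => mem_degIdeal_zero _
    | succ k ih =>
      intro i j
      rw [pow_succ, Matrix.mul_apply]
      exact sum_mem fun l _ => mul_mem_degIdeal (ih i l)
        (mem_degIdeal_one.2 (congrFun (congrFun hE l) j))
  have hn : IsNilpotent (1 - M * N₀) := ⟨Fintype.card ι + 1, by
    ext1 i j
    exact eq_zero_of_mem_degIdeal (hp _ i j)⟩
  have hu := hn.isUnit_one_sub
  rw [sub_sub_cancel] at hu
  obtain ⟨u, hu⟩ := hu
  exact ⟨N₀ * (u⁻¹ : (Matrix n n (Grassmann R ι))ˣ).1, by rw [← mul_assoc, ← hu, Units.mul_inv]⟩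

end Grassmann


namespace SuperStar

/-! ## Calculus of smooth functions on an open set -/

section SmoothCalculus

variable {m : ℕ} {U : TopologicalSpace.Opens (Fin m → ℂ)}

namespace SmoothFn

theorem ext {f g : SmoothFn U} (h : ∀ x, f.1 x = g.1 x) : f = g := Subtype.ext (funext h)

/-- The smooth function on `U` given by a function on `ℂ^m` that is smooth on `U`. -/
def ofContDiffOn (F : (Fin m → ℂ) → ℂ) (h : ContDiffOn ℝ ∞ F U) : SmoothFn U :=
  ⟨fun x => F x, h.congr fun x hx => by
    have hx : x ∈ U := hx
    simp [extendZero_apply U _ hx]⟩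

theorem ofContDiffOn_apply (F : (Fin m → ℂ) → ℂ) (h : ContDiffOn ℝ ∞ F U) (x : U) :
    (ofContDiffOn F h).1 x = F x := rfl

/-- Evaluation at a point. -/
def eval (x : U) : SmoothFn U →ₐ[ℂ] ℂ where
  toFun f := f.1 x
  map_one' := rfl
  map_mul' _ _ := rfl
  map_zero' := rfl
  map_add' _ _ := rfl
  commutes' _ := rfl

theorem eval_apply (x : U) (f : SmoothFn U) : eval x f = f.1 x := rfl

theorem ext_eval {f g : SmoothFn U} (h : ∀ x, eval x f = eval x g) : f = g := ext h

theorem isUnit_of_ne_zero {f : SmoothFn U} (h : ∀ x, f.1 x ≠ 0) : IsUnit f := by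
  have hi : ContDiffOn ℝ ∞ (fun x => (extendZero U f.1 x)⁻¹) U :=
    (contDiffOn_extendZero f).inv fun x hx => by
      rw [extendZero_apply U _ hx]
      exact h _
  refine IsUnit.of_mul_eq_one (ofContDiffOn _ hi) (ext_eval fun x => ?_)
  rw [map_mul, map_one, eval_apply, eval_apply, ofContDiffOn_apply, extendZero_apply U _ x.2]
  exact mul_inv_cancel₀ (h x)

theorem isUnit_two : IsUnit (2 : SmoothFn U) :=
  isUnit_of_ne_zero fun x => by
    rw [← eval_apply, map_ofNat]
    exact two_ne_zero

end SmoothFn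

open SmoothFn

theorem hasFDerivAt_extendZero (f : SmoothFn U) (x : U) :
    HasFDerivAt (extendZero U f.1) (fderiv ℝ (extendZero U f.1) x) x.1 :=
  (differentiableAt_extendZero f x).hasFDerivAt

theorem eval_dirDeriv (v : Fin m → ℂ) (f : SmoothFn U) (x : U) :
    eval x (dirDeriv v f) = fderiv ℝ (extendZero U f.1) x v := rfl

theorem fderiv_extendZero {f : SmoothFn U} {F : (Fin m → ℂ) → ℂ} {F' : (Fin m → ℂ) →L[ℝ] ℂ}
    (x : U) (h : ∀ y : U, f.1 y = F y) (hF : HasFDerivAt F F' x.1) :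
    fderiv ℝ (extendZero U f.1) x = F' := by
  refine (hF.congr_of_eventuallyEq ?_).fderiv
  filter_upwards [U.isOpen.mem_nhds x.2] with y hy
  rw [extendZero_apply U _ hy, h]

theorem dirDeriv_mul (v : Fin m → ℂ) (f g : SmoothFn U) :
    dirDeriv v (f * g) = dirDeriv v f * g + f * dirDeriv v g := by
  refine ext_eval fun x => ?_
  have h := (hasFDerivAt_extendZero f x).mul (hasFDerivAt_extendZero g x)
  rw [eval_dirDeriv, fderiv_extendZero x (fun y => ?_) h, map_add, map_mul, map_mul, eval_dirDeriv,
    eval_dirDeriv, eval_apply, eval_apply, extendZero_apply U _ x.2, extendZero_apply U _ x.2]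
  · simp only [add_apply, smul_apply, smul_eq_mul]
    ring
  · rw [Pi.mul_apply, extendZero_apply U _ y.2, extendZero_apply U _ y.2]
    rfl

theorem dirDeriv_exp (v : Fin m → ℂ) (f : SmoothFn U) :
    dirDeriv v (SmoothFn.exp f) = dirDeriv v f * SmoothFn.exp f := by
  refine ext_eval fun x => ?_
  have h := (hasFDerivAt_extendZero f x).cexp
  rw [eval_dirDeriv, fderiv_extendZero x (fun y => ?_) h, map_mul, eval_dirDeriv, eval_apply,
    extendZero_apply U _ x.2]
  · rw [smul_apply, smul_eq_mul, mul_comm]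
    rfl
  · rw [extendZero_apply U _ y.2]
    rfl

theorem dirDeriv_comm (v w : Fin m → ℂ) (f : SmoothFn U) :
    dirDeriv v (dirDeriv w f) = dirDeriv w (dirDeriv v f) := by
  have key : ∀ v w, ∀ x : U, eval x (dirDeriv v (dirDeriv w f)) =
      fderiv ℝ (fderiv ℝ (extendZero U f.1)) x v w := by
    intro v w x
    have hd : DifferentiableAt ℝ (fderiv ℝ (extendZero U f.1)) x :=
      (((contDiffOn_extendZero f).fderiv_of_isOpen U.isOpen (m := 1)
        (by norm_num; exact WithTop.coe_le_coe.2 le_top)).differentiableOn (by simp)).differentiableAt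
          (U.isOpen.mem_nhds x.2)
    have h := hd.hasFDerivAt.clm_apply (hasFDerivAt_const w x.1)
    rw [eval_dirDeriv, fderiv_extendZero x (fun y => ?_) h]
    · simp
    · rfl
  refine ext_eval fun x => ?_
  rw [key, key]
  refine ((contDiffOn_extendZero f).contDiffAt (U.isOpen.mem_nhds x.2)).isSymmSndFDerivAt ?_ v w
  rw [minSmoothness_of_isRCLikeNormedField]
  exact WithTop.coe_le_coe.2 le_top

/-- The derivatives `∂/∂z^k` (`true`) and `∂/∂z̄^k` (`false`). -/
noncomputable def wirt : Bool → Fin m → SmoothFn U →ₗ[ℂ] SmoothFn U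
  | true => wirtinger
  | false => wirtingerBar

/-- The coordinates `z^k` (`true`) and `z̄^k` (`false`). -/
noncomputable def coordVal : Bool → Fin m → (Fin m → ℂ) →L[ℝ] ℂ
  | true, k => ContinuousLinearMap.proj k
  | false, k => Complex.conjCLE.toContinuousLinearMap ∘L ContinuousLinearMap.proj k

theorem wirt_eq (b : Bool) (k : Fin m) (f : SmoothFn U) : wirt b k f = (1 / 2 : ℂ) •
    (dirDeriv (Pi.single k 1) f - (bif b then Complex.I else -Complex.I) •
      dirDeriv (Pi.single k Complex.I) f) := by
  cases b
  · simp only [wirt, wirtingerBar, LinearMap.smul_apply, LinearMap.add_apply, cond_false, neg_smul,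
      sub_neg_eq_add]
  · rfl

theorem wirt_mul (b : Bool) (k : Fin m) (f g : SmoothFn U) :
    wirt b k (f * g) = wirt b k f * g + f * wirt b k g := by
  simp only [wirt_eq, dirDeriv_mul, smul_add, smul_sub, smul_mul_assoc, mul_smul_comm, sub_mul,
    mul_sub]
  abel

theorem wirt_exp (b : Bool) (k : Fin m) (f : SmoothFn U) :
    wirt b k (SmoothFn.exp f) = wirt b k f * SmoothFn.exp f := by
  simp only [wirt_eq, dirDeriv_exp, smul_mul_assoc, sub_mul]

theorem wirt_comm (b b' : Bool) (k l : Fin m) (f : SmoothFn U) :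
    wirt b k (wirt b' l f) = wirt b' l (wirt b k f) := by
  simp only [wirt_eq, map_smul, map_sub, dirDeriv_comm (Pi.single l 1),
    dirDeriv_comm (Pi.single l Complex.I)]
  simp only [smul_sub, smul_smul]
  rw [mul_comm, dirDeriv_comm (Pi.single k 1) (Pi.single l Complex.I)]
  module

/-- The coordinate functions on `U`. -/
noncomputable def coordFn (b : Bool) (k : Fin m) : SmoothFn U :=
  ofContDiffOn (coordVal b k) (coordVal b k).contDiff.contDiffOn

theorem eval_coordFn (b : Bool) (k : Fin m) (x : U) : eval x (coordFn b k) = coordVal b k x := rfl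

theorem wirt_coordFn (b b' : Bool) (k l : Fin m) :
    wirt b k (coordFn b' l : SmoothFn U) = if b = b' ∧ k = l then 1 else 0 := by
  have key : ∀ v, ∀ x : U, eval x (dirDeriv v (coordFn b' l : SmoothFn U)) = coordVal b' l v := by
    intro v x
    rw [eval_dirDeriv, fderiv_extendZero x (fun y => rfl) (coordVal b' l).hasFDerivAt]
  refine ext_eval fun x => ?_
  rw [wirt_eq, map_smul, map_sub, map_smul, key, key]
  by_cases hkl : k = l
  · subst hkl
    cases b <;> cases b' <;> simp [coordVal] <;> norm_num
  · rw [if_neg fun h => hkl h.2]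
    cases b' <;> simp [coordVal, hkl]

/-- The components of a real-linear form with respect to the `dz^k` and `dz̄^k`. -/
noncomputable def wirtComp (b : Bool) (k : Fin m) (L : (Fin m → ℂ) →L[ℝ] ℂ) : ℂ :=
  (1 / 2 : ℂ) * (L (Pi.single k 1) - (bif b then Complex.I else -Complex.I) *
    L (Pi.single k Complex.I))

theorem eq_sum_wirtComp (L : (Fin m → ℂ) →L[ℝ] ℂ) (v : Fin m → ℂ) :
    L v = ∑ k, ∑ b, coordVal b k v * wirtComp b k L := by
  have hv : v = ∑ k, ((v k).re • (Pi.single k 1 : Fin m → ℂ) +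
      (v k).im • (Pi.single k Complex.I : Fin m → ℂ)) := by
    ext j
    simp only [Finset.sum_apply, Pi.add_apply, Pi.smul_apply, Pi.single_apply, smul_ite, smul_zero,
      Finset.sum_add_distrib, Finset.sum_ite_eq, Finset.mem_univ, if_true]
    simp
  conv_lhs => rw [hv]
  rw [map_sum]
  refine Finset.sum_congr rfl fun k _ => ?_
  rw [map_add, map_smul, map_smul, Fintype.sum_bool, wirtComp, wirtComp]
  have h1 : coordVal true k v = (v k).re + (v k).im * Complex.I := (Complex.re_add_im _).symm
  have h2 : coordVal false k v = (v k).re - (v k).im * Complex.I := by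
    change starRingEnd ℂ (v k) = _
    apply Complex.ext <;> simp
  rw [h1, h2]
  simp only [cond_true, cond_false, Complex.real_smul]
  linear_combination ((v k).im * L (Pi.single k Complex.I)) * Complex.I_sq

theorem eval_wirt (b : Bool) (k : Fin m) (f : SmoothFn U) (x : U) :
    eval x (wirt b k f) = wirtComp b k (fderiv ℝ (extendZero U f.1) x) := by
  rw [wirt_eq, map_smul, map_sub, map_smul]
  rfl

theorem fderiv_eq_sum_wirt (f : SmoothFn U) (x : U) (v : Fin m → ℂ) :
    fderiv ℝ (extendZero U f.1) x v = ∑ k, ∑ b, coordVal b k v * eval x (wirt b k f) := by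
  simp only [eval_wirt]
  exact eq_sum_wirtComp _ v

/-- Complex conjugation of smooth functions. -/
noncomputable def SmoothFn.conj (f : SmoothFn U) : SmoothFn U :=
  ofContDiffOn (fun x => Complex.conjCLE (extendZero U f.1 x))
    (Complex.conjCLE.contDiff.comp_contDiffOn (contDiffOn_extendZero f))

theorem eval_conj (f : SmoothFn U) (x : U) : eval x f.conj = starRingEnd ℂ (eval x f) := by
  rw [eval_apply, SmoothFn.conj, ofContDiffOn_apply, extendZero_apply U _ x.2]
  rfl

theorem extendZero_conj (f : SmoothFn U) {x : Fin m → ℂ} (hx : x ∈ U) :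
    extendZero U f.conj.1 x = starRingEnd ℂ (extendZero U f.1 x) := by
  rw [extendZero_apply U _ hx, extendZero_apply U _ hx]
  exact eval_conj f ⟨x, hx⟩

theorem dirDeriv_conj (v : Fin m → ℂ) (f : SmoothFn U) :
    dirDeriv v f.conj = (dirDeriv v f).conj := by
  refine ext_eval fun x => ?_
  have h := (Complex.conjCLE.toContinuousLinearMap.hasFDerivAt).comp x.1 (hasFDerivAt_extendZero f x)
  rw [eval_conj, eval_dirDeriv, fderiv_extendZero x (fun y => ?_) h, eval_dirDeriv]
  · rfl
  · rfl

theorem conj_eq_zero {f : SmoothFn U} : f.conj = 0 ↔ f = 0 := by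
  constructor
  · intro h
    refine ext_eval fun x => ?_
    have := eval_conj f x
    rw [h, map_zero] at this
    rw [map_zero]
    exact (map_eq_zero _).1 this.symm
  · rintro rfl
    refine ext_eval fun x => ?_
    rw [eval_conj, map_zero, map_zero]

theorem wirt_conj (b : Bool) (k : Fin m) (f : SmoothFn U) :
    wirt b k f.conj = (wirt (!b) k f).conj := by
  refine ext_eval fun x => ?_
  simp only [eval_conj, wirt_eq, map_smul, map_sub, dirDeriv_conj, smul_eq_mul]
  cases b <;> simp [sub_eq_add_neg] <;> exact Or.inl (map_ofNat (starRingEnd ℂ) 2).symm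

/-- The Cauchy–Riemann equations in several variables: without `dz̄` components the real
differential is complex linear. -/
theorem differentiableOn_iff_wirt (f : SmoothFn U) :
    DifferentiableOn ℂ (extendZero U f.1) U ↔ ∀ k, wirt false k f = 0 := by
  constructor
  · intro h k
    refine ext_eval fun x => ?_
    have hd := (h.differentiableAt (U.isOpen.mem_nhds x.2)).hasFDerivAt
    have hr := hd.restrictScalars ℝ
    rw [wirt_eq, map_smul, map_sub, map_smul, eval_dirDeriv, eval_dirDeriv, hr.fderiv]
    have : (Pi.single k Complex.I : Fin m → ℂ) = Complex.I • Pi.single k 1 := by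
      rw [← Pi.single_smul, smul_eq_mul, mul_one]
    rw [this]
    simp only [ContinuousLinearMap.coe_restrictScalars', map_smul, cond_false, smul_eq_mul, map_zero]
    linear_combination (1 / 2 * fderiv ℂ (extendZero U f.1) x (Pi.single k 1)) * Complex.I_sq
  · intro h x hx
    have hr := hasFDerivAt_extendZero f ⟨x, hx⟩
    let L : (Fin m → ℂ) →L[ℂ] ℂ :=
      ∑ k, eval ⟨x, hx⟩ (wirt true k f) • ContinuousLinearMap.proj k
    have hL : L.restrictScalars ℝ = fderiv ℝ (extendZero U f.1) (⟨x, hx⟩ : U) := by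
      ext1 v
      rw [fderiv_eq_sum_wirt]
      simp only [L, ContinuousLinearMap.coe_restrictScalars', sum_apply,
        Fintype.sum_bool, h, map_zero, mul_zero, add_zero]
      exact Finset.sum_congr rfl fun k _ => mul_comm _ _
    exact (hasFDerivAt_of_restrictScalars ℝ hr hL).differentiableAt.differentiableWithinAt

theorem differentiableOn_conj_iff_wirt (f : SmoothFn U) :
    DifferentiableOn ℂ (fun x => starRingEnd ℂ (extendZero U f.1 x)) U ↔
      ∀ k, wirt true k f = 0 := by
  rw [differentiableOn_congr fun x hx => (extendZero_conj f hx).symm, differentiableOn_iff_wirt]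
  exact forall_congr' fun k => by rw [wirt_conj, conj_eq_zero, Bool.not_false]

end SmoothCalculus

end SuperStar


namespace SuperStar

/-! ## Smoothness of radial integrals and Hadamard's lemma -/

section Hadamard

open MeasureTheory

/-- Differentiation under the integral, with a uniform bound on the derivative from compact support.
Each differentiation brings out a factor `t`; allowing `t ^ n` keeps the family closed for the
induction on smoothness. -/
theorem hasFDerivAt_radialIntegral {E V : Type} [NormedAddCommGroup E] [NormedSpace ℝ E]
    [NormedAddCommGroup V] [NormedSpace ℝ V] (F : E → V) (hF : ContDiff ℝ ∞ F)
    (hc : HasCompactSupport F) (n : ℕ) (x : E) :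
    HasFDerivAt (fun x => ∫ t in (0 : ℝ)..1, t ^ n • F (t • x))
      (∫ t in (0 : ℝ)..1, t ^ (n + 1) • fderiv ℝ F (t • x)) x := by
  have hF' : Continuous (fderiv ℝ F) := hF.continuous_fderiv (by simp)
  obtain ⟨C, hC⟩ := hF'.bounded_above_of_compact_support (hc.fderiv ℝ)
  have hcont : ∀ x, Continuous fun t : ℝ => t ^ n • F (t • x) := fun x =>
    (continuous_id.pow n).smul (hF.continuous.comp (continuous_id.smul continuous_const))
  have hcont' : ∀ x, Continuous fun t : ℝ => t ^ (n + 1) • fderiv ℝ F (t • x) := fun x =>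
    (continuous_id.pow _).smul (hF'.comp (continuous_id.smul continuous_const))
  refine intervalIntegral.hasFDerivAt_integral_of_dominated_of_fderiv_le (𝕜 := ℝ) (s := Set.univ)
    (bound := fun _ => C) (F := fun x t => t ^ n • F (t • x))
    (F' := fun x t => t ^ (n + 1) • fderiv ℝ F (t • x)) Filter.univ_mem ?_ ?_ ?_ ?_ ?_ ?_
  · exact Filter.Eventually.of_forall fun x => (hcont x).aestronglyMeasurable
  · exact (hcont x).intervalIntegrable 0 1
  · exact (hcont' x).aestronglyMeasurable
  · refine Filter.Eventually.of_forall fun t ht y _ => ?_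
    rw [Set.uIoc_of_le zero_le_one] at ht
    rw [norm_smul, norm_pow, Real.norm_of_nonneg ht.1.le]
    exact (mul_le_of_le_one_left (norm_nonneg _) (pow_le_one₀ ht.1.le ht.2)).trans (hC _)
  · exact intervalIntegrable_const
  · refine Filter.Eventually.of_forall fun t _ y _ => ?_
    have h1 : HasFDerivAt (fun y : E => t • y) (t • ContinuousLinearMap.id ℝ E) y :=
      (hasFDerivAt_id y).const_smul t
    have h2 := ((hF.differentiable (by simp) (t • y)).hasFDerivAt.comp y h1).const_smul (t ^ n)
    refine h2.congr_fderiv ?_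
    ext v
    simp [pow_succ, smul_smul]

/-- The target `V` is quantified inside the induction because the derivative takes values in `E
→L[ℝ] V`. -/
theorem contDiff_radialIntegral_nat {E : Type} [NormedAddCommGroup E] [NormedSpace ℝ E] (k : ℕ) :
    ∀ {V : Type} [NormedAddCommGroup V] [NormedSpace ℝ V] (F : E → V), ContDiff ℝ ∞ F →
      HasCompactSupport F → ∀ n : ℕ,
      ContDiff ℝ k (fun x => ∫ t in (0 : ℝ)..1, t ^ n • F (t • x)) := by
  induction k with
  | zero =>
    intro V _ _ F hF hc n
    refine contDiff_zero.2 (Differentiable.continuous (𝕜 := ℝ) fun x => ?_)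
    exact (hasFDerivAt_radialIntegral F hF hc n x).differentiableAt
  | succ k ih =>
    intro V _ _ F hF hc n
    refine contDiff_succ_iff_hasFDerivAt.2 ⟨_, ih (fderiv ℝ F) (hF.fderiv_right (by simp))
      (hc.fderiv ℝ) (n + 1), fun x => hasFDerivAt_radialIntegral F hF hc n x⟩

theorem contDiff_radialIntegral {E V : Type} [NormedAddCommGroup E] [NormedSpace ℝ E]
    [NormedAddCommGroup V] [NormedSpace ℝ V] (F : E → V) (hF : ContDiff ℝ ∞ F)
    (hc : HasCompactSupport F) : ContDiff ℝ ∞ (fun x => ∫ t in (0 : ℝ)..1, F (t • x)) :=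
  contDiff_infty.2 fun k => by simpa using contDiff_radialIntegral_nat k F hF hc 0

variable {m : ℕ} {U : TopologicalSpace.Opens (Fin m → ℂ)}

open SmoothFn

theorem sum_coordVal_ne_zero {v : Fin m → ℂ} (hv : v ≠ 0) :
    ∑ k, coordVal true k v * coordVal false k v ≠ 0 := by
  have h : ∀ k, coordVal true k v * coordVal false k v = (Complex.normSq (v k) : ℂ) :=
    fun k => Complex.mul_conj _
  simp only [h]
  rw [← Complex.ofReal_sum, Complex.ofReal_ne_zero]
  intro h0
  refine hv (funext fun k => Complex.normSq_eq_zero.1 ?_)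
  exact (Finset.sum_eq_zero_iff_of_nonneg fun k _ => Complex.normSq_nonneg _).1 h0 k
    (Finset.mem_univ k)

theorem contDiff_mul_extendZero (a : SmoothFn U) {χ : (Fin m → ℂ) → ℂ} (hχ : ContDiff ℝ ∞ χ)
    (h : tsupport χ ⊆ U) : ContDiff ℝ ∞ fun x => χ x * extendZero U a.1 x := by
  refine contDiff_iff_contDiffAt.2 fun x => ?_
  by_cases hx : x ∈ tsupport χ
  · exact hχ.contDiffAt.mul ((contDiffOn_extendZero a).contDiffAt (U.isOpen.mem_nhds (h hx)))
  · refine (contDiffAt_const (c := (0 : ℂ))).congr_of_eventuallyEq ?_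
    filter_upwards [notMem_tsupport_iff_eventuallyEq.1 hx] with y hy
    rw [hy, Pi.zero_apply, zero_mul]

theorem exists_bump (p : U) : ∃ χ : (Fin m → ℂ) → ℂ, ContDiff ℝ ∞ χ ∧ tsupport χ ⊆ U ∧
    HasCompactSupport χ ∧ ∀ᶠ x in nhds p.1, χ x = 1 := by
  obtain ⟨ε, hε, hb⟩ := Metric.nhds_basis_closedBall.mem_iff.1 (U.isOpen.mem_nhds p.2)
  let χ : ContDiffBump p.1 := ⟨ε / 2, ε, half_pos hε, half_lt_self hε⟩
  have hs : (Function.support fun x => ((χ x : ℝ) : ℂ)) = Function.support χ := by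
    ext x
    simp
  refine ⟨fun x => (χ x : ℂ), Complex.ofRealCLM.contDiff.comp χ.contDiff, ?_, ?_, ?_⟩
  · rw [tsupport, hs]
    exact χ.tsupport_eq.subset.trans hb
  · rw [HasCompactSupport, tsupport, hs]
    exact χ.hasCompactSupport
  · filter_upwards [χ.eventuallyEq_one] with x hx
    rw [hx, Pi.one_apply, Complex.ofReal_one]

/-- The fundamental theorem of calculus along the segment from `0` to `v`. -/
theorem exists_wirtComp_eq_sub {G : (Fin m → ℂ) → ℂ} (hG : ContDiff ℝ ∞ G)
    (hc : HasCompactSupport G) : ∃ H : Bool → Fin m → (Fin m → ℂ) → ℂ,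
      (∀ b k, ContDiff ℝ ∞ (H b k)) ∧
      ∀ v, G v = G 0 + ∑ b, ∑ k, coordVal b k v * H b k v := by
  have hG' : ContDiff ℝ ∞ (fderiv ℝ G) := hG.fderiv_right (by simp)
  have hI := contDiff_radialIntegral (fderiv ℝ G) hG' (hc.fderiv ℝ)
  refine ⟨fun b k v => wirtComp b k (∫ t in (0 : ℝ)..1, fderiv ℝ G (t • v)), fun b k => ?_,
    fun v => ?_⟩
  · exact contDiff_const.mul ((hI.clm_apply contDiff_const).sub
      (contDiff_const.mul (hI.clm_apply contDiff_const)))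
  · have hcont : Continuous fun t : ℝ => fderiv ℝ G (t • v) :=
      hG'.continuous.comp (continuous_id.smul continuous_const)
    have hd : ∀ t ∈ Set.uIcc (0 : ℝ) 1,
        HasDerivAt (fun t : ℝ => G (t • v)) (fderiv ℝ G (t • v) v) t := fun t _ => by
      have h1 : HasDerivAt (fun t : ℝ => t • v) v t := by
        simpa using (hasDerivAt_id t).smul_const v
      exact (hG.differentiable (by simp) (t • v)).hasFDerivAt.comp_hasDerivAt t h1
    have h2 := intervalIntegral.integral_eq_sub_of_hasDerivAt hd
      ((hcont.clm_apply continuous_const).intervalIntegrable 0 1)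
    rw [one_smul, zero_smul, ← ContinuousLinearMap.intervalIntegral_apply
      (hcont.intervalIntegrable 0 1), eq_sum_wirtComp, Finset.sum_comm] at h2
    rw [h2, add_sub_cancel]

/-- Hadamard's lemma on an open subset of `ℂ^m`. -/
theorem exists_eq_sum_coordFn (a : SmoothFn U) (p : U) : ∃ A : Bool → Fin m → SmoothFn U,
    a = algebraMap ℂ _ (eval p a) +
      ∑ b, ∑ k, (coordFn b k - algebraMap ℂ _ (coordVal b k p)) * A b k := by
  obtain ⟨χ, hχ, hs, hχc, h1⟩ := exists_bump p
  have hτ : ContDiff ℝ ∞ fun v : Fin m → ℂ => p.1 + v := contDiff_const.add contDiff_id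
  have hσ : ContDiff ℝ ∞ fun x : Fin m → ℂ => x - p.1 := contDiff_id.sub contDiff_const
  obtain ⟨H, hH, hG⟩ := exists_wirtComp_eq_sub
    (G := fun v => χ (p.1 + v) * extendZero U a.1 (p.1 + v))
    ((contDiff_mul_extendZero a hχ hs).comp hτ)
    ((hχc.mul_right).comp_homeomorph (Homeomorph.addLeft p.1))
  -- The radial argument is applied to `χ a` only. The rest `(1 - χ) a` vanishes near `p` and
  -- elsewhere is divided by `|x - p|² = Σ (z - p)(z̄ - p̄)`, so `U` need not be star-shaped.
  let Q : Bool → Fin m → (Fin m → ℂ) → ℂ := fun b k x => if b then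
    (1 - χ x) * extendZero U a.1 x * coordVal false k (x - p.1) *
      (∑ k, coordVal true k (x - p.1) * coordVal false k (x - p.1))⁻¹ else 0
  have hQ : ∀ b k, ContDiffOn ℝ ∞ (Q b k) U := by
    intro b k x hx
    cases b
    · exact contDiffWithinAt_const
    refine ContDiffAt.contDiffWithinAt ?_
    by_cases hxp : x = p.1
    · refine (contDiffAt_const (c := (0 : ℂ))).congr_of_eventuallyEq ?_
      rw [hxp]
      filter_upwards [h1] with y hy
      simp [Q, hy]
    · have hl : ∀ b k, ContDiffAt ℝ ∞ (fun x => coordVal b k (x - p.1)) x := fun b k =>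
        ((coordVal b k).contDiff.comp hσ).contDiffAt
      have hN : ContDiffAt ℝ ∞
          (fun x => ∑ k, coordVal true k (x - p.1) * coordVal false k (x - p.1)) x :=
        ContDiffAt.sum fun k _ => (hl true k).mul (hl false k)
      exact (((contDiffAt_const.sub hχ.contDiffAt).mul
        ((contDiffOn_extendZero a).contDiffAt (U.isOpen.mem_nhds hx))).mul (hl false k)).mul
          (hN.inv (sum_coordVal_ne_zero (sub_ne_zero.2 hxp)))
  refine ⟨fun b k => ofContDiffOn (fun x => H b k (x - p.1)) ((hH b k).comp hσ).contDiffOn +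
    ofContDiffOn (Q b k) (hQ b k), ext_eval fun x => ?_⟩
  simp only [map_add, map_sum, map_mul, map_sub, AlgHom.commutes, eval_coordFn]
  simp only [eval_apply, ofContDiffOn_apply, mul_add, Finset.sum_add_distrib]
  have h2 := hG (x.1 - p.1)
  simp only [add_sub_cancel, add_zero] at h2
  rw [h1.self_of_nhds, one_mul, extendZero_apply U _ x.2, extendZero_apply U _ p.2] at h2
  have h3 : ∑ b, ∑ k, coordVal b k (x.1 - p.1) * Q b k x = (1 - χ x) * a.1 x := by
    rw [Fintype.sum_bool]
    simp only [Q, if_true, Bool.false_eq_true, if_false, mul_zero, Finset.sum_const_zero, add_zero]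
    rw [extendZero_apply U _ x.2]
    by_cases hxp : x.1 = p.1
    · have h6 : χ x = 1 := hxp ▸ h1.self_of_nhds
      simp [h6]
    · have h4 := sum_coordVal_ne_zero (sub_ne_zero.2 hxp)
      refine (mul_right_cancel₀ h4 ?_)
      rw [Finset.sum_mul, Finset.mul_sum]
      exact Finset.sum_congr rfl fun k _ => by
        rw [mul_assoc, inv_mul_cancel_right₀ h4, mul_left_comm]
  have h5 : ∀ b k, coordVal b k (x.1 - p.1) = coordVal b k x - coordVal b k p := fun b k =>
    map_sub _ _ _
  simp only [Algebra.algebraMap_self, RingHom.id_apply]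
  simp only [h5] at h2 h3
  linear_combination h2 - h3

end Hadamard

end SuperStar


namespace SuperStar

/-! ## Gluing local primitives -/

section Gluing

open Topology

/-- The total space of the covering of `X` by the germs of the functions `F p + c`, which are
defined on the sets `V p`. -/
def GermSpace {X : Type*} (_V : X → Set X) (_F : X → X → ℂ) : Type _ := X × ℂ

/-- The constants, without a topology. -/
def GermFiber : Type := ℂ

instance : TopologicalSpace GermFiber := ⊥

instance : DiscreteTopology GermFiber := ⟨rfl⟩

instance : Nonempty GermFiber := ⟨(0 : ℂ)⟩

namespace GermSpace

variable {X : Type*} [TopologicalSpace X] {V : X → Set X} {F : X → X → ℂ}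

/-- The section of the space of germs given by `F p + c`. -/
def germ (V : X → Set X) (F : X → X → ℂ) (p : X) (c : ℂ) (y : X) : GermSpace V F := (y, F p y + c)

/-- The projection of the space of germs. -/
def proj (e : GermSpace V F) : X := e.1

instance : TopologicalSpace (GermSpace V F) :=
  ⨆ p, ⨆ c, TopologicalSpace.coinduced (fun y : V p => germ V F p c y) inferInstance

theorem isOpen_iff (hV : ∀ p, IsOpen (V p)) {s : Set (GermSpace V F)} :
    IsOpen s ↔ ∀ p c, IsOpen {y | y ∈ V p ∧ germ V F p c y ∈ s} := by
  rw [isOpen_iSup_iff]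
  refine forall_congr' fun p => ?_
  rw [isOpen_iSup_iff]
  refine forall_congr' fun c => ?_
  rw [isOpen_coinduced, (hV p).isOpenEmbedding_subtypeVal.isOpen_iff_image_isOpen]
  refine iff_of_eq (congrArg _ ?_)
  ext y
  simp only [Set.mem_image, Set.mem_preimage, Subtype.exists, exists_and_left, exists_prop,
    exists_eq_right_right, Set.mem_ofPred_eq]
  exact and_comm

/-- Over `V p` the sheets are the graphs of `F p + c`, indexed by the discrete set of constants.
Local constancy of `F p - F q` makes the graphs of one chart open in the topology generated by all
charts. -/
theorem isCoveringMap (hV : ∀ p, IsOpen (V p)) (hp : ∀ p, p ∈ V p)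
    (hF : ∀ p q, ∀ y ∈ V p, y ∈ V q → ∀ᶠ z in 𝓝 y, F p z - F q z = F p y - F q y) :
    IsCoveringMap (proj : GermSpace V F → X) := by
  have : Nonempty (X → GermSpace V F) := ⟨fun x => (x, 0)⟩
  refine IsCoveringMap.mk _ (fun _ => GermFiber) (fun p =>
    (hV p).trivializationDiscrete (f := (proj : GermSpace V F → X))
      (fun c : GermFiber => germ V F p c '' V p) (V p) ?_ ?_ ?_ ?_ ?_) ?_
  · intro c W hW
    rw [isOpen_iff hV]
    constructor
    · intro hWo q c'
      rw [isOpen_iff_mem_nhds]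
      rintro y ⟨hyq, hyW, y', hy'p, hy'⟩
      have h0 : y' = y := congrArg Prod.fst hy'
      subst h0
      have h1 : F p y' + (show ℂ from c) = F q y' + c' := congrArg Prod.snd hy'
      filter_upwards [hWo.mem_nhds hyW, (hV q).mem_nhds hyq, (hV p).mem_nhds hy'p,
        hF p q y' hy'p hyq] with z hzW hzq hzp hz
      exact ⟨hzq, hzW, z, hzp, Prod.ext rfl
        (show F p z + (show ℂ from c) = F q z + c' by linear_combination hz + h1)⟩
    · intro h
      convert h p c using 1
      ext y
      exact ⟨fun hy => ⟨hW hy, hy, y, hW hy, rfl⟩, fun hy => hy.2.1⟩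
  · rintro c _ ⟨y, _, rfl⟩ _ ⟨z, _, rfl⟩ h
    have h : y = z := h
    rw [h]
  · intro c y hy
    exact ⟨_, ⟨y, hy, rfl⟩, rfl⟩
  · intro c c' h
    refine Set.disjoint_left.2 ?_
    rintro _ ⟨y, _, rfl⟩ ⟨z, _, h2⟩
    have h3 : z = y := congrArg Prod.fst h2
    have h4 : F p z + (show ℂ from c') = F p y + (show ℂ from c) := congrArg Prod.snd h2
    rw [h3] at h4
    exact h (add_left_cancel h4).symm
  · rintro ⟨y, a⟩ hy
    have hy : y ∈ V p := hy
    exact Set.mem_iUnion.2 ⟨(a - F p y : ℂ), y, hy, Prod.ext rfl (add_sub_cancel _ _)⟩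
  · exact hp

end GermSpace

/-- On a simply connected space, functions that are given locally up to locally constant functions
can be glued. -/
theorem exists_glue {X : Type*} [TopologicalSpace X] [SimplyConnectedSpace X]
    [LocallyPathConnectedSpace X] (V : X → Set X) (F : X → X → ℂ) (hV : ∀ p, IsOpen (V p))
    (hp : ∀ p, p ∈ V p)
    (hF : ∀ p q, ∀ y ∈ V p, y ∈ V q → ∀ᶠ z in 𝓝 y, F p z - F q z = F p y - F q y) :
    ∃ G : X → ℂ, ∀ y, ∃ c, ∀ᶠ z in 𝓝 y, G z = F y z + c := by
  obtain ⟨x₀⟩ : Nonempty X := inferInstance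
  -- Simple connectedness lifts the identity to a global section, which is a consistent choice of
  -- constants.
  obtain ⟨σ, ⟨-, hσ⟩, -⟩ := (GermSpace.isCoveringMap hV hp hF).existsUnique_continuousMap_lifts
    (ContinuousMap.id X) x₀ ((x₀, 0) : X × ℂ) rfl
  have hσ1 : ∀ y, (σ y).1 = y := fun y => congrFun hσ y
  refine ⟨fun y => (σ y).2, fun y => ⟨(σ y).2 - F y y, ?_⟩⟩
  have ho : IsOpen (GermSpace.germ V F y ((σ y).2 - F y y) '' V y) := by
    rw [GermSpace.isOpen_iff hV]
    intro q c'
    rw [isOpen_iff_mem_nhds]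
    rintro x ⟨hxq, x', hx'p, hx'⟩
    have h0 : x' = x := congrArg Prod.fst hx'
    subst h0
    have h1 : F y x' + ((σ y).2 - F y y) = F q x' + c' := congrArg Prod.snd hx'
    filter_upwards [(hV q).mem_nhds hxq, (hV y).mem_nhds hx'p, hF y q x' hx'p hxq] with z hzq hzp hz
    exact ⟨hzq, z, hzp, Prod.ext rfl
      (show F y z + ((σ y).2 - F y y) = F q z + c' by linear_combination hz + h1)⟩
  have hm : σ y ∈ GermSpace.germ V F y ((σ y).2 - F y y) '' V y :=
    ⟨y, hp y, Prod.ext (hσ1 y).symm (add_sub_cancel _ _)⟩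
  filter_upwards [(ho.preimage σ.continuous).mem_nhds hm] with z hz
  obtain ⟨z', -, hz'⟩ := hz
  have h0 : z' = z := (congrArg Prod.fst hz').trans (hσ1 z)
  have h1 : F y z' + ((σ y).2 - F y y) = (σ z).2 := congrArg Prod.snd hz'
  rw [← h1, h0]

/-- A closed 1-form on a simply connected open set is exact. -/
theorem exists_primitive_of_fderiv_symmetric {E : Type*} [NormedAddCommGroup E] [NormedSpace ℝ E]
    (U : TopologicalSpace.Opens E) [SimplyConnectedSpace U] (w : E → E →L[ℝ] ℂ)
    (hw : DifferentiableOn ℝ w U) (hs : ∀ a ∈ U, ∀ x y, fderiv ℝ w a x y = fderiv ℝ w a y x) :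
    ∃ G : E → ℂ, ∀ x ∈ U, HasFDerivAt G (w x) x := by
  have : LocallyPathConnectedSpace U := U.isOpen.locallyPathConnectedSpace
  have hb : ∀ p : U, ∃ ε > 0, Metric.ball p.1 ε ⊆ U := fun p =>
    Metric.isOpen_iff.1 U.isOpen p p.2
  choose ε hε hbU using hb
  have hP : ∀ p : U, ∃ f : E → ℂ, ∀ a ∈ Metric.ball p.1 (ε p), HasFDerivAt f (w a) a := fun p =>
    (convex_ball p.1 (ε p)).exists_forall_hasFDerivAt_of_fderiv_symmetric Metric.isOpen_ball
      (hw.mono (hbU p)) fun a ha => hs a (hbU p ha)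
  choose f hf using hP
  obtain ⟨G, hG⟩ := exists_glue (X := U) (fun p => {y | y.1 ∈ Metric.ball p.1 (ε p)})
    (fun p y => f p y) (fun p => Metric.isOpen_ball.preimage continuous_subtype_val)
    (fun p => Metric.mem_ball_self (hε p)) (by
      intro p q y hyp hyq
      have hy : y.1 ∈ Metric.ball p.1 (ε p) ∩ Metric.ball q.1 (ε q) := ⟨hyp, hyq⟩
      have ho : IsOpen (Metric.ball p.1 (ε p) ∩ Metric.ball q.1 (ε q)) :=
        Metric.isOpen_ball.inter Metric.isOpen_ball
      have hd : ∀ a ∈ Metric.ball p.1 (ε p) ∩ Metric.ball q.1 (ε q),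
          HasFDerivAt (fun z => f p z - f q z) (0 : E →L[ℝ] ℂ) a := fun a ha =>
        ((hf p a ha.1).sub (hf q a ha.2)).congr_fderiv (sub_self _)
      -- Two balls meet in a convex set, so there the local primitives differ by a single constant.
      have hc : ∀ z ∈ Metric.ball p.1 (ε p) ∩ Metric.ball q.1 (ε q),
          f p z - f q z = f p y - f q y := fun z hz => ((convex_ball p.1 (ε p)).inter
        (convex_ball q.1 (ε q))).is_const_of_fderivWithin_eq_zero (𝕜 := ℝ) (f := fun z => f p z - f q z)
        (fun a ha => (hd a ha).differentiableAt.differentiableWithinAt)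
        (fun a ha => (fderivWithin_of_isOpen ho ha).trans (hd a ha).fderiv) hz hy
      filter_upwards [(ho.preimage continuous_subtype_val).mem_nhds hy] with z hz
      exact hc z hz)
  classical
  refine ⟨fun x => if hx : x ∈ U then G ⟨x, hx⟩ else 0, fun x hx => ?_⟩
  obtain ⟨c, hc⟩ := hG ⟨x, hx⟩
  refine ((hf ⟨x, hx⟩ x (Metric.mem_ball_self (hε _))).add_const c).congr_of_eventuallyEq ?_
  have h1 := (U.isOpen.isOpenEmbedding_subtypeVal.map_nhds_eq ⟨x, hx⟩)
  have h2 : ∀ᶠ z in Filter.map Subtype.val (𝓝 (⟨x, hx⟩ : U)),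
      (if hx : z ∈ U then G ⟨z, hx⟩ else 0) = f ⟨x, hx⟩ z + c := by
    rw [Filter.eventually_map]
    filter_upwards [hc] with z hz
    rw [dif_pos z.2, ← hz]
  exact h1 ▸ h2

variable {m : ℕ} {U : TopologicalSpace.Opens (Fin m → ℂ)}

open SmoothFn

theorem wirtComp_coordVal (b b' : Bool) (k l : Fin m) :
    wirtComp b k (coordVal b' l) = if b = b' ∧ k = l then 1 else 0 := by
  by_cases hkl : k = l
  · subst hkl
    cases b <;> cases b' <;> simp [coordVal, wirtComp] <;> norm_num
  · rw [if_neg fun h => hkl h.2]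
    cases b' <;> simp [coordVal, wirtComp, hkl]

/-- The components are assembled into a real 1-form `w`; the hypothesis is the symmetry of its
derivative. -/
theorem exists_wirt_eq [SimplyConnectedSpace U] (η : Bool → Fin m → SmoothFn U)
    (h : ∀ b b' k l, wirt b k (η b' l) = wirt b' l (η b k)) :
    ∃ f : SmoothFn U, ∀ b k, wirt b k f = η b k := by
  let w : (Fin m → ℂ) → (Fin m → ℂ) →L[ℝ] ℂ := fun x =>
    ∑ k, ∑ b, extendZero U (η b k).1 x • coordVal b k
  have hwd : ∀ x : U, HasFDerivAt w (∑ k, ∑ b,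
      (fderiv ℝ (extendZero U (η b k).1) x).smulRight (coordVal b k)) x.1 := fun x =>
    HasFDerivAt.fun_sum fun k _ => HasFDerivAt.fun_sum fun b _ =>
      (hasFDerivAt_extendZero (η b k) x).smul_const (coordVal b k)
  have hws : ContDiffOn ℝ ∞ w U := ContDiffOn.sum fun k _ => ContDiffOn.sum fun b _ =>
    (contDiffOn_extendZero (η b k)).smul contDiffOn_const
  obtain ⟨G, hG⟩ := exists_primitive_of_fderiv_symmetric U w
    (fun x hx => (hwd ⟨x, hx⟩).differentiableAt.differentiableWithinAt) (by
      intro a ha u v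
      rw [(hwd ⟨a, ha⟩).fderiv]
      have key : ∀ u v, (∑ k, ∑ b, (fderiv ℝ (extendZero U (η b k).1) (⟨a, ha⟩ : U)).smulRight
          (coordVal b k)) u v = ∑ k, ∑ b, ∑ l, ∑ b', coordVal b' l u * coordVal b k v *
            eval ⟨a, ha⟩ (wirt b' l (η b k)) := by
        intro u v
        simp only [sum_apply, ContinuousLinearMap.smulRight_apply, smul_apply, smul_eq_mul]
        refine Finset.sum_congr rfl fun k _ => Finset.sum_congr rfl fun b _ => ?_
        rw [fderiv_eq_sum_wirt (η b k) ⟨a, ha⟩, Finset.sum_mul]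
        refine Finset.sum_congr rfl fun l _ => ?_
        rw [Finset.sum_mul]
        refine Finset.sum_congr rfl fun b' _ => ?_
        ring
      rw [key, key]
      have e : ∀ S : Fin m → Bool → Fin m → Bool → ℂ, ∑ k, ∑ b, ∑ l, ∑ b', S k b l b' =
          ∑ l, ∑ b', ∑ k, ∑ b, S k b l b' := by
        intro S
        have := Finset.sum_comm (s := (Finset.univ : Finset (Fin m × Bool)))
          (t := (Finset.univ : Finset (Fin m × Bool))) (f := fun p q => S p.1 p.2 q.1 q.2)
        simpa only [Fintype.sum_prod_type] using this
      rw [e]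
      refine Finset.sum_congr rfl fun k _ => Finset.sum_congr rfl fun b _ =>
        Finset.sum_congr rfl fun l _ => Finset.sum_congr rfl fun b' _ => ?_
      rw [h, mul_comm (coordVal _ _ u)])
  have hGs : ContDiffOn ℝ ∞ G U :=
    (contDiffOn_infty_iff_fderiv_of_isOpen U.isOpen).2
      ⟨fun x hx => (hG x hx).differentiableAt.differentiableWithinAt,
        hws.congr fun x hx => (hG x hx).fderiv⟩
  refine ⟨ofContDiffOn G hGs, fun b k => ext_eval fun x => ?_⟩
  rw [eval_wirt, fderiv_extendZero x (fun _ => rfl) (hG x x.2)]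
  have hlin : wirtComp b k (w x) = ∑ l, ∑ b', extendZero U (η b' l).1 x *
      wirtComp b k (coordVal b' l) := by
    simp only [wirtComp, w, sum_apply, smul_apply, smul_eq_mul, Finset.mul_sum,
      ← Finset.sum_sub_distrib]
    refine Finset.sum_congr rfl fun l _ => Finset.sum_congr rfl fun b' _ => ?_
    ring
  rw [hlin, Finset.sum_eq_single k, Finset.sum_eq_single b]
  · rw [wirtComp_coordVal, if_pos ⟨rfl, rfl⟩, mul_one, extendZero_apply U _ x.2]
    rfl
  · intro b' _ hb
    rw [wirtComp_coordVal, if_neg fun h => hb h.1.symm, mul_zero]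
  · simp
  · intro l _ hl
    refine Finset.sum_eq_zero fun b' _ => ?_
    rw [wirtComp_coordVal, if_neg fun h => hl h.2.symm, mul_zero]
  · simp

end Gluing

end SuperStar


namespace Grassmann

/-! ### Coefficientwise operators and parity components on Grassmann algebras -/

section MapCoeff

variable {R ι S : Type*} [CommRing R] [LinearOrder ι] [CommRing S] [Algebra S R]

/-- A linear operator acting on the coefficients. -/
def mapCoeff (D : R →ₗ[S] R) : Module.End S (Grassmann R ι) where
  toFun f := fun K => D (f K)
  map_add' f g := funext fun K => map_add D (f K) (g K)
  map_smul' c f := funext fun K => map_smul D c (f K)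

theorem mapCoeff_apply (D : R →ₗ[S] R) (f : Grassmann R ι) (K : Finset ι) :
    mapCoeff D f K = D (f K) := rfl

/-- The coefficient of a monomial, as a linear map. -/
def coeffHom (S : Type*) [CommRing S] [Algebra S R] (K : Finset ι) : Grassmann R ι →ₗ[S] R where
  toFun f := f K
  map_add' _ _ := rfl
  map_smul' _ _ := rfl

theorem sum_apply {α : Type*} (s : Finset α) (F : α → Grassmann R ι) (K : Finset ι) :
    (∑ i ∈ s, F i) K = ∑ i ∈ s, F i K := map_sum (coeffHom R K) F s

theorem map_neg_one_pow_mul (D : R →ₗ[S] R) (n : ℕ) (a : R) :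
    D ((-1) ^ n * a) = (-1) ^ n * D a := by
  rcases neg_one_pow_eq_or R n with h | h <;> simp [h]

theorem mapCoeff_mul (D : R →ₗ[S] R) (hD : ∀ a b, D (a * b) = D a * b + a * D b)
    (f g : Grassmann R ι) : mapCoeff D (f * g) = mapCoeff D f * g + f * mapCoeff D g := by
  ext K
  simp only [mapCoeff_apply, add_apply, mul_apply, map_sum, map_neg_one_pow_mul]
  simp only [hD, mul_add, Finset.sum_add_distrib]

theorem mapCoeff_parity (D : R →ₗ[S] R) (f : Grassmann R ι) :
    mapCoeff D (parity S f) = parity S (mapCoeff D f) := by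
  ext K
  rw [mapCoeff_apply, parity_apply, map_neg_one_pow_mul]
  rfl

theorem mapCoeff_leftDeriv (D : R →ₗ[S] R) (i : ι) (f : Grassmann R ι) :
    mapCoeff D (leftDeriv S i f) = leftDeriv S i (mapCoeff D f) := by
  ext K
  rw [mapCoeff_apply, leftDeriv_apply, leftDeriv_apply]
  split_ifs
  · exact map_zero D
  · rw [map_neg_one_pow_mul]
    rfl

theorem mapCoeff_scalar (D : R →ₗ[S] R) (a : R) :
    mapCoeff D (scalar a : Grassmann R ι) = scalar (D a) := by
  ext K
  rw [mapCoeff_apply, scalar_apply, scalar_apply]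
  split_ifs
  · rfl
  · exact map_zero D

theorem mapCoeff_gen (D : R →ₗ[S] R) (hD : D 1 = 0) (i : ι) :
    mapCoeff D (gen i : Grassmann R ι) = 0 := by
  ext K
  rw [mapCoeff_apply, gen_apply, zero_apply]
  split_ifs
  · exact hD
  · exact map_zero D

theorem evenPart_apply (f : Grassmann R ι) (K : Finset ι) :
    evenPart S f K = if Even K.card then f K else 0 := rfl

theorem oddPart_apply (f : Grassmann R ι) (K : Finset ι) :
    oddPart S f K = if Even K.card then 0 else f K := rfl

theorem evenPart_add_oddPart (f : Grassmann R ι) : evenPart S f + oddPart S f = f := by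
  ext K
  rw [add_apply, evenPart_apply, oddPart_apply]
  split_ifs <;> simp

theorem parity_evenPart (f : Grassmann R ι) : parity S (evenPart S f) = evenPart S f := by
  ext K
  rw [parity_apply, evenPart_apply]
  split_ifs with h
  · rw [h.neg_one_pow, one_mul]
  · rw [mul_zero]

theorem parity_oddPart (f : Grassmann R ι) : parity S (oddPart S f) = -oddPart S f := by
  ext K
  rw [parity_apply, neg_apply, oddPart_apply]
  split_ifs with h
  · rw [mul_zero, neg_zero]
  · rw [(Nat.not_even_iff_odd.1 h).neg_one_pow, neg_one_mul]

theorem evenPart_of_even (h2 : IsUnit (2 : R)) {f : Grassmann R ι} (hf : parity S f = f) :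
    evenPart S f = f ∧ oddPart S f = 0 := by
  have h : oddPart S f = 0 := by
    ext K
    rw [oddPart_apply, zero_apply]
    split_ifs with hK
    · rfl
    · have h1 : parity S f K = f K := by rw [hf]
      rw [parity_apply, (Nat.not_even_iff_odd.1 hK).neg_one_pow] at h1
      exact h2.mul_right_eq_zero.1 (by linear_combination -h1)
  refine ⟨?_, h⟩
  conv_rhs => rw [← evenPart_add_oddPart (S := S) f, h, add_zero]

theorem oddPart_of_odd (h2 : IsUnit (2 : R)) {f : Grassmann R ι} (hf : parity S f = -f) :
    evenPart S f = 0 ∧ oddPart S f = f := by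
  have h : evenPart S f = 0 := by
    ext K
    rw [evenPart_apply, zero_apply]
    split_ifs with hK
    · have h1 : parity S f K = (-f) K := by rw [hf]
      rw [parity_apply, hK.neg_one_pow, neg_apply] at h1
      exact h2.mul_right_eq_zero.1 (by linear_combination h1)
    · rfl
  refine ⟨h, ?_⟩
  conv_rhs => rw [← evenPart_add_oddPart (S := S) f, h, zero_add]

theorem leftDeriv_eq_zero_iff (i : ι) (a : Grassmann R ι) :
    leftDeriv S i a = 0 ↔ ∀ K, i ∈ K → a K = 0 := by
  constructor
  · intro h K hK
    have h1 : leftDeriv S i a (K.erase i) = 0 := by rw [h, zero_apply]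
    rw [leftDeriv_apply, if_neg (Finset.notMem_erase i K), Finset.insert_erase hK] at h1
    rcases neg_one_pow_eq_or R ((K.erase i).filter (· < i)).card with h2 | h2
    · rwa [h2, one_mul] at h1
    · rwa [h2, neg_one_mul, neg_eq_zero] at h1
  · intro h
    ext1 K
    rw [leftDeriv_apply, zero_apply]
    split_ifs
    · rfl
    · rw [h _ (Finset.mem_insert_self i K), mul_zero]

end MapCoeff

end Grassmann

namespace SuperStar

/-! ## The coordinates on `U × ℂ^{0|d}` -/

section SuperCoordinates

open Grassmann SmoothFn

variable {m d : ℕ} {U : TopologicalSpace.Opens (Fin m → ℂ)}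

/-- The labels of `θ^α` (`true`) and `θ̄^α` (`false`). -/
def oddLabel : Bool → Fin d → OddIndex d
  | true, α => Sum.inlₗ α
  | false, α => Sum.inrₗ α

theorem oddLabel_injective {b b' : Bool} {α β : Fin d} (h : oddLabel b α = oddLabel b' β) :
    b = b' ∧ α = β := by
  cases b <;> cases b'
  · exact ⟨rfl, Sum.inr_injective h⟩
  · exact absurd h Sum.inr_ne_inl
  · exact absurd h Sum.inl_ne_inr
  · exact ⟨rfl, Sum.inl_injective h⟩

theorem exists_oddLabel (i : OddIndex d) : ∃ b α, i = oddLabel b α := by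
  rcases i with α | α
  · exact ⟨true, α, rfl⟩
  · exact ⟨false, α, rfl⟩

/-- The coordinate functions on `U × ℂ^{0|d}`. -/
noncomputable def superX : Bool × (Fin m ⊕ Fin d) → SuperFn U d
  | (b, Sum.inl k) => scalar (coordFn b k)
  | (b, Sum.inr α) => gen (oddLabel b α)

/-- The partial derivatives on `U × ℂ^{0|d}`. -/
noncomputable def superD : Bool × (Fin m ⊕ Fin d) → Module.End ℂ (SuperFn U d)
  | (b, Sum.inl k) => mapCoeff (wirt b k)
  | (b, Sum.inr α) => leftDeriv ℂ (oddLabel b α)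

theorem wirt_one (b : Bool) (k : Fin m) : wirt b k (1 : SmoothFn U) = 0 := by
  have := wirt_mul b k (1 : SmoothFn U) 1
  simpa using this

/-- The odd generators are dealt with by `eq_zero_of_comm_gen`. At a point `p`, Hadamard's lemma
writes `a` as a constant plus multiples of the `x - x(p)`; `D` kills the constant and commutes with
these factors, so every coefficient of the result vanishes at `p`. -/
theorem eq_zero_of_comm_superX (D : Module.End ℂ (SuperFn U d))
    (hz : ∀ b k a, D (scalar (coordFn b k) * a) = scalar (coordFn b k) * D a)
    (hθ : ∀ i a, D (gen i * a) = gen i * parity ℂ (D (parity ℂ a))) (h1 : D 1 = 0) : D = 0 := by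
  refine eq_zero_of_comm_gen D hθ fun a => ?_
  have hc : ∀ r : ℂ, (scalar (algebraMap ℂ (SmoothFn U) r) : SuperFn U d) = r • 1 := by
    intro r
    ext1 K
    rw [scalar_apply, Grassmann.smul_apply, one_apply]
    split_ifs
    · exact Algebra.algebraMap_eq_smul_one r
    · rw [smul_zero]
  ext1 K
  refine ext_eval fun p => ?_
  obtain ⟨A, hA⟩ := exists_eq_sum_coordFn a p
  have hD : D (scalar a) = ∑ b, ∑ k,
      (scalar (coordFn b k - algebraMap ℂ _ (coordVal b k p)) * D (scalar (A b k))) := by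
    conv_lhs => rw [hA]
    simp only [← scalarHom_apply, map_add, map_sum, map_mul, map_sub, sub_mul]
    simp only [scalarHom_apply, hc, hz, map_smul, h1, smul_zero, zero_add, smul_mul_assoc, one_mul]
  rw [hD, Grassmann.sum_apply, map_sum, Grassmann.zero_apply, map_zero]
  refine Finset.sum_eq_zero fun b _ => ?_
  rw [Grassmann.sum_apply, map_sum]
  refine Finset.sum_eq_zero fun k _ => ?_
  rw [scalar_mul_apply, map_mul, map_sub, eval_coordFn, AlgHom.commutes]
  simp

/-- The coordinates on `U × ℂ^{0|d}`. -/
noncomputable def superCoords (U : TopologicalSpace.Opens (Fin m → ℂ)) (d : ℕ) :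
    SuperCoords (SuperFn U d) (Bool × (Fin m ⊕ Fin d)) where
  P := par
  P_mul := parity_mul
  P_one := parity_one
  P_P := parity_parity
  even_comm := even_comm isUnit_two
  odd_comm := odd_comm isUnit_two
  odd i := i.2.isRight
  x := superX
  d := superD
  P_x i := by
    rcases i with ⟨b, k | α⟩
    · exact (parity_scalar _).trans (one_smul _ _).symm
    · exact (parity_gen _).trans (neg_one_smul _ _).symm
  P_d i a := by
    rcases i with ⟨b, k | α⟩
    · exact (mapCoeff_parity _ _).symm.trans (one_smul _ _).symm
    · exact (parity_leftDeriv _ _).trans (neg_one_smul _ _).symm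
  d_mul i a a' := by
    rcases i with ⟨b, k | α⟩
    · exact mapCoeff_mul _ (wirt_mul b k) a a'
    · exact leftDeriv_mul _ a a'
  d_d i j a := by
    rcases i with ⟨b, k | α⟩ <;> rcases j with ⟨b', l | β⟩
    · refine Eq.trans ?_ (one_smul _ _).symm
      ext1 K
      exact wirt_comm _ _ _ _ _
    · exact (mapCoeff_leftDeriv _ _ _).trans (one_smul _ _).symm
    · exact (mapCoeff_leftDeriv _ _ _).symm.trans (one_smul _ _).symm
    · exact (leftDeriv_leftDeriv _ _ _).trans (neg_one_smul _ _).symm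
  d_x i j := by
    rcases i with ⟨b, k | α⟩ <;> rcases j with ⟨b', l | β⟩
    · refine (mapCoeff_scalar _ _).trans ?_
      rw [wirt_coordFn]
      simp only [Prod.mk.injEq, Sum.inl.injEq]
      split_ifs
      · rfl
      · exact map_zero scalarHom
    · rw [if_neg (by simp)]
      exact mapCoeff_gen _ (wirt_one b k) _
    · rw [if_neg (by simp)]
      exact leftDeriv_scalar _ _
    · refine (leftDeriv_gen _ _).trans ?_
      simp only [Prod.mk.injEq, Sum.inr.injEq]
      refine if_congr ⟨fun h => ?_, fun h => ?_⟩ rfl rfl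
      · exact oddLabel_injective h
      · rw [h.1, h.2]
  hadamard D hD h1 := by
    refine eq_zero_of_comm_superX D (fun b k a => ?_) (fun i a => ?_) h1
    · exact hD (b, Sum.inl k) a
    · obtain ⟨b, α, rfl⟩ := exists_oddLabel i
      exact hD (b, Sum.inr α) a

/-- The commutator of `a P` with an even coordinate is zero and with an odd coordinate `θ` it is `-2
a θ P`. So each nonzero commutator raises the degree of `a`, which is bounded by the number `2 d` of
generators. -/
theorem parityDO_superCoords : (superCoords U d).ParityDO := by
  have key : ∀ n k, k + n = Fintype.card (OddIndex d) + 1 →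
      ∀ a ∈ degIdeal (SmoothFn U) (OddIndex d) k,
        SuperCoords.L a * (superCoords U d).P ∈ (superCoords U d).W n := by
    intro n
    induction n with
    | zero =>
      intro k hk a ha
      rw [eq_zero_of_mem_degIdeal (hk ▸ ha : a ∈ degIdeal _ _ (Fintype.card (OddIndex d) + 1))]
      refine (SuperCoords.mem_W_zero _).2 (LinearMap.ext fun f => ?_)
      exact zero_mul _
    | succ n ih =>
      intro k hk a ha
      refine (SuperCoords.mem_W_succ _).2 fun i => ?_
      have hg : (superCoords U d).gamx i (SuperCoords.L a * (superCoords U d).P) =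
          (esgn ((superCoords U d).odd i) - 1) •
            (SuperCoords.L (a * (superCoords U d).x i) * (superCoords U d).P) := by
        ext1 f
        rw [SuperCoords.gamx_apply]
        have hx := (superCoords U d).homog_x i
        have hx' := (superCoords U d).P_x i
        have hc := hx.comm_mul a
        simp only [Module.End.mul_apply, SuperCoords.L_apply, LinearMap.smul_apply, hc]
        cases h : (superCoords U d).odd i
        · rw [h, esgn_false, one_smul] at hx'
          simp only [SuperCoords.Q_false, Module.End.one_apply, esgn_false, (superCoords U d).P_mul,
            hx', sub_self, zero_smul]
          have := hx.comm_mul a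
          rw [h] at this
          simp only [SuperCoords.Q_false, Module.End.one_apply] at this
          rw [← mul_assoc, this, mul_assoc, sub_self]
        · rw [h, esgn_true, neg_one_smul] at hx'
          simp only [SuperCoords.Q_true, esgn_true, (superCoords U d).P_mul, (superCoords U d).P_P,
            hx']
          have := hx.comm_mul a
          rw [h] at this
          simp only [SuperCoords.Q_true] at this
          rw [neg_mul, mul_neg, ← mul_assoc, this, mul_assoc]
          module
      rw [hg]
      rcases i with ⟨b, k' | α⟩
      · have : esgn ((superCoords U d).odd (b, Sum.inl k')) - 1 = 0 := sub_self _
        rw [this, zero_smul]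
        exact zero_mem _
      · exact Submodule.smul_mem _ _ (ih (k + 1) (by omega) _
          (mul_mem_degIdeal ha (gen_mem_degIdeal _)))
  refine ⟨Fintype.card (OddIndex d) + 1, ?_⟩
  convert key _ 0 (zero_add _) 1 (mem_degIdeal_zero _) using 1
  ext1 f
  exact (one_mul _).symm

end SuperCoordinates

end SuperStar


namespace SuperStar

/-! ## Star products on `U × ℂ^{0|d}` in terms of the coordinates -/

theorem flip_prodSeries {V W Z : Type*} [AddCommGroup V] [Module ℂ V] [AddCommGroup W] [Module ℂ W]
    [AddCommGroup Z] [Module ℂ Z] (C : ℕ → V →ₗ[ℂ] W →ₗ[ℂ] Z) :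
    (prodSeries C).flip = prodSeries fun r => (C r).flip := by
  refine (isFormalBilin_prodSeries C).flip.ext_mono (isFormalBilin_prodSeries _) fun w v => ?_
  ext n
  rw [LinearMap.flip_apply]
  rcases lt_or_ge n 0 with hn | hn
  · rw [(isFormalBilin_prodSeries C).mem_filt 0 0 _ _ (mono_mem_filt 0 v) (mono_mem_filt 0 w) n
      (by simpa using hn), (isFormalBilin_prodSeries _).mem_filt 0 0 _ _ (mono_mem_filt 0 w)
      (mono_mem_filt 0 v) n (by simpa using hn)]
  · obtain ⟨k, rfl⟩ := Int.eq_ofNat_of_zero_le hn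
    rw [coeff_prodSeries_mono, coeff_prodSeries_mono, LinearMap.flip_apply]

theorem coef_prodSeries {V W Z : Type*} [AddCommGroup V] [Module ℂ V] [AddCommGroup W] [Module ℂ W]
    [AddCommGroup Z] [Module ℂ Z] (C : ℕ → V →ₗ[ℂ] W →ₗ[ℂ] Z) (f : LaurentSeries V) (n : ℤ) :
    ∃ R : ℕ, coef (prodSeries C f) n = ∑ r ∈ Finset.range R, C r (f.coeff (n - r)) := by
  obtain ⟨N, hN⟩ := exists_mem_filt f
  refine ⟨(n - N + 1).toNat, LinearMap.ext fun w => ?_⟩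
  rw [coef_apply, coeff_prodSeries, LinearMap.sum_apply, finsum_eq_sum_of_support_subset
    (s := (Finset.range (n - N + 1).toNat).map ⟨fun r : ℕ => (r, n - (r : ℤ)),
      fun a b h => (Prod.mk.inj h).1⟩), Finset.sum_map]
  · refine Finset.sum_congr rfl fun r _ => ?_
    change C r (f.coeff (n - r)) ((mono 0 w).coeff (n - r - (n - r))) = _
    rw [sub_self, coeff_mono_same]
  · rintro ⟨r, i⟩ hr
    by_contra hh
    apply hr
    change C r (f.coeff i) ((mono 0 w).coeff (n - r - i)) = 0
    by_cases h : n - r - i = 0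
    · rw [hN i, map_zero, LinearMap.zero_apply]
      by_contra hi
      refine hh (Finset.mem_coe.2 (Finset.mem_map.2 ⟨r, ?_, Prod.ext rfl ?_⟩))
      · rw [Finset.mem_range]
        omega
      · change n - (r : ℤ) = i
        omega
    · rw [coeff_mono, if_neg h, map_zero]

theorem SuperCoords.fdo_prodSeries {A ι : Type*} [Ring A] [Module ℂ A] [SMulCommClass ℂ A A]
    [IsScalarTower ℂ A A] [DecidableEq ι] {c : SuperCoords A ι} {C : ℕ → A →ₗ[ℂ] A →ₗ[ℂ] A}
    (h : ∀ r f, c.DO (C r f)) (f : LaurentSeries A) : c.FDO (prodSeries C f) where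
  isFormal := (isFormalBilin_prodSeries C).left f
  coef n := by
    obtain ⟨R, hR⟩ := coef_prodSeries C f n
    rw [hR]
    exact SuperCoords.DO.sum _ _ fun r _ => h r _

section Conversion

open Grassmann SmoothFn

variable {m d : ℕ} {U : TopologicalSpace.Opens (Fin m → ℂ)}

/-- `superComm` takes `f D` first and `gam` takes `D f` first. On odd `f` the reversal leaves a
conjugation by parity besides the sign. -/
theorem superComm_eq (f : SuperFn U d) (D : Module.End ℂ (SuperFn U d)) :
    superComm f D = -(superCoords U d).gam false (evenPart ℂ f) D -
      (superCoords U d).gam true (oddPart ℂ f) ((superCoords U d).cj true D) := by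
  ext1 g
  have h1 : f * D g = evenPart ℂ f * D g + oddPart ℂ f * D g := by
    rw [← add_mul, evenPart_add_oddPart]
  have h2 : ∀ x, (superCoords U d).P x = par x := fun _ => rfl
  simp only [superComm, LinearMap.sub_apply, LinearMap.neg_apply, SuperCoords.gam_apply,
    SuperCoords.cj_apply, SuperCoords.Q_true, SuperCoords.Q_false, Module.End.one_apply,
    Module.End.mul_apply, LinearMap.mulLeft_apply, (superCoords U d).P_P, h1, ← h2]
  abel

theorem superComm_mem_W {n : ℕ} {D : Module.End ℂ (SuperFn U d)}
    (hD : D ∈ (superCoords U d).W (n + 1)) (f : SuperFn U d) :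
    superComm f D ∈ (superCoords U d).W n := by
  rw [superComm_eq]
  refine Submodule.sub_mem _ (Submodule.neg_mem _ ?_) ?_
  · have hf : (superCoords U d).Homog false (evenPart ℂ f) :=
      (parity_evenPart f).trans (one_smul ℂ _).symm
    exact (superCoords U d).gam_mem_W hf hD
  · have hf : (superCoords U d).Homog true (oddPart ℂ f) :=
      (parity_oddPart f).trans (neg_one_smul ℂ _).symm
    exact (superCoords U d).gam_mem_W hf (SuperCoords.cj_mem_W _ _ hD)

/-- A coordinate is homogeneous, so only one of the two terms of `superComm_eq` survives. In the odd
case the conjugation by parity is undone inside `W n`. -/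
theorem gamx_mem_W {n : ℕ} {D : Module.End ℂ (SuperFn U d)} (i : Bool × (Fin m ⊕ Fin d))
    (h : superComm ((superCoords U d).x i) D ∈ (superCoords U d).W n) :
    (superCoords U d).gamx i D ∈ (superCoords U d).W n := by
  rw [superComm_eq] at h
  rcases i with ⟨b, k | α⟩
  · obtain ⟨h1, h2⟩ := evenPart_of_even (S := ℂ) isUnit_two
      (parity_scalar (S := ℂ) (coordFn b k : SmoothFn U) : _ = (scalar _ : SuperFn U d))
    have e1 : evenPart ℂ ((superCoords U d).x (b, Sum.inl k)) = (superCoords U d).x (b, Sum.inl k) :=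
      h1
    have e2 : oddPart ℂ ((superCoords U d).x (b, Sum.inl k)) = 0 := h2
    have e3 : ∀ E, (superCoords U d).gam true 0 E = 0 := fun E => by
      ext1 g
      simp
    rw [e1, e2, e3, sub_zero] at h
    exact (Submodule.neg_mem_iff _).1 h
  · obtain ⟨h1, h2⟩ := oddPart_of_odd (S := ℂ) isUnit_two
      (parity_gen (S := ℂ) (oddLabel b α) : _ = -(gen (oddLabel b α) : SuperFn U d))
    have e1 : evenPart ℂ ((superCoords U d).x (b, Sum.inr α)) = 0 := h1
    have e2 : oddPart ℂ ((superCoords U d).x (b, Sum.inr α)) = (superCoords U d).x (b, Sum.inr α) :=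
      h2
    have e3 : (superCoords U d).gam false 0 D = 0 := by
      ext1 g
      simp
    rw [e1, e2, e3, neg_zero, zero_sub, Submodule.neg_mem_iff,
      SuperCoords.gam_cj (p := true) ((superCoords U d).P_x (b, Sum.inr α))] at h
    have h3 := SuperCoords.cj_mem_W _ true (Submodule.smul_mem _ (ssgn true true) h)
    rw [smul_smul, ssgn_mul_self, one_smul, SuperCoords.cj_cj] at h3
    exact h3

/-- Commutators with coordinates detect the order; that they control commutators with all functions
is `gam_mem_W`. The shift by one arises because `W n` collects the orders less than `n`. -/
theorem isDiffOpOfOrder_iff (n : ℕ) (D : Module.End ℂ (SuperFn U d)) :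
    IsDiffOpOfOrder n D ↔ D ∈ (superCoords U d).W (n + 1) := by
  induction n generalizing D with
  | zero =>
    refine ⟨fun h => (SuperCoords.mem_W_succ _).2 fun i => gamx_mem_W i ?_, fun h f => ?_⟩
    · rw [h]
      exact zero_mem _
    · exact (SuperCoords.mem_W_zero _).1 (superComm_mem_W h f)
  | succ n ih =>
    exact ⟨fun h => (SuperCoords.mem_W_succ _).2 fun i => gamx_mem_W i ((ih _).1 (h _)),
      fun h f => (ih _).2 (superComm_mem_W h f)⟩

theorem isDiffOp_iff (D : Module.End ℂ (SuperFn U d)) : IsDiffOp D ↔ (superCoords U d).DO D :=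
  ⟨fun ⟨n, h⟩ => ⟨n + 1, (isDiffOpOfOrder_iff n D).1 h⟩, fun ⟨n, h⟩ =>
    ⟨n, (isDiffOpOfOrder_iff n D).2 ((superCoords U d).W_le_succ n h)⟩⟩

theorem hol_iff (b : Bool) (a : SuperFn U d) : (superCoords U d).Hol b a ↔
    (∀ K k, wirt (!b) k (a K) = 0) ∧ ∀ K (β : Fin d), oddLabel (!b) β ∈ K → a K = 0 := by
  constructor
  · intro h
    exact ⟨fun K k => congrFun (h (Sum.inl k)) K,
      fun K β hK => (leftDeriv_eq_zero_iff (S := ℂ) _ a).1 (h (Sum.inr β)) K hK⟩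
  · rintro ⟨h1, h2⟩ (k | β)
    · exact Grassmann.ext fun K => h1 K k
    · exact (leftDeriv_eq_zero_iff (S := ℂ) _ a).2 fun K hK => h2 K β hK

theorem hol_true_iff (a : SuperFn U d) : (superCoords U d).Hol true a ↔ IsHolomorphic a := by
  rw [hol_iff]
  exact and_congr (forall_congr' fun K => (differentiableOn_iff_wirt _).symm) Iff.rfl

theorem hol_false_iff (a : SuperFn U d) : (superCoords U d).Hol false a ↔ IsAntiholomorphic a := by
  rw [hol_iff]
  exact and_congr (forall_congr' fun K => (differentiableOn_conj_iff_wirt _).symm) Iff.rfl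

/-- Graded and ungraded right multiplications differ by parity, which is itself a differential
operator. -/
theorem DO_flip_iff (C : SuperFn U d →ₗ[ℂ] SuperFn U d →ₗ[ℂ] SuperFn U d) :
    (∀ g, IsDiffOp (cochainRight C g)) ↔ ∀ g, (superCoords U d).DO (C.flip g) := by
  simp only [isDiffOp_iff]
  constructor
  · intro h g
    have e : C.flip g = cochainRight C (evenPart ℂ g) +
        cochainRight C (oddPart ℂ g) * (superCoords U d).P := by
      obtain ⟨h1, h2⟩ := evenPart_of_even (S := ℂ) isUnit_two (parity_evenPart (S := ℂ) g)
      obtain ⟨h3, h4⟩ := oddPart_of_odd (S := ℂ) isUnit_two (parity_oddPart (S := ℂ) g)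
      ext1 f
      have hP : par ((superCoords U d).P f) = f := parity_parity f
      simp only [cochainRight, h1, h2, h3, h4, LinearMap.add_apply, Module.End.mul_apply,
        LinearMap.comp_apply, hP, map_zero, LinearMap.zero_apply, zero_add, add_zero]
      rw [← LinearMap.add_apply, ← map_add, evenPart_add_oddPart]
    rw [e]
    exact (h _).add ((h _).mul parityDO_superCoords)
  · intro h g
    exact (h _).add ((h _).mul parityDO_superCoords)

theorem isStarProduct_iff (s : FormalFn U d → FormalFn U d → FormalFn U d) :
    IsStarProduct s ↔ ∃ B : FormalFn U d →ₗ[ℂ] FormalFn U d →ₗ[ℂ] FormalFn U d,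
      (s = fun f g => B f g) ∧ (superCoords U d).IsStar B := by
  constructor
  · intro h
    obtain ⟨C, hs, h0, hpar, hl, hr⟩ := h.exists_cochains
    have hB := isFormalBilin_prodSeries C
    refine ⟨prodSeries C, hs, hB, fun a b => ?_, fun f g => ?_, fun f => ?_, fun f => ?_, ?_, ?_, ?_⟩
    · rw [← h0]
      exact coeff_prodSeries_mono C a b 0
    · have hP : ∀ f ∈ filt (SuperFn U d) 0, (superCoords U d).fQ true f ∈ filt (SuperFn U d) 0 :=
        fun f hf => lift_mem_filt _ hf
      have hid : ∀ f ∈ filt (SuperFn U d) 0, LinearMap.id (R := ℂ) f ∈ filt (SuperFn U d) 0 :=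
        fun f hf => hf
      have hF : IsFormal ((superCoords U d).fQ true) := isFormal_lift _
      have h1 := (hB.comp isFormal_id isFormal_id hF hid hid hP).ext_mono
        (hB.comp hF hF isFormal_id hP hP hid) fun a b => by
          ext1
          funext n
          simp only [LinearMap.compr₂_apply, LinearMap.compl₁₂_apply, LinearMap.id_apply,
            SuperCoords.fQ, lift_mono, coeff_lift]
          rcases lt_or_ge n 0 with hn | hn
          · rw [hB.mem_filt 0 0 _ _ (mono_mem_filt 0 a) (mono_mem_filt 0 b) n (by simpa using hn),
              hB.mem_filt 0 0 _ _ (mono_mem_filt 0 _) (mono_mem_filt 0 _) n (by simpa using hn),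
              map_zero]
          · obtain ⟨k, rfl⟩ := Int.eq_ofNat_of_zero_le hn
            rw [coeff_prodSeries_mono, coeff_prodSeries_mono]
            exact (hpar k a b).symm
      exact LinearMap.congr_fun₂ h1 f g
    · exact SuperCoords.fdo_prodSeries (fun r a => (isDiffOp_iff _).1 (hl r a)) f
    · rw [flip_prodSeries]
      exact SuperCoords.fdo_prodSeries (fun r a => (DO_flip_iff (C r)).1 (hr r) a) f
    · exact fun f g k => by
        have := h.assoc f g k
        rw [hs] at this
        exact this
    · exact fun f => by
        have := h.one_left f
        rw [hs] at this
        exact this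
    · exact fun f => by
        have := h.one_right f
        rw [hs] at this
        exact this
  · rintro ⟨B, rfl, h⟩
    have hC := h.isFormalBilin.eq_prodSeries
    set C : ℕ → SuperFn U d →ₗ[ℂ] SuperFn U d →ₗ[ℂ] SuperFn U d := fun n : ℕ => LinearMap.mk₂ ℂ
      (fun v w => (B (mono 0 v) (mono 0 w)).coeff n) (by intros; simp) (by intros; simp)
      (by intros; simp) (by intros; simp) with hCdef
    have hCa : ∀ r f g, C r f g = (B (mono 0 f) (mono 0 g)).coeff r := fun _ _ _ => rfl
    refine ⟨⟨C, ?_, fun f g => ?_, fun r f g => ?_, fun r f => ?_, fun r => ?_⟩, h.assoc, h.one_left,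
      h.one_right⟩
    · ext1 f
      ext1 g
      exact congrArg (fun B => B f g) hC
    · exact h.lowest f g
    · have := congrArg (fun u => HahnSeries.coeff u (r : ℤ)) (h.par (mono 0 f) (mono 0 g))
      simp only [SuperCoords.fQ, lift_mono, coeff_lift] at this
      exact this.symm
    · rw [isDiffOp_iff]
      exact (h.left (mono 0 f)).coef r
    · refine (DO_flip_iff (C r)).2 fun g => ?_
      exact (h.right (mono 0 g)).coef r

end Conversion

end SuperStar


namespace SuperStar

/-! ## Potentials and the products that they determine -/

section Potentials

open Grassmann SmoothFn

variable {m d : ℕ} {U : TopologicalSpace.Opens (Fin m → ℂ)}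

theorem coeff_singleton_of_even {Y : SuperFn U d} (hY : par Y = Y) (i : OddIndex d) :
    Y {i} = 0 := by
  have h : parity ℂ Y {i} = Y {i} := congrFun hY {i}
  rw [parity_apply, Finset.card_singleton, pow_one, neg_one_mul] at h
  exact isUnit_two.mul_right_eq_zero.1 (by linear_combination -h)

theorem leftDeriv_empty (i : OddIndex d) (Y : SuperFn U d) : leftDeriv ℂ i Y ∅ = Y {i} := by
  rw [leftDeriv_apply, if_neg (Finset.notMem_empty i)]
  simp

theorem leftDeriv_singleton_inl_inr (α β : Fin d) (Y : SuperFn U d) :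
    leftDeriv ℂ (oddLabel true α) Y {oddLabel false β} = Y {Sum.inlₗ α, Sum.inrₗ β} := by
  rw [leftDeriv_apply, if_neg (by simp [oddLabel]), Finset.filter_singleton,
    if_neg (show ¬ oddLabel false β < oddLabel true α from (Sum.Lex.inl_lt_inr α β).not_gt)]
  rw [Finset.card_empty, pow_zero, one_mul]
  rfl

theorem leftDeriv_singleton_inr_inl (α β : Fin d) (Y : SuperFn U d) :
    leftDeriv ℂ (oddLabel false β) Y {oddLabel true α} = -Y {Sum.inlₗ α, Sum.inrₗ β} := by
  rw [leftDeriv_apply, if_neg (by simp [oddLabel]), Finset.filter_singleton,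
    if_pos (show oddLabel true α < oddLabel false β from Sum.Lex.inl_lt_inr α β)]
  rw [Finset.card_singleton, pow_one, neg_one_mul, Finset.pair_comm (Sum.inlₗ α)]
  rfl

theorem isPotential_of_nondegenerate {X : FormalFn U d} (h : IsNondegeneratePotential X) :
    (superCoords U d).IsPotential X where
  mem_filt n hn := h.coeff_eq_zero n hn
  even := by
    ext1
    funext n
    exact (h.even n).trans (one_smul ℂ _).symm
  nondeg b := by
    set Y := X.coeff (-1) with hY
    have hYe : par Y = Y := h.even (-1)
    let M : Matrix (Fin m ⊕ Fin d) (Fin m ⊕ Fin d) (SuperFn U d) := Matrix.of fun j k =>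
      (superCoords U d).d (!b, j) ((superCoords U d).d (b, k) Y)
    obtain ⟨G, hG⟩ := exists_matrix_inverse M (isUnit_of_ne_zero fun x => by
      rw [← eval_apply, AlgHom.map_det]
      -- An even function has no terms linear in the odd variables, so the degree zero part of the
      -- full Hessian is block diagonal. Its blocks are the two given matrices up to transposition
      -- and sign.
      have e : (eval x).mapMatrix (bodyHom.mapMatrix M) = Matrix.fromBlocks
          (bif b then (bodyHessian X x).transpose else bodyHessian X x) 0 0
          (bif b then (oddHessian X x).transpose else -oddHessian X x) := by
        ext j k
        rcases j with j | j <;> rcases k with k | k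
        · have e1 : ((eval x).mapMatrix (bodyHom.mapMatrix M)) (Sum.inl j) (Sum.inl k) =
            eval x (wirt (!b) j (wirt b k (Y ∅))) := rfl
          rw [e1, wirt_comm]
          cases b
          · rw [wirt_comm]
            rfl
          · rfl
        · have e1 : ((eval x).mapMatrix (bodyHom.mapMatrix M)) (Sum.inl j) (Sum.inr k) =
            eval x (wirt (!b) j (leftDeriv ℂ (oddLabel b k) Y ∅)) := rfl
          rw [e1, leftDeriv_empty, coeff_singleton_of_even hYe, map_zero, map_zero]
          rfl
        · have e1 : ((eval x).mapMatrix (bodyHom.mapMatrix M)) (Sum.inr j) (Sum.inl k) =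
            eval x (leftDeriv ℂ (oddLabel (!b) j) (mapCoeff (wirt b k) Y) ∅) := rfl
          rw [e1, leftDeriv_empty, mapCoeff_apply, coeff_singleton_of_even hYe, map_zero, map_zero]
          rfl
        · have e1 : ((eval x).mapMatrix (bodyHom.mapMatrix M)) (Sum.inr j) (Sum.inr k) =
            eval x (leftDeriv ℂ (oddLabel (!b) j) (leftDeriv ℂ (oddLabel b k) Y) ∅) := rfl
          rw [e1, leftDeriv_empty]
          cases b
          · rw [Bool.not_false, leftDeriv_singleton_inr_inl, map_neg]
            rfl
          · rw [Bool.not_true, leftDeriv_singleton_inl_inr]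
            rfl
      rw [e, Matrix.det_fromBlocks_zero₂₁]
      refine mul_ne_zero ?_ ?_
      · cases b
        · exact h.body_nondegenerate x
        · exact (Matrix.det_transpose _).trans_ne (h.body_nondegenerate x)
      · cases b
        · simp only [cond_false, Matrix.det_neg]
          exact mul_ne_zero (pow_ne_zero _ (neg_ne_zero.2 one_ne_zero)) (h.odd_nondegenerate x)
        · exact (Matrix.det_transpose _).trans_ne (h.odd_nondegenerate x))
    refine ⟨fun k l => G k l, fun j l => ?_⟩
    have := congrFun (congrFun hG j) l
    rw [Matrix.mul_apply, Matrix.one_apply] at this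
    exact this

theorem gradedRight_eq (B : FormalFn U d →ₗ[ℂ] FormalFn U d →ₗ[ℂ] FormalFn U d) {p : Bool}
    {u : FormalFn U d} (hu : (superCoords U d).FHomog p u) (g : FormalFn U d) :
    gradedRight (fun f g => B f g) u g = B ((superCoords U d).fQ p g) u := by
  have hc : ∀ n, parity ℂ (u.coeff n) = esgn p • u.coeff n := fun n => hu.coeff n
  cases p
  · have h1 : u.map (evenPart ℂ) = u := by
      ext1
      funext n
      exact (evenPart_of_even isUnit_two ((hc n).trans (one_smul ℂ _))).1
    have h2 : u.map (oddPart ℂ) = (0 : FormalFn U d) := by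
      ext1
      funext n
      exact (evenPart_of_even isUnit_two ((hc n).trans (one_smul ℂ _))).2
    have h3 : (superCoords U d).fQ false g = g := by
      ext1
      rfl
    rw [gradedRight, h1, h2, h3, map_zero, add_zero]
  · have h1 : u.map (evenPart ℂ) = (0 : FormalFn U d) := by
      ext1
      funext n
      exact (oddPart_of_odd isUnit_two ((hc n).trans (neg_one_smul ℂ _))).1
    have h2 : u.map (oddPart ℂ) = u := by
      ext1
      funext n
      exact (oddPart_of_odd isUnit_two ((hc n).trans (neg_one_smul ℂ _))).2
    rw [gradedRight, h1, h2, map_zero, zero_add]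
    rfl

theorem DeterminesAntiWick.exists_bilin {X : FormalFn U d}
    {s : FormalFn U d → FormalFn U d → FormalFn U d} (h : DeterminesAntiWick X s)
    (hX : (superCoords U d).IsPotential X) :
    ∃ B : FormalFn U d →ₗ[ℂ] FormalFn U d →ₗ[ℂ] FormalFn U d,
      (s = fun f g => B f g) ∧ (superCoords U d).Determines true X B := by
  obtain ⟨B, rfl, hB⟩ := (isStarProduct_iff s).1 h.isAntiWick.isStarProduct
  refine ⟨B, rfl, hB, hX, fun a f ha => ?_, fun a f ha => ?_, fun k f => ?_, fun k f => ?_⟩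
  · exact h.isAntiWick.holomorphic_left a f ((hol_true_iff a).1 ha)
  · exact h.isAntiWick.antiholomorphic_right a f ((hol_false_iff a).1 ha)
  · rcases k with k | α
    · exact h.left_z k f
    · exact h.left_θ α f
  · have hu := hX.homog_fd (!true, k)
    have e := gradedRight_eq B hu ((superCoords U d).fQ ((superCoords U d).odd (!true, k)) f)
    rw [SuperCoords.fQ_fQ] at e
    rw [← e]
    rcases k with k | α
    · exact h.right_zBar k _
    · exact h.right_θBar α _

theorem determinesWick_iff {X : FormalFn U d} {s : FormalFn U d → FormalFn U d → FormalFn U d}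
    (hX : (superCoords U d).IsPotential X) : DeterminesWick X s ↔
      ∃ B : FormalFn U d →ₗ[ℂ] FormalFn U d →ₗ[ℂ] FormalFn U d,
        (s = fun f g => B f g) ∧ (superCoords U d).Determines false X B := by
  constructor
  · intro h
    obtain ⟨B, rfl, hB⟩ := (isStarProduct_iff s).1 h.isWick.isStarProduct
    refine ⟨B, rfl, hB, hX, fun a f ha => ?_, fun a f ha => ?_, fun k f => ?_, fun k f => ?_⟩
    · exact h.isWick.antiholomorphic_left a f ((hol_false_iff a).1 ha)
    · exact h.isWick.holomorphic_right a f ((hol_true_iff a).1 ha)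
    · rcases k with k | α
      · exact h.left_zBar k f
      · exact h.left_θBar α f
    · have hu := hX.homog_fd (!false, k)
      have e := gradedRight_eq B hu ((superCoords U d).fQ ((superCoords U d).odd (!false, k)) f)
      rw [SuperCoords.fQ_fQ] at e
      rw [← e]
      rcases k with k | α
      · exact h.right_z k _
      · exact h.right_θ α _
  · rintro ⟨B, rfl, h⟩
    have hr : ∀ k g, gradedRight (fun f g => B f g) ((superCoords U d).fd (true, k) X) g =
        (superCoords U d).cov X (true, k) g := fun k g => by
      rw [gradedRight_eq B (hX.homog_fd (true, k))]
      refine (h.right_u k _).trans ?_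
      change (superCoords U d).cov X (true, k) ((superCoords U d).fQ ((superCoords U d).odd (true, k))
        ((superCoords U d).fQ ((superCoords U d).odd (true, k)) g)) = _
      rw [SuperCoords.fQ_fQ]
    exact ⟨⟨(isStarProduct_iff _).2 ⟨B, rfl, h.isStar⟩,
      fun b f hb => h.left_hol b f ((hol_false_iff b).2 hb),
      fun a f ha => h.right_hol a f ((hol_true_iff a).2 ha)⟩,
      fun k g => hr (Sum.inl k) g, fun α g => hr (Sum.inr α) g,
      fun l g => h.left_u (Sum.inl l) g, fun β g => h.left_u (Sum.inr β) g⟩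

theorem isBerezinTransform_iff (B : FormalFn U d →ₗ[ℂ] FormalFn U d →ₗ[ℂ] FormalFn U d)
    (T : PowerSeries (Module.End ℂ (SuperFn U d))) :
    IsBerezinTransform (fun f g => B f g) T ↔ (superCoords U d).IsBerezin B T :=
  ⟨fun h => ⟨h.constantCoeff_eq_one, fun n => (isDiffOp_iff _).1 (h.isDiffOp n), fun a b ha hb =>
    h.map_mul a b ((hol_true_iff a).1 ha) ((hol_false_iff b).1 hb)⟩,
   fun h => ⟨h.constantCoeff, fun n => (isDiffOp_iff _).2 (h.coeff_do n), fun a b ha hb =>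
    h.map_mul a b ((hol_true_iff a).2 ha) ((hol_false_iff b).2 hb)⟩⟩

theorem dualProduct_eq (B : FormalFn U d →ₗ[ℂ] FormalFn U d →ₗ[ℂ] FormalFn U d)
    (T : PowerSeries (Module.End ℂ (SuperFn U d))) :
    dualProduct (fun f g => B f g) T = fun f g => SuperCoords.dualB B T f g := rfl

end Potentials

end SuperStar


namespace Grassmann

/-! ### The Poincaré lemma in the odd variables -/

section Poincare

variable {R ι S : Type*} [CommRing R] [LinearOrder ι] [CommRing S] [Algebra S R]

/-- A primitive of the odd closed form with components `w i`. -/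
def primitive (w : ι → Grassmann R ι) : Grassmann R ι := fun K =>
  if h : K.Nonempty then w (K.min' h) (K.erase (K.min' h)) else 0

theorem primitive_insert (w : ι → Grassmann R ι) {i : ι} {K : Finset ι} (hK : ∀ j ∈ K, i < j) :
    primitive w (insert i K) = w i K := by
  have hne : (insert i K).Nonempty := Finset.insert_nonempty i K
  have hm : (insert i K).min' hne = i := le_antisymm (Finset.min'_le _ _ (by simp))
    (Finset.le_min' _ _ _ fun j hj => by
      rcases Finset.mem_insert.1 hj with rfl | hj
      · exact le_rfl
      · exact (hK j hj).le)
  have : primitive w (insert i K) =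
      w ((insert i K).min' hne) ((insert i K).erase ((insert i K).min' hne)) := dif_pos hne
  rw [this, hm, Finset.erase_insert fun h => lt_irrefl _ (hK i h)]

theorem exists_eq_insert_min {K : Finset ι} (h : K.Nonempty) :
    ∃ i L, (∀ j ∈ L, i < j) ∧ K = insert i L :=
  ⟨K.min' h, K.erase (K.min' h), fun _ hj => K.min'_lt_of_mem_erase_min' h hj,
    (Finset.insert_erase (K.min'_mem h)).symm⟩

/-- If `j` precedes all of `K`, the coefficient is that of `w j` by construction. Otherwise it comes
from `w i` for the minimum `i` of `K`, and closedness in the directions `i`, `j` transfers it to `w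
j`. For `j ∈ K` both sides vanish, as `∂_j w_j = 0` by invertibility of `2`. -/
theorem leftDeriv_primitive (h2 : IsUnit (2 : R)) {w : ι → Grassmann R ι}
    (hw : ∀ i j, leftDeriv S i (w j) = -leftDeriv S j (w i)) (j : ι) :
    leftDeriv S j (primitive w) = w j := by
  ext K
  rw [leftDeriv_apply]
  split_ifs with hj
  · have h0 : leftDeriv S j (w j) = 0 := by
      ext L
      have h1 : leftDeriv S j (w j) L = (-leftDeriv S j (w j)) L := congrArg (fun f => f L) (hw j j)
      rw [neg_apply] at h1
      exact h2.mul_right_eq_zero.1 (by linear_combination h1)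
    exact ((leftDeriv_eq_zero_iff j _).1 h0 K hj).symm
  · by_cases hlt : ∀ i ∈ K, j < i
    · rw [primitive_insert w hlt, Finset.filter_false_of_mem fun i hi => (hlt i hi).not_gt,
        Finset.card_empty, pow_zero, one_mul]
    · have hne : K.Nonempty := by
        rw [Finset.nonempty_iff_ne_empty]
        rintro rfl
        simp at hlt
      obtain ⟨i, L, hL, rfl⟩ := exists_eq_insert_min hne
      have hij : i < j := by
        push Not at hlt
        obtain ⟨x, hx, hxj⟩ := hlt
        have hix : i ≤ x := by
          rcases Finset.mem_insert.1 hx with rfl | hx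
          · exact le_rfl
          · exact (hL x hx).le
        refine lt_of_le_of_ne (hix.trans hxj) ?_
        rintro rfl
        exact hj (Finset.mem_insert_self _ _)
      have hiL : i ∉ L := fun h => lt_irrefl _ (hL i h)
      have hjL : j ∉ L := fun h => hj (Finset.mem_insert_of_mem h)
      rw [Finset.insert_comm, primitive_insert w (fun x hx => by
        rcases Finset.mem_insert.1 hx with rfl | hx
        · exact hij
        · exact hL x hx)]
      have h1 : leftDeriv S j (w i) L = (-leftDeriv S i (w j)) L := congrArg (fun f => f L) (hw j i)
      rw [neg_apply, leftDeriv_apply, leftDeriv_apply, if_neg hjL, if_neg hiL,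
        Finset.filter_false_of_mem (s := L) (p := (· < i)) fun x hx => (hL x hx).not_gt,
        Finset.card_empty, pow_zero, one_mul] at h1
      rw [Finset.filter_insert, if_pos hij, Finset.card_insert_of_notMem (by simp [hiL]), pow_succ]
      linear_combination -h1

theorem parity_primitive {w : ι → Grassmann R ι} (hw : ∀ i, parity S (w i) = -w i) :
    parity S (primitive w) = primitive w := by
  ext K
  rw [parity_apply]
  rcases K.eq_empty_or_nonempty with rfl | h
  · simp
  · obtain ⟨i, L, hL, rfl⟩ := exists_eq_insert_min h
    rw [primitive_insert w hL, Finset.card_insert_of_notMem fun h => lt_irrefl _ (hL i h), pow_succ]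
    have h1 : parity S (w i) L = (-w i) L := congrArg (fun f => f L) (hw i)
    rw [parity_apply, neg_apply] at h1
    linear_combination -h1

end Poincare

end Grassmann

namespace SuperStar

/-! ### The Poincaré lemma on `U × ℂ^{0|d}` -/

section Poincare

open Grassmann SmoothFn

variable {m d : ℕ} {U : TopologicalSpace.Opens (Fin m → ℂ)}

/-- Closed forms on `U × ℂ^{0|d}` are exact. -/
theorem exists_superD_eq [SimplyConnectedSpace U]
    (w : Bool × (Fin m ⊕ Fin d) → SuperFn U d)
    (hpar : ∀ i, par (w i) = esgn ((superCoords U d).odd i) • w i)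
    (hcl : ∀ i j, superD i (w j) =
      ssgn ((superCoords U d).odd i) ((superCoords U d).odd j) • superD j (w i)) :
    ∃ Y : SuperFn U d, par Y = Y ∧ ∀ i, superD i Y = w i := by
  choose lb la hl using exists_oddLabel (d := d)
  let w' : OddIndex d → SuperFn U d := fun i => w (lb i, Sum.inr (la i))
  have hw'l : ∀ b α, w' (oddLabel b α) = w (b, Sum.inr α) := fun b α => by
    obtain ⟨h1, h2⟩ := oddLabel_injective (hl (oddLabel b α))
    change w (lb _, Sum.inr (la _)) = _
    rw [← h1, ← h2]
  have hw' : ∀ i j, leftDeriv ℂ i (w' j) = -leftDeriv ℂ j (w' i) := fun i j => by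
    have := hcl (lb i, Sum.inr (la i)) (lb j, Sum.inr (la j))
    change leftDeriv ℂ (oddLabel (lb i) (la i)) (w' j) =
      (-1 : ℂ) • leftDeriv ℂ (oddLabel (lb j) (la j)) (w' i) at this
    rwa [← hl, ← hl, neg_one_smul] at this
  have hp' : ∀ i, parity ℂ (w' i) = -w' i := fun i =>
    (hpar (lb i, Sum.inr (la i))).trans (neg_one_smul ℂ _)
  set Y := primitive w' with hY
  have hYd : ∀ i, leftDeriv ℂ i Y = w' i := leftDeriv_primitive isUnit_two hw'
  -- Once the odd primitive is subtracted, closedness makes the remaining even components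
  -- independent of the odd variables. What is left is a closed form on `U`.
  let v : Bool → Fin m → SuperFn U d := fun b k => w (b, Sum.inl k) - mapCoeff (wirt b k) Y
  have hv : ∀ b k i, leftDeriv ℂ i (v b k) = 0 := fun b k i => by
    have := hcl (lb i, Sum.inr (la i)) (b, Sum.inl k)
    change leftDeriv ℂ (oddLabel (lb i) (la i)) (w (b, Sum.inl k)) =
      (1 : ℂ) • mapCoeff (wirt b k) (w' i) at this
    rw [← hl, one_smul] at this
    change leftDeriv ℂ i (w (b, Sum.inl k) - mapCoeff (wirt b k) Y) = 0
    rw [map_sub, this, ← mapCoeff_leftDeriv, hYd, sub_self]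
  have hvs : ∀ b k, v b k = scalar (v b k ∅) := fun b k => by
    ext1 K
    rw [scalar_apply]
    split_ifs with hK
    · rw [hK]
    · obtain ⟨i, hi⟩ := Finset.nonempty_iff_ne_empty.2 hK
      exact (leftDeriv_eq_zero_iff i _).1 (hv b k i) K hi
  obtain ⟨f, hf⟩ := exists_wirt_eq (fun b k => v b k ∅) fun b b' k l => by
    have := hcl (b, Sum.inl k) (b', Sum.inl l)
    change mapCoeff (wirt b k) (w (b', Sum.inl l)) =
      (1 : ℂ) • mapCoeff (wirt b' l) (w (b, Sum.inl k)) at this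
    rw [one_smul] at this
    have h1 : wirt b k (w (b', Sum.inl l) ∅) = wirt b' l (w (b, Sum.inl k) ∅) :=
      congrFun this ∅
    have h2 : ∀ b k, v b k ∅ = w (b, Sum.inl k) ∅ - wirt b k (Y ∅) := fun b k => rfl
    rw [h2, h2, map_sub, map_sub, h1, wirt_comm _ _ _ _ (Y ∅)]
  refine ⟨Y + scalar f, ?_, ?_⟩
  · rw [map_add]
    exact congrArg₂ _ (parity_primitive hp') (parity_scalar f)
  · rintro ⟨b, k | α⟩
    · change mapCoeff (wirt b k) (Y + scalar f) = _
      rw [map_add, mapCoeff_scalar, hf, ← hvs]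
      exact add_sub_cancel _ _
    · change leftDeriv ℂ (oddLabel b α) (Y + scalar f) = _
      rw [map_add, leftDeriv_scalar, add_zero, hYd, hw'l]

end Poincare

end SuperStar


namespace SuperStar

/-! ## The dual potential -/

section DualPotential

open Grassmann SmoothFn SuperCoords

variable {m d : ℕ} {U : TopologicalSpace.Opens (Fin m → ℂ)}
  {B : FormalFn U d →ₗ[ℂ] FormalFn U d →ₗ[ℂ] FormalFn U d}
  {T : PowerSeries (Module.End ℂ (SuperFn U d))} {X X' : FormalFn U d}

theorem bodyHessian_of_coeff_eq_neg (h : X'.coeff (-1) = -X.coeff (-1)) (x : U) :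
    bodyHessian X' x = -bodyHessian X x := by
  ext k l
  change (wirtinger k (wirtingerBar l (X'.coeff (-1) ∅))).1 x =
    -(wirtinger k (wirtingerBar l (X.coeff (-1) ∅))).1 x
  rw [h, Grassmann.neg_apply, map_neg, map_neg]
  rfl

theorem oddHessian_of_coeff_eq_neg (h : X'.coeff (-1) = -X.coeff (-1)) (x : U) :
    oddHessian X' x = -oddHessian X x := by
  ext α β
  change (X'.coeff (-1) _).1 x = -(X.coeff (-1) _).1 x
  rw [h]
  rfl

theorem exists_dual_coeff [SimplyConnectedSpace U] (hT : (superCoords U d).IsBerezin B T)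
    (h : (superCoords U d).Determines true X B) (n : ℤ) :
    ∃ Y : SuperFn U d, par Y = Y ∧
      ∀ i, superD i Y = -(opI T ((superCoords U d).fd i X)).coeff n := by
  refine exists_superD_eq (fun i => -(opI T ((superCoords U d).fd i X)).coeff n) (fun i => ?_)
    fun i j => ?_
  · have h1 := hT.homog_opI_u parityDO_superCoords h i
    have h2 : par ((opI T ((superCoords U d).fd i X)).coeff n) =
        esgn ((superCoords U d).odd i) • (opI T ((superCoords U d).fd i X)).coeff n :=
      congrArg (fun f : FormalFn U d => f.coeff n) h1
    rw [map_neg, h2, smul_neg]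
  · have h1 := hT.fd_opI_u parityDO_superCoords h i j
    have h2 : superD i ((opI T ((superCoords U d).fd j X)).coeff n) =
        ssgn ((superCoords U d).odd i) ((superCoords U d).odd j) •
          superD j ((opI T ((superCoords U d).fd i X)).coeff n) :=
      congrArg (fun f : FormalFn U d => f.coeff n) h1
    rw [map_neg, h2, map_neg, smul_neg]

/-- Nondegeneracy and the derivative equations imply all the star product conditions, by
`determines_dualB` and `Determines.unique`. -/
theorem isDualPotential_iff (hT : (superCoords U d).IsBerezin B T)
    (h : (superCoords U d).Determines true X B) :
    IsDualPotential (fun f g => B f g) T X X' ↔ IsNondegeneratePotential X' ∧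
      ∀ i, (superCoords U d).fd i X' = -opI T ((superCoords U d).fd i X) := by
  constructor
  · refine fun h' => ⟨h'.nondegenerate, ?_⟩
    rintro ⟨_ | _, k | α⟩
    · exact h'.deriv_zBar k
    · exact h'.deriv_θBar α
    · exact h'.deriv_z k
    · exact h'.deriv_θ α
  · rintro ⟨hn, hd⟩
    have hX' := isPotential_of_nondegenerate hn
    have hD := hT.determines_dualB parityDO_superCoords h hX' hd
    exact ⟨hn, (determinesWick_iff hX').2 ⟨_, dualProduct_eq B T, hD⟩, fun t ht => by
      obtain ⟨B', rfl, hB'⟩ := (determinesWick_iff hX').1 ht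
      rw [hB'.unique hD]
      rfl, fun k => hd (true, Sum.inl k), fun α => hd (true, Sum.inr α),
      fun k => hd (false, Sum.inl k), fun α => hd (false, Sum.inr α)⟩

/-- Primitives are determined only up to constants. At `ν⁻¹` the choice `-X₋₁` is legitimate because
`I⁻¹` preserves lowest coefficients. It yields the regularity of `X + X'`, the nondegeneracy of `X'`
and the reality statement at once. -/
theorem exists_dualPotential [SimplyConnectedSpace U] (hX : IsNondegeneratePotential X)
    (hT : (superCoords U d).IsBerezin B T) (h : (superCoords U d).Determines true X B) :
    ∃ X', IsDualPotential (fun f g => B f g) T X X' ∧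
      (∃ S, X + X' = HahnSeries.ofPowerSeries ℤ (SuperFn U d) S) ∧
        X'.coeff (-1) = -X.coeff (-1) := by
  choose Y hYp hYd using exists_dual_coeff hT h
  let X' : FormalFn U d := HahnSeries.ofSuppBddBelow
    (fun n : ℤ => if n < -1 then 0 else if n = -1 then -X.coeff (-1) else Y n) <| by
      refine ⟨-1, fun n hn => not_lt.1 fun h => hn ?_⟩
      exact if_pos h
  have hlt : ∀ n < -1, X'.coeff n = 0 := fun n hn => if_pos hn
  have heq : X'.coeff (-1) = -X.coeff (-1) := rfl
  have hgt : ∀ n : ℤ, -1 < n → X'.coeff n = Y n := fun n hn =>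
    (if_neg (by omega)).trans (if_neg (by omega))
  have hfilt : ∀ i, (superCoords U d).fd i X ∈ filt (SuperFn U d) (-1) := fun i n hn => by
    change superD i (X.coeff n) = 0
    rw [hX.coeff_eq_zero n hn, map_zero]
  have hn : IsNondegeneratePotential X' := by
    refine ⟨hlt, fun n => ?_, fun x => ?_, fun x => ?_⟩
    · rcases lt_trichotomy n (-1) with hn | rfl | hn
      · rw [hlt n hn, map_zero]
      · rw [heq, map_neg, hX.even]
      · rw [hgt n hn, hYp]
    · rw [bodyHessian_of_coeff_eq_neg heq, Matrix.det_neg]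
      exact mul_ne_zero (pow_ne_zero _ (by norm_num)) (hX.body_nondegenerate x)
    · rw [oddHessian_of_coeff_eq_neg heq, Matrix.det_neg]
      exact mul_ne_zero (pow_ne_zero _ (by norm_num)) (hX.odd_nondegenerate x)
  refine ⟨X', (isDualPotential_iff hT h).2 ⟨hn, fun i => ?_⟩, ?_, heq⟩
  · ext1
    funext n
    change superD i (X'.coeff n) = -(opI T ((superCoords U d).fd i X)).coeff n
    rcases lt_trichotomy n (-1) with hn | rfl | hn
    · rw [hlt n hn, map_zero, IsBerezin.opI_mem_filt (hfilt i) n hn, neg_zero]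
    · rw [heq, map_neg, hT.coeff_opI_lowest (hfilt i)]
      rfl
    · rw [hgt n hn, hYd]
  · refine ⟨PowerSeries.mk fun n => (X + X').coeff n, ?_⟩
    ext1
    funext n
    rcases lt_or_ge n 0 with hn | hn
    · rw [HahnSeries.ofPowerSeries_apply, HahnSeries.embDomain_of_notMem_range, HahnSeries.coeff_add]
      · rcases lt_or_eq_of_le (show n ≤ -1 by omega) with hn | rfl
        · rw [hX.coeff_eq_zero n hn, hlt n hn, add_zero]
        · rw [heq, add_neg_cancel]
      · rintro ⟨k, hk⟩
        change (k : ℤ) = n at hk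
        omega
    · obtain ⟨k, rfl⟩ := Int.eq_ofNat_of_zero_le hn
      rw [HahnSeries.ofPowerSeries_apply_coeff, PowerSeries.coeff_mk]

end DualPotential

end SuperStar


namespace Grassmann

/-- A coefficient of `g` appears as the top coefficient of the product with a monomial. -/
theorem exists_mul_univ_eq {R ι : Type*} [CommRing R] [LinearOrder ι] [Fintype ι] (r : R)
    (K : Finset ι) : ∃ a : Grassmann R ι, (∀ J, a J = r ∨ a J = 0) ∧ ∃ n : ℕ,
      ∀ g : Grassmann R ι, (a * g) Finset.univ = (-1) ^ n * (r * g K) := by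
  let a : Grassmann R ι := fun J => if J = Finset.univ \ K then r else 0
  refine ⟨a, fun J => ?_, inv (Finset.univ \ K) K, fun g => ?_⟩
  · by_cases h : J = Finset.univ \ K
    · exact Or.inl (if_pos h)
    · exact Or.inr (if_neg h)
  · rw [mul_apply, Finset.sum_eq_single (Finset.univ \ K)]
    · have h4 : a (Finset.univ \ K) = r := if_pos rfl
      rw [h4, Finset.sdiff_sdiff_eq_self (Finset.subset_univ K)]
    · intro I _ hI
      have h4 : a I = 0 := if_neg hI
      rw [h4, zero_mul, mul_zero]
    · intro h
      exact absurd (Finset.mem_powerset.2 (Finset.subset_univ _)) h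

end Grassmann

namespace SuperStar

/-! ## The Berezin integral -/

section BerezinIntegral

open Grassmann SmoothFn MeasureTheory

variable {m : ℕ} {U : TopologicalSpace.Opens (Fin m → ℂ)} {d : ℕ}

theorem tsupport_extendZero_subset {f : SmoothFn U} (hf : HasCompactSupport f.1) :
    tsupport (extendZero U f.1) ⊆ Subtype.val '' tsupport f.1 := by
  refine closure_minimal (fun x hx => ?_) (hf.isCompact.image continuous_subtype_val).isClosed
  by_cases hxU : x ∈ U
  · rw [Function.mem_support, extendZero_apply U _ hxU] at hx
    exact ⟨⟨x, hxU⟩, subset_tsupport _ hx, rfl⟩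
  · refine absurd (Function.extend_apply' _ _ _ ?_) hx
    rintro ⟨y, rfl⟩
    exact hxU y.2

theorem tsupport_extendZero_subset_opens {f : SmoothFn U} (hf : HasCompactSupport f.1) :
    tsupport (extendZero U f.1) ⊆ U := by
  refine (tsupport_extendZero_subset hf).trans ?_
  rintro _ ⟨y, _, rfl⟩
  exact y.2

theorem hasCompactSupport_extendZero {f : SmoothFn U} (hf : HasCompactSupport f.1) :
    HasCompactSupport (extendZero U f.1) :=
  (hf.isCompact.image continuous_subtype_val).of_isClosed_subset (isClosed_tsupport _)
    (tsupport_extendZero_subset hf)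

theorem contDiff_extendZero {f : SmoothFn U} (hf : HasCompactSupport f.1) :
    ContDiff ℝ ∞ (extendZero U f.1) := by
  refine contDiff_iff_contDiffAt.2 fun x => ?_
  by_cases hx : x ∈ tsupport (extendZero U f.1)
  · exact (contDiffOn_extendZero f).contDiffAt
      (U.isOpen.mem_nhds (tsupport_extendZero_subset_opens hf hx))
  · exact (contDiffAt_const (c := (0 : ℂ))).congr_of_eventuallyEq
      (notMem_tsupport_iff_eventuallyEq.1 hx)

theorem integrable_extendZero {f : SmoothFn U} (hf : HasCompactSupport f.1) :
    Integrable (extendZero U f.1) :=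
  (contDiff_extendZero hf).continuous.integrable_of_hasCompactSupport
    (hasCompactSupport_extendZero hf)

theorem hasCompactSupport_dirDeriv {f : SmoothFn U} (hf : HasCompactSupport f.1)
    (v : Fin m → ℂ) : HasCompactSupport (dirDeriv v f).1 := by
  refine HasCompactSupport.intro hf.isCompact fun x hx => ?_
  change fderiv ℝ (extendZero U f.1) x v = 0
  refine DFunLike.congr_fun (fderiv_of_notMem_tsupport (𝕜 := ℝ) fun h => ?_) v
  obtain ⟨y, hy, hyx⟩ := tsupport_extendZero_subset hf h
  exact hx (Subtype.ext hyx ▸ hy)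

theorem extendZero_dirDeriv {f : SmoothFn U} (hf : HasCompactSupport f.1) (v x : Fin m → ℂ) :
    extendZero U (dirDeriv v f).1 x = fderiv ℝ (extendZero U f.1) x v := by
  by_cases hx : x ∈ U
  · rw [extendZero_apply U _ hx]
    rfl
  · rw [fderiv_of_notMem_tsupport (𝕜 := ℝ) fun h => hx (tsupport_extendZero_subset_opens hf h)]
    refine Function.extend_apply' _ _ _ ?_
    rintro ⟨y, rfl⟩
    exact hx y.2

variable (U) in
/-- The smooth functions with compact support in `U`. -/
noncomputable def compactlySupported : Submodule ℂ (SmoothFn U) where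
  carrier := {f | HasCompactSupport f.1}
  add_mem' hf hg := HasCompactSupport.add hf hg
  zero_mem' := HasCompactSupport.zero
  smul_mem' c _ hf := HasCompactSupport.smul_left (f := fun _ => c) hf

/-- The Lebesgue integral of compactly supported functions. -/
noncomputable def integralCompact : compactlySupported U →ₗ[ℂ] ℂ where
  toFun f := ∫ x, extendZero U f.1.1 x
  map_add' f g := by
    rw [← integral_add (integrable_extendZero f.2) (integrable_extendZero g.2)]
    refine integral_congr_ae (Filter.Eventually.of_forall fun x => ?_)
    by_cases hx : x ∈ U
    · simp only [extendZero_apply U _ hx]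
      rfl
    · have h0 : ∀ h : SmoothFn U, extendZero U h.1 x = 0 := fun h =>
        Function.extend_apply' _ _ _ (by rintro ⟨y, rfl⟩; exact hx y.2)
      simp only [h0, add_zero]
  map_smul' c f := by
    rw [RingHom.id_apply, ← integral_smul]
    refine integral_congr_ae (Filter.Eventually.of_forall fun x => ?_)
    by_cases hx : x ∈ U
    · simp only [extendZero_apply U _ hx]
      rfl
    · have h0 : ∀ h : SmoothFn U, extendZero U h.1 x = 0 := fun h =>
        Function.extend_apply' _ _ _ (by rintro ⟨y, rfl⟩; exact hx y.2)
      simp only [h0, smul_zero]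

theorem integralCompact_eq (f : compactlySupported U) :
    integralCompact f = ∫ x in (U : Set (Fin m → ℂ)), extendZero U f.1.1 x := by
  refine (setIntegral_eq_integral_of_forall_compl_eq_zero fun x hx => ?_).symm
  refine Function.extend_apply' _ _ _ ?_
  rintro ⟨y, rfl⟩
  exact hx y.2

theorem integralCompact_dirDeriv (f : compactlySupported U) (v : Fin m → ℂ) :
    integralCompact ⟨dirDeriv v f.1, hasCompactSupport_dirDeriv f.2 v⟩ = 0 := by
  change ∫ x, extendZero U (dirDeriv v f.1).1 x = 0
  simp only [extendZero_dirDeriv f.2]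
  have hc := contDiff_extendZero f.2
  have hf' : Integrable fun x => fderiv ℝ (extendZero U f.1.1) x v :=
    ((hc.continuous_fderiv (by simp)).clm_apply continuous_const).integrable_of_hasCompactSupport
      ((hasCompactSupport_extendZero f.2).fderiv_apply ℝ v)
  have h := integral_smul_fderiv_eq_neg_fderiv_smul_of_integrable (𝕜 := ℝ) (μ := volume)
    (f := fun _ : Fin m → ℂ => (1 : ℝ)) (g := extendZero U f.1.1) (v := v)
    (by simp) (by simpa using hf') (by simpa using integrable_extendZero f.2)
    (fun _ _ => differentiableAt_const _) (fun x _ => hc.differentiable (by simp) x)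
  simpa using h

theorem wirt_mem (b : Bool) (k : Fin m) {f : SmoothFn U} (hf : f ∈ compactlySupported U) :
    wirt b k f ∈ compactlySupported U := by
  cases b
  · exact Submodule.smul_mem _ _ (Submodule.add_mem _ (hasCompactSupport_dirDeriv hf _)
      (Submodule.smul_mem _ _ (hasCompactSupport_dirDeriv hf _)))
  · exact Submodule.smul_mem _ _ (Submodule.sub_mem _ (hasCompactSupport_dirDeriv hf _)
      (Submodule.smul_mem _ _ (hasCompactSupport_dirDeriv hf _)))

theorem integralCompact_wirt (b : Bool) (k : Fin m) (f : compactlySupported U) :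
    integralCompact ⟨wirt b k f.1, wirt_mem b k f.2⟩ = 0 := by
  let D : (Fin m → ℂ) → compactlySupported U := fun v =>
    ⟨dirDeriv v f.1, hasCompactSupport_dirDeriv f.2 v⟩
  have hD : ∀ v, integralCompact (D v) = 0 := integralCompact_dirDeriv f
  cases b
  · change integralCompact ((1 / 2 : ℂ) • (D _ + Complex.I • D _)) = 0
    rw [map_smul, map_add, map_smul, hD, hD, smul_zero, add_zero, smul_zero]
  · change integralCompact ((1 / 2 : ℂ) • (D _ - Complex.I • D _)) = 0
    rw [map_smul, map_sub, map_smul, hD, hD, smul_zero, sub_zero, smul_zero]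

/-- The test function is the conjugate of `χ g` times `χ`, with a bump `χ` at a point where `g ≠ 0`;
the integral becomes that of `|χ g|²`. -/
theorem eq_zero_of_integralCompact {g : SmoothFn U} (hg : ∀ φ (hφ : φ ∈ compactlySupported U),
    integralCompact ⟨φ * g, HasCompactSupport.mul_right (f' := g.1) hφ⟩ = 0) : g = 0 := by
  refine SmoothFn.ext fun p => ?_
  by_contra hp
  obtain ⟨χ, hχ, hs, hχc, h1⟩ := exists_bump p
  let F : (Fin m → ℂ) → ℂ := fun x => χ x * extendZero U g.1 x
  have hF : ContDiff ℝ ∞ F := contDiff_mul_extendZero g hχ hs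
  let φ : SmoothFn U := ofContDiffOn (fun x => starRingEnd ℂ (F x) * χ x)
    ((Complex.conjCLE.contDiff.comp hF).mul hχ).contDiffOn
  have hφ : φ ∈ compactlySupported U := by
    have hK : IsCompact (Subtype.val ⁻¹' tsupport χ : Set U) :=
      U.isOpen.isOpenEmbedding_subtypeVal.isInducing.isCompact_preimage_iff
        (by rw [Subtype.range_coe]; exact hs) |>.2 hχc.isCompact
    refine HasCompactSupport.intro hK fun x hx => ?_
    change starRingEnd ℂ (F x) * χ x = 0
    rw [image_eq_zero_of_notMem_tsupport hx, mul_zero]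
  have h2 := hg φ hφ
  have h3 : ∀ x, extendZero U (φ * g).1 x = ((Complex.normSq (F x) : ℝ) : ℂ) := fun x => by
    by_cases hx : x ∈ U
    · rw [extendZero_apply U _ hx]
      change starRingEnd ℂ (F x) * χ x * g.1 ⟨x, hx⟩ = _
      rw [Complex.normSq_eq_conj_mul_self, mul_assoc]
      change _ = starRingEnd ℂ (F x) * (χ x * extendZero U g.1 x)
      rw [extendZero_apply U _ hx]
    · have h0 : ∀ h : SmoothFn U, extendZero U h.1 x = 0 := fun h =>
        Function.extend_apply' _ _ _ (by rintro ⟨y, rfl⟩; exact hx y.2)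
      change _ = ((Complex.normSq (χ x * extendZero U g.1 x) : ℝ) : ℂ)
      rw [h0, h0, mul_zero, map_zero, Complex.ofReal_zero]
  change ∫ x, extendZero U (φ * g).1 x = 0 at h2
  simp only [h3] at h2
  rw [integral_complex_ofReal, Complex.ofReal_eq_zero] at h2
  refine absurd h2 (ne_of_gt ?_)
  have hFc : HasCompactSupport F := hχc.mul_right
  refine Continuous.integral_pos_of_hasCompactSupport_nonneg_nonzero (x := p.1)
    (Complex.continuous_normSq.comp hF.continuous) (hFc.comp_left (map_zero Complex.normSq))
    (fun x => Complex.normSq_nonneg _) ?_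
  rw [Ne, Complex.normSq_eq_zero]
  change ¬ χ p.1 * extendZero U g.1 p.1 = 0
  rw [h1.self_of_nhds, one_mul, extendZero_apply U _ p.2]
  exact hp

variable (U d) in
/-- The functions on `U × ℂ^{0|d}` with compact support. -/
noncomputable def superCompact : Submodule ℂ (SuperFn U d) where
  carrier := {f | ∀ K, f K ∈ compactlySupported U}
  add_mem' hf hg K := Submodule.add_mem _ (hf K) (hg K)
  zero_mem' _ := Submodule.zero_mem _
  smul_mem' c _ hf K := Submodule.smul_mem _ c (hf K)

theorem mul_mem_compactlySupported {f g : SmoothFn U}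
    (h : f ∈ compactlySupported U ∨ g ∈ compactlySupported U) : f * g ∈ compactlySupported U :=
  h.elim (fun h => HasCompactSupport.mul_right (f' := g.1) h)
    (fun h => HasCompactSupport.mul_left (f := f.1) h)

theorem neg_one_pow_mul_mem {n : ℕ} {f : SmoothFn U} (h : f ∈ compactlySupported U) :
    (-1) ^ n * f ∈ compactlySupported U := mul_mem_compactlySupported (Or.inr h)

theorem mul_mem_superCompact {f g : SuperFn U d} (h : f ∈ superCompact U d ∨ g ∈ superCompact U d) :
    f * g ∈ superCompact U d := fun K => by
  rw [Grassmann.mul_apply]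
  exact Submodule.sum_mem _ fun I _ => neg_one_pow_mul_mem
    (mul_mem_compactlySupported (h.imp (fun h => h I) fun h => h _))

variable (U d) in
theorem exists_integration : ∃ S : (superCoords U d).Integration, S.Ac = superCompact U d ∧
    ∀ f ∈ superCompact U d,
      S.int f = ∫ x in (U : Set (Fin m → ℂ)), extendZero U (f Finset.univ).1 x := by
  let int₀ : superCompact U d →ₗ[ℂ] ℂ := integralCompact ∘ₗ
    LinearMap.codRestrict (compactlySupported U)
      (coeffHom ℂ Finset.univ ∘ₗ (superCompact U d).subtype) fun f => f.2 _
  -- Only values on compactly supported functions matter; an arbitrary linear extension gives a map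
  -- on the whole algebra.
  obtain ⟨int, hint⟩ := LinearMap.exists_extend int₀
  have hi : ∀ f (hf : f ∈ superCompact U d), int f = integralCompact ⟨f Finset.univ, hf _⟩ :=
    fun f hf => LinearMap.congr_fun hint ⟨f, hf⟩
  have hd : ∀ i a, a ∈ superCompact U d → (superCoords U d).d i a ∈ superCompact U d := by
    rintro ⟨b, k | α⟩ a ha K
    · exact wirt_mem b k (ha K)
    · change leftDeriv ℂ (oddLabel b α) a K ∈ _
      rw [leftDeriv_apply]
      split_ifs
      · exact Submodule.zero_mem _
      · exact neg_one_pow_mul_mem (ha _)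
  have hP : ∀ a, a ∈ superCompact U d → (superCoords U d).P a ∈ superCompact U d :=
    fun a ha K => neg_one_pow_mul_mem (ha K)
  refine ⟨⟨superCompact U d, int, fun a b hb => mul_mem_superCompact (Or.inr hb),
    fun a b ha => mul_mem_superCompact (Or.inl ha), hd, hP, fun i a ha => ?_, fun a ha => ?_,
    fun g hg => ?_⟩, rfl, fun f hf => ?_⟩
  · rw [hi _ (hd i a ha)]
    rcases i with ⟨b, k | α⟩
    · exact integralCompact_wirt b k ⟨a Finset.univ, ha _⟩
    -- No odd derivative produces the top monomial, so integration by parts in odd variables is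
    -- automatic.
    · refine Eq.trans (congrArg _ (Subtype.ext ?_)) (map_zero integralCompact)
      change leftDeriv ℂ (oddLabel b α) a Finset.univ = 0
      rw [leftDeriv_apply, if_pos (Finset.mem_univ _)]
  · rw [hi _ (hP a ha), hi _ ha]
    congr 2
    change parity ℂ a Finset.univ = _
    have hc : Even (Finset.univ : Finset (OddIndex d)).card := by
      rw [Finset.card_univ]
      change Even (Fintype.card (Fin d ⊕ Fin d))
      rw [Fintype.card_sum]
      exact ⟨_, rfl⟩
    rw [parity_apply, hc.neg_one_pow, one_mul]
  · ext1 K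
    rw [Grassmann.zero_apply]
    refine eq_zero_of_integralCompact fun φ hφ => ?_
    obtain ⟨a, ha', n, h2⟩ := exists_mul_univ_eq (ι := OddIndex d) φ K
    have ha : a ∈ superCompact U d := fun J => by
      rcases ha' J with h | h
      · rw [h]
        exact hφ
      · rw [h]
        exact Submodule.zero_mem _
    have h1 := hg a ha
    rw [hi _ (mul_mem_superCompact (Or.inl ha))] at h1
    have h2 := h2 g
    set F : compactlySupported U := ⟨φ * g K, HasCompactSupport.mul_right (f' := (g K).1) hφ⟩
    rcases neg_one_pow_eq_or (SmoothFn U) n with h | h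
    · rw [h, one_mul] at h2
      refine Eq.trans ?_ h1
      congr 1
      exact Subtype.ext h2.symm
    · rw [h, neg_one_mul] at h2
      refine neg_eq_zero.1 (Eq.trans ?_ h1)
      rw [← map_neg]
      congr 1
      exact Subtype.ext h2.symm
  · exact (hi f hf).trans (integralCompact_eq _)

end BerezinIntegral

end SuperStar


namespace SuperStar

/-! ## Exponentials of even formal functions -/

section FormalExponential

namespace SuperCoords

variable {A ι : Type*} [Ring A] [Module ℂ A] [SMulCommClass ℂ A A] [IsScalarTower ℂ A A]
  [DecidableEq ι] {c : SuperCoords A ι}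

theorem fhomog_false_iff {f : LaurentSeries A} : c.FHomog false f ↔ c.fQ true f = f := by
  rw [FHomog, esgn_false, one_smul]

theorem FHomog.even_mul {f g : LaurentSeries A} (hf : c.FHomog false f) (hg : c.FHomog false g) :
    c.FHomog false (f * g) := by
  rw [fhomog_false_iff] at *
  rw [c.fQ_mul, hf, hg]

theorem FHomog.even_pow {f : LaurentSeries A} (hf : c.FHomog false f) (n : ℕ) :
    c.FHomog false (f ^ n) := by
  induction n with
  | zero => exact fhomog_false_iff.2 (by rw [pow_zero, c.fQ_one])
  | succ n ih => exact pow_succ f n ▸ ih.even_mul hf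

theorem FHomog.fd_mul_even {f : LaurentSeries A} (hf : c.FHomog false f) (i : ι)
    (g : LaurentSeries A) : c.fd i (f * g) = c.fd i f * g + f * c.fd i g := by
  rw [c.fd_mul, hf.fQ, ssgn_false_right, one_smul]

theorem FHomog.fd_pow {f : LaurentSeries A} (hf : c.FHomog false f) (i : ι) (n : ℕ) :
    c.fd i (f ^ (n + 1)) = ((n : ℂ) + 1) • (c.fd i f * f ^ n) := by
  induction n with
  | zero => simp
  | succ n ih =>
    rw [pow_succ', hf.fd_mul_even, ih, mul_smul_series, ← mul_assoc, hf.mul_comm, fQ_false,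
      mul_assoc, ← pow_succ']
    push_cast
    module

/-- The partial sums of the exponential series. -/
noncomputable def expSum (f : LaurentSeries A) (n : ℕ) : LaurentSeries A :=
  ∑ k ∈ Finset.range n, ((k.factorial : ℂ)⁻¹) • f ^ k

theorem FHomog.expSum {f : LaurentSeries A} (hf : c.FHomog false f) (n : ℕ) :
    c.FHomog false (expSum f n) := by
  rw [fhomog_false_iff, SuperCoords.expSum, map_sum]
  refine Finset.sum_congr rfl fun k _ => ?_
  rw [map_smul, fhomog_false_iff.1 (hf.even_pow k)]

theorem FHomog.fd_expSum {f : LaurentSeries A} (hf : c.FHomog false f) (i : ι) (n : ℕ) :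
    c.fd i (SuperCoords.expSum f (n + 1)) = c.fd i f * SuperCoords.expSum f n := by
  rw [SuperCoords.expSum, Finset.sum_range_succ', map_add, map_sum, pow_zero, map_smul, fd_one,
    smul_zero, add_zero, SuperCoords.expSum, Finset.mul_sum]
  refine Finset.sum_congr rfl fun k _ => ?_
  rw [map_smul, hf.fd_pow, smul_smul, mul_smul_series]
  congr 1
  rw [Nat.factorial_succ]
  push_cast
  field_simp

theorem eq_zero_of_mem_filt {f : LaurentSeries A} {D : ℤ}
    (h : ∀ n : ℕ, f ∈ filt A ((n : ℤ) - D)) : f = 0 := by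
  ext k
  exact h (k + D + 1).toNat k (by omega)

/-- The differential equation for an exponential, approximated by its partial sums. -/
theorem fd_exponential {E F f a : LaurentSeries A} {D : ℤ} (i : ι) (hf : c.FHomog false f)
    (hF : c.FHomog false F) (hF0 : F ∈ filt A 0) (hf0 : f ∈ filt A 0) (ha : a ∈ filt A 0)
    (hd : c.fd i F = a * F) (hpow : ∀ n : ℕ, f ^ n ∈ filt A ((n : ℤ) - D))
    (hE : ∀ n : ℕ, E - F * expSum f n ∈ filt A ((n : ℤ) - D)) :
    c.fd i E = (a + c.fd i f) * E := by
  rw [← sub_eq_zero]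
  refine eq_zero_of_mem_filt (D := D) fun n => ?_
  -- The partial sums satisfy the differential equation up to the single term `f^n / n!`, whose
  -- order in `ν` grows with `n` by `hpow`.
  have e1 : c.fd i E - (a + c.fd i f) * E =
      c.fd i (E - F * expSum f (n + 1)) - (a + c.fd i f) * (E - F * expSum f n) +
        ((n.factorial : ℂ)⁻¹) • (a * F * f ^ n) := by
    have h1 : c.fd i (F * expSum f (n + 1)) =
        a * F * expSum f (n + 1) + F * (c.fd i f * expSum f n) := by
      rw [hF.fd_mul_even, hd, hf.fd_expSum]
    have h2 : F * (c.fd i f * expSum f n) = c.fd i f * (F * expSum f n) := by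
      rw [← mul_assoc, hF.mul_comm, fQ_false, mul_assoc]
    have h3 : expSum f (n + 1) = expSum f n + ((n.factorial : ℂ)⁻¹) • f ^ n :=
      Finset.sum_range_succ _ _
    rw [map_sub, h1, h2, h3, mul_add, mul_smul_series, add_mul, add_mul, mul_sub, mul_sub,
      ← mul_assoc a]
    abel
  rw [e1]
  have hfd : c.fd i f ∈ filt A 0 := lift_mem_filt _ hf0
  refine Submodule.add_mem _ (Submodule.sub_mem _ ?_ ?_) (Submodule.smul_mem _ _ ?_)
  · exact filt_anti (by push_cast; omega) (lift_mem_filt _ (hE (n + 1)))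
  · have := mul_mem_filt (Submodule.add_mem _ ha hfd) (hE n)
    rwa [zero_add] at this
  · have := mul_mem_filt (mul_mem_filt ha hF0) (hpow n)
    rwa [zero_add, zero_add] at this

theorem fhomog_exponential {E F f : LaurentSeries A} {D : ℤ} (hf : c.FHomog false f)
    (hF : c.FHomog false F) (hE : ∀ n : ℕ, E - F * expSum f n ∈ filt A ((n : ℤ) - D)) :
    c.FHomog false E := by
  rw [fhomog_false_iff, ← sub_eq_zero]
  refine eq_zero_of_mem_filt (D := D) fun n => ?_
  have e : c.fQ true E - E =
      c.fQ true (E - F * expSum f n) - (E - F * expSum f n) := by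
    rw [map_sub, fhomog_false_iff.1 (hF.even_mul (hf.expSum n))]
    abel
  rw [e]
  exact Submodule.sub_mem _ (lift_mem_filt _ (hE n)) (hE n)

end SuperCoords

theorem ofPowerSeries_mem_filt {A : Type*} [Ring A] [Module ℂ A] (f : PowerSeries A) :
    HahnSeries.ofPowerSeries ℤ A f ∈ filt A 0 := fun n hn => by
  rw [HahnSeries.ofPowerSeries_apply, HahnSeries.embDomain_of_notMem_range]
  rintro ⟨k, hk⟩
  change (k : ℤ) = n at hk
  omega

end FormalExponential

end SuperStar

namespace Grassmann

theorem degIdeal_anti {R ι : Type*} [CommRing R] {k l : ℕ} (h : k ≤ l) :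
    degIdeal R ι l ≤ degIdeal R ι k := fun _ hf K hK => hf K (hK.trans_le h)

/-- Among `k` factors whose exponents of `ν` add up to `n`, at least `k - n` have exponent zero, and
each of these has positive degree in the generators. -/
theorem coeff_pow_mem_degIdeal {R ι : Type*} [CommRing R] [LinearOrder ι]
    {f : PowerSeries (Grassmann R ι)} (hf : PowerSeries.coeff 0 f ∈ degIdeal R ι 1) (k : ℕ) :
    ∀ n, PowerSeries.coeff n (f ^ k) ∈ degIdeal R ι (k - n) := by
  induction k with
  | zero =>
    intro n
    rw [Nat.zero_sub]
    exact mem_degIdeal_zero _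
  | succ k ih =>
    intro n
    rw [pow_succ, PowerSeries.coeff_mul]
    refine sum_mem fun ij hij => ?_
    rw [Finset.HasAntidiagonal.mem_antidiagonal] at hij
    rcases Nat.eq_zero_or_pos ij.2 with h | h
    · rw [h]
      exact degIdeal_anti (by omega) (mul_mem_degIdeal (ih ij.1) hf)
    · exact degIdeal_anti (by omega) (mul_mem_degIdeal (ih ij.1) (mem_degIdeal_zero _))

end Grassmann

namespace SuperStar

/-! ### The exponential density -/

section Density

open Grassmann SmoothFn SuperCoords

variable {m : ℕ} {U : TopologicalSpace.Opens (Fin m → ℂ)} {d : ℕ} (S : PowerSeries (SuperFn U d))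

/-- The series `S` without its component `φ` of degree zero. -/
noncomputable def soulSeries : PowerSeries (SuperFn U d) :=
  S - PowerSeries.C (scalar (PowerSeries.coeff 0 S ∅))

theorem coeff_zero_soulSeries_mem : PowerSeries.coeff 0 (soulSeries S) ∈ degIdeal _ _ 1 := by
  refine mem_degIdeal_one.2 ?_
  rw [soulSeries, map_sub, PowerSeries.coeff_zero_C, map_sub, bodyHom_scalar, bodyHom_apply, sub_self]

theorem coeff_soulSeries_pow_eq_zero {n k : ℕ} (h : n + 2 * d < k) :
    PowerSeries.coeff n (soulSeries S ^ k) = 0 := by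
  refine eq_zero_of_mem_degIdeal (degIdeal_anti ?_
    (coeff_pow_mem_degIdeal (coeff_zero_soulSeries_mem S) k n))
  change Fintype.card (Fin d ⊕ Fin d) + 1 ≤ _
  rw [Fintype.card_sum, Fintype.card_fin]
  omega

theorem coeff_formalExp (n : ℕ) : PowerSeries.coeff n (formalExp S) =
    scalar (SmoothFn.exp (PowerSeries.coeff 0 S ∅)) *
      ∑ k ∈ Finset.range (n + 2 * d + 1), ((k.factorial : ℂ)⁻¹) •
        PowerSeries.coeff n (soulSeries S ^ k) := PowerSeries.coeff_mk _ _

theorem isUnit_formalExp : IsUnit (formalExp S) := by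
  rw [PowerSeries.isUnit_iff_constantCoeff, ← PowerSeries.coeff_zero_eq_constantCoeff_apply]
  refine isUnit_of_body ?_
  rw [coeff_formalExp, map_mul, bodyHom_scalar, map_sum, Finset.sum_eq_single 0]
  · rw [pow_zero, Nat.factorial_zero, Nat.cast_one, inv_one, one_smul,
      PowerSeries.coeff_zero_one, map_one, mul_one]
    exact isUnit_of_ne_zero fun x => Complex.exp_ne_zero _
  · intro k _ hk
    have h := coeff_pow_mem_degIdeal (coeff_zero_soulSeries_mem S) k 0
    have h1 := mem_degIdeal_one.1 (degIdeal_anti (by omega) h)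
    rw [bodyHom_apply] at h1 ⊢
    rw [Grassmann.smul_apply, h1, smul_zero]
  · intro h
    simp at h

/-- The offset `2 d` is the number of odd generators: below order `n - 2 d` the powers missing from
the `n`-th partial sum do not contribute. -/
theorem formalExp_sub_mem_filt (n : ℕ) :
    HahnSeries.ofPowerSeries ℤ (SuperFn U d) (formalExp S) -
      mono 0 (scalar (SmoothFn.exp (PowerSeries.coeff 0 S ∅))) *
        expSum (HahnSeries.ofPowerSeries ℤ (SuperFn U d) (soulSeries S)) n ∈
      filt (SuperFn U d) ((n : ℤ) - (2 * d : ℕ)) := fun k hk => by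
  have hp : ∀ j, HahnSeries.ofPowerSeries ℤ (SuperFn U d) (soulSeries S) ^ j =
      HahnSeries.ofPowerSeries ℤ (SuperFn U d) (soulSeries S ^ j) := fun j => (map_pow _ _ _).symm
  have hs : (expSum (HahnSeries.ofPowerSeries ℤ (SuperFn U d) (soulSeries S)) n).coeff k =
      ∑ j ∈ Finset.range n, ((j.factorial : ℂ)⁻¹) •
        (HahnSeries.ofPowerSeries ℤ (SuperFn U d) (soulSeries S ^ j)).coeff k := by
    simp only [expSum, hp, HahnSeries.coeff_sum, HahnSeries.coeff_smul]
  rw [HahnSeries.coeff_sub, coeff_mono_zero_mul, hs]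
  rcases lt_or_ge k 0 with h | h
  · rw [ofPowerSeries_mem_filt _ _ h, Finset.sum_eq_zero, mul_zero, sub_zero]
    intro j _
    rw [ofPowerSeries_mem_filt _ _ h, smul_zero]
  · obtain ⟨k, rfl⟩ := Int.eq_ofNat_of_zero_le h
    simp only [HahnSeries.ofPowerSeries_apply_coeff]
    rw [coeff_formalExp, Finset.sum_subset (s₂ := Finset.range n) (fun j hj => ?_) fun j _ hj => ?_,
      sub_self]
    · simp only [Finset.mem_range] at hj ⊢
      omega
    · rw [coeff_soulSeries_pow_eq_zero, smul_zero]
      simp only [Finset.mem_range] at hj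
      omega

variable {S}

theorem isDensity_formalExp
    (hS : (superCoords U d).FHomog false (HahnSeries.ofPowerSeries ℤ (SuperFn U d) S)) :
    ∃ σ, Integration.IsDensity (superCoords U d) (HahnSeries.ofPowerSeries ℤ _ (formalExp S)) σ ∧
      ∀ i, (superCoords U d).fd i (HahnSeries.ofPowerSeries ℤ _ (formalExp S)) =
        (superCoords U d).fd i (HahnSeries.ofPowerSeries ℤ _ S) *
          HahnSeries.ofPowerSeries ℤ _ (formalExp S) := by
  set φ := PowerSeries.coeff 0 S ∅ with hφ
  have hmono : ∀ a : SmoothFn U, (superCoords U d).FHomog false (mono 0 (scalar a)) := fun a => by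
    rw [fhomog_false_iff, SuperCoords.fQ, lift_mono]
    congr 1
    exact parity_scalar a
  have hC : HahnSeries.ofPowerSeries ℤ (SuperFn U d) (PowerSeries.C (scalar φ)) =
      mono 0 (scalar φ) := HahnSeries.ofPowerSeries_C _
  have hN : HahnSeries.ofPowerSeries ℤ (SuperFn U d) (soulSeries S) =
      HahnSeries.ofPowerSeries ℤ (SuperFn U d) S - mono 0 (scalar φ) := by
    rw [soulSeries, map_sub, hC]
  have hNe : (superCoords U d).FHomog false
      (HahnSeries.ofPowerSeries ℤ (SuperFn U d) (soulSeries S)) := by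
    rw [hN, fhomog_false_iff, map_sub, fhomog_false_iff.1 hS, fhomog_false_iff.1 (hmono φ)]
  have hpow : ∀ n : ℕ, HahnSeries.ofPowerSeries ℤ (SuperFn U d) (soulSeries S) ^ n ∈
      filt (SuperFn U d) ((n : ℤ) - (2 * d : ℕ)) := fun n k hk => by
    rw [← map_pow]
    rcases lt_or_ge k 0 with h | h
    · exact ofPowerSeries_mem_filt _ _ h
    · obtain ⟨k, rfl⟩ := Int.eq_ofNat_of_zero_le h
      rw [HahnSeries.ofPowerSeries_apply_coeff, coeff_soulSeries_pow_eq_zero]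
      omega
  have hE := formalExp_sub_mem_filt S
  obtain ⟨u, hu⟩ := isUnit_formalExp S
  refine ⟨HahnSeries.ofPowerSeries ℤ _ (u⁻¹ : (PowerSeries (SuperFn U d))ˣ).1,
    ⟨ofPowerSeries_mem_filt _, ofPowerSeries_mem_filt _,
      fhomog_exponential hNe (hmono _) hE, ?_⟩, fun i => ?_⟩
  · rw [← map_mul, ← hu, Units.mul_inv, map_one]
  · have hd : (superCoords U d).fd i (mono 0 (scalar (SmoothFn.exp φ))) =
        (superCoords U d).fd i (mono 0 (scalar φ)) * mono 0 (scalar (SmoothFn.exp φ)) := by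
      rw [SuperCoords.fd, lift_mono, lift_mono, mono_zero_mul_mono_zero]
      congr 1
      rcases i with ⟨b, k | α⟩
      · change mapCoeff (wirt b k) _ = mapCoeff (wirt b k) _ * _
        rw [mapCoeff_scalar, mapCoeff_scalar, wirt_exp]
        exact map_mul scalarHom _ _
      · change leftDeriv ℂ (oddLabel b α) _ = leftDeriv ℂ (oddLabel b α) _ * _
        rw [leftDeriv_scalar, leftDeriv_scalar, zero_mul]
    have h := fd_exponential i hNe (hmono _) (mono_mem_filt 0 _) (ofPowerSeries_mem_filt _)
      (lift_mem_filt _ (mono_mem_filt 0 _)) hd hpow hE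
    refine h.trans ?_
    rw [hN, map_sub]
    congr 1
    exact add_sub_cancel _ _

end Density

end SuperStar


namespace SuperStar

/-! ### Reduction of the supertrace identity to homogeneous functions -/

section Supertrace

open Grassmann SmoothFn SuperCoords

variable {m : ℕ} {U : TopologicalSpace.Opens (Fin m → ℂ)} {d : ℕ}
  {B : FormalFn U d →ₗ[ℂ] FormalFn U d →ₗ[ℂ] FormalFn U d}

theorem exists_fhomog_add (f : FormalFn U d) : ∃ f₀ f₁ : FormalFn U d, f = f₀ + f₁ ∧
    (superCoords U d).FHomog false f₀ ∧ (superCoords U d).FHomog true f₁ ∧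
      ((∀ n, f.coeff n ∈ superCompact U d) →
        (∀ n, f₀.coeff n ∈ superCompact U d) ∧ ∀ n, f₁.coeff n ∈ superCompact U d) := by
  refine ⟨f.map (evenPart ℂ), f.map (oddPart ℂ), ?_, fhomog_of_coeff fun n => ?_,
    fhomog_of_coeff fun n => ?_, fun h => ⟨fun n K => ?_, fun n K => ?_⟩⟩
  · ext1
    funext n
    exact (evenPart_add_oddPart _).symm
  · exact (parity_evenPart _).trans (one_smul ℂ _).symm
  · exact (parity_oddPart _).trans (neg_one_smul ℂ _).symm
  · change evenPart ℂ (f.coeff n) K ∈ _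
    rw [evenPart_apply]
    split_ifs
    · exact h n K
    · exact Submodule.zero_mem _
  · change oddPart ℂ (f.coeff n) K ∈ _
    rw [oddPart_apply]
    split_ifs
    · exact Submodule.zero_mem _
    · exact h n K

theorem gradedRight_add (u v g : FormalFn U d) : gradedRight (fun f g => B f g) (u + v) g =
    gradedRight (fun f g => B f g) u g + gradedRight (fun f g => B f g) v g := by
  have he : (u + v).map (evenPart ℂ) = u.map (evenPart ℂ) + v.map (evenPart ℂ) := by
    ext1
    funext n
    exact map_add (evenPart ℂ) _ _
  have ho : (u + v).map (oddPart ℂ) = u.map (oddPart ℂ) + v.map (oddPart ℂ) := by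
    ext1
    funext n
    exact map_add (oddPart ℂ) _ _
  simp only [gradedRight, he, ho, map_add]
  abel

theorem isSupertraceDensity {T : PowerSeries (Module.End ℂ (SuperFn U d))} {X X' : FormalFn U d}
    {S : PowerSeries (SuperFn U d)} (hT : (superCoords U d).IsBerezin B T)
    (h : (superCoords U d).Determines true X B) (hX' : IsDualPotential (fun f g => B f g) T X X')
    (hS : X + X' = HahnSeries.ofPowerSeries ℤ (SuperFn U d) S) :
    IsSupertraceDensity (fun f g => B f g)
      (HahnSeries.ofPowerSeries ℤ (SuperFn U d) (formalExp S)) := by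
  obtain ⟨hn, hd⟩ := (isDualPotential_iff hT h).1 hX'
  have hp := isPotential_of_nondegenerate hn
  obtain ⟨J, hJ, hint⟩ := exists_integration U d
  have hSe : (superCoords U d).FHomog false (HahnSeries.ofPowerSeries ℤ (SuperFn U d) S) := by
    rw [← hS, fhomog_false_iff, map_add, fhomog_false_iff.1 h.isPotential.even,
      fhomog_false_iff.1 hp.even]
  obtain ⟨σ, hσ, hfd⟩ := isDensity_formalExp hSe
  set ρ := HahnSeries.ofPowerSeries ℤ (SuperFn U d) (formalExp S)
  have t : Integration.TraceData J ρ σ X X' B T := ⟨hσ, parityDO_superCoords, h, hT, hp, hd, fun i => by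
    rw [hfd, ← hS, map_add]⟩
  have hFAc : ∀ f, J.FAc f ↔ ∀ n, f.coeff n ∈ superCompact U d := fun f => by
    rw [Integration.FAc, hJ]
  intro f g hfg
  obtain ⟨f₀, f₁, rfl, hf₀, hf₁, hfc⟩ := exists_fhomog_add f
  obtain ⟨g₀, g₁, rfl, hg₀, hg₁, hgc⟩ := exists_fhomog_add g
  have hc : (J.FAc f₀ ∧ J.FAc f₁) ∨ (J.FAc g₀ ∧ J.FAc g₁) := by
    simp only [hFAc]
    exact hfg.imp hfc hgc
  -- Compact support of the commutators is recorded as well, because the abstract integral is known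
  -- to be the Lebesgue integral only on compactly supported functions.
  have key : ∀ {p q : Bool} {u v : FormalFn U d}, (superCoords U d).FHomog p u →
      (superCoords U d).FHomog q v → J.FAc u ∨ J.FAc v →
      J.FAc (B u v - B ((superCoords U d).fQ p v) u) ∧
        J.fint ((B u v - B ((superCoords U d).fQ p v) u) * ρ) = 0 := by
    intro p q u v hu hv huv
    refine ⟨?_, ?_⟩
    · rcases huv with h' | h'
      · exact (h'.map (h.isStar.right v)).sub (h'.map (h.isStar.left _))
      · exact (h'.map (h.isStar.left u)).sub ((h'.fQ p).map (h.isStar.right u))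
    · rw [sub_mul, map_sub, t.supertrace hu hv huv, sub_self]
  have k00 := key hf₀ hg₀ (hc.imp And.left And.left)
  have k01 := key hf₀ hg₁ (hc.imp And.left And.right)
  have k10 := key hf₁ hg₀ (hc.imp And.right And.left)
  have k11 := key hf₁ hg₁ (hc.imp And.right And.right)
  have e : B (f₀ + f₁) (g₀ + g₁) - gradedRight (fun f g => B f g) (f₀ + f₁) (g₀ + g₁) =
      (B f₀ g₀ - B ((superCoords U d).fQ false g₀) f₀) +
      (B f₀ g₁ - B ((superCoords U d).fQ false g₁) f₀) +
      (B f₁ g₀ - B ((superCoords U d).fQ true g₀) f₁) +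
      (B f₁ g₁ - B ((superCoords U d).fQ true g₁) f₁) := by
    rw [gradedRight_add, gradedRight_eq B hf₀, gradedRight_eq B hf₁]
    simp only [map_add, LinearMap.add_apply]
    abel
  have hA : J.FAc ((B (f₀ + f₁) (g₀ + g₁) -
      gradedRight (fun f g => B f g) (f₀ + f₁) (g₀ + g₁)) * ρ) := by
    rw [e]
    exact (((k00.1.add k01.1).add k10.1).add k11.1).mul_right ρ
  have hI : J.fint ((B (f₀ + f₁) (g₀ + g₁) -
      gradedRight (fun f g => B f g) (f₀ + f₁) (g₀ + g₁)) * ρ) = 0 := by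
    rw [e, add_mul, add_mul, add_mul, map_add, map_add, map_add, k00.2, k01.2, k10.2, k11.2]
    simp
  funext n
  exact (hint _ ((hFAc _).1 hA n)).symm.trans (congrArg (fun f => HahnSeries.coeff f n) hI)

end Supertrace

end SuperStar

theorem mainTheorem6 {m d : ℕ} (U : TopologicalSpace.Opens (Fin m → ℂ)) [ContractibleSpace U]
    (s : SuperStar.FormalFn U d → SuperStar.FormalFn U d → SuperStar.FormalFn U d)
    (X : SuperStar.FormalFn U d) (hX : SuperStar.IsNondegeneratePotential X)
    (hs : SuperStar.DeterminesAntiWick X s) :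
    (∃! T, SuperStar.IsBerezinTransform s T) ∧
    ∀ T, SuperStar.IsBerezinTransform s T →
      (∃ X', SuperStar.IsDualPotential s T X X' ∧
        (∃ S, X + X' = HahnSeries.ofPowerSeries ℤ (SuperStar.SuperFn U d) S) ∧
        ((∀ x, (SuperStar.bodyHessian X x).IsHermitian) →
          ∀ x, (SuperStar.bodyHessian X' x).IsHermitian)) ∧
      ∀ X', SuperStar.IsDualPotential s T X X' →
        ∀ S, X + X' = HahnSeries.ofPowerSeries ℤ (SuperStar.SuperFn U d) S →
          SuperStar.IsSupertraceDensity s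
            (HahnSeries.ofPowerSeries ℤ (SuperStar.SuperFn U d) (SuperStar.formalExp S)) := by
  have hP := SuperStar.isPotential_of_nondegenerate hX
  obtain ⟨B, rfl, hB⟩ := hs.exists_bilin hP
  simp only [SuperStar.isBerezinTransform_iff]
  refine ⟨?_, fun T hT => ⟨?_, fun X' hX' S hS => SuperStar.isSupertraceDensity hT hB hX' hS⟩⟩
  · obtain ⟨T, hT⟩ := SuperStar.SuperCoords.exists_isBerezin SuperStar.parityDO_superCoords hB
    exact ⟨T, hT, fun T' hT' => hT'.unique hT⟩
  · obtain ⟨X', hX', hS, h⟩ := SuperStar.exists_dualPotential hX hT hB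
    -- Reality of the form is Hermitian symmetry of the Hessian, which is preserved by the change of
    -- sign in `X'₋₁ = -X₋₁`.
    refine ⟨X', hX', hS, fun hH x => ?_⟩
    rw [SuperStar.bodyHessian_of_coeff_eq_neg h]
    exact (hH x).neg
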